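/- Everything is over $\mathbb C$; $|x|$ denotes degree, sums over indices in parentheses are Sweedler sums. **Data.** Let $\mathcal H^*$ be an $\mathbb N$-graded DG Hopf algebra (product and coproduct compatible with the Koszul sign rule, differential $d$ of degree $1$), with counit $\varepsilon$ and antipode $S$. Let $(\delta,\sigma)$ be a modular pair in involution: $\delta:\mathcal H^*\to\mathbb C$ is a character vanishing in positive degrees, $\sigma\in\mathcal H^0$ is group-like with $d\sigma=0$, and $(\sigma^{-1}\widetilde S)^2=\mathrm{id}$, where $\widetilde S(h)=\sum\delta(h_{(0)})S(h_{(1)})$. Let $\Omega^*$ be a unital $\mathbb N$-graded DG algebra which is a topological ring with continuous differential and continuous projections onto its homogeneous components (the discrete topology is allowed). Let $\pi$ be an action of the DG Hopf algebra $\mathcal H^*$ on the DG algebra $\Omega^*$ by continuous operators. Let $\rho^\pm:\mathcal H^*\to\Omega^*$ be degree-preserving linear maps commuting with $d$, inverse to each other for convolution, with $\rho^\pm(1)=\rho^\pm(\sigma)=1$ and $$\rho^+(hg)=\sum\rho^+(h_{(0)})\,\pi(h_{(1)})(\rho^+(g)),\qquad \rho^-(hg)=\sum(-1)^{|g||h_{(1)}|}\pi(h_{(0)})(\rho^-(g))\,\rho^-(h_{(1)}).$$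 Put $\pi'(h)(a)=\sum(-1)^{|h_{(2)}||a|}\rho^+(h_{(0)})\,\pi(h_{(1)})(a)\,\rho^-(h_{(2)})$. Let $\int$ be a continuous linear functional on $\Omega^*$, vanishing in all sufficiently large degrees, which is a closed graded $\delta$-invariant $\sigma$-trace for both $\pi$ and $\pi'$, i.e. $\int da=0$ and, for $\theta=\pi$ and for $\theta=\pi'$, $$\int\theta(h)(a)\,b=(-1)^{|h||a|}\int a\,\theta(\widetilde S h)(b),\qquad \int ab=(-1)^{|a||b|}\int b\,\theta(\sigma)(a).$$ **Complexes.** For the cyclic module $X^*$ given by $X^n=(\mathcal H^*)^{\otimes n}$ (the Connes–Moscovici cyclic module with Koszul signs, $\tau_n(h^1\otimes\dots\otimes h^n)=\widetilde S(h^1)\cdot(h^2\otimes\cdots\otimes h^n\otimes\sigma)$ for the diagonal action), or by $X^n=C^n(\Omega^*)$ (continuous $(n+1)$-linear functionals), $\mathcal B$ is the total complex of finite cochains of the $(b,B)$-bicomplex $\mathcal B^{p,q}=X^{p-q}$, $p\ge q\ge0$, with differential $\partial=b+B+(-1)^nd$ on $X^n$; here finite also means a finite sum of functionals of fixed weight.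 $HC^*$ is its cohomology. The characteristic map of $\theta=\pi,\pi'$ is $$\chi_\theta(h^1\otimes\cdots\otimes h^k)(a_0,\dots,a_k)=(-1)^{\frac{N(N+1)}2+\sum_{j>i\ge0}|h^j||a_i|}\int a_0\,\theta(h^1)(a_1)\cdots\theta(h^k)(a_k),\qquad N=\sum_j|h^j|.$$ **Claim 1.** $\chi_\pi$ and $\chi_{\pi'}$ are maps of complexes $\mathcal B(\mathcal H^*,d)\to\mathcal B(\Omega^*,d)$, and they induce the same map $HC^*(\mathcal H^*,d)\to HC^*(\Omega^*,d)$. **Claim 2.** On $M_2(\Omega^*)$ let $\pi_2'$ be the twist, by the formula defining $\pi'$, of the entrywise action of $\pi$ by $\rho_2^\pm=\operatorname{diag}(\rho^\pm,\varepsilon)$, and let $\chi_{\pi'_2}$ be formed with $\int_2M=\int(M_{11}+M_{22})$. Put $g=\begin{pmatrix}0&-1\\1&0\end{pmatrix}$, $u_t=e^{tg}$, and let $i_t:\mathbb C\oplus\Omega^*\to M_2(\Omega^*)$ be $i_t(z,a)=z\cdot 1+u_t\begin{pmatrix}0&0\\0&a\end{pmatrix}u_t^{-1}$, where $\mathbb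 C\oplus\Omega^*$ is $\Omega^*$ with a unit adjoined. Put $$I_g\varphi(x_0,\dots,x_k)=\sum_{j=0}^{k}(-1)^{j+1}\varphi(x_0,\dots,x_j,g,x_{j+1},\dots,x_k),\qquad K\varphi=\int_0^{\pi/2}i_t^*I_g\varphi\,dt,\qquad H=K\circ\chi_{\pi_2'}.$$ Then $H$ is linear, maps normalized finite cochains of $\mathcal H^*$ (those killed by all degeneracies) to normalized finite cochains of $\mathbb C\oplus\Omega^*$, and on normalized finite cochains of $\mathcal H^*$ $$p^*(\chi_{\pi'}-\chi_\pi)=\partial H+H\partial,$$ where $p:\mathbb C\oplus\Omega^*\to\Omega^*$, $p(z,a)=z1+a$. -/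

import Mathlib

open scoped TensorProduct

noncomputable section

namespace DGCyc

universe u v

/-! ### Graded vector spaces -/

section Graded

variable {A : Type*} [AddCommGroup A] [Module ℂ A]

/-- The linear map `a ↦ c n • a` for `a` homogeneous of degree `n`. -/
def gradeScale (𝒜 : ℕ → Submodule ℂ A) [DirectSum.Decomposition 𝒜] (c : ℕ → ℂ) : A →ₗ[ℂ] A :=
  DirectSum.toModule ℂ ℕ A (fun n => c n • (𝒜 n).subtype) ∘ₗ
    (DirectSum.decomposeLinearEquiv 𝒜).toLinearMap

/-- The grading involution `γ a = (-1) ^ n • a` for `a` of degree `n`.  A Koszul sign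
`(-1) ^ (m * n)` is produced by applying `γ ^ m` to an element of degree `n`. -/
def gradeSign (𝒜 : ℕ → Submodule ℂ A) [DirectSum.Decomposition 𝒜] : A →ₗ[ℂ] A :=
  gradeScale 𝒜 (fun n => (-1) ^ n)

/-- The even (`e = 0`) or odd (`e = 1`) part with respect to a grading involution `γ`. -/
def parityPart (γ : A →ₗ[ℂ] A) (e : ℕ) : A →ₗ[ℂ] A :=
  (2⁻¹ : ℂ) • (LinearMap.id + ((-1 : ℂ) ^ e) • γ)

end Graded

/-! ### DG algebras -/

/-- `d` is a differential of degree one making the graded algebra `𝒜` a DG algebra. -/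
structure IsDGAlgebra {A : Type*} [Ring A] [Algebra ℂ A] (𝒜 : ℕ → Submodule ℂ A)
    [GradedAlgebra 𝒜] (d : A →ₗ[ℂ] A) : Prop where
  map_deg : ∀ n, ∀ a ∈ 𝒜 n, d a ∈ 𝒜 (n + 1)
  d_d : ∀ a, d (d a) = 0
  leibniz : ∀ n, ∀ a ∈ 𝒜 n, ∀ b, d (a * b) = d a * b + (-1 : ℂ) ^ n • (a * d b)

/-- A DG algebra whose differential and projections onto the homogeneous components are
continuous. -/
structure IsTopDGAlgebra {A : Type*} [Ring A] [Algebra ℂ A] [TopologicalSpace A]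
    (𝒜 : ℕ → Submodule ℂ A) [GradedAlgebra 𝒜] (d : A →ₗ[ℂ] A) : Prop extends
    IsDGAlgebra 𝒜 d where
  continuous_d : Continuous d
  continuous_component : ∀ n, Continuous fun a : A => (DirectSum.decompose 𝒜 a n : A)

/-! ### DG Hopf algebras -/

section Hopf

variable {H : Type u} [Ring H] [Algebra ℂ H] [Coalgebra ℂ H]

/-- The Sweedler sum `h ↦ ∑ f (h₍₀₎) (h₍₁₎)`. -/
def sw {M : Type*} [AddCommGroup M] [Module ℂ M] (f : H →ₗ[ℂ] H →ₗ[ℂ] M) : H →ₗ[ℂ] M :=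
  TensorProduct.lift f ∘ₗ Coalgebra.comul

/-- `H` with grading `𝓗`, differential `d` and antipode `S` is a DG Hopf algebra.  The coproduct
is multiplicative for the graded (Koszul) tensor product algebra. -/
structure IsDGHopfAlgebra (𝓗 : ℕ → Submodule ℂ H) [GradedAlgebra 𝓗] (d S : H →ₗ[ℂ] H) :
    Prop extends IsDGAlgebra 𝓗 d where
  comul_deg : ∀ n, ∀ h ∈ 𝓗 n, (Coalgebra.comul h : H ⊗[ℂ] H) ∈
    ⨆ p ∈ Finset.HasAntidiagonal.antidiagonal n,
      LinearMap.range (TensorProduct.map (𝓗 p.1).subtype (𝓗 p.2).subtype)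
  counit_deg : ∀ n, n ≠ 0 → ∀ h ∈ 𝓗 n, Coalgebra.counit (R := ℂ) h = 0
  comul_one : (Coalgebra.comul (1 : H) : H ⊗[ℂ] H) = 1 ⊗ₜ 1
  comul_mul : ∀ g h : H,
    GradedTensorProduct.of ℂ 𝓗 𝓗 (Coalgebra.comul (g * h)) =
      GradedTensorProduct.of ℂ 𝓗 𝓗 (Coalgebra.comul g) *
        GradedTensorProduct.of ℂ 𝓗 𝓗 (Coalgebra.comul h)
  counit_one : Coalgebra.counit (R := ℂ) (1 : H) = 1
  counit_mul : ∀ g h : H, Coalgebra.counit (R := ℂ) (g * h) =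
    Coalgebra.counit (R := ℂ) g * Coalgebra.counit (R := ℂ) h
  comul_d : ∀ h, (Coalgebra.comul (d h) : H ⊗[ℂ] H) =
    TensorProduct.map d LinearMap.id (Coalgebra.comul h) +
      TensorProduct.map (gradeSign 𝓗) d (Coalgebra.comul h)
  antipode_deg : ∀ n, ∀ h ∈ 𝓗 n, S h ∈ 𝓗 n
  antipode_d : ∀ h, S (d h) = d (S h)
  antipode_left : ∀ h, sw ((LinearMap.mul ℂ H).compl₁₂ S LinearMap.id) h =
    algebraMap ℂ H (Coalgebra.counit h)
  antipode_right : ∀ h, sw ((LinearMap.mul ℂ H).compl₁₂ LinearMap.id S) h =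
    algebraMap ℂ H (Coalgebra.counit h)

/-- The twisted antipode `S̃ h = ∑ δ (h₍₀₎) • S (h₍₁₎)`. -/
def twistedAntipode (S : H →ₗ[ℂ] H) (δ : H →ₐ[ℂ] ℂ) : H →ₗ[ℂ] H :=
  sw ((LinearMap.lsmul ℂ H).compl₁₂ δ.toLinearMap S)

/-- `(δ, σ)` is a modular pair in involution: `δ` is a graded character, `σ` is a closed group-like
element of degree zero (with inverse `S σ`), and `(σ⁻¹ S̃)² = id`.  At `1` the last condition
says `δ σ = 1`. -/
structure IsModularPairInInvolution (𝓗 : ℕ → Submodule ℂ H) (d S : H →ₗ[ℂ] H)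
    (δ : H →ₐ[ℂ] ℂ) (σ : H) : Prop where
  delta_deg : ∀ n, n ≠ 0 → ∀ h ∈ 𝓗 n, δ h = 0
  isGroupLike : IsGroupLikeElem ℂ σ
  sigma_deg : σ ∈ 𝓗 0
  d_sigma : d σ = 0
  involution : ∀ h, S σ * twistedAntipode S δ (S σ * twistedAntipode S δ h) = h

end Hopf

/-! ### Actions, cocycle pairs, traces -/

section Action

variable {H : Type u} [Ring H] [Algebra ℂ H] [Coalgebra ℂ H]
variable {A : Type v} [Ring A] [Algebra ℂ A]

/-- `π` is an action of the DG Hopf algebra `H` on the DG algebra `A`. -/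
structure IsDGAction (𝓗 : ℕ → Submodule ℂ H) [GradedAlgebra 𝓗] (dH : H →ₗ[ℂ] H)
    (𝒜 : ℕ → Submodule ℂ A) (d : A →ₗ[ℂ] A) (π : H →ₗ[ℂ] A →ₗ[ℂ] A) : Prop where
  one_act : ∀ a, π 1 a = a
  mul_act : ∀ g h a, π (g * h) a = π g (π h a)
  act_one : ∀ h, π h 1 = algebraMap ℂ A (Coalgebra.counit h)
  /-- `π h (a b) = ∑ (-1) ^ (|h₍₁₎| |a|) π h₍₀₎ a * π h₍₁₎ b`. -/
  act_mul : ∀ h, ∀ m, ∀ a ∈ 𝒜 m, ∀ b, π h (a * b) =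
    sw ((LinearMap.mul ℂ A).compl₁₂ (π.flip a) (π.flip b ∘ₗ gradeSign 𝓗 ^ m)) h
  act_deg : ∀ m n, ∀ h ∈ 𝓗 m, ∀ a ∈ 𝒜 n, π h a ∈ 𝒜 (m + n)
  d_act : ∀ m, ∀ h ∈ 𝓗 m, ∀ a, d (π h a) = π (dH h) a + (-1 : ℂ) ^ m • π h (d a)

/-- `(ρ⁺, ρ⁻)` is an inner cocycle pair for the action `π`: degree-preserving maps commuting with
the differentials, inverse to each other for convolution, satisfying the cocycle identities
`ρ⁺ (h g) = ∑ ρ⁺ h₍₀₎ * π h₍₁₎ (ρ⁺ g)` and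
`ρ⁻ (h g) = ∑ (-1) ^ (|g| |h₍₁₎|) π h₍₀₎ (ρ⁻ g) * ρ⁻ h₍₁₎`, with value `1` at `1` and `σ`. -/
structure IsInnerCocyclePair (𝓗 : ℕ → Submodule ℂ H) [GradedAlgebra 𝓗] (dH : H →ₗ[ℂ] H) (σ : H)
    (𝒜 : ℕ → Submodule ℂ A) (d : A →ₗ[ℂ] A) (π : H →ₗ[ℂ] A →ₗ[ℂ] A)
    (ρp ρm : H →ₗ[ℂ] A) : Prop where
  deg_pos : ∀ n, ∀ h ∈ 𝓗 n, ρp h ∈ 𝒜 n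
  deg_neg : ∀ n, ∀ h ∈ 𝓗 n, ρm h ∈ 𝒜 n
  d_pos : ∀ h, ρp (dH h) = d (ρp h)
  d_neg : ∀ h, ρm (dH h) = d (ρm h)
  pos_neg : ∀ h, sw ((LinearMap.mul ℂ A).compl₁₂ ρp ρm) h = algebraMap ℂ A (Coalgebra.counit h)
  neg_pos : ∀ h, sw ((LinearMap.mul ℂ A).compl₁₂ ρm ρp) h = algebraMap ℂ A (Coalgebra.counit h)
  cocycle_pos : ∀ h g, ρp (h * g) = sw ((LinearMap.mul ℂ A).compl₁₂ ρp (π.flip (ρp g))) h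
  cocycle_neg : ∀ h, ∀ n, ∀ g ∈ 𝓗 n, ρm (h * g) =
    sw ((LinearMap.mul ℂ A).compl₁₂ (π.flip (ρm g)) (ρm ∘ₗ gradeSign 𝓗 ^ n)) h
  pos_one : ρp 1 = 1
  neg_one : ρm 1 = 1
  pos_sigma : ρp σ = 1
  neg_sigma : ρm σ = 1

/-- The map `h ↦ (a ↦ ∑ ρ⁺ h₍₀₎ * π h₍₁₎ a)`. -/
def leftTwist (π : H →ₗ[ℂ] A →ₗ[ℂ] A) (ρp : H →ₗ[ℂ] A) : H →ₗ[ℂ] Module.End ℂ A :=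
  sw ((LinearMap.mul ℂ (Module.End ℂ A)).compl₁₂ (LinearMap.mul ℂ A ∘ₗ ρp) π)

/-- The twisted action
`π' h a = ∑ (-1) ^ (|h₍₂₎| |a|) ρ⁺ h₍₀₎ * π h₍₁₎ a * ρ⁻ h₍₂₎`;
here `γH` and `γ` are the grading involutions of `H` and `A`, and the sum over `e` splits
`h₍₂₎` into its even and odd parts. -/
def twist (γH : H →ₗ[ℂ] H) (γ : A →ₗ[ℂ] A) (π : H →ₗ[ℂ] A →ₗ[ℂ] A) (ρp ρm : H →ₗ[ℂ] A) :
    H →ₗ[ℂ] A →ₗ[ℂ] A :=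
  ∑ e ∈ Finset.range 2,
    (LinearMap.lcomp ℂ A (γ ^ e)) ∘ₗ
      sw ((LinearMap.mul ℂ (Module.End ℂ A)).flip.compl₁₂ (leftTwist π ρp)
        ((LinearMap.mul ℂ A).flip ∘ₗ ρm ∘ₗ parityPart γH e))

/-- `I` is a closed graded `σ`-trace which is `δ`-invariant under `π`. -/
structure IsClosedInvariantTrace (𝓗 : ℕ → Submodule ℂ H) (S : H →ₗ[ℂ] H) (δ : H →ₐ[ℂ] ℂ) (σ : H)
    (𝒜 : ℕ → Submodule ℂ A) (d : A →ₗ[ℂ] A) (π : H →ₗ[ℂ] A →ₗ[ℂ] A) (I : A →ₗ[ℂ] ℂ) :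
    Prop where
  closed : ∀ a, I (d a) = 0
  invariant : ∀ m n, ∀ h ∈ 𝓗 m, ∀ a ∈ 𝒜 n, ∀ b,
    I (π h a * b) = (-1 : ℂ) ^ (m * n) * I (a * π (twistedAntipode S δ h) b)
  trace : ∀ m n, ∀ a ∈ 𝒜 m, ∀ b ∈ 𝒜 n, I (a * b) = (-1 : ℂ) ^ (m * n) * I (b * π σ a)

end Action

/-! ### Total complexes and cyclic cohomology -/

/-- The operators from which the `(b, B)`-complex with extra differential is formed. -/
structure CyclicOps (X : ℕ → Type u) [∀ n, AddCommGroup (X n)] [∀ n, Module ℂ (X n)] where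
  face : ∀ n, Fin (n + 2) → (X n →ₗ[ℂ] X (n + 1))
  degen : ∀ n, Fin (n + 1) → (X (n + 1) →ₗ[ℂ] X n)
  cyc : ∀ n, X n →ₗ[ℂ] X n
  diff : ∀ n, X n →ₗ[ℂ] X n

namespace CyclicOps

variable {X : ℕ → Type u} [∀ n, AddCommGroup (X n)] [∀ n, Module ℂ (X n)]
variable {Y : ℕ → Type v} [∀ n, AddCommGroup (Y n)] [∀ n, Module ℂ (Y n)]

/-- `b = ∑ (-1) ^ j δ_j`. -/
def b (O : CyclicOps X) (n : ℕ) : X n →ₗ[ℂ] X (n + 1) :=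
  ∑ j : Fin (n + 2), (-1 : ℂ) ^ (j : ℕ) • O.face n j

/-- The signed cyclic operator `(-1) ^ n τ_n`. -/
def lam (O : CyclicOps X) (n : ℕ) : Module.End ℂ (X n) := (-1 : ℂ) ^ n • O.cyc n

/-- `B = (∑_{j ≤ n} λ_n ^ j) σ_n τ_{n+1} (1 - λ_{n+1}) : X^{n+1} → X^n`. -/
def B (O : CyclicOps X) (n : ℕ) : X (n + 1) →ₗ[ℂ] X n :=
  (∑ j ∈ Finset.range (n + 1), O.lam n ^ j) ∘ₗ O.degen n (Fin.last n) ∘ₗ O.cyc (n + 1) ∘ₗ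
    (LinearMap.id - O.lam (n + 1))

/-- The part of the total differential given by `b`. -/
def bPart (O : CyclicOps X) (q : ℕ) : ∀ k, (∀ _ k : ℕ, X k) →ₗ[ℂ] X k
  | 0 => 0
  | k + 1 => O.b k ∘ₗ LinearMap.proj k ∘ₗ LinearMap.proj q

/-- The part of the total differential given by `B`. -/
def BPart (O : CyclicOps X) : ∀ (_ k : ℕ), (∀ _ k : ℕ, X k) →ₗ[ℂ] X k
  | 0, _ => 0
  | q + 1, k => O.B k ∘ₗ LinearMap.proj (k + 1) ∘ₗ LinearMap.proj q

/-- The total differential `∂ = b + B + (-1) ^ k d`.  A family `x` has component `x q k : X k` in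
bidegree `(p, q) = (q + k, q)` of the bicomplex; `b` raises `p` and `B` raises `q` by one. -/
def total (O : CyclicOps X) : (∀ _ k : ℕ, X k) →ₗ[ℂ] (∀ _ k : ℕ, X k) :=
  LinearMap.pi fun q => LinearMap.pi fun k =>
    O.bPart q k + O.BPart q k +
      (-1 : ℂ) ^ k • (O.diff k ∘ₗ LinearMap.proj k ∘ₗ LinearMap.proj q)

/-- The elements of `X k` killed by all degeneracies. -/
def normalized (O : CyclicOps X) : ∀ k, Submodule ℂ (X k)
  | 0 => ⊤
  | k + 1 => ⨅ j : Fin (k + 1), LinearMap.ker (O.degen k j)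

end CyclicOps

section Total

variable {X : ℕ → Type u} [∀ n, AddCommGroup (X n)] [∀ n, Module ℂ (X n)]
variable {Y : ℕ → Type v} [∀ n, AddCommGroup (Y n)] [∀ n, Module ℂ (Y n)]

/-- Finite families with components in prescribed subspaces `W k` of `X k`. -/
def finiteCochains (W : ∀ k, Submodule ℂ (X k)) : Submodule ℂ (∀ _ k : ℕ, X k) where
  carrier := {x | (∀ q k, x q k ∈ W k) ∧ ∃ N, ∀ q k, N ≤ q + k → x q k = 0}
  zero_mem' := ⟨fun _ k => (W k).zero_mem, 0, fun _ _ _ => rfl⟩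
  add_mem' := by
    rintro x y ⟨hx, N, hN⟩ ⟨hy, M, hM⟩
    refine ⟨fun q k => (W k).add_mem (hx q k) (hy q k), N + M, fun q k h => ?_⟩
    simp [hN q k (by omega), hM q k (by omega)]
  smul_mem' := by
    rintro c x ⟨hx, N, hN⟩
    refine ⟨fun q k => (W k).smul_mem c (hx q k), N, fun q k h => ?_⟩
    simp [hN q k h]

/-- The map of families given by a linear map in each cyclic degree. -/
def totMap (f : ∀ k, X k →ₗ[ℂ] Y k) : (∀ _ k : ℕ, X k) →ₗ[ℂ] (∀ _ k : ℕ, Y k) :=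
  LinearMap.pi fun q => LinearMap.pi fun k => f k ∘ₗ LinearMap.proj k ∘ₗ LinearMap.proj q

/-- The cocycles of the total complex `C`. -/
def cocycles (O : CyclicOps X) (C : Submodule ℂ (∀ _ k : ℕ, X k)) :
    Submodule ℂ (∀ _ k : ℕ, X k) :=
  C ⊓ LinearMap.ker O.total

/-- The cohomology (in all degrees at once) of the total complex `C` with differential `∂`. -/
abbrev HC (O : CyclicOps X) (C : Submodule ℂ (∀ _ k : ℕ, X k)) : Type u :=
  ↥(cocycles O C) ⧸ (C.map O.total).comap (cocycles O C).subtype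

/-- `F` maps the complex `C` to the complex `D` and commutes with the total differentials. -/
structure IsCochainMap (O : CyclicOps X) (C : Submodule ℂ (∀ _ k : ℕ, X k))
    (P : CyclicOps Y) (D : Submodule ℂ (∀ _ k : ℕ, Y k))
    (F : (∀ _ k : ℕ, X k) →ₗ[ℂ] (∀ _ k : ℕ, Y k)) : Prop where
  map_mem : ∀ x ∈ C, F x ∈ D
  comm : ∀ x ∈ C, P.total (F x) = F (O.total x)

/-- The map induced on cohomology by a map of complexes. -/
def HC.map {O : CyclicOps X} {C : Submodule ℂ (∀ _ k : ℕ, X k)}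
    {P : CyclicOps Y} {D : Submodule ℂ (∀ _ k : ℕ, Y k)}
    {F : (∀ _ k : ℕ, X k) →ₗ[ℂ] (∀ _ k : ℕ, Y k)} (hF : IsCochainMap O C P D F) :
    HC O C →ₗ[ℂ] HC P D :=
  Submodule.mapQ _ _
    (F.restrict (p := cocycles O C) (q := cocycles P D) (by
      rintro x ⟨hx, hx'⟩
      refine ⟨hF.map_mem x hx, ?_⟩
      change O.total x = 0 at hx'
      change P.total (F x) = 0
      rw [hF.comm x hx, hx', map_zero]))
    (by
      rintro ⟨x, hx⟩ ⟨y, hy, hyx⟩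
      refine ⟨F y, hF.map_mem y hy, ?_⟩
      rw [hF.comm y hy, hyx]
      rfl)

end Total

/-! ### The cyclic module of a Hopf algebra -/

section HopfCyclic

/-- The iterated tensor power `H ⊗ (H ⊗ (⋯ ⊗ ℂ))`. -/
def tpowMod (H : Type u) [AddCommGroup H] [Module ℂ H] : ℕ → ModuleCat.{u} ℂ
  | 0 => ModuleCat.of ℂ (ULift.{u} ℂ)
  | n + 1 => ModuleCat.of ℂ (H ⊗[ℂ] tpowMod H n)

/-- The tensor power `H^{⊗ n}`. -/
abbrev TPow (H : Type u) [AddCommGroup H] [Module ℂ H] (n : ℕ) : Type u := tpowMod H n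

section Basic

variable {H : Type u} [AddCommGroup H] [Module ℂ H]

/-- The unit of `H^{⊗ 0} = ℂ`. -/
def tone : TPow H 0 := (ULift.up 1 : ULift.{u} ℂ)

/-- The identification of `H^{⊗ 0}` with `ℂ`. -/
def tzero : TPow H 0 →ₗ[ℂ] ℂ := (ULift.moduleEquiv (R := ℂ) (M := ℂ)).toLinearMap

/-- `h ⊗ t`. -/
def tcons (n : ℕ) : H →ₗ[ℂ] TPow H n →ₗ[ℂ] TPow H (n + 1) := TensorProduct.mk ℂ H (TPow H n)

/-- The linear map with `h ⊗ t ↦ f h t`. -/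
def tlift {M : Type*} [AddCommGroup M] [Module ℂ M] {n : ℕ}
    (f : H →ₗ[ℂ] TPow H n →ₗ[ℂ] M) : TPow H (n + 1) →ₗ[ℂ] M :=
  TensorProduct.lift f

@[simp]
theorem tlift_tcons {M : Type*} [AddCommGroup M] [Module ℂ M] {n : ℕ}
    (f : H →ₗ[ℂ] TPow H n →ₗ[ℂ] M) (h : H) (t : TPow H n) : tlift f (tcons n h t) = f h t :=
  TensorProduct.lift.tmul h t

@[simp]
theorem tzero_tone : tzero (tone : TPow H 0) = 1 := rfl

/-- `h₁ ⊗ ⋯ ⊗ hₙ ↦ h₁ ⊗ ⋯ ⊗ hₙ ⊗ s`. -/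
def tappend (s : H) : ∀ n, TPow H n →ₗ[ℂ] TPow H (n + 1)
  | 0 => tcons 0 s
  | n + 1 => tlift ((tcons (n + 1)).compl₂ (tappend s n))

/-- The differential on tensor powers: `d (h ⊗ t) = d h ⊗ t + (-1) ^ |h| h ⊗ d t`. -/
def tdiff (γH d : H →ₗ[ℂ] H) : ∀ n, TPow H n →ₗ[ℂ] TPow H n
  | 0 => 0
  | n + 1 => tlift ((tcons n) ∘ₗ d + ((tcons n).compl₂ (tdiff γH d n)) ∘ₗ γH)

end Basic

variable {H : Type u} [Ring H] [Algebra ℂ H] [Coalgebra ℂ H]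

/-- Face maps: `1 ⊗ t` for `j = 0`, coproduct of the `j`-th factor for `1 ≤ j ≤ n`, and
`t ⊗ σ` for `j = n + 1`. -/
def tface (σ : H) : ∀ (n _ : ℕ), TPow H n →ₗ[ℂ] TPow H (n + 1)
  | n, 0 => tcons n 1
  | 0, _ + 1 => tappend σ 0
  | n + 1, 1 => (TensorProduct.assoc ℂ H H (TPow H n)).toLinearMap ∘ₗ
      TensorProduct.map Coalgebra.comul LinearMap.id
  | n + 1, j + 2 => tlift ((tcons (n + 1)).compl₂ (tface σ n (j + 1)))

/-- Degeneracies: apply the counit to the factor number `i + 1`. -/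
def tdegen : ∀ (n _ : ℕ), TPow H (n + 1) →ₗ[ℂ] TPow H n
  | n, 0 => tlift (LinearMap.lsmul ℂ (TPow H n) ∘ₗ Coalgebra.counit)
  | 0, _ + 1 => 0
  | n + 1, i + 1 => tlift ((tcons n).compl₂ (tdegen n i))

/-- Diagonal left multiplication of `H` on `H^{⊗ n}`:
`h · (x ⊗ t) = ∑ (-1) ^ (|h₍₁₎| |x|) h₍₀₎ x ⊗ h₍₁₎ · t`, and `h · z = ε(h) z` for `n = 0`. -/
def tact (γH : H →ₗ[ℂ] H) : ∀ n, H →ₗ[ℂ] TPow H n →ₗ[ℂ] TPow H n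
  | 0 => LinearMap.lsmul ℂ (TPow H 0) ∘ₗ Coalgebra.counit
  | n + 1 => ∑ e ∈ Finset.range 2,
      (TensorProduct.homTensorHomMap (RingHom.id ℂ) H (TPow H n) H (TPow H n)) ∘ₗ
        TensorProduct.map (LinearMap.lcomp ℂ H (γH ^ e) ∘ₗ LinearMap.mul ℂ H)
          (tact γH n ∘ₗ parityPart γH e) ∘ₗ Coalgebra.comul

/-- The cyclic operators `h ⊗ t ↦ S̃(h) · (t ⊗ σ)`. -/
def tcyc (γH S : H →ₗ[ℂ] H) (δ : H →ₐ[ℂ] ℂ) (σ : H) : ∀ n, TPow H n →ₗ[ℂ] TPow H n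
  | 0 => LinearMap.id
  | n + 1 => tlift ((tact γH (n + 1) ∘ₗ twistedAntipode S δ).compl₂ (tappend σ n))

/-- The cyclic module `n ↦ H^{⊗ n}` with the differential. -/
def hopfOps (𝓗 : ℕ → Submodule ℂ H) [GradedAlgebra 𝓗] (d S : H →ₗ[ℂ] H) (δ : H →ₐ[ℂ] ℂ) (σ : H) :
    CyclicOps (TPow H) where
  face n j := tface σ n j
  degen n j := tdegen n j
  cyc n := tcyc (gradeSign 𝓗) S δ σ n
  diff n := tdiff (gradeSign 𝓗) d n

end HopfCyclic

/-! ### The cyclic module of a graded algebra -/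

section AlgCyclic

variable {A : Type v} [Ring A] [Algebra ℂ A]

/-- The operators are given on all functions of `k + 1` variables, by linear precomposition
formulas; they are used on multilinear functionals. -/
abbrev Fun (A : Type v) (k : ℕ) : Type v := (Fin (k + 1) → A) → ℂ

/-- `(a₀, …, aₖ) ↦ (aₖ, γ^e a₀, …, γ^e aₖ₋₁)` with `aₖ` replaced by its part of parity `e`; summing
over `e` gives the cyclic permutation with its Koszul sign. -/
def rot (γ : A →ₗ[ℂ] A) (k : ℕ) (e : ℕ) (a : Fin (k + 1) → A) : Fin (k + 1) → A :=
  Fin.cons (α := fun _ => A) (parityPart γ e (a (Fin.last k)))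
    (fun i : Fin k => (γ ^ e) (a i.castSucc))

/-- The cyclic operator
`(τ φ)(a₀, …, aₖ) = (-1) ^ (|aₖ| (|a₀| + ⋯ + |aₖ₋₁|)) φ(aₖ, a₀, …, aₖ₋₁)`. -/
def algCyc (γ : A →ₗ[ℂ] A) (k : ℕ) : Fun A k →ₗ[ℂ] Fun A k :=
  ∑ e ∈ Finset.range 2, LinearMap.funLeft ℂ ℂ (rot γ k e)

/-- The faces `φ(…, aⱼ aⱼ₊₁, …)` for `j ≤ k`, and for `j = k + 1`
`(-1) ^ (|aₖ₊₁| (|a₀| + ⋯ + |aₖ|)) φ(aₖ₊₁ a₀, a₁, …, aₖ)`. -/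
def algFace (γ : A →ₗ[ℂ] A) (k : ℕ) (j : Fin (k + 2)) : Fun A k →ₗ[ℂ] Fun A (k + 1) :=
  if j = Fin.last (k + 1) then
    ∑ e ∈ Finset.range 2,
      LinearMap.funLeft ℂ ℂ (fun a => Fin.contractNth 0 (· * ·) (rot γ (k + 1) e a))
  else LinearMap.funLeft ℂ ℂ (fun a => Fin.contractNth j (· * ·) a)

/-- `(d φ)(a₀, …, aₖ) = ∑ (-1) ^ (|a₀| + ⋯ + |aⱼ₋₁|) φ(a₀, …, d aⱼ, …, aₖ)`. -/
def algDiff (γ d : A →ₗ[ℂ] A) (k : ℕ) : Fun A k →ₗ[ℂ] Fun A k :=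
  ∑ j : Fin (k + 1), LinearMap.funLeft ℂ ℂ
    (fun a i => if i < j then γ (a i) else if i = j then d (a i) else a i)

/-- The cyclic module of functionals on `A`; the `j`-th degeneracy inserts `1` after `aⱼ`. -/
def algOps (γ d : A →ₗ[ℂ] A) : CyclicOps (Fun A) where
  face k j := algFace γ k j
  degen k j := LinearMap.funLeft ℂ ℂ
    (fun a => Fin.insertNth (α := fun _ => A) j.succ (1 : A) a)
  cyc k := algCyc γ k
  diff k := algDiff γ d k

/-- Continuous `(k + 1)`-linear functionals which are finite sums of functionals with weights, that
is, which vanish on homogeneous arguments of large total degree. -/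
def algCochain [TopologicalSpace A] (𝒜 : ℕ → Submodule ℂ A) (k : ℕ) : Submodule ℂ (Fun A k) where
  carrier := {φ | (∃ f : ContinuousMultilinearMap ℂ (fun _ : Fin (k + 1) => A) ℂ, ⇑f = φ) ∧
    ∃ N, ∀ (m : Fin (k + 1) → ℕ) (a : Fin (k + 1) → A), (∀ i, a i ∈ 𝒜 (m i)) →
      N < ∑ i, m i → φ a = 0}
  zero_mem' := ⟨⟨0, rfl⟩, 0, fun _ _ _ _ => rfl⟩
  add_mem' := by
    rintro φ ψ ⟨⟨f, rfl⟩, N, hN⟩ ⟨⟨g, rfl⟩, M, hM⟩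
    refine ⟨⟨f + g, rfl⟩, N + M, fun m a ha h => ?_⟩
    simp [hN m a ha (by omega), hM m a ha (by omega)]
  smul_mem' := by
    rintro c φ ⟨⟨f, rfl⟩, N, hN⟩
    refine ⟨⟨c • f, rfl⟩, N, fun m a ha h => ?_⟩
    simp [hN m a ha h]

end AlgCyclic

/-! ### The characteristic map -/

section Chi

variable {H : Type u} [Ring H] [Algebra ℂ H]
variable {A : Type v} [Ring A] [Algebra ℂ A]

/-- Auxiliary: `P ↦ (-1) ^ (n (n + 1) / 2 + n |P|) P * π h a`, for `h` of degree `n`. -/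
def chiStep (𝓗 : ℕ → Submodule ℂ H) [GradedAlgebra 𝓗] (γ : A →ₗ[ℂ] A) (π : H →ₗ[ℂ] A →ₗ[ℂ] A)
    (a : A) : H →ₗ[ℂ] Module.End ℂ A :=
  ∑ e ∈ Finset.range 2,
    (LinearMap.lcomp ℂ A (γ ^ e)) ∘ₗ (LinearMap.mul ℂ A).flip ∘ₗ π.flip a ∘ₗ
      parityPart (gradeSign 𝓗) e ∘ₗ gradeScale 𝓗 (fun n => (-1) ^ (n * (n + 1) / 2))

/-- Auxiliary: `P ↦ ± P * π h¹ a₁ * ⋯ * π hᵏ aₖ`. -/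
def chiAux (𝓗 : ℕ → Submodule ℂ H) [GradedAlgebra 𝓗] (γ : A →ₗ[ℂ] A)
    (π : H →ₗ[ℂ] A →ₗ[ℂ] A) : ∀ k, TPow H k →ₗ[ℂ] ((Fin k → A) → Module.End ℂ A)
  | 0 => LinearMap.pi fun _ => LinearMap.lsmul ℂ A ∘ₗ tzero
  | k + 1 => LinearMap.pi fun a => tlift
      ((LinearMap.mul ℂ (Module.End ℂ A)).flip.compl₁₂ (chiStep 𝓗 γ π (a 0))
        (LinearMap.proj (Fin.tail a) ∘ₗ chiAux 𝓗 γ π k))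

/-- The characteristic map.  On homogeneous elements, with `N = ∑ |hʲ|`,
`χ(h¹ ⊗ ⋯ ⊗ hᵏ)(a₀, …, aₖ) =
  (-1) ^ (N (N + 1) / 2 + ∑_{j > i ≥ 0} |hʲ| |aᵢ|) ∫ a₀ * π h¹ a₁ * ⋯ * π hᵏ aₖ`.
In the recursion each `hʲ` is moved past `a₀ * π h¹ a₁ * ⋯ * π hʲ⁻¹ aⱼ₋₁`, and the signs
`∑ |hⁱ| |hʲ|` so obtained combine with the `|hʲ| (|hʲ| + 1) / 2` to `N (N + 1) / 2`. -/
def chi (𝓗 : ℕ → Submodule ℂ H) [GradedAlgebra 𝓗] (γ : A →ₗ[ℂ] A) (π : H →ₗ[ℂ] A →ₗ[ℂ] A)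
    (I : A →ₗ[ℂ] ℂ) (k : ℕ) : TPow H k →ₗ[ℂ] Fun A k :=
  LinearMap.pi fun a =>
    I ∘ₗ LinearMap.applyₗ (a 0) ∘ₗ LinearMap.proj (Fin.tail a) ∘ₗ chiAux 𝓗 γ π k

end Chi

/-! ### Two by two matrices and the explicit homotopy -/

section Homotopy

variable {H : Type u} [Ring H] [Algebra ℂ H] [Coalgebra ℂ H]
variable {A : Type v} [Ring A] [Algebra ℂ A]

/-- Two by two matrices over `A`. -/
abbrev M₂ (A : Type v) : Type v := Matrix (Fin 2) (Fin 2) A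

/-- A linear map applied to all entries. -/
def entrywise (f : A →ₗ[ℂ] A) : M₂ A →ₗ[ℂ] M₂ A := LinearMap.mapMatrix f

/-- The action on matrices by `π` on all entries. -/
def matrixAction (π : H →ₗ[ℂ] A →ₗ[ℂ] A) : H →ₗ[ℂ] M₂ A →ₗ[ℂ] M₂ A :=
  LinearMap.mk₂ ℂ (fun h M => entrywise (π h) M)
    (by intros; ext; simp [entrywise]) (by intros; ext; simp [entrywise])
    (by intros; ext; simp [entrywise]) (by intros; ext; simp [entrywise])

/-- `h ↦ diag(ρ h, ε h)`. -/
def matrixCocycle (ρ : H →ₗ[ℂ] A) : H →ₗ[ℂ] M₂ A where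
  toFun h := !![ρ h, 0; 0, algebraMap ℂ A (Coalgebra.counit h)]
  map_add' := by intros; ext i j; fin_cases i <;> fin_cases j <;> simp
  map_smul' := by
    intro c h; ext i j; fin_cases i <;> fin_cases j <;> simp [Algebra.algebraMap_eq_smul_one, mul_smul]

/-- `∫₂ M = ∫ (M₁₁ + M₂₂)`. -/
def matrixTrace (I : A →ₗ[ℂ] ℂ) : M₂ A →ₗ[ℂ] ℂ := I ∘ₗ Matrix.traceLinearMap (Fin 2) ℂ A

/-- The twist `π'₂` of the entrywise action by `diag(ρ⁺, ε)` and `diag(ρ⁻, ε)`. -/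
def matrixTwist (γH : H →ₗ[ℂ] H) (γ : A →ₗ[ℂ] A) (π : H →ₗ[ℂ] A →ₗ[ℂ] A) (ρp ρm : H →ₗ[ℂ] A) :
    H →ₗ[ℂ] M₂ A →ₗ[ℂ] M₂ A :=
  twist γH (entrywise γ) (matrixAction π) (matrixCocycle ρp) (matrixCocycle ρm)

/-- The infinitesimal rotation. -/
def gMat (A : Type v) [Ring A] : M₂ A := !![0, -1; 1, 0]

/-- The rotation `u_t = exp (t g)`. -/
def uMat (A : Type v) [Ring A] [Algebra ℂ A] (t : ℝ) : M₂ A :=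
  !![algebraMap ℂ A (Real.cos t), -algebraMap ℂ A (Real.sin t);
     algebraMap ℂ A (Real.sin t), algebraMap ℂ A (Real.cos t)]

/-- The unital extension to `ℂ ⊕ A` of `i_t a = u_t * diag(0, a) * u_t⁻¹`. -/
def iMap (t : ℝ) (x : Unitization ℂ A) : M₂ A :=
  algebraMap ℂ (M₂ A) x.fst + uMat A t * !![0, 0; 0, x.snd] * uMat A (-t)

/-- `(I_g φ)(x₀, …, xₖ) = ∑ (-1) ^ (j + 1) φ(x₀, …, xⱼ, g, xⱼ₊₁, …, xₖ)`. -/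
def insertG (k : ℕ) (φ : Fun (M₂ A) (k + 1)) : Fun (M₂ A) k := fun x =>
  ∑ j : Fin (k + 1), (-1 : ℂ) ^ ((j : ℕ) + 1) *
    φ (Fin.insertNth (α := fun _ => M₂ A) j.succ (gMat A) x)

/-- The operator `K φ = ∫_0^{π/2} i_t^* I_g φ dt`. -/
def kOp (k : ℕ) (φ : Fun (M₂ A) (k + 1)) : Fun (Unitization ℂ A) k := fun a =>
  ∫ t in (0 : ℝ)..(Real.pi / 2), insertG k φ (fun i => iMap t (a i))

/-- The algebra with a unit adjoined carries the product topology of `ℂ × A`. -/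
instance unitizationTopology [TopologicalSpace A] : TopologicalSpace (Unitization ℂ A) :=
  TopologicalSpace.induced (fun x => (x.fst, x.snd)) inferInstance

/-- The extension `(z, a) ↦ (z, f a)` of the grading involution of `A`. -/
def unitSign (f : A →ₗ[ℂ] A) : Unitization ℂ A →ₗ[ℂ] Unitization ℂ A where
  toFun x := Unitization.inl x.fst + Unitization.inr (f x.snd)
  map_add' := by intros; ext <;> simp
  map_smul' := by intros; ext <;> simp

/-- The extension `(z, a) ↦ (0, d a)` of the differential. -/
def unitDiff (d : A →ₗ[ℂ] A) : Unitization ℂ A →ₗ[ℂ] Unitization ℂ A where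
  toFun x := Unitization.inr (d x.snd)
  map_add' := by intros; ext <;> simp
  map_smul' := by intros; ext <;> simp

/-- The grading of the algebra with a unit adjoined; the new unit has degree zero. -/
def unitGrading (𝒜 : ℕ → Submodule ℂ A) (n : ℕ) : Submodule ℂ (Unitization ℂ A) where
  carrier := {x | (n ≠ 0 → x.fst = 0) ∧ x.snd ∈ 𝒜 n}
  zero_mem' := ⟨fun _ => rfl, (𝒜 n).zero_mem⟩
  add_mem' := by
    rintro x y ⟨hx, hx'⟩ ⟨hy, hy'⟩
    exact ⟨fun h => by simp [hx h, hy h], (𝒜 n).add_mem hx' hy'⟩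
  smul_mem' := by
    rintro c x ⟨hx, hx'⟩
    exact ⟨fun h => by simp [hx h], (𝒜 n).smul_mem c hx'⟩

/-- Pull-back of functionals along the unital homomorphism `ℂ ⊕ A → A`, `(z, a) ↦ z 1 + a`. -/
def unitPull (k : ℕ) : Fun A k →ₗ[ℂ] Fun (Unitization ℂ A) k :=
  LinearMap.funLeft ℂ ℂ (fun a i => algebraMap ℂ A (a i).fst + (a i).snd)

end Homotopy

/-! ### The complexes and maps of the theorem -/

section Main

variable {H : Type u} [Ring H] [Algebra ℂ H] [Coalgebra ℂ H]
variable {A : Type v} [Ring A] [Algebra ℂ A]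

/-- The finite cochains of the total complex of the Hopf algebra. -/
def hopfCochains (H : Type u) [Ring H] [Algebra ℂ H] : Submodule ℂ (∀ _ k : ℕ, TPow H k) :=
  finiteCochains fun _ => ⊤

/-- The finite cochains of the normalized total complex of the Hopf algebra. -/
def hopfNormCochains (𝓗 : ℕ → Submodule ℂ H) [GradedAlgebra 𝓗] (d S : H →ₗ[ℂ] H) (δ : H →ₐ[ℂ] ℂ)
    (σ : H) : Submodule ℂ (∀ _ k : ℕ, TPow H k) :=
  finiteCochains (hopfOps 𝓗 d S δ σ).normalized

/-- The finite cochains of the total complex of the DG algebra. -/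
def algCochains [TopologicalSpace A] (𝒜 : ℕ → Submodule ℂ A) : Submodule ℂ (∀ _ k : ℕ, Fun A k) :=
  finiteCochains (algCochain 𝒜)

/-- The operators of the cyclic module of the DG algebra `A`. -/
def dgaOps (𝒜 : ℕ → Submodule ℂ A) [GradedAlgebra 𝒜] (d : A →ₗ[ℂ] A) : CyclicOps (Fun A) :=
  algOps (gradeSign 𝒜) d

/-- The operators of the cyclic module of the DG algebra `ℂ ⊕ A` with a unit adjoined. -/
def unitOps (𝒜 : ℕ → Submodule ℂ A) [GradedAlgebra 𝒜] (d : A →ₗ[ℂ] A) :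
    CyclicOps (Fun (Unitization ℂ A)) :=
  algOps (unitSign (gradeSign 𝒜)) (unitDiff d)

/-- The finite cochains of the normalized total complex of `ℂ ⊕ A`. -/
def unitNormCochains [TopologicalSpace A] (𝒜 : ℕ → Submodule ℂ A) [GradedAlgebra 𝒜]
    (d : A →ₗ[ℂ] A) : Submodule ℂ (∀ _ k : ℕ, Fun (Unitization ℂ A) k) :=
  finiteCochains fun k => algCochain (unitGrading 𝒜) k ⊓ (unitOps 𝒜 d).normalized k

/-- The action `π'` conjugate to `π` by `(ρ⁺, ρ⁻)`. -/
def innerTwist (𝓗 : ℕ → Submodule ℂ H) [GradedAlgebra 𝓗] (𝒜 : ℕ → Submodule ℂ A) [GradedAlgebra 𝒜]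
    (π : H →ₗ[ℂ] A →ₗ[ℂ] A) (ρp ρm : H →ₗ[ℂ] A) : H →ₗ[ℂ] A →ₗ[ℂ] A :=
  twist (gradeSign 𝓗) (gradeSign 𝒜) π ρp ρm

/-- The characteristic map on total complexes. -/
def chiTot (𝓗 : ℕ → Submodule ℂ H) [GradedAlgebra 𝓗] (𝒜 : ℕ → Submodule ℂ A) [GradedAlgebra 𝒜]
    (π : H →ₗ[ℂ] A →ₗ[ℂ] A) (I : A →ₗ[ℂ] ℂ) :
    (∀ _ k : ℕ, TPow H k) →ₗ[ℂ] (∀ _ k : ℕ, Fun A k) :=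
  totMap (chi 𝓗 (gradeSign 𝒜) π I)

/-- The characteristic map `χ_{π'₂}` with values in functionals on two by two matrices. -/
def matrixChi (𝓗 : ℕ → Submodule ℂ H) [GradedAlgebra 𝓗] (𝒜 : ℕ → Submodule ℂ A) [GradedAlgebra 𝒜]
    (π : H →ₗ[ℂ] A →ₗ[ℂ] A) (ρp ρm : H →ₗ[ℂ] A) (I : A →ₗ[ℂ] ℂ) (k : ℕ) :
    TPow H k →ₗ[ℂ] Fun (M₂ A) k :=
  chi 𝓗 (entrywise (gradeSign 𝒜)) (matrixTwist (gradeSign 𝓗) (gradeSign 𝒜) π ρp ρm)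
    (matrixTrace I) k

end Main

end DGCyc

end

open DGCyc

/-!
The characteristic maps respect all the structure of the cocyclic modules (`isCyclicMap_chi`): a
coproduct in the tensor corresponds to a product of neighbouring arguments because `θ` is an action
on an algebra, the last face is the trace property, the cyclic operator is invariance together with
the trace property, and the differential is closedness.  So `χ_π` and `χ_{π'}` are maps of
complexes; the twist `π'` is again an action since `ρ⁻ * ρ⁺ = 1` can be inserted between two factors
(`isDGAction_twist`).

To compare them, both are made corners of one characteristic map.  The twist of the entrywise action
on `M₂(A)` by `diag(ρ^±, ε)` is an action with invariant trace `∫ (M₁₁ + M₂₂)`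
(`isClosedInvariantTrace_matrixTrace`), and on diagonal matrices its characteristic map is the sum
of `χ_{π'}` on the first entry and `χ_π` on the second (`matrixChi_diagonal`).  The homomorphisms
`i_t : ℂ ⊕ A → M₂(A)` rotate the second corner, at `t = 0`, into the first, at `t = π / 2`; the
values on scalars do not depend on the action and cancel in the difference (`pull_matrixChi`).
The derivative of `i_t^*` is `i_t^*` composed with the inner derivation by `g`, which is contracted
by insertion: `b I + I b = ad g` (`b_insertion`), while `I` anticommutes with `B` on normalized
functionals (`B_insertion`).  The operators of the bicomplex evaluate functionals at finitely many
points, and hence commute with integration over `t` (`IsLocal.integral`); integration of the Cartan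
formula gives the homotopy formula (`total_kOp`, `homotopy_total`).  The homotopy takes values in
functionals continuous for the discrete topology on the scalars; normalized ones are linear in at
most one scalar, and therefore continuous for the usual topology (`mem_algCochain_unit`).

The homotopy formula on normalized cochains does not by itself compare the classes of arbitrary
cocycles, as `B` and the insertion of `g` need not anticommute without normalization.  However, in
characteristic zero every cocycle of the total complex is cohomologous to a cyclic cocycle in column
zero (`CyclicRelations.exists_cyclic_of_total`, `CyclicOps.single_total`), and on cyclic functionals
`B` vanishes before and after insertion, so that the homotopy formula holds there as well.  It
yields a primitive on `ℂ ⊕ A` of the pull-back of a cyclic cocycle representing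
`χ_{π'} - χ_π`.  The primitive may again be taken cyclic; on cyclic functionals the total
differential involves only faces and the differential, so it may be restricted along the non-unital
inclusion of `A` (`exists_total_eq`).
-/

noncomputable section

namespace DGCyc

/-! ### Reduction of the total complex to cyclic cochains -/

section Reduction

variable {V : Type*} [AddCommGroup V] [Module ℂ V]

/-- The operators `D = b ± d`, `D' = b' ± d`, the extra degeneracy `s`, `P = 1 - λ` and the norm
`N = ∑ λ ^ j` of a cocyclic module, acting on families of cochains, together with the relations
between them.  `F K` is the space of finite families vanishing in all degrees `≥ K`. -/
structure CyclicRelations (F : ℕ → Submodule ℂ V) (D D' s P N : Module.End ℂ V) : Prop where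
  mono : Monotone F
  zero : F 0 = ⊥
  D_mem : ∀ {K x}, x ∈ F K → D x ∈ F (K + 1)
  D'_mem : ∀ {K x}, x ∈ F K → D' x ∈ F (K + 1)
  s_mem : ∀ {K x}, x ∈ F (K + 1) → s x ∈ F K
  P_mem : ∀ {K x}, x ∈ F K → P x ∈ F K
  N_mem : ∀ {K x}, x ∈ F K → N x ∈ F K
  PD : ∀ {K x}, x ∈ F K → P (D x) = D' (P x)
  ND' : ∀ {K x}, x ∈ F K → N (D' x) = D (N x)
  homotopy : ∀ {K x}, x ∈ F K → D' (s x) + s (D' x) = x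
  D'D' : ∀ {K x}, x ∈ F K → D' (D' x) = 0
  DD : ∀ {K x}, x ∈ F K → D (D x) = 0
  PN : ∀ {K x}, x ∈ F K → P (N x) = 0
  NP : ∀ {K x}, x ∈ F K → N (P x) = 0
  kerN : ∀ {K x}, x ∈ F K → N x = 0 → ∃ u ∈ F K, P u = x
  kerP : ∀ {K x}, x ∈ F K → P x = 0 → ∃ v ∈ F K, N v = x

/-- The finite sequences of finite families. -/
def finSeq (F : ℕ → Submodule ℂ V) (hF : Monotone F) : Submodule ℂ (ℕ → V) where
  carrier := {x | ∃ K, (∀ q, x q ∈ F K) ∧ ∀ q, K ≤ q → x q = 0}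
  zero_mem' := ⟨0, fun _ => (F 0).zero_mem, fun _ _ => rfl⟩
  add_mem' := by
    rintro x y ⟨K, hK, hK'⟩ ⟨L, hL, hL'⟩
    refine ⟨K + L, fun q => add_mem (hF (by omega) (hK q)) (hF (by omega) (hL q)), fun q h => ?_⟩
    simp [hK' q (by omega), hL' q (by omega)]
  smul_mem' := by
    rintro c x ⟨K, hK, hK'⟩
    exact ⟨K, fun q => (F K).smul_mem c (hK q), fun q h => by simp [hK' q h]⟩

/-- The total differential `D + N s P` on sequences. -/
def seqTotal (D s P N : Module.End ℂ V) : Module.End ℂ (ℕ → V) :=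
  LinearMap.pi fun q => D ∘ₗ LinearMap.proj q +
    match q with
    | 0 => 0
    | q + 1 => N ∘ₗ s ∘ₗ P ∘ₗ LinearMap.proj q

namespace CyclicRelations

variable {F : ℕ → Submodule ℂ V} {D D' s P N : Module.End ℂ V}

theorem seqTotal_zero (x : ℕ → V) : seqTotal D s P N x 0 = D (x 0) := by
  simp [seqTotal]

theorem seqTotal_succ (x : ℕ → V) (q : ℕ) :
    seqTotal D s P N x (q + 1) = D (x (q + 1)) + N (s (P (x q))) := by
  simp [seqTotal]

theorem seqTotal_single (q : ℕ) (v : V) :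
    seqTotal D s P N (Pi.single q v) = Pi.single q (D v) + Pi.single (q + 1) (N (s (P v))) := by
  ext r
  rcases r with _ | r
  · rw [seqTotal_zero]
    rcases eq_or_ne q 0 with rfl | h
    · simp
    · simp [Pi.single_eq_of_ne (Ne.symm h)]
  · rw [seqTotal_succ]
    rcases eq_or_ne q (r + 1) with rfl | h
    · simp
    · rcases eq_or_ne q r with rfl | h'
      · simp
      · simp [Pi.single_eq_of_ne (Ne.symm h), Pi.single_eq_of_ne (Ne.symm h'),
          Pi.single_eq_of_ne (show r + 1 ≠ q + 1 by omega)]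

/-- Finite sequences which differ by the boundary of a finite sequence. -/
def Homologous (h : CyclicRelations F D D' s P N) (x y : ℕ → V) : Prop :=
  ∃ z ∈ finSeq F h.mono, x = y + seqTotal D s P N z

variable (h : CyclicRelations F D D' s P N)
include h

theorem single_mem {K : ℕ} {v : V} (q : ℕ) (hv : v ∈ F K) :
    (Pi.single q v : ℕ → V) ∈ finSeq F h.mono := by
  refine ⟨K + q + 1, fun r => ?_, fun r hr => Pi.single_eq_of_ne (by omega) _⟩
  rcases eq_or_ne r q with rfl | hr
  · simpa using h.mono (by omega) hv
  · simp [Pi.single_eq_of_ne hr]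

theorem s_mem' {K : ℕ} {x : V} (hx : x ∈ F K) : s x ∈ F K := by
  cases K with
  | zero =>
    rw [h.zero, Submodule.mem_bot] at hx
    simp [hx]
  | succ K => exact h.mono K.le_succ (h.s_mem hx)

theorem B_mem {K : ℕ} {x : V} (hx : x ∈ F K) : N (s (P x)) ∈ F K :=
  h.N_mem (h.s_mem' (h.P_mem hx))

theorem DB {K : ℕ} {x : V} (hx : x ∈ F K) : D (N (s (P x))) + N (s (P (D x))) = 0 := by
  rw [h.PD hx, ← h.ND' (h.s_mem' (h.P_mem hx)), ← map_add, h.homotopy (h.P_mem hx), h.NP hx]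

theorem BB {K : ℕ} {x : V} (hx : x ∈ F K) : N (s (P (N (s (P x))))) = 0 := by
  rw [h.PN (h.s_mem' (h.P_mem hx)), map_zero, map_zero]

theorem seqTotal_seqTotal {x : ℕ → V} (hx : x ∈ finSeq F h.mono) :
    seqTotal D s P N (seqTotal D s P N x) = 0 := by
  obtain ⟨K, hK, -⟩ := hx
  ext q
  rcases q with _ | _ | q
  · simp [seqTotal_zero, h.DD (hK 0)]
  · rw [seqTotal_succ, seqTotal_succ, seqTotal_zero, map_add, h.DD (hK _), zero_add, h.DB (hK _)]
    rfl
  · rw [seqTotal_succ, seqTotal_succ, seqTotal_succ, map_add, h.DD (hK _), zero_add, map_add,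
      map_add, map_add, h.BB (hK _), add_zero, h.DB (hK _)]
    rfl

theorem Homologous.trans {x y z : ℕ → V} (hxy : h.Homologous x y) (hyz : h.Homologous y z) :
    h.Homologous x z := by
  obtain ⟨u, hu, rfl⟩ := hxy
  obtain ⟨v, hv, rfl⟩ := hyz
  exact ⟨v + u, add_mem hv hu, by rw [map_add, add_assoc]⟩

theorem Homologous.add {x y x' y' : ℕ → V} (hx : h.Homologous x y) (hx' : h.Homologous x' y') :
    h.Homologous (x + x') (y + y') := by
  obtain ⟨u, hu, rfl⟩ := hx
  obtain ⟨v, hv, rfl⟩ := hx'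
  exact ⟨u + v, add_mem hu hv, by rw [map_add]; abel⟩

theorem Homologous.refl (x : ℕ → V) : h.Homologous x x :=
  ⟨0, zero_mem _, by simp⟩

theorem Homologous.total_eq {x y : ℕ → V} (hx : h.Homologous x y) :
    seqTotal D s P N x = seqTotal D s P N y := by
  obtain ⟨u, hu, rfl⟩ := hx
  rw [map_add, h.seqTotal_seqTotal hu, add_zero]

/-- A cyclic cocycle can be moved to the preceding column (the periodicity operator). -/
theorem shift {K : ℕ} {c : V} (hc : c ∈ F K) (hPc : P c = 0) (hDc : D c = 0) (q : ℕ) :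
    ∃ K', ∃ c' ∈ F K', P c' = 0 ∧ D c' = 0 ∧
      h.Homologous (Pi.single (q + 1) c) (Pi.single q c') := by
  obtain ⟨v, hv, rfl⟩ := h.kerP hc hPc
  obtain ⟨y, hy, hPy⟩ := h.kerN (h.D'_mem hv) (by rw [h.ND' hv, hDc])
  have hsv := h.s_mem' hv
  refine ⟨K + 1 + 1, -D y, neg_mem (h.D_mem hy), ?_, ?_,
    Pi.single q y + Pi.single (q + 1) (N (s v)),
    add_mem (h.single_mem _ hy) (h.single_mem _ (h.N_mem hsv)), ?_⟩
  · rw [map_neg, h.PD hy, hPy, h.D'D' hv, neg_zero]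
  · rw [map_neg, h.DD hy, neg_zero]
  · have e : N (s (P y)) + D (N (s v)) = N v := by
      rw [hPy, ← h.ND' hsv, ← map_add, add_comm, h.homotopy hv]
    rw [map_add, seqTotal_single, seqTotal_single, h.PN hsv, map_zero, map_zero, Pi.single_zero,
      Pi.single_neg, ← e, Pi.single_add]
    abel

/-- A family killed by `B`, with `D z` cyclic, is homologous to a cyclic family. -/
theorem exists_cyclic (K : ℕ) : ∀ {z : V}, z ∈ F K → P (D z) = 0 → N (s (P z)) = 0 → ∀ Q : ℕ,
    ∃ K', ∃ c ∈ F K', P c = 0 ∧ D c = D z ∧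
      h.Homologous (Pi.single Q z) (Pi.single Q c) := by
  induction K using Nat.strong_induction_on with
  | _ K ih =>
  intro z hz hPD hB Q
  rcases K with _ | K
  · rw [h.zero, Submodule.mem_bot] at hz
    subst hz
    exact ⟨0, 0, zero_mem _, by simp, rfl, Homologous.refl h _⟩
  obtain ⟨u, hu, hPu⟩ := h.kerN (h.s_mem (h.P_mem hz)) hB
  -- `P z = D' s P z + s D' P z`, and the last term is `s P D z = 0`
  have hcyc : P (z - D u) = 0 := by
    rw [map_sub, h.PD hu, hPu, sub_eq_zero]
    conv_lhs => rw [← h.homotopy (h.P_mem hz), ← h.PD hz, hPD, map_zero, add_zero]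
  have hDu : D u ∈ F (K + 1) := h.D_mem hu
  have step : h.Homologous (Pi.single Q z)
      (Pi.single Q (z - D u) + Pi.single (Q + 1) (-N (s (P u)))) := by
    refine ⟨Pi.single Q u, h.single_mem _ hu, ?_⟩
    rw [seqTotal_single, Pi.single_sub, Pi.single_neg]
    abel
  have hBD : N (s (P (D u))) = 0 := by
    have : P (D u) = P z := by rw [map_sub, sub_eq_zero] at hcyc; exact hcyc.symm
    rw [this, hB]
  have hDB : D (N (s (P u))) = 0 := by
    have := h.DB hu
    rwa [hBD, add_zero] at this
  have hz1 : -N (s (P u)) ∈ F K := neg_mem (h.B_mem hu)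
  obtain ⟨L, c1, hc1, hPc1, hDc1, hom1⟩ := ih K (by omega) hz1 (by rw [map_neg, hDB]; simp)
    (by rw [map_neg, h.PN (h.s_mem' (h.P_mem hu))]; simp) (Q + 1)
  rw [map_neg, hDB, neg_zero] at hDc1
  obtain ⟨M, c2, hc2, hPc2, hDc2, hom2⟩ := h.shift hc1 hPc1 hDc1 Q
  refine ⟨K + 1 + M, z - D u + c2, add_mem (h.mono (by omega) (sub_mem hz hDu))
    (h.mono (by omega) hc2), by rw [map_add, hcyc, hPc2, add_zero],
    by rw [map_add, map_sub, h.DD hu, hDc2]; simp, ?_⟩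
  rw [Pi.single_add]
  exact (Homologous.trans h step (Homologous.add h (Homologous.refl h _)
    (Homologous.trans h hom1 hom2)))

/-- A finite sequence whose total differential is a cyclic family in column zero is homologous to
a cyclic family in column zero. -/
theorem exists_cyclic_of_total (Q : ℕ) : ∀ {x : ℕ → V}, x ∈ finSeq F h.mono →
    (∀ q, Q < q → x q = 0) → ∀ {φ : V}, P φ = 0 → seqTotal D s P N x = Pi.single 0 φ →
    ∃ K, ∃ ψ ∈ F K, P ψ = 0 ∧ h.Homologous x (Pi.single 0 ψ) := by
  induction Q with
  | zero =>
    intro x hx hQ φ hφ hT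
    obtain ⟨K, hK, -⟩ := hx
    have hx0 : x = Pi.single 0 (x 0) := by
      ext q
      rcases q with _ | q
      · simp
      · simp [hQ (q + 1) (by omega)]
    have h0 : D (x 0) = φ := by
      have := congr_fun hT 0
      rwa [seqTotal_zero, Pi.single_eq_same] at this
    have h1 : N (s (P (x 0))) = 0 := by
      have := congr_fun hT 1
      rwa [seqTotal_succ, hQ 1 (by omega), map_zero, zero_add,
        Pi.single_eq_of_ne (by omega)] at this
    obtain ⟨L, c, hc, hPc, -, hom⟩ := h.exists_cyclic K (hK 0) (by rw [h0, hφ]) h1 0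
    exact ⟨L, c, hc, hPc, by rw [hx0]; exact hom⟩
  | succ Q ih =>
    intro x hx hQ φ hφ hT
    obtain ⟨K, hK, -⟩ := id hx
    have hB : N (s (P (x (Q + 1)))) = 0 := by
      have := congr_fun hT (Q + 2)
      rwa [seqTotal_succ, hQ (Q + 2) (by omega), map_zero, zero_add,
        Pi.single_eq_of_ne (by omega)] at this
    have hD : D (x (Q + 1)) + N (s (P (x Q))) = 0 := by
      have := congr_fun hT (Q + 1)
      rwa [seqTotal_succ, Pi.single_eq_of_ne (by omega)] at this
    have hPD : P (D (x (Q + 1))) = 0 := by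
      rw [eq_neg_of_add_eq_zero_left hD, map_neg, h.PN (h.s_mem' (h.P_mem (hK Q))), neg_zero]
    have hPDw : P (D (x Q)) = 0 := by
      rcases Q with _ | Q
      · have := congr_fun hT 0
        rw [seqTotal_zero, Pi.single_eq_same] at this
        rw [this, hφ]
      · have := congr_fun hT (Q + 1)
        rw [seqTotal_succ, Pi.single_eq_of_ne (by omega)] at this
        rw [eq_neg_of_add_eq_zero_left this, map_neg, h.PN (h.s_mem' (h.P_mem (hK Q))), neg_zero]
    obtain ⟨L, c, hc, hPc, hDc, hom⟩ := h.exists_cyclic K (hK (Q + 1)) hPD hB (Q + 1)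
    obtain ⟨v, hv, rfl⟩ := h.kerP hc hPc
    -- the top component is now `N v`; it is cancelled by modifying the column before it
    set w := x Q with hw
    have hwK : w ∈ F K := hK Q
    have hsPw := h.s_mem' (h.P_mem hwK)
    have hsv := h.s_mem' hv
    obtain ⟨y, hy, hPy⟩ := h.kerN (x := D' v + s (P w)) (K := L + 1 + K)
      (add_mem (h.mono (by omega) (h.D'_mem hv)) (h.mono (by omega) hsPw))
      (by rw [map_add, h.ND' hv, hDc, hD])
    -- boundaries of `y` in column `Q` and of `N s v` in column `Q + 1` make the component in column
    -- `Q` cyclic; `c'` replaces the component in column `Q + 1`; it is again a cyclic cocycle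
    set c' := -N (s (s (P w))) with hc'
    have hc'K : c' ∈ F K := neg_mem (h.N_mem (h.s_mem' hsPw))
    have hPc' : P c' = 0 := by rw [hc', map_neg, h.PN (h.s_mem' hsPw), neg_zero]
    have hPw' : P (w - D y) = 0 := by
      rw [map_sub, h.PD hy, hPy, map_add, h.D'D' hv, zero_add, sub_eq_zero]
      conv_lhs => rw [← h.homotopy (h.P_mem hwK), ← h.PD hwK, hPDw, map_zero, add_zero]
    set x0 : ℕ → V := x - Pi.single (Q + 1) (x (Q + 1)) - Pi.single Q w with hx0
    have hx0mem : x0 ∈ finSeq F h.mono :=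
      sub_mem (sub_mem hx (h.single_mem _ (hK _))) (h.single_mem _ hwK)
    have hx0Q : ∀ q, Q ≤ q → x0 q = 0 := by
      intro q hq
      rcases eq_or_ne q Q with rfl | h1
      · simp [hx0, hw]
      · rcases eq_or_ne q (Q + 1) with rfl | h2
        · simp [hx0]
        · simp [hx0, h1, h2, hQ q (by omega)]
    have hom2 : h.Homologous (Pi.single Q w + Pi.single (Q + 1) (N v))
        (Pi.single Q (w - D y) + Pi.single (Q + 1) c') := by
      refine ⟨Pi.single Q y + Pi.single (Q + 1) (N (s v)),
        add_mem (h.single_mem _ hy) (h.single_mem _ (h.N_mem hsv)), ?_⟩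
      have e : N (s (P y)) + D (N (s v)) = N v - c' := by
        rw [hPy, ← h.ND' hsv, ← map_add, hc', sub_neg_eq_add, ← map_add]
        congr 1
        conv_rhs => rw [← h.homotopy hv]
        rw [map_add]
        abel
      rw [map_add, seqTotal_single, seqTotal_single, h.PN hsv, map_zero, map_zero, Pi.single_zero,
        Pi.single_sub]
      have e' : (Pi.single (Q + 1) (N (s (P y))) : ℕ → V) + Pi.single (Q + 1) (D (N (s v))) =
          Pi.single (Q + 1) (N v) - Pi.single (Q + 1) c' := by
        rw [← Pi.single_add, e, Pi.single_sub]
      rw [show ∀ a b c d e : ℕ → V, a - b + c + (b + d + (e + 0)) = a + c + (d + e) from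
        fun a b c d e => by abel, e']
      abel
    have hxsum : x = x0 + (Pi.single Q w + Pi.single (Q + 1) (x (Q + 1))) := by
      rw [hx0]; abel
    have hom3 : h.Homologous x (x0 + (Pi.single Q (w - D y) + Pi.single (Q + 1) c')) := by
      conv_lhs => rw [hxsum]
      exact Homologous.add h (Homologous.refl h _) (Homologous.trans h
        (Homologous.add h (Homologous.refl h _) hom) hom2)
    have hT3 := hom3.total_eq h
    rw [hT] at hT3
    have hDc' : D c' = 0 := by
      have := congr_fun hT3 (Q + 1)
      rw [seqTotal_succ, Pi.single_eq_of_ne (by omega)] at this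
      simpa [hx0Q Q le_rfl, hx0Q (Q + 1) (by omega), hPw',
        Pi.single_eq_of_ne (show Q + 1 ≠ Q by omega),
        Pi.single_eq_of_ne (show Q ≠ Q + 1 by omega)] using this.symm
    -- so it can be moved to column `Q`, and the number of columns drops
    obtain ⟨M, c2, hc2, -, -, hom4⟩ := h.shift hc'K hPc' hDc' Q
    have hom5 : h.Homologous x (x0 + (Pi.single Q (w - D y) + Pi.single Q c2)) :=
      Homologous.trans h hom3 (Homologous.add h (Homologous.refl h _)
        (Homologous.add h (Homologous.refl h _) hom4))
    obtain ⟨R, ψ, hψ, hPψ, hom6⟩ := ih (x := x0 + (Pi.single Q (w - D y) + Pi.single Q c2))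
      (add_mem hx0mem (add_mem (sub_mem (h.single_mem Q hwK) (h.single_mem Q (h.D_mem hy)) |>
        fun t => by rwa [← Pi.single_sub] at t) (h.single_mem _ hc2)))
      (fun q hq => by
        simp [hx0Q q (by omega), Pi.single_eq_of_ne (show q ≠ Q by omega)]) hφ
      (by rw [← hom5.total_eq h, hT])
    exact ⟨R, ψ, hψ, hPψ, Homologous.trans h hom5 hom6⟩

end CyclicRelations

end Reduction

/-! ### Cocyclic modules with a differential -/

section Alternating

/-- The cancellation behind `b ∘ b = 0`. -/
theorem sum_alternating_eq_zero {M : Type*} [AddCommGroup M] [Module ℂ M] {n : ℕ}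
    (G : Fin (n + 1) → Fin n → M) (hG : ∀ i j : Fin n, i ≤ j → G j.succ i = G i.castSucc j) :
    ∑ j : Fin (n + 1), ∑ i : Fin n, ((-1 : ℂ) ^ (j : ℕ) * (-1 : ℂ) ^ (i : ℕ)) • G j i = 0 := by
  have key : ∀ i : Fin n, ∑ j : Fin (n + 1), ((-1 : ℂ) ^ (j : ℕ) * (-1 : ℂ) ^ (i : ℕ)) • G j i =
      (∑ j : Fin n, if i ≤ j then
        (-((-1 : ℂ) ^ (j : ℕ) * (-1 : ℂ) ^ (i : ℕ))) • G i.castSucc j else 0) +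
      ∑ j : Fin n, if j ≤ i then
        ((-1 : ℂ) ^ (j : ℕ) * (-1 : ℂ) ^ (i : ℕ)) • G j.castSucc i else 0 := by
    intro i
    have h1 : ∀ j : Fin (n + 1), ((-1 : ℂ) ^ (j : ℕ) * (-1 : ℂ) ^ (i : ℕ)) • G j i =
        (if i.castSucc < j then ((-1 : ℂ) ^ (j : ℕ) * (-1 : ℂ) ^ (i : ℕ)) • G j i else 0) +
        (if j ≤ i.castSucc then ((-1 : ℂ) ^ (j : ℕ) * (-1 : ℂ) ^ (i : ℕ)) • G j i else 0) := by
      intro j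
      rcases lt_or_ge i.castSucc j with h | h
      · simp [h, not_le.2 h]
      · simp [h, not_lt.2 h]
    rw [Finset.sum_congr rfl fun j _ => h1 j, Finset.sum_add_distrib, Fin.sum_univ_succ,
      Fin.sum_univ_castSucc (f := fun j : Fin (n + 1) => if j ≤ i.castSucc then _ else _)]
    congr 1
    · rw [if_neg (by simp), zero_add]
      refine Finset.sum_congr rfl fun j _ => ?_
      by_cases h : i ≤ j
      · rw [if_pos h, if_pos (Fin.castSucc_lt_succ_iff.2 h), hG i j h, Fin.val_succ, pow_succ]
        congr 1; ring
      · rw [if_neg h, if_neg (fun h' => h (Fin.castSucc_lt_succ_iff.1 h'))]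
    · rw [if_neg (by simp [Fin.le_def]), add_zero]
      rfl
  rw [Finset.sum_comm, Finset.sum_congr rfl fun i _ => key i, Finset.sum_add_distrib]
  have e : (∑ i : Fin n, ∑ j : Fin n, if j ≤ i then
        ((-1 : ℂ) ^ (j : ℕ) * (-1 : ℂ) ^ (i : ℕ)) • G j.castSucc i else 0) =
      ∑ i : Fin n, ∑ j : Fin n, if i ≤ j then
        ((-1 : ℂ) ^ (i : ℕ) * (-1 : ℂ) ^ (j : ℕ)) • G i.castSucc j else 0 := Finset.sum_comm
  rw [e, ← Finset.sum_add_distrib]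
  refine Finset.sum_eq_zero fun i _ => ?_
  rw [← Finset.sum_add_distrib]
  refine Finset.sum_eq_zero fun j _ => ?_
  by_cases h : i ≤ j
  · simp only [if_pos h, neg_smul]
    rw [mul_comm, neg_add_cancel]
  · simp [h]

end Alternating

namespace CyclicOps

universe u
variable {X : ℕ → Type u} [∀ n, AddCommGroup (X n)] [∀ n, Module ℂ (X n)]

/-- The extra degeneracy. -/
def extra (O : CyclicOps X) (k : ℕ) : X (k + 1) →ₗ[ℂ] X k :=
  O.degen k (Fin.last k) ∘ₗ O.cyc (k + 1)

/-- The part `∑_{j ≤ k} (-1) ^ j δ_j` of `b` without the last face. -/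
def b' (O : CyclicOps X) (k : ℕ) : X k →ₗ[ℂ] X (k + 1) :=
  ∑ j : Fin (k + 1), (-1 : ℂ) ^ (j : ℕ) • O.face k j.castSucc

/-- The norm `∑_{j ≤ k} λ ^ j`. -/
def norm (O : CyclicOps X) (k : ℕ) : Module.End ℂ (X k) :=
  ∑ j ∈ Finset.range (k + 1), O.lam k ^ j

/-- The relations between the operators of a cocyclic module with a compatible differential,
required on subspaces `W k` preserved by the operators. -/
structure IsCocyclic (O : CyclicOps X) (W : ∀ k, Submodule ℂ (X k)) : Prop where
  face_mem : ∀ {k φ}, φ ∈ W k → ∀ j, O.face k j φ ∈ W (k + 1)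
  degen_mem : ∀ {k φ}, φ ∈ W (k + 1) → ∀ j, O.degen k j φ ∈ W k
  cyc_mem : ∀ {k φ}, φ ∈ W k → O.cyc k φ ∈ W k
  diff_mem : ∀ {k φ}, φ ∈ W k → O.diff k φ ∈ W k
  cyc_pow : ∀ {k φ}, φ ∈ W k → (O.cyc k ^ (k + 1)) φ = φ
  cyc_face_zero : ∀ {k φ}, φ ∈ W k →
    O.cyc (k + 1) (O.face k 0 φ) = O.face k (Fin.last (k + 1)) φ
  cyc_face_succ : ∀ {k φ}, φ ∈ W k → ∀ j : Fin (k + 1),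
    O.cyc (k + 1) (O.face k j.succ φ) = O.face k j.castSucc (O.cyc k φ)
  face_face : ∀ {k φ}, φ ∈ W k → ∀ i j : Fin (k + 1), i ≤ j →
    O.face (k + 1) j.succ.castSucc (O.face k i.castSucc φ) =
      O.face (k + 1) i.castSucc.castSucc (O.face k j.castSucc φ)
  extra_face_zero : ∀ {k φ}, φ ∈ W k → O.extra k (O.face k 0 φ) = φ
  extra_face_succ : ∀ {k φ}, φ ∈ W (k + 1) → ∀ j : Fin (k + 1),
    O.extra (k + 1) (O.face (k + 1) j.succ.castSucc φ) = O.face k j.castSucc (O.extra k φ)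
  diff_cyc : ∀ {k φ}, φ ∈ W k → O.diff k (O.cyc k φ) = O.cyc k (O.diff k φ)
  diff_face : ∀ {k φ}, φ ∈ W k → ∀ j : Fin (k + 1),
    O.diff (k + 1) (O.face k j.castSucc φ) = O.face k j.castSucc (O.diff k φ)
  diff_extra : ∀ {k φ}, φ ∈ W (k + 1) → O.diff k (O.extra k φ) = O.extra k (O.diff (k + 1) φ)
  diff_diff : ∀ {k φ}, φ ∈ W k → O.diff k (O.diff k φ) = 0

theorem b_eq (O : CyclicOps X) (k : ℕ) (φ : X k) :
    O.b k φ = O.b' k φ + (-1 : ℂ) ^ (k + 1) • O.face k (Fin.last (k + 1)) φ := by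
  simp [b, b', Fin.sum_univ_castSucc]

namespace IsCocyclic

variable {O : CyclicOps X} {W : ∀ k, Submodule ℂ (X k)} (h : O.IsCocyclic W)
include h

section Memberships

variable {k : ℕ} {φ : X k} (hφ : φ ∈ W k)
include hφ

theorem b_mem : O.b k φ ∈ W (k + 1) := by
  simp only [b, LinearMap.sum_apply, LinearMap.smul_apply]
  exact sum_mem fun j _ => Submodule.smul_mem _ _ (h.face_mem hφ j)

theorem b'_mem : O.b' k φ ∈ W (k + 1) := by
  simp only [b', LinearMap.sum_apply, LinearMap.smul_apply]
  exact sum_mem fun j _ => Submodule.smul_mem _ _ (h.face_mem hφ _)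

theorem lam_mem : O.lam k φ ∈ W k := Submodule.smul_mem _ _ (h.cyc_mem hφ)

theorem lam_pow_mem (j : ℕ) : (O.lam k ^ j) φ ∈ W k := by
  induction j with
  | zero => simpa
  | succ j ih => rw [pow_succ', Module.End.mul_apply]; exact h.lam_mem ih

theorem norm_mem : O.norm k φ ∈ W k := by
  simp only [norm, LinearMap.sum_apply]
  exact sum_mem fun j _ => h.lam_pow_mem hφ j

end Memberships

theorem extra_mem {k : ℕ} {φ : X (k + 1)} (hφ : φ ∈ W (k + 1)) : O.extra k φ ∈ W k :=
  h.degen_mem (h.cyc_mem hφ) _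

section Relations

variable {k : ℕ} {φ : X k} (hφ : φ ∈ W k)
include hφ

theorem lam_pow : (O.lam k ^ (k + 1)) φ = φ := by
  rw [lam, smul_pow, LinearMap.smul_apply, h.cyc_pow hφ, ← pow_mul,
    Even.neg_one_pow (Nat.even_mul_succ_self k), one_smul]

theorem norm_sub_lam : O.norm k (φ - O.lam k φ) = 0 := by
  have := congr_arg (fun f : Module.End ℂ (X k) => f φ) (geom_sum_mul_neg (O.lam k) (k + 1))
  simp only [Module.End.mul_apply, LinearMap.sub_apply, Module.End.one_apply, h.lam_pow hφ,
    sub_self] at this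
  exact this

theorem sub_lam_norm : O.norm k φ - O.lam k (O.norm k φ) = 0 := by
  have := congr_arg (fun f : Module.End ℂ (X k) => f φ) (mul_neg_geom_sum (O.lam k) (k + 1))
  simp only [Module.End.mul_apply, LinearMap.sub_apply, Module.End.one_apply, h.lam_pow hφ,
    sub_self] at this
  exact this

theorem lam_norm : O.lam k (O.norm k φ) = O.norm k φ :=
  (sub_eq_zero.1 (h.sub_lam_norm hφ)).symm

theorem norm_lam : O.norm k (O.lam k φ) = O.norm k φ := by
  have := h.norm_sub_lam hφ
  rw [map_sub, sub_eq_zero] at this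
  exact this.symm

theorem norm_lam_pow (j : ℕ) : O.norm k ((O.lam k ^ j) φ) = O.norm k φ := by
  induction j with
  | zero => simp
  | succ j ih => rw [pow_succ', Module.End.mul_apply, h.norm_lam (h.lam_pow_mem hφ j), ih]

omit h hφ in
theorem lam_pow_fixed (hlam : O.lam k φ = φ) (j : ℕ) : (O.lam k ^ j) φ = φ := by
  induction j with
  | zero => simp
  | succ j ih => rw [pow_succ, Module.End.mul_apply, hlam, ih]

omit h hφ in
theorem norm_of_fixed (hlam : O.lam k φ = φ) : O.norm k φ = ((k : ℂ) + 1) • φ := by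
  simp only [norm, LinearMap.sum_apply, lam_pow_fixed hlam, Finset.sum_const, Finset.card_range]
  rw [← Nat.cast_smul_eq_nsmul ℂ]
  push_cast
  rfl

/-- The kernel of the norm is the image of `1 - λ`: the element `u` is the mean of the partial sums
`∑ i < j, λ ^ i φ`, whose image under `1 - λ` is `φ` minus the mean of the `λ ^ j φ`. -/
theorem exists_sub_lam (hN : O.norm k φ = 0) : ∃ u ∈ W k, u - O.lam k u = φ := by
  have hk : ((k : ℂ) + 1) ≠ 0 := by exact_mod_cast k.succ_ne_zero
  refine ⟨((k : ℂ) + 1)⁻¹ • ∑ j ∈ Finset.range (k + 1), ∑ i ∈ Finset.range j, (O.lam k ^ i) φ,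
    Submodule.smul_mem _ _ (sum_mem fun j _ => sum_mem fun i _ => h.lam_pow_mem hφ i), ?_⟩
  have e : ∀ j, (∑ i ∈ Finset.range j, (O.lam k ^ i) φ) -
      O.lam k (∑ i ∈ Finset.range j, (O.lam k ^ i) φ) = φ - (O.lam k ^ j) φ := by
    intro j
    have := congr_arg (fun f : Module.End ℂ (X k) => f φ) (mul_neg_geom_sum (O.lam k) j)
    simpa only [Module.End.mul_apply, LinearMap.sub_apply, Module.End.one_apply,
      LinearMap.sum_apply] using this
  have hN' : ∑ j ∈ Finset.range (k + 1), (O.lam k ^ j) φ = 0 := by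
    simpa only [norm, LinearMap.sum_apply] using hN
  rw [map_smul, ← smul_sub, map_sum, ← Finset.sum_sub_distrib, Finset.sum_congr rfl fun j _ => e j,
    Finset.sum_sub_distrib, hN', sub_zero, Finset.sum_const, Finset.card_range,
    ← Nat.cast_smul_eq_nsmul ℂ, smul_smul]
  push_cast
  rw [inv_mul_cancel₀ hk, one_smul]

theorem face_lam (j : Fin (k + 1)) :
    O.lam (k + 1) ((-1 : ℂ) ^ ((j.succ : Fin (k + 2)) : ℕ) • O.face k j.succ φ) =
      (-1 : ℂ) ^ (j : ℕ) • O.face k j.castSucc (O.lam k φ) := by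
  simp only [lam, LinearMap.smul_apply, map_smul, h.cyc_face_succ hφ, smul_smul, Fin.val_succ]
  congr 1
  ring

theorem lam_pow_face : ∀ (j : ℕ) (hj : j < k + 2), (O.lam (k + 1) ^ j)
    ((-1 : ℂ) ^ j • O.face k ⟨j, hj⟩ φ) = O.face k 0 ((O.lam k ^ j) φ) := by
  intro j
  induction j generalizing φ with
  | zero => intro hj; simp
  | succ j ih =>
    intro hj
    rw [pow_succ, Module.End.mul_apply]
    have := h.face_lam hφ ⟨j, by omega⟩
    simp only [Fin.succ_mk, Fin.castSucc_mk] at this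
    rw [this, ih (h.lam_mem hφ), pow_succ, Module.End.mul_apply]

theorem norm_face (j : ℕ) (hj : j < k + 2) :
    O.norm (k + 1) ((-1 : ℂ) ^ j • O.face k ⟨j, hj⟩ φ) =
      O.norm (k + 1) (O.face k 0 ((O.lam k ^ j) φ)) := by
  rw [← h.lam_pow_face hφ j hj,
    h.norm_lam_pow (Submodule.smul_mem _ _ (h.face_mem hφ _))]

theorem norm_b' : O.norm (k + 1) (O.b' k φ) = O.b k (O.norm k φ) := by
  have hN := h.norm_mem hφ
  have h1 : O.norm (k + 1) (O.b' k φ) = O.norm (k + 1) (O.face k 0 (O.norm k φ)) := by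
    simp only [b', LinearMap.sum_apply, LinearMap.smul_apply, map_sum]
    rw [Finset.sum_congr rfl fun j _ => h.norm_face hφ j.1 (by omega)]
    conv_rhs => rw [show O.norm k φ = ∑ j ∈ Finset.range (k + 1), (O.lam k ^ j) φ by
      simp [norm], map_sum, map_sum, Finset.sum_range]
  have h2 : ∀ j : Fin (k + 2), (-1 : ℂ) ^ (j : ℕ) • O.face k j (O.norm k φ) =
      (O.lam (k + 1) ^ (k + 2 - (j : ℕ))) (O.face k 0 (O.norm k φ)) := by
    intro j
    have e := h.lam_pow_face hN j.1 j.2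
    rw [lam_pow_fixed (h.lam_norm hφ)] at e
    rw [← e, ← Module.End.mul_apply, ← pow_add, Nat.sub_add_cancel j.2.le,
      h.lam_pow (Submodule.smul_mem _ _ (h.face_mem hN _))]
  rw [h1]
  simp only [b, LinearMap.sum_apply, LinearMap.smul_apply]
  rw [Finset.sum_congr rfl fun j _ => h2 j, Fin.sum_univ_succ, norm, LinearMap.sum_apply,
    Finset.sum_range_succ', add_comm (∑ _ ∈ _, _)]
  congr 1
  · rw [Fin.val_zero, Nat.sub_zero, h.lam_pow (h.face_mem hN _)]
    simp
  · rw [← Finset.sum_range_reflect, Finset.sum_range]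
    refine Finset.sum_congr rfl fun j _ => ?_
    congr 2
    rw [Fin.val_succ]
    omega

theorem sub_lam_b : O.b k φ - O.lam (k + 1) (O.b k φ) = O.b' k (φ - O.lam k φ) := by
  have e : O.lam (k + 1) (O.b k φ) =
      (-1 : ℂ) ^ (k + 1) • O.face k (Fin.last (k + 1)) φ + O.b' k (O.lam k φ) := by
    simp only [b, LinearMap.sum_apply, LinearMap.smul_apply, map_sum]
    rw [Fin.sum_univ_succ]
    congr 1
    · simp [lam, h.cyc_face_zero hφ]
    · rw [b', LinearMap.sum_apply]
      exact Finset.sum_congr rfl fun j _ => h.face_lam hφ j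
  rw [e, b_eq, map_sub]
  abel

theorem face_face_all (i j : Fin (k + 2)) (hij : i ≤ j) :
    O.face (k + 1) j.succ (O.face k i φ) = O.face (k + 1) i.castSucc (O.face k j φ) := by
  have hlast : ∀ i : Fin (k + 1), O.face (k + 1) (Fin.last (k + 1)).succ (O.face k i.castSucc φ) =
      O.face (k + 1) i.castSucc.castSucc (O.face k (Fin.last (k + 1)) φ) := by
    intro i
    have e0 := h.face_face hφ 0 i (Fin.zero_le i)
    simp only [Fin.castSucc_zero] at e0
    rw [Fin.succ_last, ← h.cyc_face_zero (h.face_mem hφ _), ← e0, ← h.cyc_face_zero hφ,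
      ← h.cyc_face_succ (h.face_mem hφ _), Fin.succ_castSucc]
  induction j using Fin.lastCases with
  | last =>
    induction i using Fin.lastCases with
    | last =>
      have e1 := hlast 0
      simp only [Fin.castSucc_zero] at e1
      rw [Fin.succ_last] at e1 ⊢
      rw [← h.cyc_face_zero (h.face_mem hφ _), ← e1, ← Fin.succ_last,
        h.cyc_face_succ (h.face_mem hφ _), h.cyc_face_zero hφ]
    | cast i => exact hlast i
  | cast j =>
    induction i using Fin.lastCases with
    | last => exact absurd hij (not_le.2 (Fin.castSucc_lt_last j))
    | cast i => exact h.face_face hφ i j (by simpa using hij)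

theorem b_b : O.b (k + 1) (O.b k φ) = 0 := by
  simp only [b, LinearMap.sum_apply, LinearMap.smul_apply, map_sum, map_smul, Finset.smul_sum,
    smul_smul]
  refine Eq.trans (Finset.sum_comm.trans (Finset.sum_congr rfl fun j _ =>
    Finset.sum_congr rfl fun i _ => by rw [mul_comm])) (sum_alternating_eq_zero
      (fun j i => O.face (k + 1) j (O.face k i φ)) (h.face_face_all hφ))

theorem b'_b' : O.b' (k + 1) (O.b' k φ) = 0 := by
  simp only [b', LinearMap.sum_apply, LinearMap.smul_apply, map_sum, map_smul, Finset.smul_sum,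
    smul_smul]
  refine Eq.trans (Finset.sum_comm.trans (Finset.sum_congr rfl fun j _ =>
    Finset.sum_congr rfl fun i _ => by rw [mul_comm])) (sum_alternating_eq_zero
      (fun j i => O.face (k + 1) j.castSucc (O.face k i.castSucc φ)) (h.face_face hφ))

theorem diff_face_all (j : Fin (k + 2)) :
    O.diff (k + 1) (O.face k j φ) = O.face k j (O.diff k φ) := by
  induction j using Fin.lastCases with
  | last =>
    have := h.diff_face hφ 0
    rw [Fin.castSucc_zero] at this
    rw [← h.cyc_face_zero hφ, ← h.cyc_face_zero (h.diff_mem hφ), h.diff_cyc (h.face_mem hφ _), this]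
  | cast j => exact h.diff_face hφ j

theorem diff_b : O.diff (k + 1) (O.b k φ) = O.b k (O.diff k φ) := by
  simp only [b, LinearMap.sum_apply, LinearMap.smul_apply, map_sum, map_smul, h.diff_face_all hφ]

theorem diff_b' : O.diff (k + 1) (O.b' k φ) = O.b' k (O.diff k φ) := by
  simp only [b', LinearMap.sum_apply, LinearMap.smul_apply, map_sum, map_smul, h.diff_face_all hφ]

theorem diff_lam : O.diff k (O.lam k φ) = O.lam k (O.diff k φ) := by
  simp only [lam, LinearMap.smul_apply, map_smul, h.diff_cyc hφ]

theorem diff_lam_pow (j : ℕ) : O.diff k ((O.lam k ^ j) φ) = (O.lam k ^ j) (O.diff k φ) := by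
  induction j with
  | zero => simp
  | succ j ih =>
    rw [pow_succ', Module.End.mul_apply, h.diff_lam (h.lam_pow_mem hφ j), ih, Module.End.mul_apply]

theorem diff_norm : O.diff k (O.norm k φ) = O.norm k (O.diff k φ) := by
  simp only [norm, LinearMap.sum_apply, map_sum, h.diff_lam_pow hφ]

end Relations

theorem b'_extra_add {k : ℕ} {φ : X (k + 1)} (hφ : φ ∈ W (k + 1)) :
    O.b' k (O.extra k φ) + O.extra (k + 1) (O.b' (k + 1) φ) = φ := by
  have e : O.extra (k + 1) (O.b' (k + 1) φ) = φ - O.b' k (O.extra k φ) := by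
    simp only [b', LinearMap.sum_apply, LinearMap.smul_apply, map_sum, map_smul]
    rw [Fin.sum_univ_succ, Fin.castSucc_zero, h.extra_face_zero hφ, sub_eq_add_neg,
      ← Finset.sum_neg_distrib]
    congr 1
    · simp
    · refine Finset.sum_congr rfl fun j _ => ?_
      rw [h.extra_face_succ hφ, Fin.val_succ, pow_succ]
      simp
  rw [e]
  abel

end IsCocyclic

/-! ### The operators on families -/

/-- `b ± d` on families of cochains. -/
def famD (O : CyclicOps X) : Module.End ℂ (∀ k, X k) :=
  LinearMap.pi fun k => (match k with
    | 0 => 0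
    | k + 1 => O.b k ∘ₗ LinearMap.proj k) + (-1 : ℂ) ^ k • (O.diff k ∘ₗ LinearMap.proj k)

/-- `b' ± d` on families of cochains. -/
def famD' (O : CyclicOps X) : Module.End ℂ (∀ k, X k) :=
  LinearMap.pi fun k => (match k with
    | 0 => 0
    | k + 1 => O.b' k ∘ₗ LinearMap.proj k) + (-1 : ℂ) ^ k • (O.diff k ∘ₗ LinearMap.proj k)

/-- The extra degeneracy on families of cochains. -/
def famS (O : CyclicOps X) : Module.End ℂ (∀ k, X k) :=
  LinearMap.pi fun k => O.extra k ∘ₗ LinearMap.proj (k + 1)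

/-- `1 - λ` on families of cochains. -/
def famP (O : CyclicOps X) : Module.End ℂ (∀ k, X k) :=
  LinearMap.pi fun k => (LinearMap.id - O.lam k) ∘ₗ LinearMap.proj k

/-- The norm on families of cochains. -/
def famN (O : CyclicOps X) : Module.End ℂ (∀ k, X k) :=
  LinearMap.pi fun k => O.norm k ∘ₗ LinearMap.proj k

/-- Families with components in `W` which vanish in degrees `≥ K`. -/
def famFin (W : ∀ k, Submodule ℂ (X k)) (K : ℕ) : Submodule ℂ (∀ k, X k) where
  carrier := {x | (∀ k, x k ∈ W k) ∧ ∀ k, K ≤ k → x k = 0}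
  zero_mem' := ⟨fun k => (W k).zero_mem, fun _ _ => rfl⟩
  add_mem' := by
    rintro x y ⟨hx, hx'⟩ ⟨hy, hy'⟩
    exact ⟨fun k => add_mem (hx k) (hy k), fun k h => by simp [hx' k h, hy' k h]⟩
  smul_mem' := by
    rintro c x ⟨hx, hx'⟩
    exact ⟨fun k => Submodule.smul_mem _ _ (hx k), fun k h => by simp [hx' k h]⟩

section FamApply

variable (O : CyclicOps X) (x : ∀ k, X k)

theorem famD_zero : O.famD x 0 = O.diff 0 (x 0) := by simp [famD]

theorem famD_succ (k : ℕ) :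
    O.famD x (k + 1) = O.b k (x k) + (-1 : ℂ) ^ (k + 1) • O.diff (k + 1) (x (k + 1)) := by
  simp [famD]

theorem famD'_zero : O.famD' x 0 = O.diff 0 (x 0) := by simp [famD']

theorem famD'_succ (k : ℕ) :
    O.famD' x (k + 1) = O.b' k (x k) + (-1 : ℂ) ^ (k + 1) • O.diff (k + 1) (x (k + 1)) := by
  simp [famD']

theorem famS_apply (k : ℕ) : O.famS x k = O.extra k (x (k + 1)) := rfl

theorem famP_apply (k : ℕ) : O.famP x k = x k - O.lam k (x k) := rfl

theorem famN_apply (k : ℕ) : O.famN x k = O.norm k (x k) := rfl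

theorem total_eq_seqTotal (x : ∀ _ k : ℕ, X k) :
    O.total x = seqTotal O.famD O.famS O.famP O.famN x := by
  ext q k
  rcases q with _ | q <;> rcases k with _ | k <;>
    simp [total, bPart, BPart, B, seqTotal, famD, famS, famP, famN, extra, norm, add_assoc,
      add_comm, add_left_comm]

end FamApply

namespace IsCocyclic

variable {O : CyclicOps X} {W : ∀ k, Submodule ℂ (X k)}

/-- The columns of the cyclic bicomplex with coefficients in characteristic zero: the extra
degeneracy contracts `b'`, and the rows `1 - λ`, `N` are exact. -/
theorem cyclicRelations (h : O.IsCocyclic W) :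
    CyclicRelations (famFin W) O.famD O.famD' O.famS O.famP O.famN where
  mono := fun K L hKL x hx => ⟨hx.1, fun k hk => hx.2 k (hKL.trans hk)⟩
  zero := by
    refine le_antisymm (fun x hx => ?_) bot_le
    exact funext fun k => hx.2 k (Nat.zero_le k)
  D_mem := by
    rintro K x ⟨hx, hx'⟩
    refine ⟨fun k => ?_, fun k hk => ?_⟩
    · cases k with
      | zero => rw [famD_zero]; exact h.diff_mem (hx 0)
      | succ k =>
        rw [famD_succ]
        exact add_mem (h.b_mem (hx k)) (Submodule.smul_mem _ _ (h.diff_mem (hx _)))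
    · cases k with
      | zero => omega
      | succ k => rw [famD_succ, hx' k (by omega), hx' (k + 1) (by omega)]; simp
  D'_mem := by
    rintro K x ⟨hx, hx'⟩
    refine ⟨fun k => ?_, fun k hk => ?_⟩
    · cases k with
      | zero => rw [famD'_zero]; exact h.diff_mem (hx 0)
      | succ k =>
        rw [famD'_succ]
        exact add_mem (h.b'_mem (hx k)) (Submodule.smul_mem _ _ (h.diff_mem (hx _)))
    · cases k with
      | zero => omega
      | succ k => rw [famD'_succ, hx' k (by omega), hx' (k + 1) (by omega)]; simp
  s_mem := by
    rintro K x ⟨hx, hx'⟩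
    exact ⟨fun k => h.extra_mem (hx _), fun k hk => by
      rw [famS_apply, hx' (k + 1) (by omega), map_zero]⟩
  P_mem := by
    rintro K x ⟨hx, hx'⟩
    exact ⟨fun k => sub_mem (hx k) (h.lam_mem (hx k)), fun k hk => by
      rw [famP_apply, hx' k hk, map_zero, sub_zero]⟩
  N_mem := by
    rintro K x ⟨hx, hx'⟩
    exact ⟨fun k => h.norm_mem (hx k), fun k hk => by rw [famN_apply, hx' k hk, map_zero]⟩
  PD := by
    rintro K x ⟨hx, -⟩
    ext k
    cases k with
    | zero => rw [famP_apply, famD_zero, famD'_zero, famP_apply, map_sub, h.diff_lam (hx _)]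
    | succ k =>
      rw [famP_apply, famD_succ, famD'_succ, famP_apply, famP_apply, ← h.sub_lam_b (hx k), map_sub,
        map_add, map_smul, h.diff_lam (hx _), smul_sub]
      abel
  ND' := by
    rintro K x ⟨hx, -⟩
    ext k
    cases k with
    | zero => rw [famN_apply, famD_zero, famD'_zero, famN_apply, h.diff_norm (hx _)]
    | succ k =>
      rw [famN_apply, famD_succ, famD'_succ, famN_apply, famN_apply, map_add, map_smul,
        h.norm_b' (hx k), h.diff_norm (hx _)]
  homotopy := by
    rintro K x ⟨hx, -⟩
    ext k
    rw [Pi.add_apply]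
    cases k with
    | zero =>
      rw [famD'_zero, famS_apply, famS_apply, famD'_succ, map_add, map_smul, h.diff_extra (hx _)]
      have : O.b' 0 (x 0) = O.face 0 0 (x 0) := by simp [b']
      rw [this, h.extra_face_zero (hx 0)]
      simp
    | succ k =>
      rw [famD'_succ, famS_apply, famS_apply, famS_apply, famD'_succ, map_add, map_smul,
        h.diff_extra (hx _)]
      conv_rhs => rw [← h.b'_extra_add (hx (k + 1))]
      rw [pow_succ (-1 : ℂ) (k + 1)]
      simp only [mul_neg, mul_one, neg_smul]
      abel
  D'D' := by
    rintro K x ⟨hx, -⟩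
    ext k
    rcases k with _ | _ | k
    · simp [famD'_zero, h.diff_diff (hx 0)]
    · simp only [famD'_zero, famD'_succ, map_add, map_smul, h.diff_diff (hx _), h.diff_b' (hx _)]
      simp
    · simp only [famD'_succ, map_add, map_smul, h.diff_diff (hx _), h.diff_b' (hx _),
        h.b'_b' (hx _), pow_succ (-1 : ℂ) (k + 1)]
      simp
  DD := by
    rintro K x ⟨hx, -⟩
    ext k
    rcases k with _ | _ | k
    · simp [famD_zero, h.diff_diff (hx 0)]
    · simp only [famD_zero, famD_succ, map_add, map_smul, h.diff_diff (hx _), h.diff_b (hx _)]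
      simp
    · simp only [famD_succ, map_add, map_smul, h.diff_diff (hx _), h.diff_b (hx _),
        h.b_b (hx _), pow_succ (-1 : ℂ) (k + 1)]
      simp
  PN := by
    rintro K x ⟨hx, -⟩
    exact funext fun k => h.sub_lam_norm (hx k)
  NP := by
    rintro K x ⟨hx, -⟩
    exact funext fun k => h.norm_sub_lam (hx k)
  kerN := by
    rintro K x ⟨hx, hx'⟩ hN
    have : ∀ k, ∃ u ∈ W k, u - O.lam k u = x k ∧ (x k = 0 → u = 0) := by
      intro k
      by_cases h0 : x k = 0
      · exact ⟨0, zero_mem _, by simp [h0], fun _ => rfl⟩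
      · obtain ⟨u, hu, hu'⟩ := h.exists_sub_lam (hx k) (congr_fun hN k)
        exact ⟨u, hu, hu', fun h1 => absurd h1 h0⟩
    choose u hu hu' hu0 using this
    exact ⟨u, ⟨hu, fun k hk => hu0 k (hx' k hk)⟩, funext hu'⟩
  kerP := by
    rintro K x ⟨hx, hx'⟩ hP
    refine ⟨fun k => ((k : ℂ) + 1)⁻¹ • x k, ⟨fun k => Submodule.smul_mem _ _ (hx k), fun k hk => by
      simp [hx' k hk]⟩, funext fun k => ?_⟩
    have hk : ((k : ℂ) + 1) ≠ 0 := by exact_mod_cast k.succ_ne_zero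
    have : O.lam k (x k) = x k := (sub_eq_zero.1 (congr_fun hP k)).symm
    rw [famN_apply, map_smul, norm_of_fixed this, smul_smul, inv_mul_cancel₀ hk, one_smul]

theorem finSeq_eq (h : O.IsCocyclic W) :
    finSeq (famFin W) h.cyclicRelations.mono = finiteCochains W := by
  ext x
  constructor
  · rintro ⟨K, hK, hK'⟩
    refine ⟨fun q => (hK q).1, K + K, fun q k hqk => ?_⟩
    rcases le_or_gt K q with hq | hq
    · rw [hK' q hq]; rfl
    · exact (hK q).2 k (by omega)
  · rintro ⟨hx, K, hK⟩
    exact ⟨K, fun q => ⟨hx q, fun k hk => hK q k (by omega)⟩, fun q hq => funext fun k =>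
      hK q k (by omega)⟩

/-- A finite cochain whose total differential is a cyclic family in column zero differs from a
cyclic family in column zero by a coboundary. -/
theorem exists_cyclic (h : O.IsCocyclic W) {x : ∀ _ k : ℕ, X k} (hx : x ∈ finiteCochains W)
    {φ : ∀ k, X k} (hφ : O.famP φ = 0) (hT : O.total x = Pi.single 0 φ) :
    ∃ K, ∃ ψ ∈ famFin W K, O.famP ψ = 0 ∧ ∃ y ∈ finiteCochains W,
      x = Pi.single 0 ψ + O.total y := by
  rw [← h.finSeq_eq] at hx
  have hx' := hx
  obtain ⟨Q, -, hQ⟩ := hx'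
  rw [total_eq_seqTotal] at hT
  obtain ⟨K, ψ, hψ, hPψ, y, hy, hxy⟩ :=
    h.cyclicRelations.exists_cyclic_of_total Q hx (fun q hq => hQ q hq.le) hφ hT
  rw [h.finSeq_eq] at hy
  exact ⟨K, ψ, hψ, hPψ, y, hy, by rw [total_eq_seqTotal]; exact hxy⟩

theorem total_total (h : O.IsCocyclic W) {x : ∀ _ k : ℕ, X k} (hx : x ∈ finiteCochains W) :
    O.total (O.total x) = 0 := by
  rw [← h.finSeq_eq] at hx
  rw [total_eq_seqTotal, total_eq_seqTotal]
  exact h.cyclicRelations.seqTotal_seqTotal hx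

theorem total_single_of_cyclic {φ : ∀ k, X k} (hφ : O.famP φ = 0) :
    O.total (Pi.single 0 φ) = Pi.single 0 (O.famD φ) := by
  rw [total_eq_seqTotal, CyclicRelations.seqTotal_single, hφ, map_zero, map_zero, Pi.single_zero,
    add_zero]

theorem single_mem {K : ℕ} {φ : ∀ k, X k} (hφ : φ ∈ famFin W K) (q : ℕ) :
    Pi.single q φ ∈ finiteCochains W := by
  refine ⟨fun r => ?_, K + q + 1, fun r k hrk => ?_⟩
  · rcases eq_or_ne r q with rfl | hr
    · simpa using hφ.1
    · simp [Pi.single_eq_of_ne hr]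
  · rcases eq_or_ne r q with rfl | hr
    · simpa using hφ.2 k (by omega)
    · simp [Pi.single_eq_of_ne hr]

end IsCocyclic

end CyclicOps

/-! ### Multilinear functionals -/

section Multilinear

variable {A B C : Type*} [AddCommGroup A] [Module ℂ A] [AddCommGroup B] [Module ℂ B]
  [AddCommGroup C] [Module ℂ C]

/-- A function of `n` variables which is linear in each of them. -/
def IsMultilinear {n : ℕ} (φ : (Fin n → A) → C) : Prop :=
  ∃ f : MultilinearMap ℂ (fun _ : Fin n => A) C, ⇑f = φ

/-- A map between tuples for which a change of one variable changes one variable of the value, in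
a linear way.  Precomposition with such a map preserves multilinear functions. -/
def IsSlotwise {n m : ℕ} (c : (Fin n → A) → (Fin m → B)) : Prop :=
  ∀ i a, ∃ (i' : Fin m) (l : A →ₗ[ℂ] B), ∀ x, c (Function.update a i x) =
    Function.update (c a) i' (l x)

theorem IsMultilinear.comp {n m : ℕ} {φ : (Fin m → B) → C} (hφ : IsMultilinear φ)
    {c : (Fin n → A) → (Fin m → B)} (hc : IsSlotwise c) : IsMultilinear fun a => φ (c a) := by
  obtain ⟨f, rfl⟩ := hφ
  refine ⟨⟨fun a => f (c a), fun {inst} a i x y => ?_, fun {inst} a i r x => ?_⟩, rfl⟩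
  · obtain rfl : inst = instDecidableEqFin n := Subsingleton.elim _ _
    obtain ⟨i', l, h⟩ := hc i a
    simp only [h, map_add, MultilinearMap.map_update_add]
  · obtain rfl : inst = instDecidableEqFin n := Subsingleton.elim _ _
    obtain ⟨i', l, h⟩ := hc i a
    simp only [h, map_smul, MultilinearMap.map_update_smul]

theorem IsMultilinear.add {n : ℕ} {φ ψ : (Fin n → A) → C} (hφ : IsMultilinear φ)
    (hψ : IsMultilinear ψ) : IsMultilinear fun a => φ a + ψ a := by
  obtain ⟨f, rfl⟩ := hφ
  obtain ⟨g, rfl⟩ := hψ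
  exact ⟨f + g, rfl⟩

theorem IsMultilinear.smul {n : ℕ} (r : ℂ) {φ : (Fin n → A) → C} (hφ : IsMultilinear φ) :
    IsMultilinear fun a => r • φ a := by
  obtain ⟨f, rfl⟩ := hφ
  exact ⟨r • f, rfl⟩

theorem IsMultilinear.sum {n : ℕ} {ι : Type*} (s : Finset ι) {φ : ι → (Fin n → A) → C}
    (hφ : ∀ i ∈ s, IsMultilinear (φ i)) : IsMultilinear fun a => ∑ i ∈ s, φ i a := by
  classical
  induction s using Finset.induction_on with
  | empty => exact ⟨0, by ext; simp⟩
  | insert i s hi ih =>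
    simp only [Finset.sum_insert hi]
    exact (hφ i (by simp)).add (ih fun j hj => hφ j (by simp [hj]))

theorem IsMultilinear.linear_comp {n : ℕ} {φ : (Fin n → A) → B} (hφ : IsMultilinear φ)
    (L : B →ₗ[ℂ] C) : IsMultilinear fun a => L (φ a) := by
  obtain ⟨f, rfl⟩ := hφ
  exact ⟨L.compMultilinearMap f, rfl⟩

theorem IsSlotwise.pi {n : ℕ} (L : Fin n → A →ₗ[ℂ] B) :
    IsSlotwise fun (a : Fin n → A) i => L i (a i) := by
  intro i a
  refine ⟨i, L i, fun x => ?_⟩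
  ext j
  rcases eq_or_ne j i with rfl | h <;> simp [*]

theorem IsSlotwise.insertNth {n : ℕ} (p : Fin (n + 1)) (y : A) :
    IsSlotwise fun a : Fin n → A => Fin.insertNth (α := fun _ => A) p y a := by
  intro i a
  exact ⟨p.succAbove i, LinearMap.id, fun x => Fin.insertNth_update _ _ _ _ _⟩

theorem IsSlotwise.rot {γ : A →ₗ[ℂ] A} {k : ℕ} (e : ℕ) : IsSlotwise (n := k + 1) (m := k + 1)
    (fun a => Fin.cons (α := fun _ => A) (parityPart γ e (a (Fin.last k)))
      (fun i : Fin k => (γ ^ e) (a i.castSucc))) := by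
  intro i a
  induction i using Fin.lastCases with
  | last =>
    refine ⟨0, parityPart γ e, fun x => ?_⟩
    ext j
    cases j using Fin.cases with
    | zero => simp
    | succ j => simp [Fin.succ_ne_zero]
  | cast i =>
    refine ⟨i.succ, γ ^ e, fun x => ?_⟩
    ext j
    cases j using Fin.cases with
    | zero => simp [Function.update_of_ne (Fin.succ_ne_zero i).symm,
        Function.update_of_ne (Fin.castSucc_lt_last i).ne']
    | succ j =>
      rcases eq_or_ne j i with rfl | h
      · simp
      · simp [Function.update_of_ne (fun h' => h (Fin.succ_injective _ h')),
          Function.update_of_ne (fun h' => h (Fin.castSucc_injective _ h'))]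

theorem IsSlotwise.diffSlot {γ d : A →ₗ[ℂ] A} {k : ℕ} (j : Fin k) : IsSlotwise
    (fun (a : Fin k → A) i => if i < j then γ (a i) else if i = j then d (a i) else a i) := by
  convert IsSlotwise.pi (fun i : Fin k => if i < j then γ else if i = j then d else LinearMap.id)
    using 4 with a i
  split_ifs <;> rfl

/-- Two multilinear functions which agree on tuples of even or odd elements are equal. -/
theorem IsMultilinear.ext_parity {γ : A →ₗ[ℂ] A} (hγ : ∀ a, γ (γ a) = a) {n : ℕ}
    {φ ψ : (Fin n → A) → C} (hφ : IsMultilinear φ) (hψ : IsMultilinear ψ)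
    (h : ∀ (p : Fin n → ℕ) a, (∀ i, γ (a i) = (-1 : ℂ) ^ p i • a i) → φ a = ψ a) : φ = ψ := by
  obtain ⟨f, rfl⟩ := hφ
  obtain ⟨g, rfl⟩ := hψ
  have hp : ∀ e a, γ (parityPart γ e a) = (-1 : ℂ) ^ e • parityPart γ e a := by
    intro e a
    have : ((-1 : ℂ) ^ e) * (-1) ^ e = 1 := by rw [← mul_pow]; simp
    simp only [parityPart, LinearMap.smul_apply, LinearMap.add_apply, LinearMap.id_apply, map_smul,
      map_add, hγ, smul_add, smul_smul]
    rw [add_comm]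
    congr 2
    · ring
    · rw [mul_comm, mul_assoc, this, mul_one]
  have hs : ∀ a : A, ∑ e : Fin 2, parityPart γ (e : ℕ) a = a := by
    intro a
    simp only [parityPart, Fin.sum_univ_two, LinearMap.smul_apply, LinearMap.add_apply,
      LinearMap.id_apply, Fin.val_zero, Fin.val_one, pow_zero, pow_one, one_smul, neg_smul]
    rw [← smul_add, show a + γ a + (a + -γ a) = (2 : ℂ) • a by rw [two_smul]; abel, smul_smul]
    norm_num
  ext a
  have e1 : a = fun i => ∑ e : Fin 2, parityPart γ (e : ℕ) (a i) := funext fun i => (hs (a i)).symm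
  rw [e1, f.map_sum, g.map_sum]
  exact Finset.sum_congr rfl fun r _ => h (fun i => r i) _ fun i => hp _ _

end Multilinear

/-! ### The cyclic module of a graded algebra -/

/-- `d` is an odd derivation of square zero with respect to the grading involution `γ`. -/
structure IsSuperDG {A : Type*} [Ring A] [Algebra ℂ A] (γ d : A →ₗ[ℂ] A) : Prop where
  sign_sign : ∀ a, γ (γ a) = a
  sign_mul : ∀ a b, γ (a * b) = γ a * γ b
  sign_one : γ 1 = 1
  sign_d : ∀ a, γ (d a) = -d (γ a)
  leibniz : ∀ a b, d (a * b) = d a * b + γ a * d b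
  d_d : ∀ a, d (d a) = 0

section Operators

variable {A : Type*} [Ring A] [Algebra ℂ A]

theorem IsSlotwise.contractNth {n : ℕ} (j : Fin (n + 1)) : IsSlotwise
    fun a : Fin (n + 2) → A => Fin.contractNth j.castSucc (· * ·) a := by
  intro i a
  refine ⟨⟨if (i : ℕ) ≤ j then i else i - 1, by split_ifs <;> omega⟩,
    if i = j.castSucc then LinearMap.mulRight ℂ (a j.succ)
      else if i = j.succ then LinearMap.mulLeft ℂ (a j.castSucc) else LinearMap.id, fun x => ?_⟩
  ext r
  simp only [Fin.contractNth, Function.update_apply, Fin.ext_iff, Fin.val_castSucc, Fin.val_succ]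
  have hj : ∀ h : (r : ℕ) = j, r = j := fun h => Fin.ext h
  split_ifs <;>
    first
    | omega
    | rfl
    | (obtain rfl := hj (by omega); rfl)

variable {γ d : A →ₗ[ℂ] A}

theorem algFace_castSucc {k : ℕ} (j : Fin (k + 1)) (φ : Fun A k) (a : Fin (k + 2) → A) :
    algFace γ k j.castSucc φ a = φ (Fin.contractNth j.castSucc (· * ·) a) := by
  rw [algFace, if_neg (Fin.castSucc_lt_last j).ne]
  rfl

theorem algFace_last {k : ℕ} (φ : Fun A k) (a : Fin (k + 2) → A) :
    algFace γ k (Fin.last (k + 1)) φ a =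
      ∑ e ∈ Finset.range 2, φ (Fin.contractNth 0 (· * ·) (rot γ (k + 1) e a)) := by
  rw [algFace, if_pos rfl]
  simp [LinearMap.funLeft_apply]

theorem algCyc_apply {k : ℕ} (φ : Fun A k) (a : Fin (k + 1) → A) :
    algCyc γ k φ a = ∑ e ∈ Finset.range 2, φ (rot γ k e a) := by
  simp [algCyc, LinearMap.funLeft_apply]

theorem algDiff_apply {k : ℕ} (φ : Fun A k) (a : Fin (k + 1) → A) : algDiff γ d k φ a =
    ∑ j : Fin (k + 1), φ fun i => if i < j then γ (a i) else if i = j then d (a i) else a i := by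
  simp [algDiff, LinearMap.funLeft_apply]

theorem algFace_last_eq {k : ℕ} (φ : Fun A k) :
    algFace γ k (Fin.last (k + 1)) φ = algCyc γ (k + 1) (algFace γ k 0 φ) := by
  ext a
  rw [algFace_last, algCyc_apply]
  exact Finset.sum_congr rfl fun e _ => (algFace_castSucc 0 φ _).symm

theorem IsMultilinear.algCyc {k : ℕ} {φ : Fun A k} (hφ : IsMultilinear φ) :
    IsMultilinear (algCyc γ k φ) := by
  have : DGCyc.algCyc γ k φ = fun a => ∑ e ∈ Finset.range 2, φ (DGCyc.rot γ k e a) :=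
    funext fun a => algCyc_apply φ a
  rw [this]
  exact IsMultilinear.sum _ fun e _ => hφ.comp (IsSlotwise.rot e)

theorem IsMultilinear.algFace {k : ℕ} {φ : Fun A k} (hφ : IsMultilinear φ) (j : Fin (k + 2)) :
    IsMultilinear (algFace γ k j φ) := by
  have h1 : ∀ j : Fin (k + 1), IsMultilinear (DGCyc.algFace γ k j.castSucc φ) := fun j => by
    have : DGCyc.algFace γ k j.castSucc φ = fun a => φ (Fin.contractNth j.castSucc (· * ·) a) :=
      funext fun a => algFace_castSucc j φ a
    rw [this]
    exact hφ.comp (IsSlotwise.contractNth j)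
  induction j using Fin.lastCases with
  | last =>
    rw [algFace_last_eq]
    exact IsMultilinear.algCyc (h1 0)
  | cast j => exact h1 j

theorem IsMultilinear.algDiff {k : ℕ} {φ : Fun A k} (hφ : IsMultilinear φ) :
    IsMultilinear (algDiff γ d k φ) := by
  have : DGCyc.algDiff γ d k φ = fun a => ∑ j : Fin (k + 1), φ fun i =>
      if i < j then γ (a i) else if i = j then d (a i) else a i :=
    funext fun a => algDiff_apply φ a
  rw [this]
  exact IsMultilinear.sum _ fun j _ => hφ.comp (IsSlotwise.diffSlot j)

theorem IsMultilinear.algDegen {k : ℕ} {φ : Fun A (k + 1)} (hφ : IsMultilinear φ)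
    (j : Fin (k + 1)) : IsMultilinear ((algOps γ d).degen k j φ) :=
  hφ.comp (IsSlotwise.insertNth j.succ 1)

/-! ### Values on homogeneous arguments -/

/-- The cyclic rotation `(a₀, …, aₖ) ↦ (aₖ, a₀, …, aₖ₋₁)`. -/
def rotate {α : Type*} {k : ℕ} (a : Fin (k + 1) → α) : Fin (k + 1) → α :=
  Fin.cons (α := fun _ => α) (a (Fin.last k)) (fun i : Fin k => a i.castSucc)

theorem rotate_apply {α : Type*} {k : ℕ} (a : Fin (k + 1) → α) (i : Fin (k + 1)) :
    rotate a i = a (i - 1) := by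
  cases i using Fin.cases with
  | zero =>
    have : (0 - 1 : Fin (k + 1)) = Fin.last k := by
      rw [sub_eq_iff_eq_add]; simp
    simp [rotate, this]
  | succ i =>
    have : i.succ - 1 = i.castSucc := by
      rw [sub_eq_iff_eq_add]; exact (Fin.coeSucc_eq_succ).symm
    simp [rotate, this]

open scoped Fin.CommRing in
theorem iterate_rotate_apply {α : Type*} {k : ℕ} (l : ℕ) (a : Fin (k + 1) → α) (i : Fin (k + 1)) :
    rotate^[l] a i = a (i - (l : Fin (k + 1))) := by
  induction l generalizing a with
  | zero => simp
  | succ l ih =>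
    rw [Function.iterate_succ_apply, ih, rotate_apply]
    congr 1
    push_cast
    abel

theorem sum_rotate {k : ℕ} (p : Fin (k + 1) → ℕ) : ∑ i, rotate p i = ∑ i, p i := by
  rw [Fin.sum_univ_succ, Fin.sum_univ_castSucc]
  simp [rotate, add_comm]

theorem neg_one_pow_congr {m n : ℕ} (h : (m : ZMod 2) = n) : (-1 : ℂ) ^ m = (-1 : ℂ) ^ n := by
  rw [ZMod.natCast_eq_natCast_iff] at h
  rw [neg_one_pow_eq_pow_mod_two, neg_one_pow_eq_pow_mod_two (n := n), h]

theorem isMultilinear_smul_univ {B : Type*} [AddCommGroup B] [Module ℂ B] {n : ℕ}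
    {φ : (Fin n → A) → B} (hφ : IsMultilinear φ) (c : Fin n → ℂ) (a : Fin n → A) :
    φ (fun i => c i • a i) = (∏ i, c i) • φ a := by
  obtain ⟨f, rfl⟩ := hφ
  exact f.map_smul_univ c a

theorem isMultilinear_zero {B : Type*} [AddCommGroup B] [Module ℂ B] {n : ℕ}
    {φ : (Fin n → A) → B} (hφ : IsMultilinear φ) {a : Fin n → A} (i : Fin n) (hi : a i = 0) :
    φ a = 0 := by
  obtain ⟨f, rfl⟩ := hφ
  exact f.map_coord_zero i hi

theorem parityPart_of_parity {e p : ℕ} {a : A} (ha : γ a = (-1 : ℂ) ^ p • a) :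
    parityPart γ e a = if (e + p) % 2 = 0 then a else 0 := by
  simp only [parityPart, LinearMap.smul_apply, LinearMap.add_apply, LinearMap.id_apply, ha,
    smul_smul, ← pow_add]
  split_ifs with h
  · rw [Even.neg_one_pow (Nat.even_iff.2 h), one_smul, ← two_smul ℂ a, smul_smul]
    norm_num
  · rw [Odd.neg_one_pow (by rw [← Nat.not_even_iff_odd, Nat.even_iff]; exact h)]
    simp

/-- On homogeneous arguments of total degree `M` the cyclic operator is the rotation with the sign
`(-1) ^ ((M + 1) |aₖ|)`. -/
theorem algCyc_of_parity {k : ℕ} {φ : Fun A k} (hφ : IsMultilinear φ) {p : Fin (k + 1) → ℕ}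
    {a : Fin (k + 1) → A} (ha : ∀ i, γ (a i) = (-1 : ℂ) ^ p i • a i) :
    algCyc γ k φ a = (-1 : ℂ) ^ (p (Fin.last k) * (∑ i, p i + 1)) * φ (rotate a) := by
  rw [algCyc_apply, Finset.sum_range_succ, Finset.sum_range_one]
  have h0 : rot γ k 0 a = Fin.cons (α := fun _ => A) (parityPart γ 0 (a (Fin.last k)))
      (fun i : Fin k => a i.castSucc) := by simp [rot]
  rcases Nat.mod_two_eq_zero_or_one (p (Fin.last k)) with hp | hp
  · have e0 : rot γ k 0 a = rotate a := by
      rw [h0, parityPart_of_parity (ha _), if_pos (by omega)]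
      rfl
    have e1 : φ (rot γ k 1 a) = 0 := by
      refine isMultilinear_zero hφ 0 ?_
      rw [rot, Fin.cons_zero, parityPart_of_parity (ha _), if_neg (by omega)]
    rw [e0, e1, add_zero, Even.neg_one_pow, one_mul]
    exact Even.mul_right (Nat.even_iff.2 hp) _
  · have e0 : φ (rot γ k 0 a) = 0 := by
      refine isMultilinear_zero hφ 0 ?_
      rw [rot, Fin.cons_zero, parityPart_of_parity (ha _), if_neg (by omega)]
    have e1 : rot γ k 1 a = fun i => (Fin.cons (α := fun _ => ℂ) 1
        (fun i : Fin k => (-1 : ℂ) ^ p i.castSucc) : Fin (k + 1) → ℂ) i • rotate a i := by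
      ext i
      cases i using Fin.cases with
      | zero =>
        simp [rot, rotate, parityPart_of_parity (ha _),
          show (1 + p (Fin.last k)) % 2 = 0 by omega]
      | succ i => simp [rot, rotate, ha]
    rw [e0, e1, zero_add, isMultilinear_smul_univ hφ, Fin.prod_univ_succ, Fin.sum_univ_castSucc]
    simp only [Fin.cons_zero, Fin.cons_succ, one_mul, smul_eq_mul, Finset.prod_pow_eq_pow_sum]
    congr 1
    apply neg_one_pow_congr
    have : ((p (Fin.last k) : ℕ) : ZMod 2) = 1 := by
      rw [← Nat.cast_one, ZMod.natCast_eq_natCast_iff]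
      exact hp
    push_cast
    rw [this]
    have h2 : (2 : ZMod 2) = 0 := rfl
    linear_combination (-1) * h2

theorem parity_rotate {k : ℕ} {p : Fin (k + 1) → ℕ} {a : Fin (k + 1) → A}
    (ha : ∀ i, γ (a i) = (-1 : ℂ) ^ p i • a i) (i : Fin (k + 1)) :
    γ (rotate a i) = (-1 : ℂ) ^ rotate p i • rotate a i := by
  rw [rotate_apply, rotate_apply, ha]

theorem isMultilinear_algCyc_pow {k : ℕ} {φ : Fun A k} (hφ : IsMultilinear φ) (l : ℕ) :
    IsMultilinear ((algCyc γ k ^ l) φ) := by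
  induction l with
  | zero => simpa
  | succ l ih => rw [pow_succ', Module.End.mul_apply]; exact ih.algCyc

theorem algCyc_pow_of_parity {k : ℕ} {φ : Fun A k} (hφ : IsMultilinear φ) (l : ℕ) :
    ∀ {p : Fin (k + 1) → ℕ} {a : Fin (k + 1) → A} (_ : ∀ i, γ (a i) = (-1 : ℂ) ^ p i • a i),
    (algCyc γ k ^ l) φ a =
      (-1 : ℂ) ^ ((∑ j ∈ Finset.range l, rotate^[j] p (Fin.last k)) * (∑ i, p i + 1)) *
        φ (rotate^[l] a) := by
  induction l with
  | zero => simp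
  | succ l ih =>
    intro p a ha
    rw [pow_succ', Module.End.mul_apply, algCyc_of_parity (isMultilinear_algCyc_pow hφ l) ha,
      ih (parity_rotate ha), sum_rotate, ← mul_assoc, ← pow_add, ← add_mul,
      Finset.sum_range_succ', add_comm (p (Fin.last k))]
    rfl

open scoped Fin.CommRing in
theorem algCyc_pow_eq {k : ℕ} {φ : Fun A k} (hγ : ∀ a, γ (γ a) = a) (hφ : IsMultilinear φ) :
    (algCyc γ k ^ (k + 1)) φ = φ := by
  refine (isMultilinear_algCyc_pow hφ _).ext_parity hγ hφ fun p a ha => ?_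
  rw [algCyc_pow_of_parity hφ _ ha]
  have e1 : rotate^[k + 1] a = a := by
    ext i
    rw [iterate_rotate_apply, Fin.natCast_self, sub_zero]
  have e2 : ∑ j ∈ Finset.range (k + 1), rotate^[j] p (Fin.last k) = ∑ i, p i := by
    rw [Finset.sum_range, ← Equiv.sum_comp (Equiv.subLeft (Fin.last k)) p]
    refine Finset.sum_congr rfl fun j _ => ?_
    rw [iterate_rotate_apply, Fin.cast_val_eq_self]
    rfl
  rw [e1, e2, Even.neg_one_pow (Nat.even_mul_succ_self _), one_mul]

end Operators

/-! ### Cocyclic identities for functionals -/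

section Identities

section Contraction

variable {A : Type*} [Ring A]

theorem contractNth_zero_cons {k : ℕ} (x : A) (a : Fin (k + 1) → A) :
    Fin.contractNth 0 (· * ·) (Fin.cons (α := fun _ => A) x a : Fin (k + 2) → A) =
      Fin.cons (α := fun _ => A) (x * a 0) (Fin.tail a) := by
  ext i
  cases i using Fin.cases with
  | zero => simp [Fin.contractNth]
  | succ i => simp [Fin.contractNth, Fin.tail]

theorem contractNth_succ_cons {k : ℕ} (j : Fin (k + 1)) (x : A) (a : Fin (k + 1) → A) :
    Fin.contractNth j.succ (· * ·) (Fin.cons (α := fun _ => A) x a : Fin (k + 2) → A) =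
      Fin.cons (α := fun _ => A) x (Fin.contractNth j (· * ·) a) := by
  ext i
  cases i using Fin.cases with
  | zero => simp [Fin.contractNth]
  | succ i => simp [Fin.contractNth]

theorem contractNth_contractNth {k : ℕ} {i j : Fin (k + 1)} (hij : i ≤ j) (a : Fin (k + 3) → A) :
    Fin.contractNth i.castSucc (· * ·) (Fin.contractNth j.succ.castSucc (· * ·) a) =
      Fin.contractNth j.castSucc (· * ·) (Fin.contractNth i.castSucc.castSucc (· * ·) a) := by
  ext r
  rw [Fin.le_def] at hij
  simp only [Fin.contractNth, Fin.val_castSucc, Fin.val_succ]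
  split_ifs <;> first | omega | rfl | simp [mul_assoc]

end Contraction

variable {A : Type*} [Ring A] [Algebra ℂ A] {γ d : A →ₗ[ℂ] A}

theorem sign_pow_mul (hγ : ∀ a b, γ (a * b) = γ a * γ b) (e : ℕ) (a b : A) :
    (γ ^ e) (a * b) = (γ ^ e) a * (γ ^ e) b := by
  induction e with
  | zero => simp
  | succ e ih => simp only [pow_succ', Module.End.mul_apply, ih, hγ]

theorem algOps_extra_apply (h1 : γ 1 = 1) {k : ℕ} {φ : Fun A (k + 1)} (hφ : IsMultilinear φ)
    (a : Fin (k + 1) → A) :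
    (algOps γ d).extra k φ a = φ (Fin.cons (α := fun _ => A) 1 a) := by
  change algCyc γ (k + 1) φ (Fin.insertNth (α := fun _ => A) (Fin.last k).succ (1 : A) a) = _
  rw [algCyc_apply, Finset.sum_range_succ, Finset.sum_range_one, Fin.succ_last,
    Fin.insertNth_last']
  have e1 : φ (rot γ (k + 1) 1 (Fin.snoc a 1)) = 0 := by
    refine isMultilinear_zero hφ 0 ?_
    simp [rot, parityPart, h1]
  rw [e1, add_zero]
  congr 1
  ext i
  cases i using Fin.cases with
  | zero =>
    simp only [rot, parityPart, Fin.cons_zero, Fin.snoc_last, LinearMap.smul_apply,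
      LinearMap.add_apply, LinearMap.id_apply, h1, pow_zero, one_smul]
    rw [← two_smul ℂ (1 : A), smul_smul]
    norm_num
  | succ i => simp [rot]

theorem algOps_cyc_face_succ (hγ : ∀ a, γ (γ a) = a) (hm : ∀ a b, γ (a * b) = γ a * γ b) {k : ℕ}
    {φ : Fun A k} (hφ : IsMultilinear φ) (j : Fin (k + 1)) :
    algCyc γ (k + 1) (algFace γ k j.succ φ) = algFace γ k j.castSucc (algCyc γ k φ) := by
  induction j using Fin.lastCases with
  | last =>
    refine ((hφ.algFace _).algCyc).ext_parity hγ (hφ.algCyc.algFace _) fun p a ha => ?_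
    have hpar : ∀ i, γ (Fin.contractNth (Fin.last k).castSucc (· * ·) a i) =
        (-1 : ℂ) ^ (Fin.contractNth (Fin.last k).castSucc (· + ·) p i) •
          Fin.contractNth (Fin.last k).castSucc (· * ·) a i := by
      intro i
      simp only [Fin.contractNth]
      split_ifs
      · exact ha _
      · rw [hm, ha, ha, smul_mul_smul_comm, pow_add]
      · exact ha _
    have hsum : ∑ i, Fin.contractNth (Fin.last k).castSucc (· + ·) p i = ∑ i, p i := by
      rw [Fin.sum_univ_castSucc, Fin.sum_univ_castSucc, Fin.sum_univ_castSucc, add_assoc]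
      congr 1
      · refine Finset.sum_congr rfl fun i _ => ?_
        simp [Fin.contractNth]
      · simp [Fin.contractNth]
    rw [Fin.succ_last, algFace_last_eq, algCyc_of_parity (hφ.algFace 0).algCyc ha,
      algCyc_of_parity (hφ.algFace 0) (parity_rotate ha), algFace_castSucc,
      algCyc_of_parity hφ hpar, hsum, sum_rotate, ← mul_assoc, ← pow_add]
    have e2 := algFace_castSucc (γ := γ) 0 φ (rotate (rotate a))
    rw [Fin.castSucc_zero] at e2
    rw [e2]
    congr 2
    · simp [Fin.contractNth, rotate, ← add_mul, add_comm]
    · rw [rotate, contractNth_zero_cons]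
      ext i
      cases i using Fin.cases with
      | zero => simp [rotate, Fin.contractNth]
      | succ i => simp [rotate, Fin.contractNth, Fin.tail]
  | cast j =>
    ext a
    rw [algCyc_apply, algFace_castSucc, algCyc_apply]
    refine Finset.sum_congr rfl fun e _ => ?_
    rw [Fin.succ_castSucc, algFace_castSucc]
    congr 1
    rw [← Fin.succ_castSucc, rot, contractNth_succ_cons]
    ext i
    cases i using Fin.cases with
    | zero =>
      simp [rot, Fin.contractNth, show ¬ k < (j : ℕ) by omega, show k ≠ (j : ℕ) by omega]
    | succ i =>
      simp only [rot, Fin.cons_succ, Fin.contractNth, Fin.val_castSucc]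
      split_ifs <;> simp [sign_pow_mul hm]

theorem algOps_face_face {k : ℕ} (φ : Fun A k) (i j : Fin (k + 1)) (hij : i ≤ j) :
    algFace γ (k + 1) j.succ.castSucc (algFace γ k i.castSucc φ) =
      algFace γ (k + 1) i.castSucc.castSucc (algFace γ k j.castSucc φ) := by
  ext a
  rw [algFace_castSucc, algFace_castSucc, algFace_castSucc, algFace_castSucc,
    contractNth_contractNth hij]

theorem algOps_extra_face_zero (h1 : γ 1 = 1) {k : ℕ} {φ : Fun A k} (hφ : IsMultilinear φ) :
    (algOps γ d).extra k (algFace γ k 0 φ) = φ := by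
  ext a
  rw [algOps_extra_apply h1 (hφ.algFace 0), ← Fin.castSucc_zero, algFace_castSucc,
    Fin.castSucc_zero, contractNth_zero_cons, one_mul, Fin.cons_self_tail]

theorem algOps_extra_face_succ (h1 : γ 1 = 1) {k : ℕ} {φ : Fun A (k + 1)} (hφ : IsMultilinear φ)
    (j : Fin (k + 1)) :
    (algOps γ d).extra (k + 1) (algFace γ (k + 1) j.succ.castSucc φ) =
      algFace γ k j.castSucc ((algOps γ d).extra k φ) := by
  ext a
  rw [algOps_extra_apply h1 (hφ.algFace _), algFace_castSucc, algFace_castSucc,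
    algOps_extra_apply h1 hφ, ← Fin.succ_castSucc, contractNth_succ_cons]

end Identities

section Differential

variable {A : Type*} [Ring A] [Algebra ℂ A] {γ d : A →ₗ[ℂ] A}

/-- `(a₀, …, aₖ) ↦ (γ a₀, …, γ aⱼ₋₁, d aⱼ, aⱼ₊₁, …, aₖ)`. -/
def diffAt (γ d : A →ₗ[ℂ] A) {k : ℕ} (j : Fin k) (a : Fin k → A) : Fin k → A := fun i =>
  if i < j then γ (a i) else if i = j then d (a i) else a i

theorem algDiff_eq_sum {k : ℕ} (φ : Fun A k) (a : Fin (k + 1) → A) :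
    algDiff γ d k φ a = ∑ j : Fin (k + 1), φ (diffAt γ d j a) :=
  algDiff_apply φ a

theorem diffAt_succ_cons {k : ℕ} (j : Fin k) (x : A) (a : Fin k → A) :
    diffAt γ d j.succ (Fin.cons (α := fun _ => A) x a : Fin (k + 1) → A) =
      Fin.cons (α := fun _ => A) (γ x) (diffAt γ d j a) := by
  ext i
  cases i using Fin.cases with
  | zero => simp [diffAt]
  | succ i => simp [diffAt]

theorem diffAt_zero_cons {k : ℕ} (x : A) (a : Fin k → A) :
    diffAt γ d 0 (Fin.cons (α := fun _ => A) x a : Fin (k + 1) → A) =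
      Fin.cons (α := fun _ => A) (d x) a := by
  ext i
  cases i using Fin.cases with
  | zero => simp [diffAt]
  | succ i => simp [diffAt, Fin.succ_ne_zero]

variable (h : IsSuperDG γ d)
include h

theorem IsSuperDG.d_one : d 1 = 0 := by
  have := h.leibniz 1 1
  rw [h.sign_one, one_mul, mul_one, one_mul] at this
  simpa using this

theorem algOps_diff_extra {k : ℕ} {φ : Fun A (k + 1)} (hφ : IsMultilinear φ) :
    algDiff γ d k ((algOps γ d).extra k φ) = (algOps γ d).extra k (algDiff γ d (k + 1) φ) := by
  ext a
  rw [algOps_extra_apply h.sign_one hφ.algDiff, algDiff_eq_sum, algDiff_eq_sum]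
  conv_rhs => rw [Fin.sum_univ_succ]
  have e0 : φ (diffAt γ d 0 (Fin.cons (α := fun _ => A) 1 a)) = 0 := by
    refine isMultilinear_zero hφ 0 ?_
    rw [diffAt_zero_cons, Fin.cons_zero, h.d_one]
  rw [e0, zero_add]
  refine Finset.sum_congr rfl fun j _ => ?_
  rw [diffAt_succ_cons, h.sign_one, algOps_extra_apply h.sign_one hφ]

theorem diffAt_diffAt_of_lt {k : ℕ} {i j : Fin k} (hij : i < j) (a : Fin k → A) :
    diffAt γ d i (diffAt γ d j a) =
      fun r => (if r = i then (-1 : ℂ) else 1) • diffAt γ d j (diffAt γ d i a) r := by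
  ext r
  simp only [diffAt, Fin.ext_iff, Fin.lt_def] at *
  split_ifs <;> first | omega | simp [h.sign_d, h.sign_sign]

theorem algOps_diff_diff {k : ℕ} {φ : Fun A k} (hφ : IsMultilinear φ) :
    algDiff γ d k (algDiff γ d k φ) = 0 := by
  ext a
  rw [algDiff_eq_sum]
  simp only [algDiff_eq_sum, Pi.zero_apply]
  set G : Fin (k + 1) → Fin (k + 1) → ℂ := fun i j => φ (diffAt γ d j (diffAt γ d i a)) with hG
  have hlt : ∀ i j, i < j → G j i = -G i j := by
    intro i j hij
    rw [hG]
    simp only [diffAt_diffAt_of_lt h hij]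
    rw [isMultilinear_smul_univ hφ, Finset.prod_ite_eq' Finset.univ i]
    simp
  have hanti : ∀ i j, G i j = -G j i := by
    intro i j
    rcases lt_trichotomy i j with hij | rfl | hij
    · rw [hlt i j hij, neg_neg]
    · have : G i i = 0 := isMultilinear_zero hφ i (by simp [diffAt, h.d_d])
      rw [this, neg_zero]
    · exact hlt j i hij
  change ∑ i, ∑ j, G i j = 0
  have e : ∑ i, ∑ j, G i j = -∑ i, ∑ j, G i j := by
    conv_lhs => rw [Finset.sum_comm]
    simp only [← Finset.sum_neg_distrib]
    exact Finset.sum_congr rfl fun i _ => Finset.sum_congr rfl fun j _ => hanti j i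
  linear_combination (1 / 2 : ℂ) * e

theorem algOps_diff_face {k : ℕ} {φ : Fun A k} (hφ : IsMultilinear φ) (i : Fin (k + 1)) :
    algDiff γ d (k + 1) (algFace γ k i.castSucc φ) =
      algFace γ k i.castSucc (algDiff γ d k φ) := by
  ext a
  rw [algFace_castSucc, algDiff_eq_sum, algDiff_eq_sum, Fin.sum_univ_succAbove _ i.castSucc]
  simp only [algFace_castSucc]
  have e1 : ∀ j : Fin (k + 1), φ (Fin.contractNth i.castSucc (· * ·)
      (diffAt γ d (i.castSucc.succAbove j) a)) =
      φ (diffAt γ d j (Fin.contractNth i.castSucc (· * ·) a)) -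
        if j = i then φ (Fin.contractNth i.castSucc (· * ·) (diffAt γ d i.castSucc a)) else 0 := by
    intro j
    rcases eq_or_ne j i with rfl | hj
    · rw [if_pos rfl, eq_sub_iff_add_eq]
      obtain ⟨f, rfl⟩ := hφ
      have hu : ∀ x, Function.update (diffAt γ d j (Fin.contractNth j.castSucc (· * ·) a)) j x =
        fun r => if r = j then x else diffAt γ d j (Fin.contractNth j.castSucc (· * ·) a) r :=
          fun x => funext fun r => Function.update_apply _ _ _ _
      have := f.map_update_add (diffAt γ d j (Fin.contractNth j.castSucc (· * ·) a)) j
        (γ (a j.castSucc) * d (a j.succ)) (d (a j.castSucc) * a j.succ)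
      rw [add_comm (γ _ * _), ← h.leibniz] at this
      have hj' : ∀ r : Fin (k + 1), (r : ℕ) = j → r = j := fun r h => Fin.ext h
      convert this.symm using 2
      · congr 1
        rw [hu]
        ext r
        simp only [Fin.contractNth, diffAt, Fin.ext_iff, Fin.lt_def, Fin.val_castSucc, Fin.val_succ,
          Fin.succAbove_castSucc_self]
        split_ifs <;> first | omega | rfl | (obtain rfl := hj' r (by omega); rfl)
      all_goals
        congr 1
        rw [hu]
        ext r
        simp only [Fin.contractNth, diffAt, Fin.ext_iff, Fin.lt_def, Fin.val_castSucc, Fin.val_succ]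
        split_ifs <;> first | omega | rfl | (obtain rfl := hj' r (by omega); rfl)
    · rw [if_neg hj, sub_zero]
      congr 1
      have hv : ((i.castSucc.succAbove j : Fin (k + 2)) : ℕ) =
          if (j : ℕ) < i then (j : ℕ) else j + 1 := by
        simp only [Fin.succAbove, Fin.lt_def, Fin.val_castSucc]
        split_ifs <;> rfl
      have hne : (j : ℕ) ≠ i := fun h => hj (Fin.ext h)
      ext r
      simp only [Fin.contractNth, diffAt, Fin.ext_iff, Fin.lt_def, hv, Fin.val_castSucc,
        Fin.val_succ]
      split_ifs <;> first | omega | rfl | simp [h.sign_mul]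
  rw [Finset.sum_congr rfl fun j _ => e1 j, Finset.sum_sub_distrib, Finset.sum_ite_eq']
  simp

omit h in
/-- The differential of a functional on homogeneous arguments. -/
theorem algDiff_of_parity {k : ℕ} {φ : Fun A k} (hφ : IsMultilinear φ) {p : Fin (k + 1) → ℕ}
    {a : Fin (k + 1) → A} (ha : ∀ i, γ (a i) = (-1 : ℂ) ^ p i • a i) :
    algDiff γ d k φ a = ∑ j, (-1 : ℂ) ^ (∑ i, if i < j then p i else 0) *
      φ (Function.update a j (d (a j))) := by
  rw [algDiff_eq_sum]
  refine Finset.sum_congr rfl fun j _ => ?_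
  rw [← Finset.prod_pow_eq_pow_sum, ← smul_eq_mul, ← isMultilinear_smul_univ hφ]
  congr 1
  ext i
  rcases lt_trichotomy i j with hij | rfl | hij
  · simp [diffAt, hij, hij.ne, ha]
  · simp [diffAt]
  · simp [diffAt, not_lt.2 hij.le, hij.ne']

omit h in
theorem rotate_update_castSucc {α : Type*} {k : ℕ} (a : Fin (k + 1) → α) (j : Fin k) (x : α) :
    rotate (Function.update a j.castSucc x) = Function.update (rotate a) j.succ x := by
  ext i
  cases i using Fin.cases with
  | zero => simp [rotate, Function.update_of_ne (Fin.castSucc_lt_last j).ne',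
      Function.update_of_ne (Fin.succ_ne_zero j).symm]
  | succ i => simp [rotate, Function.update_apply]

omit h in
theorem rotate_update_last {α : Type*} {k : ℕ} (a : Fin (k + 1) → α) (x : α) :
    rotate (Function.update a (Fin.last k) x) = Function.update (rotate a) 0 x := by
  ext i
  cases i using Fin.cases with
  | zero => simp [rotate]
  | succ i => simp [rotate, Fin.succ_ne_zero]

theorem algOps_diff_cyc {k : ℕ} {φ : Fun A k} (hφ : IsMultilinear φ) :
    algDiff γ d k (algCyc γ k φ) = algCyc γ k (algDiff γ d k φ) := by
  refine hφ.algCyc.algDiff.ext_parity h.sign_sign hφ.algDiff.algCyc fun p a ha => ?_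
  have hup : ∀ j i, γ (Function.update a j (d (a j)) i) =
      (-1 : ℂ) ^ (Function.update p j (p j + 1) i) • Function.update a j (d (a j)) i := by
    intro j i
    rcases eq_or_ne i j with rfl | hij
    · simp [h.sign_d, ha, pow_succ]
    · simp [hij, ha]
  have hsum : ∀ j, ∑ i, Function.update p j (p j + 1) i = ∑ i, p i + 1 := by
    intro j
    rw [Finset.sum_update_of_mem (Finset.mem_univ j),
      ← Finset.add_sum_erase _ _ (Finset.mem_univ j),
      Finset.sdiff_singleton_eq_erase]
    ring
  rw [algDiff_of_parity hφ.algCyc ha, algCyc_of_parity hφ.algDiff ha,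
    algDiff_of_parity hφ (parity_rotate ha), Finset.mul_sum]
  conv_lhs => rw [Fin.sum_univ_castSucc, add_comm]
  conv_rhs => rw [Fin.sum_univ_succ]
  simp only [algCyc_of_parity hφ (hup _), hsum, rotate_update_last, rotate_update_castSucc]
  congr 1
  · rw [← mul_assoc, ← mul_assoc, ← pow_add, ← pow_add]
    congr 1
    apply neg_one_pow_congr
    have e1 : (∑ i, if i < Fin.last k then p i else 0) + p (Fin.last k) = ∑ i, p i := by
      simp [Fin.sum_univ_castSucc, Fin.castSucc_lt_last]
    have e2 : (∑ i, if i < (0 : Fin (k + 1)) then rotate p i else 0) = 0 := by simp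
    rw [e2, ← e1]
    simp only [Function.update_self]
    generalize (∑ i, if i < Fin.last k then p i else 0) = x
    generalize p (Fin.last k) = y
    push_cast
    generalize (x : ZMod 2) = x
    generalize (y : ZMod 2) = y
    revert x y
    decide
  · refine Finset.sum_congr rfl fun j _ => ?_
    rw [← mul_assoc, ← mul_assoc, ← pow_add, ← pow_add]
    congr 1
    apply neg_one_pow_congr
    have e1 : (∑ i, if i < j.castSucc then p i else 0) =
        ∑ i : Fin k, if i < j then p i.castSucc else 0 := by
      simp [Fin.sum_univ_castSucc, not_lt.2 (Fin.castSucc_lt_last j).le]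
    have e2 : (∑ i, if i < j.succ then rotate p i else 0) =
        p (Fin.last k) + ∑ i : Fin k, if i < j then p i.castSucc else 0 := by
      simp [Fin.sum_univ_succ, rotate]
    rw [e1, e2, Function.update_of_ne (Fin.castSucc_lt_last j).ne']
    generalize (∑ i : Fin k, if i < j then p i.castSucc else 0) = x
    generalize p (Fin.last k) = y
    generalize (∑ i, p i) = z
    push_cast
    generalize (x : ZMod 2) = x
    generalize (y : ZMod 2) = y
    generalize (z : ZMod 2) = z
    revert x y z
    decide

/-- The multilinear functionals of `k + 1` variables. -/
def multilinearFunctionals (A : Type*) [Ring A] [Algebra ℂ A] (k : ℕ) : Submodule ℂ (Fun A k) where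
  carrier := {φ | IsMultilinear φ}
  zero_mem' := ⟨0, rfl⟩
  add_mem' := fun hφ hψ => hφ.add hψ
  smul_mem' := fun r _ hφ => hφ.smul r

/-- The multilinear functionals on a super algebra with an odd derivation of square zero form a
cocyclic module with differential. -/
theorem isCocyclic_multilinear : (algOps γ d).IsCocyclic (multilinearFunctionals A) where
  face_mem hφ j := IsMultilinear.algFace hφ j
  degen_mem hφ j := IsMultilinear.algDegen (γ := γ) (d := d) hφ j
  cyc_mem hφ := IsMultilinear.algCyc hφ
  diff_mem hφ := IsMultilinear.algDiff hφ
  cyc_pow hφ := algCyc_pow_eq h.sign_sign hφ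
  cyc_face_zero {_ φ} _ := (algFace_last_eq φ).symm
  cyc_face_succ hφ j := algOps_cyc_face_succ h.sign_sign h.sign_mul hφ j
  face_face {_ φ} _ i j hij := algOps_face_face φ i j hij
  extra_face_zero hφ := algOps_extra_face_zero h.sign_one hφ
  extra_face_succ hφ j := algOps_extra_face_succ h.sign_one hφ j
  diff_cyc hφ := algOps_diff_cyc h hφ
  diff_face hφ j := algOps_diff_face h hφ j
  diff_extra hφ := algOps_diff_extra h hφ
  diff_diff hφ := algOps_diff_diff h hφ

end Differential

/-! ### Gradings -/

section Grading

variable {A : Type*} [AddCommGroup A] [Module ℂ A] (𝒜 : ℕ → Submodule ℂ A)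
  [DirectSum.Decomposition 𝒜]

/-- The projection onto the component of degree `n`. -/
def component (n : ℕ) : A →ₗ[ℂ] A :=
  (𝒜 n).subtype ∘ₗ DirectSum.component ℂ ℕ (fun n => 𝒜 n) n ∘ₗ
    (DirectSum.decomposeLinearEquiv 𝒜).toLinearMap

theorem component_apply (n : ℕ) (a : A) : component 𝒜 n a = (DirectSum.decompose 𝒜 a n : A) := rfl

theorem component_mem (n : ℕ) (a : A) : component 𝒜 n a ∈ 𝒜 n :=
  (DirectSum.decompose 𝒜 a n).2

theorem component_of_mem {n : ℕ} {a : A} (ha : a ∈ 𝒜 n) : component 𝒜 n a = a := by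
  rw [component_apply, DirectSum.decompose_of_mem_same 𝒜 ha]

theorem exists_sum_component (a : A) : ∃ N, ∀ M, N ≤ M →
    a = ∑ n ∈ Finset.range M, component 𝒜 n a := by
  classical
  refine ⟨(DFinsupp.support (DirectSum.decompose 𝒜 a)).sup id + 1, fun M hM => ?_⟩
  conv_lhs => rw [← DirectSum.sum_support_decompose 𝒜 a]
  refine Finset.sum_subset (fun n hn => ?_) (fun n _ hn => ?_)
  · rw [Finset.mem_range]
    have := Finset.le_sup (f := id) hn
    simp only [id] at this
    omega
  · rw [DFinsupp.notMem_support_iff] at hn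
    rw [hn]; rfl

theorem gradeScale_of_mem (c : ℕ → ℂ) {n : ℕ} {a : A} (ha : a ∈ 𝒜 n) :
    gradeScale 𝒜 c a = c n • a := by
  simp only [gradeScale, LinearMap.comp_apply, LinearEquiv.coe_coe,
    DirectSum.decomposeLinearEquiv_apply]
  rw [DirectSum.decompose_of_mem 𝒜 ha, ← DirectSum.lof_eq_of ℂ, DirectSum.toModule_lof]
  rfl

theorem gradeSign_of_mem {n : ℕ} {a : A} (ha : a ∈ 𝒜 n) : gradeSign 𝒜 a = (-1 : ℂ) ^ n • a :=
  gradeScale_of_mem 𝒜 _ ha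

theorem linearMap_ext_graded {B : Type*} [AddCommGroup B] [Module ℂ B] {f g : A →ₗ[ℂ] B}
    (h : ∀ n, ∀ a ∈ 𝒜 n, f a = g a) : f = g := by
  ext a
  obtain ⟨N, hN⟩ := exists_sum_component 𝒜 a
  rw [hN N le_rfl, map_sum, map_sum]
  exact Finset.sum_congr rfl fun n _ => h n _ (component_mem 𝒜 n a)

theorem gradeSign_gradeSign (a : A) : gradeSign 𝒜 (gradeSign 𝒜 a) = a := by
  have : gradeSign 𝒜 ∘ₗ gradeSign 𝒜 = LinearMap.id := by
    refine linearMap_ext_graded 𝒜 fun n a ha => ?_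
    simp only [LinearMap.comp_apply, gradeSign_of_mem 𝒜 ha, map_smul, smul_smul, LinearMap.id_apply]
    rw [← mul_pow]
    simp
  exact LinearMap.congr_fun this a

theorem gradeSign_pow_of_mem {n : ℕ} {a : A} (ha : a ∈ 𝒜 n) (e : ℕ) :
    (gradeSign 𝒜 ^ e) a = (-1 : ℂ) ^ (n * e) • a := by
  induction e with
  | zero => simp
  | succ e ih =>
    rw [pow_succ', Module.End.mul_apply, ih, map_smul, gradeSign_of_mem 𝒜 ha, smul_smul, ← pow_add,
      mul_add, mul_one]

theorem gradeSign_pow_mem {n : ℕ} {a : A} (ha : a ∈ 𝒜 n) (e : ℕ) :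
    (gradeSign 𝒜 ^ e) a ∈ 𝒜 n := by
  rw [gradeSign_pow_of_mem 𝒜 ha]
  exact Submodule.smul_mem _ _ ha

end Grading

section GradedAlgebra

variable {A : Type*} [Ring A] [Algebra ℂ A] (𝒜 : ℕ → Submodule ℂ A) [GradedAlgebra 𝒜]

theorem gradeSign_mul (a b : A) : gradeSign 𝒜 (a * b) = gradeSign 𝒜 a * gradeSign 𝒜 b := by
  have : (LinearMap.mul ℂ A).compr₂ (gradeSign 𝒜) =
      (LinearMap.mul ℂ A).compl₁₂ (gradeSign 𝒜) (gradeSign 𝒜) := by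
    refine linearMap_ext_graded 𝒜 fun n a ha => linearMap_ext_graded 𝒜 fun m b hb => ?_
    simp only [LinearMap.compr₂_apply, LinearMap.mul_apply', LinearMap.compl₁₂_apply]
    rw [gradeSign_of_mem 𝒜 (SetLike.mul_mem_graded ha hb), gradeSign_of_mem 𝒜 ha,
      gradeSign_of_mem 𝒜 hb, smul_mul_smul_comm, pow_add]
  exact LinearMap.congr_fun (LinearMap.congr_fun this a) b

theorem gradeSign_one : gradeSign 𝒜 1 = 1 := by
  rw [gradeSign_of_mem 𝒜 (SetLike.one_mem_graded 𝒜), pow_zero, one_smul]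

theorem gradeSign_pow_mul (e : ℕ) (a b : A) :
    (gradeSign 𝒜 ^ e) (a * b) = (gradeSign 𝒜 ^ e) a * (gradeSign 𝒜 ^ e) b :=
  sign_pow_mul (gradeSign_mul 𝒜) e a b

theorem parityPart_of_mem {n : ℕ} {a : A} (ha : a ∈ 𝒜 n) (e : ℕ) :
    parityPart (gradeSign 𝒜) e a = if (e + n) % 2 = 0 then a else 0 :=
  parityPart_of_parity (gradeSign_of_mem 𝒜 ha)

theorem IsDGAlgebra.isSuperDG {d : A →ₗ[ℂ] A} (h : IsDGAlgebra 𝒜 d) :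
    IsSuperDG (gradeSign 𝒜) d where
  sign_sign := gradeSign_gradeSign 𝒜
  sign_mul := gradeSign_mul 𝒜
  sign_one := gradeSign_one 𝒜
  sign_d := by
    have : gradeSign 𝒜 ∘ₗ d = -(d ∘ₗ gradeSign 𝒜) := by
      refine linearMap_ext_graded 𝒜 fun n a ha => ?_
      simp only [LinearMap.comp_apply, LinearMap.neg_apply, gradeSign_of_mem 𝒜 ha, map_smul,
        gradeSign_of_mem 𝒜 (h.map_deg n a ha), pow_succ, mul_neg, mul_one, neg_smul]
    exact LinearMap.congr_fun this
  leibniz := by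
    have : (LinearMap.mul ℂ A).compr₂ d = (LinearMap.mul ℂ A).compl₁₂ d LinearMap.id +
        (LinearMap.mul ℂ A).compl₁₂ (gradeSign 𝒜) d := by
      refine linearMap_ext_graded 𝒜 fun n a ha => LinearMap.ext fun b => ?_
      simp [h.leibniz n a ha b, gradeSign_of_mem 𝒜 ha]
    exact fun a b => LinearMap.congr_fun (LinearMap.congr_fun this a) b
  d_d := h.d_d

end GradedAlgebra

/-! ### Continuous functionals of bounded weight -/

section Cochains

variable {A : Type*} [Ring A] [Algebra ℂ A] [TopologicalSpace A] {𝒜 : ℕ → Submodule ℂ A}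
  [GradedAlgebra 𝒜]
variable {B : Type*} [Ring B] [Algebra ℂ B] [TopologicalSpace B] {ℬ : ℕ → Submodule ℂ B}

omit [TopologicalSpace A] in
theorem sum_component_of_weight {k N : ℕ} {φ : Fun A k} (hφ : IsMultilinear φ)
    (hN : ∀ (m : Fin (k + 1) → ℕ) (a : Fin (k + 1) → A), (∀ i, a i ∈ 𝒜 (m i)) →
      N < ∑ i, m i → φ a = 0) (a : Fin (k + 1) → A) :
    φ a = ∑ m ∈ Fintype.piFinset fun _ : Fin (k + 1) => Finset.range (N + 1),
      φ fun i => component 𝒜 (m i) (a i) := by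
  classical
  obtain ⟨f, rfl⟩ := hφ
  choose M hM using fun i => exists_sum_component 𝒜 (a i)
  set L := ∑ i, M i + (N + 1) with hL
  have e : a = fun i => ∑ n ∈ Finset.range L, component 𝒜 n (a i) := funext fun i =>
    hM i L (by have := Finset.single_le_sum (f := M) (fun _ _ => Nat.zero_le _)
                (Finset.mem_univ i); omega)
  conv_lhs => rw [e, f.map_sum_finset]
  symm
  refine Finset.sum_subset (fun m hm => ?_) (fun m _ hm' => ?_)
  · rw [Fintype.mem_piFinset] at hm ⊢
    intro i
    have := hm i
    rw [Finset.mem_range] at this ⊢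
    omega
  · refine hN m _ (fun i => component_mem 𝒜 _ _) ?_
    rw [Fintype.mem_piFinset] at hm'
    push Not at hm'
    obtain ⟨i, hi⟩ := hm'
    rw [Finset.mem_range] at hi
    have := Finset.single_le_sum (f := m) (fun _ _ => Nat.zero_le _) (Finset.mem_univ i)
    omega

/-- Membership in the space of cochains.  Continuity only has to be checked on each homogeneous
component of the arguments; the grading involution need not be continuous. -/
theorem mem_algCochain_iff (hc : ∀ n, Continuous (component 𝒜 n)) {k : ℕ} {φ : Fun A k} :
    φ ∈ algCochain 𝒜 k ↔ IsMultilinear φ ∧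
      (∃ N, ∀ (m : Fin (k + 1) → ℕ) (a : Fin (k + 1) → A), (∀ i, a i ∈ 𝒜 (m i)) →
        N < ∑ i, m i → φ a = 0) ∧
      ∀ m : Fin (k + 1) → ℕ, Continuous fun a : Fin (k + 1) → A =>
        φ fun i => component 𝒜 (m i) (a i) := by
  constructor
  · rintro ⟨⟨f, rfl⟩, hN⟩
    refine ⟨⟨f.toMultilinearMap, rfl⟩, hN, fun m => ?_⟩
    exact f.cont.comp (continuous_pi fun i => (hc _).comp (continuous_apply i))
  · rintro ⟨⟨f, rfl⟩, ⟨N, hN⟩, hcont⟩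
    refine ⟨⟨⟨f, ?_⟩, rfl⟩, N, hN⟩
    have : (f : (Fin (k + 1) → A) → ℂ) = fun a =>
        ∑ m ∈ Fintype.piFinset fun _ : Fin (k + 1) => Finset.range (N + 1),
          f fun i => component 𝒜 (m i) (a i) :=
      funext fun a => sum_component_of_weight ⟨f, rfl⟩ hN a
    change Continuous (f : (Fin (k + 1) → A) → ℂ)
    rw [this]
    exact continuous_finsetSum _ fun m _ => hcont m

omit [GradedAlgebra 𝒜] in
theorem algCochain.isMultilinear {k : ℕ} {φ : Fun A k} (hφ : φ ∈ algCochain 𝒜 k) :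
    IsMultilinear φ := by
  obtain ⟨⟨f, rfl⟩, -⟩ := hφ
  exact ⟨f.toMultilinearMap, rfl⟩

/-- A slotwise linear map between tuples which does not lower the total degree and is continuous
on homogeneous components. -/
structure IsGradedMap (𝒜 : ℕ → Submodule ℂ A) [GradedAlgebra 𝒜] (ℬ : ℕ → Submodule ℂ B)
    {n m : ℕ} (c : (Fin n → A) → (Fin m → B)) : Prop where
  slotwise : IsSlotwise c
  degree : ∀ (p : Fin n → ℕ) (a : Fin n → A), (∀ i, a i ∈ 𝒜 (p i)) →
    ∃ p' : Fin m → ℕ, (∀ i, c a i ∈ ℬ (p' i)) ∧ ∑ i, p i ≤ ∑ i, p' i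
  continuous : ∀ p : Fin n → ℕ, Continuous fun a : Fin n → A => c fun i => component 𝒜 (p i) (a i)

theorem IsGradedMap.comp_mem (hc : ∀ n, Continuous (component 𝒜 n)) {k l : ℕ}
    {c : (Fin (k + 1) → A) → (Fin (l + 1) → B)} (h : IsGradedMap 𝒜 ℬ c) {φ : Fun B l}
    (hφ : φ ∈ algCochain ℬ l) : (fun a => φ (c a)) ∈ algCochain 𝒜 k := by
  rw [mem_algCochain_iff hc]
  refine ⟨(algCochain.isMultilinear hφ).comp h.slotwise, ?_, fun m => ?_⟩
  · obtain ⟨-, N, hN⟩ := hφ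
    refine ⟨N, fun p a ha hp => ?_⟩
    obtain ⟨p', hp', hle⟩ := h.degree p a ha
    exact hN p' _ hp' (by omega)
  · obtain ⟨⟨f, rfl⟩, -⟩ := hφ
    exact f.cont.comp (h.continuous m)

theorem IsGradedMap.pi {n : ℕ} (L : Fin n → A →ₗ[ℂ] B)
    (hL : ∀ i p, ∀ a ∈ 𝒜 p, ∃ p', p ≤ p' ∧ L i a ∈ ℬ p')
    (hc : ∀ i p, Continuous fun a => L i (component 𝒜 p a)) :
    IsGradedMap 𝒜 ℬ fun (a : Fin n → A) i => L i (a i) where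
  slotwise := IsSlotwise.pi L
  degree := by
    intro p a ha
    choose p' hp hp' using fun i => hL i (p i) (a i) (ha i)
    exact ⟨p', hp', Finset.sum_le_sum fun i _ => hp i⟩
  continuous := fun p => continuous_pi fun i => (hc i (p i)).comp (continuous_apply i)

end Cochains

section CochainOperators

variable {A : Type*} [Ring A] [Algebra ℂ A] [TopologicalSpace A] [IsTopologicalRing A]
  {𝒜 : ℕ → Submodule ℂ A} [GradedAlgebra 𝒜]

theorem continuous_sign_smul {X : Type*} [TopologicalSpace X] {f : X → A} (hf : Continuous f)
    (n : ℕ) : Continuous fun x => (-1 : ℂ) ^ n • f x := by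
  rcases neg_one_pow_eq_or ℂ n with h | h
  · simpa [h] using hf
  · simp only [h, neg_smul, one_smul]
    exact hf.neg

theorem continuous_gradeSign_component (hc : ∀ n, Continuous (component 𝒜 n)) (e n : ℕ) :
    Continuous fun a => (gradeSign 𝒜 ^ e) (component 𝒜 n a) := by
  simp only [gradeSign_pow_of_mem 𝒜 (component_mem 𝒜 n _)]
  exact continuous_sign_smul (hc n) _

theorem isGradedMap_rot (hc : ∀ n, Continuous (component 𝒜 n)) (k e : ℕ) :
    IsGradedMap 𝒜 𝒜 (rot (gradeSign 𝒜) k e) where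
  slotwise := IsSlotwise.rot e
  degree := by
    intro p a ha
    refine ⟨rotate p, fun i => ?_, (sum_rotate p).ge⟩
    cases i using Fin.cases with
    | zero =>
      simp only [rot, rotate, Fin.cons_zero, parityPart_of_mem 𝒜 (ha _)]
      split_ifs
      · exact ha _
      · exact zero_mem _
    | succ i => exact gradeSign_pow_mem 𝒜 (ha _) e
  continuous := by
    intro p
    refine continuous_pi fun i => ?_
    cases i using Fin.cases with
    | zero =>
      simp only [rot, Fin.cons_zero, parityPart_of_mem 𝒜 (component_mem 𝒜 _ _)]
      split_ifs
      · exact (hc _).comp (continuous_apply _)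
      · exact continuous_const
    | succ i => exact (continuous_gradeSign_component hc e _).comp (continuous_apply _)

theorem isGradedMap_contractNth (hc : ∀ n, Continuous (component 𝒜 n)) {k : ℕ} (j : Fin (k + 1)) :
    IsGradedMap 𝒜 𝒜 fun a : Fin (k + 2) → A => Fin.contractNth j.castSucc (· * ·) a where
  slotwise := IsSlotwise.contractNth j
  degree := by
    intro p a ha
    refine ⟨Fin.contractNth j.castSucc (· + ·) p, fun i => ?_, le_of_eq ?_⟩
    · simp only [Fin.contractNth]
      split_ifs
      · exact ha _
      · exact SetLike.mul_mem_graded (ha _) (ha _)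
      · exact ha _
    · rw [Fin.sum_univ_succAbove _ j.castSucc, Fin.sum_univ_succAbove _ j, ← add_assoc]
      conv_rhs => rw [Fin.sum_univ_succAbove _ j]
      congr 1
      · simp [Fin.contractNth]
      · refine Finset.sum_congr rfl fun i _ => ?_
        rw [Fin.contractNth_apply_of_ne _ _ _ _ fun h => Fin.succAbove_ne j i (Fin.ext h.symm)]
  continuous := by
    intro p
    refine continuous_pi fun i => ?_
    simp only [Fin.contractNth]
    have hp : ∀ r, Continuous fun a : Fin (k + 2) → A => component 𝒜 (p r) (a r) :=
      fun r => (hc _).comp (continuous_apply _)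
    split_ifs
    · exact hp _
    · exact (hp _).mul (hp _)
    · exact hp _

omit [IsTopologicalRing A] in
theorem isGradedMap_insertNth (hc : ∀ n, Continuous (component 𝒜 n)) {k : ℕ} (j : Fin (k + 1))
    {y : A} (hy : y ∈ 𝒜 0) :
    IsGradedMap 𝒜 𝒜 fun a : Fin k → A => Fin.insertNth (α := fun _ => A) j y a where
  slotwise := IsSlotwise.insertNth j y
  degree := by
    intro p a ha
    refine ⟨Fin.insertNth (α := fun _ => ℕ) j 0 p, fun i => ?_, le_of_eq ?_⟩
    · induction i using Fin.succAboveCases j with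
      | x => simpa using hy
      | p i => simpa using ha i
    · rw [Fin.sum_univ_succAbove _ j]
      simp
  continuous := by
    intro p
    refine continuous_pi fun i => ?_
    induction i using Fin.succAboveCases j with
    | x => simpa using continuous_const
    | p i =>
      simp only [Fin.insertNth_apply_succAbove]
      exact (hc (p i)).comp (continuous_apply i)

theorem isGradedMap_diffAt {d : A →ₗ[ℂ] A} (hd : IsTopDGAlgebra 𝒜 d) {k : ℕ} (j : Fin k) :
    IsGradedMap 𝒜 𝒜 (diffAt (gradeSign 𝒜) d j) := by
  have hc : ∀ n, Continuous (component 𝒜 n) := hd.continuous_component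
  have := IsGradedMap.pi (𝒜 := 𝒜) (ℬ := 𝒜)
    (fun i : Fin k => if i < j then gradeSign 𝒜 else if i = j then d else LinearMap.id)
    (fun i p a ha => by
      split_ifs
      · exact ⟨p, le_rfl, by simpa using gradeSign_pow_mem 𝒜 ha 1⟩
      · exact ⟨p + 1, p.le_succ, hd.map_deg p a ha⟩
      · exact ⟨p, le_rfl, ha⟩)
    (fun i p => by
      split_ifs
      · simpa using continuous_gradeSign_component hc 1 p
      · exact hd.continuous_d.comp (hc p)
      · exact hc p)
  convert this using 3 with a i
  simp only [diffAt]
  split_ifs <;> rfl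

/-- The continuous functionals of bounded weight on a topological DG algebra form a cocyclic module
with differential. -/
theorem isCocyclic_algOps {d : A →ₗ[ℂ] A} (hd : IsTopDGAlgebra 𝒜 d) :
    (algOps (gradeSign 𝒜) d).IsCocyclic (algCochain 𝒜) := by
  have hc : ∀ n, Continuous (component 𝒜 n) := hd.continuous_component
  have hs := IsDGAlgebra.isSuperDG 𝒜 hd.toIsDGAlgebra
  have hcyc : ∀ {k} {φ : Fun A k}, φ ∈ algCochain 𝒜 k →
      algCyc (gradeSign 𝒜) k φ ∈ algCochain 𝒜 k := by
    intro k φ hφ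
    have : algCyc (gradeSign 𝒜) k φ = ∑ e ∈ Finset.range 2,
        fun a => φ (rot (gradeSign 𝒜) k e a) := by
      ext a; rw [algCyc_apply, Finset.sum_apply]
    rw [this]
    exact sum_mem fun e _ => (isGradedMap_rot hc k e).comp_mem hc hφ
  have hface : ∀ {k} {φ : Fun A k}, φ ∈ algCochain 𝒜 k → ∀ j : Fin (k + 1),
      algFace (gradeSign 𝒜) k j.castSucc φ ∈ algCochain 𝒜 (k + 1) := by
    intro k φ hφ j
    have : algFace (gradeSign 𝒜) k j.castSucc φ =
        fun a => φ (Fin.contractNth j.castSucc (· * ·) a) := funext fun a => algFace_castSucc j φ a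
    rw [this]
    exact (isGradedMap_contractNth hc j).comp_mem hc hφ
  have hm := isCocyclic_multilinear hs
  have hml : ∀ {k} {φ : Fun A k}, φ ∈ algCochain 𝒜 k → φ ∈ multilinearFunctionals A k :=
    algCochain.isMultilinear
  refine {
    face_mem := fun {k φ} hφ j => ?_
    degen_mem := fun {k φ} hφ j =>
      (isGradedMap_insertNth hc j.succ (SetLike.one_mem_graded 𝒜)).comp_mem hc hφ
    cyc_mem := hcyc
    diff_mem := fun {k φ} hφ => ?_
    cyc_pow := fun hφ => hm.cyc_pow (hml hφ)
    cyc_face_zero := fun hφ => hm.cyc_face_zero (hml hφ)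
    cyc_face_succ := fun hφ => hm.cyc_face_succ (hml hφ)
    face_face := fun hφ => hm.face_face (hml hφ)
    extra_face_zero := fun hφ => hm.extra_face_zero (hml hφ)
    extra_face_succ := fun hφ => hm.extra_face_succ (hml hφ)
    diff_cyc := fun hφ => hm.diff_cyc (hml hφ)
    diff_face := fun hφ => hm.diff_face (hml hφ)
    diff_extra := fun hφ => hm.diff_extra (hml hφ)
    diff_diff := fun hφ => hm.diff_diff (hml hφ) }
  · induction j using Fin.lastCases with
    | last =>
      change algFace (gradeSign 𝒜) k (Fin.last (k + 1)) φ ∈ _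
      rw [algFace_last_eq]
      exact hcyc (hface hφ 0)
    | cast j => exact hface hφ j
  · have : (algOps (gradeSign 𝒜) d).diff k φ = ∑ j : Fin (k + 1),
        fun a => φ (diffAt (gradeSign 𝒜) d j a) := by
      ext a
      rw [Finset.sum_apply]
      exact algDiff_eq_sum φ a
    rw [this]
    exact sum_mem fun j _ => (isGradedMap_diffAt hd j).comp_mem hc hφ

end CochainOperators

/-! ### Sweedler sums and convolution -/

section Sweedler

variable {H : Type u} [Ring H] [Algebra ℂ H] [Coalgebra ℂ H]
variable {M : Type*} [AddCommGroup M] [Module ℂ M] {N : Type*} [AddCommGroup N] [Module ℂ N]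

theorem sw_apply (f : H →ₗ[ℂ] H →ₗ[ℂ] M) (h : H) :
    sw f h = TensorProduct.lift f (Coalgebra.comul h) := rfl

theorem sw_eq_sum {f : H →ₗ[ℂ] H →ₗ[ℂ] M} {h : H} {ι : Type*} {s : Finset ι} {x y : ι → H}
    (hs : (Coalgebra.comul h : H ⊗[ℂ] H) = ∑ i ∈ s, x i ⊗ₜ y i) :
    sw f h = ∑ i ∈ s, f (x i) (y i) := by
  rw [sw_apply, hs, map_sum]
  rfl

theorem exists_comul (h : H) : ∃ (s : Finset (H × H)),
    (Coalgebra.comul h : H ⊗[ℂ] H) = ∑ i ∈ s, i.1 ⊗ₜ i.2 :=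
  TensorProduct.exists_finset _

theorem sw_ext {f g : H →ₗ[ℂ] H →ₗ[ℂ] M} (hfg : ∀ x y, f x y = g x y) (h : H) :
    sw f h = sw g h := by
  have : f = g := by ext x y; exact hfg x y
  rw [this]

theorem map_sw (φ : M →ₗ[ℂ] N) (f : H →ₗ[ℂ] H →ₗ[ℂ] M) (h : H) :
    φ (sw f h) = sw (f.compr₂ φ) h := by
  obtain ⟨s, hs⟩ := exists_comul h
  rw [sw_eq_sum hs, sw_eq_sum hs, map_sum]
  rfl

theorem sw_of_comul_eq {h x : H} (hx : (Coalgebra.comul h : H ⊗[ℂ] H) = x ⊗ₜ x)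
    (f : H →ₗ[ℂ] H →ₗ[ℂ] M) : sw f h = f x x := by
  rw [sw_apply, hx]; rfl

theorem sw_counit_left {f : H →ₗ[ℂ] H →ₗ[ℂ] M} {g : H →ₗ[ℂ] M}
    (hf : ∀ x y, f x y = Coalgebra.counit (R := ℂ) x • g y) (h : H) : sw f h = g h := by
  obtain ⟨s, hs⟩ := exists_comul h
  have h1 := Coalgebra.rTensor_counit_comul (R := ℂ) h
  rw [hs, map_sum] at h1
  have h2 := congrArg
    (TensorProduct.lift (LinearMap.lsmul ℂ M ∘ₗ (LinearMap.id (R := ℂ) (M := ℂ))) ∘ₗ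
    TensorProduct.map LinearMap.id g) h1
  rw [map_sum] at h2
  rw [sw_eq_sum hs]
  simpa [hf] using h2

theorem sw_counit_right {f : H →ₗ[ℂ] H →ₗ[ℂ] M} {g : H →ₗ[ℂ] M}
    (hf : ∀ x y, f x y = Coalgebra.counit (R := ℂ) y • g x) (h : H) : sw f h = g h := by
  obtain ⟨s, hs⟩ := exists_comul h
  have h1 := Coalgebra.lTensor_counit_comul (R := ℂ) h
  rw [hs, map_sum] at h1
  have h2 := congrArg
    (TensorProduct.lift (LinearMap.lsmul ℂ M ∘ₗ (LinearMap.id (R := ℂ) (M := ℂ))).flip ∘ₗ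
    TensorProduct.map g LinearMap.id) h1
  rw [map_sum] at h2
  rw [sw_eq_sum hs]
  simpa [hf] using h2

/-- Coassociativity: both sides are `∑ T h₍₀₎ h₍₁₎ h₍₂₎`. -/
theorem sw_coassoc (T : H →ₗ[ℂ] H →ₗ[ℂ] H →ₗ[ℂ] M) {J K : H →ₗ[ℂ] H →ₗ[ℂ] M}
    (hJ : ∀ x z, J x z = sw T x z) (hK : ∀ x z, K x z = sw (T x) z) (h : H) :
    sw J h = sw K h := by
  set Φ : H ⊗[ℂ] (H ⊗[ℂ] H) →ₗ[ℂ] M :=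
    TensorProduct.lift (TensorProduct.uncurry (RingHom.id ℂ) H H M ∘ₗ T) with hΦ
  have h1 : ∀ (u : H ⊗[ℂ] H) (z : H),
      Φ (TensorProduct.assoc ℂ H H H (u ⊗ₜ z)) = TensorProduct.lift T u z := by
    intro u z
    induction u with
    | zero => simp
    | add a b ha hb => rw [TensorProduct.add_tmul, map_add, map_add, ha, hb, map_add]; rfl
    | tmul x y => simp [hΦ]
  have hL : TensorProduct.lift J = Φ ∘ₗ (TensorProduct.assoc ℂ H H H).toLinearMap ∘ₗ
      (Coalgebra.comul (R := ℂ) (A := H)).rTensor H := by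
    ext x z
    simp [hJ, h1, sw_apply]
  have hR : TensorProduct.lift K = Φ ∘ₗ (Coalgebra.comul (R := ℂ) (A := H)).lTensor H := by
    ext x z
    simp only [TensorProduct.AlgebraTensorModule.curry_apply, LinearMap.restrictScalars_self,
      TensorProduct.curry_apply, TensorProduct.lift.tmul, hK, hΦ, sw_apply, LinearMap.comp_apply,
      LinearMap.lTensor_tmul]
    rfl
  rw [sw_apply, sw_apply, hL, hR]
  simp only [LinearMap.comp_apply, LinearEquiv.coe_coe]
  rw [Coalgebra.coassoc_apply]

variable {A : Type*} [Ring A] [Algebra ℂ A]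

/-- The convolution product of linear maps `H → A`. -/
def conv (f g : H →ₗ[ℂ] A) : H →ₗ[ℂ] A := sw ((LinearMap.mul ℂ A).compl₁₂ f g)

/-- The unit `h ↦ ε(h) 1` of the convolution product. -/
def convUnit (H : Type u) [Ring H] [Algebra ℂ H] [Coalgebra ℂ H] (A : Type*) [Ring A]
    [Algebra ℂ A] :
    H →ₗ[ℂ] A := Algebra.linearMap ℂ A ∘ₗ Coalgebra.counit

theorem conv_eq_sum (f g : H →ₗ[ℂ] A) {h : H} {ι : Type*} {s : Finset ι} {x y : ι → H}
    (hs : (Coalgebra.comul h : H ⊗[ℂ] H) = ∑ i ∈ s, x i ⊗ₜ y i) :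
    conv f g h = ∑ i ∈ s, f (x i) * g (y i) := sw_eq_sum hs

theorem conv_of_comul_eq {h x : H} (hx : (Coalgebra.comul h : H ⊗[ℂ] H) = x ⊗ₜ x)
    (f g : H →ₗ[ℂ] A) : conv f g h = f x * g x := sw_of_comul_eq hx _

theorem conv_eq_ofConv (f g : H →ₗ[ℂ] A) :
    conv f g = (WithConv.toConv f * WithConv.toConv g).ofConv := by
  ext h
  obtain ⟨s, hs⟩ := exists_comul h
  rw [conv_eq_sum f g hs, LinearMap.convMul_def]
  simp [hs]

theorem conv_assoc (f g k : H →ₗ[ℂ] A) : conv (conv f g) k = conv f (conv g k) := by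
  simp only [conv_eq_ofConv]
  exact congrArg WithConv.ofConv (mul_assoc (WithConv.toConv f) _ _)

theorem convUnit_conv (f : H →ₗ[ℂ] A) : conv (convUnit H A) f = f := by
  rw [conv_eq_ofConv]
  exact congrArg WithConv.ofConv (one_mul (WithConv.toConv f))

theorem conv_convUnit (f : H →ₗ[ℂ] A) : conv f (convUnit H A) = f := by
  rw [conv_eq_ofConv]
  exact congrArg WithConv.ofConv (mul_one (WithConv.toConv f))

theorem conv_smul_left (c : ℂ) (f g : H →ₗ[ℂ] A) : conv (c • f) g = c • conv f g := by
  ext h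
  obtain ⟨s, hs⟩ := exists_comul h
  rw [LinearMap.smul_apply, conv_eq_sum _ _ hs, conv_eq_sum _ _ hs, Finset.smul_sum]
  simp

theorem conv_smul_right (c : ℂ) (f g : H →ₗ[ℂ] A) : conv f (c • g) = c • conv f g := by
  ext h
  obtain ⟨s, hs⟩ := exists_comul h
  rw [LinearMap.smul_apply, conv_eq_sum _ _ hs, conv_eq_sum _ _ hs, Finset.smul_sum]
  simp

theorem conv_add_left (f f' g : H →ₗ[ℂ] A) : conv (f + f') g = conv f g + conv f' g := by
  ext h
  obtain ⟨s, hs⟩ := exists_comul h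
  simp only [LinearMap.add_apply, conv_eq_sum _ _ hs, add_mul, Finset.sum_add_distrib]

theorem conv_add_right (f g g' : H →ₗ[ℂ] A) : conv f (g + g') = conv f g + conv f g' := by
  ext h
  obtain ⟨s, hs⟩ := exists_comul h
  simp only [LinearMap.add_apply, conv_eq_sum _ _ hs, mul_add, Finset.sum_add_distrib]

end Sweedler

/-! ### Graded Hopf algebras -/

section GradedHopf

variable {H : Type u} [Ring H] [Algebra ℂ H] [Coalgebra ℂ H] {𝓗 : ℕ → Submodule ℂ H}
  [GradedAlgebra 𝓗] {dH S : H →ₗ[ℂ] H}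

/-- The tensors in `H ⊗ H` which are sums of `x ⊗ y` with `x`, `y` homogeneous of total degree
`n`. -/
def homogeneousTensors (𝓗 : ℕ → Submodule ℂ H) (n : ℕ) : Submodule ℂ (H ⊗[ℂ] H) where
  carrier := {T | ∃ (ι : Type) (_ : Fintype ι) (x y : ι → H) (p q : ι → ℕ),
    (∀ i, x i ∈ 𝓗 (p i)) ∧ (∀ i, y i ∈ 𝓗 (q i)) ∧ (∀ i, p i + q i = n) ∧ T = ∑ i, x i ⊗ₜ y i}
  zero_mem' := ⟨Empty, inferInstance, nofun, nofun, nofun, nofun, nofun, nofun, nofun, by simp⟩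
  add_mem' := by
    rintro _ _ ⟨ι, _, x, y, p, q, hx, hy, hpq, rfl⟩ ⟨ι', _, x', y', p', q', hx', hy', hpq', rfl⟩
    refine ⟨ι ⊕ ι', inferInstance, Sum.elim x x', Sum.elim y y', Sum.elim p p', Sum.elim q q',
      ?_, ?_, ?_, by simp⟩ <;> rintro (i | i) <;> simp [hx, hy, hpq, hx', hy', hpq']
  smul_mem' := by
    rintro c _ ⟨ι, _, x, y, p, q, hx, hy, hpq, rfl⟩
    exact ⟨ι, inferInstance, fun i => c • x i, y, p, q, fun i => (𝓗 _).smul_mem c (hx i), hy, hpq,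
      by simp [Finset.smul_sum, TensorProduct.smul_tmul']⟩

/-- The coproduct of a homogeneous element is a sum of tensors of homogeneous elements. -/
theorem IsDGHopfAlgebra.exists_comul (hH : IsDGHopfAlgebra 𝓗 dH S) {n : ℕ} {h : H} (hh : h ∈ 𝓗 n) :
    ∃ (ι : Type) (_ : Fintype ι) (x y : ι → H) (p q : ι → ℕ),
      (∀ i, x i ∈ 𝓗 (p i)) ∧ (∀ i, y i ∈ 𝓗 (q i)) ∧ (∀ i, p i + q i = n) ∧
      (Coalgebra.comul h : H ⊗[ℂ] H) = ∑ i, x i ⊗ₜ y i := by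
  have key : (⨆ p ∈ Finset.HasAntidiagonal.antidiagonal n,
      LinearMap.range (TensorProduct.map (𝓗 p.1).subtype (𝓗 p.2).subtype)) ≤
      homogeneousTensors 𝓗 n := by
    refine iSup₂_le fun r hr => ?_
    rintro _ ⟨u, rfl⟩
    induction u with
    | zero => simpa only [map_zero] using (homogeneousTensors 𝓗 n).zero_mem
    | add a b ha hb => simpa only [map_add] using (homogeneousTensors 𝓗 n).add_mem ha hb
    | tmul a b =>
      exact ⟨Unit, inferInstance, fun _ => a, fun _ => b, fun _ => r.1, fun _ => r.2,
        fun _ => a.2, fun _ => b.2, fun _ => Finset.HasAntidiagonal.mem_antidiagonal.1 hr, by simp⟩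
  exact key (hH.comul_deg n h hh)

variable {M : Type*} [AddCommGroup M] [Module ℂ M]

theorem IsDGHopfAlgebra.sw_congr (hH : IsDGHopfAlgebra 𝓗 dH S) {f g : H →ₗ[ℂ] H →ₗ[ℂ] M} {n : ℕ}
    {h : H} (hh : h ∈ 𝓗 n)
    (hfg : ∀ p q, p + q = n → ∀ x ∈ 𝓗 p, ∀ y ∈ 𝓗 q, f x y = g x y) : sw f h = sw g h := by
  obtain ⟨ι, _, x, y, p, q, hx, hy, hpq, hs⟩ := hH.exists_comul hh
  rw [sw_eq_sum hs, sw_eq_sum hs]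
  exact Finset.sum_congr rfl fun i _ => hfg _ _ (hpq i) _ (hx i) _ (hy i)

theorem IsDGHopfAlgebra.sw_mem (hH : IsDGHopfAlgebra 𝓗 dH S) {f : H →ₗ[ℂ] H →ₗ[ℂ] M} {n : ℕ}
    {h : H} (hh : h ∈ 𝓗 n) (W : Submodule ℂ M)
    (hf : ∀ p q, p + q = n → ∀ x ∈ 𝓗 p, ∀ y ∈ 𝓗 q, f x y ∈ W) : sw f h ∈ W := by
  obtain ⟨ι, _, x, y, p, q, hx, hy, hpq, hs⟩ := hH.exists_comul hh
  rw [sw_eq_sum hs]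
  exact W.sum_mem fun i _ => hf _ _ (hpq i) _ (hx i) _ (hy i)

variable {A : Type*} [Ring A] [Algebra ℂ A] {𝒜 : ℕ → Submodule ℂ A} [GradedAlgebra 𝒜]
  {d : A →ₗ[ℂ] A}

theorem IsDGHopfAlgebra.conv_congr (hH : IsDGHopfAlgebra 𝓗 dH S) {f g f' g' : H →ₗ[ℂ] A} {n : ℕ}
    {h : H} (hh : h ∈ 𝓗 n)
    (hfg : ∀ p q, p + q = n → ∀ x ∈ 𝓗 p, ∀ y ∈ 𝓗 q, f x * g y = f' x * g' y) :
    conv f g h = conv f' g' h :=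
  hH.sw_congr hh hfg

theorem IsDGHopfAlgebra.conv_comp_gradeSign (hH : IsDGHopfAlgebra 𝓗 dH S) (f g : H →ₗ[ℂ] A) :
    conv f g ∘ₗ gradeSign 𝓗 = conv (f ∘ₗ gradeSign 𝓗) (g ∘ₗ gradeSign 𝓗) := by
  refine linearMap_ext_graded 𝓗 fun n h hh => ?_
  rw [LinearMap.comp_apply, gradeSign_of_mem 𝓗 hh, map_smul, ← LinearMap.smul_apply,
    ← conv_smul_left]
  refine hH.conv_congr hh fun p q hpq x hx y hy => ?_
  simp only [LinearMap.smul_apply, LinearMap.comp_apply, gradeSign_of_mem 𝓗 hx,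
    gradeSign_of_mem 𝓗 hy, map_smul, smul_mul_assoc, mul_smul_comm, smul_smul]
  rw [← hpq, pow_add, mul_comm]

theorem IsDGHopfAlgebra.conv_comp_gradeSign_pow (hH : IsDGHopfAlgebra 𝓗 dH S) (f g : H →ₗ[ℂ] A)
    (e : ℕ) : conv f g ∘ₗ gradeSign 𝓗 ^ e =
      conv (f ∘ₗ gradeSign 𝓗 ^ e) (g ∘ₗ gradeSign 𝓗 ^ e) := by
  induction e with
  | zero => rfl
  | succ e ih =>
    have h1 : ∀ f : H →ₗ[ℂ] A, f ∘ₗ gradeSign 𝓗 ^ (e + 1) =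
        (f ∘ₗ gradeSign 𝓗 ^ e) ∘ₗ gradeSign 𝓗 := fun f => rfl
    rw [h1, h1, h1, ih, hH.conv_comp_gradeSign]

theorem IsDGHopfAlgebra.conv_comp_d (hH : IsDGHopfAlgebra 𝓗 dH S) (f g : H →ₗ[ℂ] A) :
    conv f g ∘ₗ dH = conv (f ∘ₗ dH) g + conv (f ∘ₗ gradeSign 𝓗) (g ∘ₗ dH) := by
  ext h
  obtain ⟨s, hs⟩ := DGCyc.exists_comul h
  rw [LinearMap.comp_apply, LinearMap.add_apply, conv_eq_sum _ _ hs, conv_eq_sum _ _ hs, conv,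
    sw_apply, hH.comul_d, hs]
  simp

/-- If `f` has degree `m`, then `d ∘ (f ∗ g) = (d ∘ f) ∗ g + (-1) ^ m (f ∘ γ) ∗ (d ∘ g)`. -/
theorem IsDGHopfAlgebra.d_comp_conv (hH : IsDGHopfAlgebra 𝓗 dH S) (hd : IsDGAlgebra 𝒜 d) {m : ℕ}
    {f : H →ₗ[ℂ] A} (hf : ∀ n, ∀ h ∈ 𝓗 n, f h ∈ 𝒜 (n + m)) (g : H →ₗ[ℂ] A) :
    d ∘ₗ conv f g = conv (d ∘ₗ f) g + (-1 : ℂ) ^ m • conv (f ∘ₗ gradeSign 𝓗) (d ∘ₗ g) := by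
  refine linearMap_ext_graded 𝓗 fun n h hh => ?_
  obtain ⟨ι, _, x, y, p, q, hx, hy, hpq, hs⟩ := hH.exists_comul hh
  rw [LinearMap.comp_apply, LinearMap.add_apply, LinearMap.smul_apply, conv_eq_sum _ _ hs,
    conv_eq_sum _ _ hs, conv_eq_sum _ _ hs, map_sum, Finset.smul_sum, ← Finset.sum_add_distrib]
  refine Finset.sum_congr rfl fun i _ => ?_
  rw [hd.leibniz _ _ (hf _ _ (hx i))]
  simp only [LinearMap.comp_apply, gradeSign_of_mem 𝓗 (hx i), map_smul, smul_mul_assoc, smul_smul]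
  rw [pow_add, mul_comm]

/-- `∑ f (g h)₍₀₎ (g h)₍₁₎ = ∑ (-1) ^ (|g₍₁₎| |h₍₀₎|) f (g₍₀₎ h₍₀₎) (g₍₁₎ h₍₁₎)`. -/
theorem IsDGHopfAlgebra.sw_mul (hH : IsDGHopfAlgebra 𝓗 dH S) (f : H →ₗ[ℂ] H →ₗ[ℂ] M) (g : H) {h : H}
    {ι : Type*} [Fintype ι] {x y : ι → H} {p : ι → ℕ} (hx : ∀ i, x i ∈ 𝓗 (p i))
    (hs : (Coalgebra.comul h : H ⊗[ℂ] H) = ∑ i, x i ⊗ₜ y i) :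
    sw f (g * h) = ∑ i, sw (f.compl₁₂ (LinearMap.mulRight ℂ (x i))
      (LinearMap.mulRight ℂ (y i) ∘ₗ gradeSign 𝓗 ^ p i)) g := by
  suffices hg : sw f ∘ₗ LinearMap.mulRight ℂ h = ∑ i, sw (f.compl₁₂ (LinearMap.mulRight ℂ (x i))
      (LinearMap.mulRight ℂ (y i) ∘ₗ gradeSign 𝓗 ^ p i)) by
    simpa using LinearMap.congr_fun hg g
  refine linearMap_ext_graded 𝓗 fun n g hg => ?_
  obtain ⟨κ, _, u, v, r, s, hu, hv, hrs, hg'⟩ := hH.exists_comul hg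
  have h1 := hH.comul_mul g h
  rw [hg', hs, map_sum, map_sum, Finset.sum_mul_sum] at h1
  have h2 : (Coalgebra.comul (g * h) : H ⊗[ℂ] H) =
      ∑ k, ∑ i, (u k * x i) ⊗ₜ[ℂ] ((gradeSign 𝓗 ^ p i) (v k) * y i) := by
    apply (GradedTensorProduct.of ℂ 𝓗 𝓗).injective
    rw [h1, map_sum]
    refine Finset.sum_congr rfl fun k _ => ?_
    rw [map_sum]
    refine Finset.sum_congr rfl fun i _ => ?_
    have h3 := GradedTensorProduct.tmul_coe_mul_coe_tmul (R := ℂ) 𝓗 𝓗 (u k) ⟨v k, hv k⟩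
      ⟨x i, hx i⟩ (y i)
    refine h3.trans ?_
    rw [gradeSign_pow_of_mem 𝓗 (hv k), smul_mul_assoc, TensorProduct.tmul_smul, map_smul]
    rcases Nat.even_or_odd (s k * p i) with he | ho
    · rw [he.neg_one_pow, he.neg_one_pow, one_smul, one_smul]
    · rw [ho.neg_one_pow, ho.neg_one_pow, Units.neg_smul, one_smul, neg_smul, one_smul]
  rw [LinearMap.comp_apply, LinearMap.mulRight_apply, sw_apply, h2, LinearMap.sum_apply, map_sum,
    Finset.sum_congr rfl fun k _ => map_sum _ _ _, Finset.sum_comm]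
  refine Finset.sum_congr rfl fun i _ => ?_
  rw [sw_eq_sum hg']
  rfl

end GradedHopf

/-! ### The twist of an action by an inner cocycle pair -/

section Twist

variable {H : Type u} [Ring H] [Algebra ℂ H] [Coalgebra ℂ H] {𝓗 : ℕ → Submodule ℂ H}
  [GradedAlgebra 𝓗] {dH S : H →ₗ[ℂ] H} {σ : H}
variable {A : Type v} [Ring A] [Algebra ℂ A] {𝒜 : ℕ → Submodule ℂ A} [GradedAlgebra 𝒜]
  {d : A →ₗ[ℂ] A} {π : H →ₗ[ℂ] A →ₗ[ℂ] A} {ρp ρm : H →ₗ[ℂ] A}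

theorem leftTwist_apply (π : H →ₗ[ℂ] A →ₗ[ℂ] A) (ρp : H →ₗ[ℂ] A) (h : H) (a : A) :
    leftTwist π ρp h a = conv ρp (π.flip a) h := by
  obtain ⟨s, hs⟩ := exists_comul h
  rw [conv_eq_sum _ _ hs, leftTwist, sw_eq_sum hs]
  simp

theorem flip_leftTwist (π : H →ₗ[ℂ] A →ₗ[ℂ] A) (ρp : H →ₗ[ℂ] A) (a : A) :
    (leftTwist π ρp).flip a = conv ρp (π.flip a) := by
  ext h
  exact leftTwist_apply π ρp h a

omit [Coalgebra ℂ H] in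
theorem sum_parityPart_gradeSign (h : H) (m : ℕ) :
    ∑ e ∈ Finset.range 2, (-1 : ℂ) ^ (m * e) • parityPart (gradeSign 𝓗) e h =
      (gradeSign 𝓗 ^ m) h := by
  have h2 : gradeSign 𝓗 ^ 2 = 1 := by
    ext h; exact gradeSign_gradeSign 𝓗 h
  rcases Nat.even_or_odd m with hm | hm
  · have h3 : gradeSign 𝓗 ^ m = 1 := by
      obtain ⟨r, rfl⟩ := hm
      rw [← two_mul, pow_mul, h2, one_pow]
    simp only [Finset.sum_range_succ, Finset.sum_range_zero, pow_mul, hm.neg_one_pow, one_pow, h3,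
      parityPart, LinearMap.smul_apply, LinearMap.add_apply, LinearMap.id_apply,
      Module.End.one_apply]
    module
  · have h3 : gradeSign 𝓗 ^ m = gradeSign 𝓗 := by
      obtain ⟨r, rfl⟩ := hm
      rw [pow_succ, pow_mul, h2, one_pow, one_mul]
    simp only [Finset.sum_range_succ, Finset.sum_range_zero, pow_mul, hm.neg_one_pow, h3,
      parityPart, LinearMap.smul_apply, LinearMap.add_apply, LinearMap.id_apply]
    module

/-- On elements of degree `m` the twist is the convolution of `a ↦ ∑ ρ⁺ h₍₀₎ * π h₍₁₎ a` with
`ρ⁻ ∘ γ ^ m`. -/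
theorem flip_twist_of_mem {m : ℕ} {a : A} (ha : a ∈ 𝒜 m) :
    (twist (gradeSign 𝓗) (gradeSign 𝒜) π ρp ρm).flip a =
      conv ((leftTwist π ρp).flip a) (ρm ∘ₗ gradeSign 𝓗 ^ m) := by
  ext h
  obtain ⟨s, hs⟩ := exists_comul h
  simp only [twist, LinearMap.flip_apply, LinearMap.sum_apply, LinearMap.comp_apply,
    LinearMap.lcomp_apply, sw_eq_sum hs, conv_eq_sum _ _ hs, gradeSign_pow_of_mem 𝒜 ha]
  rw [Finset.sum_comm]
  refine Finset.sum_congr rfl fun i _ => ?_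
  rw [← sum_parityPart_gradeSign, map_sum, Finset.mul_sum]
  simp

theorem twist_of_mem {m : ℕ} {a : A} (ha : a ∈ 𝒜 m) (h : H) :
    twist (gradeSign 𝓗) (gradeSign 𝒜) π ρp ρm h a =
      conv ((leftTwist π ρp).flip a) (ρm ∘ₗ gradeSign 𝓗 ^ m) h :=
  LinearMap.congr_fun (flip_twist_of_mem ha) h

omit [GradedAlgebra 𝒜] in
theorem IsDGAction.flip_mul (hπ : IsDGAction 𝓗 dH 𝒜 d π) {m : ℕ} {a : A} (ha : a ∈ 𝒜 m) (b : A) :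
    π.flip (a * b) = conv (π.flip a) (π.flip b ∘ₗ gradeSign 𝓗 ^ m) := by
  ext h
  exact hπ.act_mul h m a ha b

omit [GradedAlgebra 𝒜] in
theorem flip_leftTwist_mul (hπ : IsDGAction 𝓗 dH 𝒜 d π) {m : ℕ} {a : A} (ha : a ∈ 𝒜 m) (b : A) :
    (leftTwist π ρp).flip (a * b) =
      conv ((leftTwist π ρp).flip a) (π.flip b ∘ₗ gradeSign 𝓗 ^ m) := by
  rw [flip_leftTwist, flip_leftTwist, hπ.flip_mul ha, conv_assoc]

omit [Coalgebra ℂ H] in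
theorem gradeSign_pow_comp_pow (f : H →ₗ[ℂ] A) (m n : ℕ) :
    (f ∘ₗ gradeSign 𝓗 ^ n) ∘ₗ gradeSign 𝓗 ^ m = f ∘ₗ gradeSign 𝓗 ^ (m + n) := by
  rw [LinearMap.comp_assoc, ← Module.End.mul_eq_comp, ← pow_add, add_comm]

/-- `π' h (a b) = ∑ ± (ρ⁺ h₍₀₎ π h₍₁₎ a) (π h₍₂₎ b ρ⁻ h₍₃₎)`. -/
theorem flip_twist_mul (hH : IsDGHopfAlgebra 𝓗 dH S) (hπ : IsDGAction 𝓗 dH 𝒜 d π) {m n : ℕ}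
    {a b : A} (ha : a ∈ 𝒜 m) (hb : b ∈ 𝒜 n) :
    (twist (gradeSign 𝓗) (gradeSign 𝒜) π ρp ρm).flip (a * b) =
      conv ((leftTwist π ρp).flip a)
        (conv (π.flip b) (ρm ∘ₗ gradeSign 𝓗 ^ n) ∘ₗ gradeSign 𝓗 ^ m) := by
  rw [flip_twist_of_mem (SetLike.mul_mem_graded ha hb), flip_leftTwist_mul hπ ha, conv_assoc,
    hH.conv_comp_gradeSign_pow, gradeSign_pow_comp_pow]

theorem convUnit_comp_gradeSign (hH : IsDGHopfAlgebra 𝓗 dH S) (m : ℕ) :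
    convUnit H A ∘ₗ gradeSign 𝓗 ^ m = convUnit H A := by
  refine linearMap_ext_graded 𝓗 fun n h hh => ?_
  rw [LinearMap.comp_apply, gradeSign_pow_of_mem 𝓗 hh, map_smul]
  rcases eq_or_ne n 0 with rfl | hn
  · simp
  · simp [convUnit, hH.counit_deg n hn h hh]

/-- A homogeneous version of `ρ⁻ * ρ⁺ = 1` inserted between two factors. -/
theorem flip_twist_eq (hρ : IsInnerCocyclePair 𝓗 dH σ 𝒜 d π ρp ρm) {m : ℕ}
    {a : A} (ha : a ∈ 𝒜 m) :
    conv ρm ((twist (gradeSign 𝓗) (gradeSign 𝒜) π ρp ρm).flip a) =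
      conv (π.flip a) (ρm ∘ₗ gradeSign 𝓗 ^ m) := by
  have h1 : conv ρm ρp = convUnit H A := by ext h; exact hρ.neg_pos h
  rw [flip_twist_of_mem ha, flip_leftTwist, ← conv_assoc, ← conv_assoc, h1, convUnit_conv]

/-- The twist acts on products by the coproduct: `ρ⁻ * ρ⁺ = 1` is inserted between the two factors
of `∑ ± (ρ⁺ h₍₀₎ π h₍₁₎ a) (π h₍₂₎ b ρ⁻ h₍₃₎)`. -/
theorem flip_twist_mul_eq_conv (hH : IsDGHopfAlgebra 𝓗 dH S) (hπ : IsDGAction 𝓗 dH 𝒜 d π)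
    (hρ : IsInnerCocyclePair 𝓗 dH σ 𝒜 d π ρp ρm) {m : ℕ} {a : A} (ha : a ∈ 𝒜 m) (b : A) :
    (twist (gradeSign 𝓗) (gradeSign 𝒜) π ρp ρm).flip (a * b) =
      conv ((twist (gradeSign 𝓗) (gradeSign 𝒜) π ρp ρm).flip a)
        ((twist (gradeSign 𝓗) (gradeSign 𝒜) π ρp ρm).flip b ∘ₗ gradeSign 𝓗 ^ m) := by
  obtain ⟨N, hN⟩ := exists_sum_component 𝒜 b
  have h0 : ∀ n, ∀ b ∈ 𝒜 n, (twist (gradeSign 𝓗) (gradeSign 𝒜) π ρp ρm).flip (a * b) =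
      conv ((twist (gradeSign 𝓗) (gradeSign 𝒜) π ρp ρm).flip a)
        ((twist (gradeSign 𝓗) (gradeSign 𝒜) π ρp ρm).flip b ∘ₗ gradeSign 𝓗 ^ m) := by
    intro n b hb
    rw [flip_twist_mul hH hπ ha hb, ← flip_twist_eq hρ hb, hH.conv_comp_gradeSign_pow, ← conv_assoc,
      ← flip_twist_of_mem ha]
  rw [hN N le_rfl, Finset.mul_sum, map_sum, map_sum]
  ext h
  obtain ⟨s, hs⟩ := exists_comul h
  rw [LinearMap.sum_apply, conv_eq_sum _ _ hs]
  simp only [h0 _ _ (component_mem 𝒜 _ b), conv_eq_sum _ _ hs, LinearMap.comp_apply,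
    LinearMap.sum_apply, Finset.mul_sum]
  rw [Finset.sum_comm]

theorem leftTwist_mem (hH : IsDGHopfAlgebra 𝓗 dH S) (hπ : IsDGAction 𝓗 dH 𝒜 d π)
    (hρ : IsInnerCocyclePair 𝓗 dH σ 𝒜 d π ρp ρm) {m n : ℕ} {a : A} (ha : a ∈ 𝒜 m) {h : H}
    (hh : h ∈ 𝓗 n) : leftTwist π ρp h a ∈ 𝒜 (n + m) := by
  rw [leftTwist_apply]
  refine hH.sw_mem hh _ fun p q hpq x hx y hy => ?_
  have := SetLike.mul_mem_graded (hρ.deg_pos p x hx) (hπ.act_deg q m y hy a ha)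
  rwa [← add_assoc, hpq] at this

theorem twist_mem (hH : IsDGHopfAlgebra 𝓗 dH S) (hπ : IsDGAction 𝓗 dH 𝒜 d π)
    (hρ : IsInnerCocyclePair 𝓗 dH σ 𝒜 d π ρp ρm) {m n : ℕ} {h : H}
    (hh : h ∈ 𝓗 n) {a : A} (ha : a ∈ 𝒜 m) :
    twist (gradeSign 𝓗) (gradeSign 𝒜) π ρp ρm h a ∈ 𝒜 (n + m) := by
  rw [twist_of_mem ha]
  refine hH.sw_mem hh _ fun p q hpq x hx y hy => ?_
  have := SetLike.mul_mem_graded (leftTwist_mem hH hπ hρ ha hx)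
    (hρ.deg_neg q _ (gradeSign_pow_mem 𝓗 hy m))
  rwa [add_right_comm, hpq] at this

omit [GradedAlgebra 𝒜] in
/-- `ρ⁺ (g h) = L g (ρ⁺ h)` for `L g a = ∑ ρ⁺ g₍₀₎ * π g₍₁₎ a`; this makes `L` multiplicative. -/
theorem leftTwist_mul (hH : IsDGHopfAlgebra 𝓗 dH S) (hπ : IsDGAction 𝓗 dH 𝒜 d π)
    (hρ : IsInnerCocyclePair 𝓗 dH σ 𝒜 d π ρp ρm) (g h : H) (a : A) :
    leftTwist π ρp (g * h) a = leftTwist π ρp g (leftTwist π ρp h a) := by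
  suffices hg : (leftTwist π ρp).flip a ∘ₗ LinearMap.mulLeft ℂ g =
      leftTwist π ρp g ∘ₗ (leftTwist π ρp).flip a by
    simpa using LinearMap.congr_fun hg h
  refine linearMap_ext_graded 𝓗 fun n h hh => ?_
  obtain ⟨ι, _, x, y, p, q, hx, hy, hpq, hs⟩ := hH.exists_comul hh
  rw [LinearMap.comp_apply, LinearMap.comp_apply, LinearMap.mulLeft_apply, flip_leftTwist,
    conv_eq_sum _ _ hs, conv, hH.sw_mul _ g hx hs, map_sum]
  refine Finset.sum_congr rfl fun i _ => ?_
  have h1 := LinearMap.congr_fun (flip_leftTwist_mul (ρp := ρp) hπ (hρ.deg_pos _ _ (hx i))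
    (π.flip a (y i))) g
  rw [LinearMap.flip_apply] at h1
  rw [h1]
  refine sw_ext (fun u v => ?_) g
  have h2 := hρ.cocycle_pos u (x i)
  have h3 : leftTwist π ρp u (ρp (x i)) = ρp (u * x i) := by rw [leftTwist_apply, h2]; rfl
  simp [h3, hπ.mul_act]

/-- The twist is multiplicative, by the cocycle identities of both `ρ⁺` and `ρ⁻`: the former makes
`leftTwist` multiplicative, the latter handles the right factor `ρ⁻`. -/
theorem twist_mul (hH : IsDGHopfAlgebra 𝓗 dH S) (hπ : IsDGAction 𝓗 dH 𝒜 d π)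
    (hρ : IsInnerCocyclePair 𝓗 dH σ 𝒜 d π ρp ρm) (g h : H) (a : A) :
    twist (gradeSign 𝓗) (gradeSign 𝒜) π ρp ρm (g * h) a =
      twist (gradeSign 𝓗) (gradeSign 𝒜) π ρp ρm g
        (twist (gradeSign 𝓗) (gradeSign 𝒜) π ρp ρm h a) := by
  set π' := twist (gradeSign 𝓗) (gradeSign 𝒜) π ρp ρm with hπ'
  suffices hg : ∀ m, ∀ a ∈ 𝒜 m, ∀ n, ∀ h ∈ 𝓗 n, π' (g * h) a = π' g (π' h a) by
    have h1 : (π' ∘ₗ LinearMap.mulLeft ℂ g) = (LinearMap.llcomp ℂ A A A (π' g)) ∘ₗ π' := by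
      refine linearMap_ext_graded 𝓗 fun n h hh => linearMap_ext_graded 𝒜 fun m a ha => ?_
      exact hg m a ha n h hh
    simpa using LinearMap.congr_fun (LinearMap.congr_fun h1 h) a
  intro m a ha n h hh
  obtain ⟨ι, _, x, y, p, q, hx, hy, hpq, hs⟩ := hH.exists_comul hh
  rw [hπ', twist_of_mem ha, twist_of_mem ha, conv_eq_sum _ _ hs, conv, hH.sw_mul _ g hx hs, map_sum]
  refine Finset.sum_congr rfl fun i _ => ?_
  have h1 := LinearMap.congr_fun (flip_twist_mul (ρp := ρp) (ρm := ρm) hH hπ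
    (leftTwist_mem hH hπ hρ ha (hx i)) (hρ.deg_neg _ _ (gradeSign_pow_mem 𝓗 (hy i) m))) g
  rw [LinearMap.flip_apply] at h1
  refine Eq.trans ?_ h1.symm
  refine sw_ext (fun u v => ?_) g
  have h2 : ∀ v, conv (π.flip ((ρm ∘ₗ gradeSign 𝓗 ^ m) (y i))) (ρm ∘ₗ gradeSign 𝓗 ^ q i) v =
      ρm (v * (gradeSign 𝓗 ^ m) (y i)) := fun v =>
    (hρ.cocycle_neg v (q i) _ (gradeSign_pow_mem 𝓗 (hy i) m)).symm
  simp only [LinearMap.compl₁₂_apply, LinearMap.mul_apply', LinearMap.comp_apply,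
    LinearMap.flip_apply, LinearMap.mulRight_apply] at h2 ⊢
  rw [leftTwist_mul hH hπ hρ, h2, gradeSign_pow_mul, add_comm (p i), pow_add, Module.End.mul_apply]

theorem flip_leftTwist_d (hH : IsDGHopfAlgebra 𝓗 dH S) (hd : IsDGAlgebra 𝒜 d)
    (hπ : IsDGAction 𝓗 dH 𝒜 d π) (hρ : IsInnerCocyclePair 𝓗 dH σ 𝒜 d π ρp ρm) (a : A) :
    d ∘ₗ (leftTwist π ρp).flip a =
      (leftTwist π ρp).flip a ∘ₗ dH + (leftTwist π ρp).flip (d a) ∘ₗ gradeSign 𝓗 := by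
  have h1 : d ∘ₗ ρp = ρp ∘ₗ dH := by ext h; exact (hρ.d_pos h).symm
  have h2 : d ∘ₗ π.flip a = π.flip a ∘ₗ dH + π.flip (d a) ∘ₗ gradeSign 𝓗 := by
    refine linearMap_ext_graded 𝓗 fun n h hh => ?_
    simp [hπ.d_act n h hh, gradeSign_of_mem 𝓗 hh]
  rw [flip_leftTwist, flip_leftTwist, hH.d_comp_conv (m := 0) hd hρ.deg_pos, h1, h2, pow_zero,
    one_smul, conv_add_right, hH.conv_comp_d, hH.conv_comp_gradeSign, add_assoc]

theorem twist_d (hH : IsDGHopfAlgebra 𝓗 dH S) (hd : IsDGAlgebra 𝒜 d)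
    (hπ : IsDGAction 𝓗 dH 𝒜 d π) (hρ : IsInnerCocyclePair 𝓗 dH σ 𝒜 d π ρp ρm) {m : ℕ} {a : A}
    (ha : a ∈ 𝒜 m) : d ∘ₗ (twist (gradeSign 𝓗) (gradeSign 𝒜) π ρp ρm).flip a =
      (twist (gradeSign 𝓗) (gradeSign 𝒜) π ρp ρm).flip a ∘ₗ dH +
        (twist (gradeSign 𝓗) (gradeSign 𝒜) π ρp ρm).flip (d a) ∘ₗ gradeSign 𝓗 := by
  have h1 : d ∘ₗ (ρm ∘ₗ gradeSign 𝓗 ^ m) = (-1 : ℂ) ^ m • (ρm ∘ₗ gradeSign 𝓗 ^ m) ∘ₗ dH := by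
    refine linearMap_ext_graded 𝓗 fun n h hh => ?_
    simp only [LinearMap.comp_apply, LinearMap.smul_apply, gradeSign_pow_of_mem 𝓗 hh,
      gradeSign_pow_of_mem 𝓗 (hH.map_deg n h hh), map_smul, hρ.d_neg, smul_smul, ← pow_add]
    congr 1
    apply neg_one_pow_congr
    push_cast
    generalize (n : ZMod 2) = x
    generalize (m : ZMod 2) = y
    revert x y; decide
  have h2 : ρm ∘ₗ gradeSign 𝓗 ^ m = (ρm ∘ₗ gradeSign 𝓗 ^ (m + 1)) ∘ₗ gradeSign 𝓗 := by
    ext h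
    simp only [LinearMap.comp_apply, pow_succ, Module.End.mul_apply, gradeSign_gradeSign]
  rw [flip_twist_of_mem ha, flip_twist_of_mem (hd.map_deg m a ha),
    hH.d_comp_conv hd (fun n h hh => leftTwist_mem hH hπ hρ ha hh), h1,
    flip_leftTwist_d hH hd hπ hρ, conv_smul_right, smul_smul, ← mul_pow, neg_one_mul, neg_neg,
    one_pow, one_smul, conv_add_left,
    hH.conv_comp_d, hH.conv_comp_gradeSign, ← h2]
  abel

/-- The twist of a DG action by an inner cocycle pair is a DG action. -/
theorem isDGAction_twist (hH : IsDGHopfAlgebra 𝓗 dH S) (hd : IsDGAlgebra 𝒜 d)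
    (hπ : IsDGAction 𝓗 dH 𝒜 d π) (hρ : IsInnerCocyclePair 𝓗 dH σ 𝒜 d π ρp ρm) :
    IsDGAction 𝓗 dH 𝒜 d (twist (gradeSign 𝓗) (gradeSign 𝒜) π ρp ρm) where
  one_act a := by
    have h1 : twist (gradeSign 𝓗) (gradeSign 𝒜) π ρp ρm 1 = LinearMap.id := by
      refine linearMap_ext_graded 𝒜 fun m a ha => ?_
      rw [twist_of_mem ha, conv_of_comul_eq hH.comul_one, LinearMap.flip_apply, leftTwist_apply,
        conv_of_comul_eq hH.comul_one, hρ.pos_one, LinearMap.flip_apply, hπ.one_act,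
        LinearMap.comp_apply, gradeSign_pow_of_mem 𝓗 (SetLike.GradedOne.one_mem (A := 𝓗))]
      simp [hρ.neg_one]
    rw [h1]; rfl
  mul_act g h a := twist_mul hH hπ hρ g h a
  act_one h := by
    have h1 : π.flip 1 = convUnit H A := by ext h; exact hπ.act_one h
    have h2 : conv ρp ρm = convUnit H A := by ext h; exact hρ.pos_neg h
    rw [twist_of_mem (SetLike.GradedOne.one_mem (A := 𝒜)), flip_leftTwist, h1, conv_convUnit]
    exact LinearMap.congr_fun h2 h
  act_mul h m a ha b := LinearMap.congr_fun (flip_twist_mul_eq_conv hH hπ hρ ha b) h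
  act_deg m n h hh a ha := twist_mem hH hπ hρ hh ha
  d_act m h hh a := by
    have h1 : d ∘ₗ twist (gradeSign 𝓗) (gradeSign 𝒜) π ρp ρm h =
        twist (gradeSign 𝓗) (gradeSign 𝒜) π ρp ρm (dH h) +
          (-1 : ℂ) ^ m • twist (gradeSign 𝓗) (gradeSign 𝒜) π ρp ρm h ∘ₗ d := by
      refine linearMap_ext_graded 𝒜 fun n a ha => ?_
      have := LinearMap.congr_fun (twist_d hH hd hπ hρ ha) h
      simpa [gradeSign_of_mem 𝓗 hh] using this
    exact LinearMap.congr_fun h1 a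

theorem continuous_twist_component [TopologicalSpace A] [IsTopologicalRing A]
    (hc : ∀ n, Continuous (component 𝒜 n)) (hπc : ∀ h, Continuous (π h)) (h : H) (n : ℕ) :
    Continuous fun a => twist (gradeSign 𝓗) (gradeSign 𝒜) π ρp ρm h (component 𝒜 n a) := by
  obtain ⟨s, hs⟩ := exists_comul h
  have h1 : ∀ h, Continuous fun a => leftTwist π ρp h a := by
    intro h
    obtain ⟨s, hs⟩ := exists_comul h
    simp only [leftTwist_apply, conv_eq_sum _ _ hs, LinearMap.flip_apply]
    exact continuous_finsetSum _ fun i _ => continuous_const.mul (hπc _)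
  simp only [twist_of_mem (component_mem 𝒜 n _), conv_eq_sum _ _ hs, LinearMap.flip_apply]
  exact continuous_finsetSum _ fun i _ => ((h1 _).comp (hc n)).mul continuous_const

theorem twist_of_comul_eq {h : H} (hh : (Coalgebra.comul h : H ⊗[ℂ] H) = h ⊗ₜ h) (h0 : h ∈ 𝓗 0)
    (a : A) : twist (gradeSign 𝓗) (gradeSign 𝒜) π ρp ρm h a = ρp h * π h a * ρm h := by
  have h1 : twist (gradeSign 𝓗) (gradeSign 𝒜) π ρp ρm h =
      LinearMap.mulRight ℂ (ρm h) ∘ₗ LinearMap.mulLeft ℂ (ρp h) ∘ₗ π h := by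
    refine linearMap_ext_graded 𝒜 fun m a ha => ?_
    rw [twist_of_mem ha, conv_of_comul_eq hh, LinearMap.flip_apply, leftTwist_apply,
      conv_of_comul_eq hh, LinearMap.comp_apply, gradeSign_pow_of_mem 𝓗 h0]
    simp
  rw [h1]
  rfl

end Twist

/-! ### Invariant functionals -/

section Invariance

variable {H : Type u} [Ring H] [Algebra ℂ H] [Coalgebra ℂ H] {𝓗 : ℕ → Submodule ℂ H}
  [GradedAlgebra 𝓗] {dH S : H →ₗ[ℂ] H} {σ : H} {δ : H →ₐ[ℂ] ℂ}
variable {A : Type v} [Ring A] [Algebra ℂ A] {𝒜 : ℕ → Submodule ℂ A} [GradedAlgebra 𝒜]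
  {d : A →ₗ[ℂ] A} {π : H →ₗ[ℂ] A →ₗ[ℂ] A} {I : A →ₗ[ℂ] ℂ}

theorem counit_antipode (hH : IsDGHopfAlgebra 𝓗 dH S) (h : H) :
    Coalgebra.counit (R := ℂ) (S h) = Coalgebra.counit (R := ℂ) h := by
  have h1 := congrArg (Coalgebra.counit (R := ℂ)) (hH.antipode_right h)
  rw [map_sw, sw_counit_left (g := Coalgebra.counit ∘ₗ S) (fun x y => by
    simp [hH.counit_mul])] at h1
  rw [LinearMap.comp_apply] at h1
  rw [h1, Algebra.algebraMap_eq_smul_one, map_smul, hH.counit_one, smul_eq_mul, mul_one]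

theorem counit_twistedAntipode (hH : IsDGHopfAlgebra 𝓗 dH S) (h : H) :
    Coalgebra.counit (R := ℂ) (twistedAntipode S δ h) = δ h := by
  rw [twistedAntipode, map_sw]
  refine sw_counit_right (g := δ.toLinearMap) (fun x y => ?_) h
  simp [counit_antipode hH, mul_comm]

theorem twistedAntipode_mem (hH : IsDGHopfAlgebra 𝓗 dH S)
    (hδ : IsModularPairInInvolution 𝓗 dH S δ σ) {n : ℕ} {h : H} (hh : h ∈ 𝓗 n) :
    twistedAntipode S δ h ∈ 𝓗 n := by
  refine hH.sw_mem hh _ fun p q hpq x hx y hy => ?_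
  rcases eq_or_ne p 0 with rfl | hp
  · rw [zero_add] at hpq
    subst hpq
    exact (𝓗 _).smul_mem _ (hH.antipode_deg _ y hy)
  · have : δ x = 0 := hδ.delta_deg p hp x hx
    simp [this]

/-- Invariance at `b = 1` says `I (θ h a) = δ h * I a`. -/
theorem IsClosedInvariantTrace.apply_act (hH : IsDGHopfAlgebra 𝓗 dH S)
    (hδ : IsModularPairInInvolution 𝓗 dH S δ σ) (hπ : IsDGAction 𝓗 dH 𝒜 d π)
    (hI : IsClosedInvariantTrace 𝓗 S δ σ 𝒜 d π I) (h : H) (a : A) : I (π h a) = δ h * I a := by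
  have h1 : π.compr₂ I = (LinearMap.lsmul ℂ (A →ₗ[ℂ] ℂ)).flip I ∘ₗ δ.toLinearMap := by
    refine linearMap_ext_graded 𝓗 fun m h hh => linearMap_ext_graded 𝒜 fun n a ha => ?_
    have h2 := hI.invariant m n h hh a ha 1
    rw [mul_one, hπ.act_one, counit_twistedAntipode hH, ← Algebra.commutes, ← Algebra.smul_def,
      map_smul] at h2
    rcases eq_or_ne m 0 with rfl | hm
    · simpa using h2
    · simpa [hδ.delta_deg m hm h hh] using h2
  simpa using LinearMap.congr_fun (LinearMap.congr_fun h1 h) a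

omit [GradedAlgebra 𝒜] in
/-- Conversely `I (θ h a) = δ h * I a` gives invariance, by
`θ h a * b = ∑ θ h₍₀₎ (a * θ (S h₍₁₎) b)`. -/
theorem invariant_of_apply_act (hH : IsDGHopfAlgebra 𝓗 dH S)
    (hδ : IsModularPairInInvolution 𝓗 dH S δ σ) (hπ : IsDGAction 𝓗 dH 𝒜 d π)
    (hI : ∀ h a, I (π h a) = δ h * I a) {m n : ℕ} {h : H} (hh : h ∈ 𝓗 m) {a : A} (ha : a ∈ 𝒜 n)
    (b : A) : I (π h a * b) = (-1 : ℂ) ^ (m * n) * I (a * π (twistedAntipode S δ h) b) := by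
  set G := gradeSign 𝓗 ^ n with hG
  have hGS : ∀ y, S (G y) = G (S y) := by
    intro y
    have : S ∘ₗ G = G ∘ₗ S := by
      refine linearMap_ext_graded 𝓗 fun p y hy => ?_
      simp [hG, gradeSign_pow_of_mem 𝓗 hy, gradeSign_pow_of_mem 𝓗 (hH.antipode_deg p y hy)]
    exact LinearMap.congr_fun this y
  -- `T x y z = θ x a * θ (γ y * S (γ z)) b` with `γ` the sign for moving past `a`
  let Q : H →ₗ[ℂ] H →ₗ[ℂ] A := ((LinearMap.mul ℂ H).compl₁₂ G (S ∘ₗ G)).compr₂ (π.flip b)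
  let T : H →ₗ[ℂ] H →ₗ[ℂ] H →ₗ[ℂ] A :=
    LinearMap.mk₂ ℂ (fun x y => LinearMap.mulLeft ℂ (π x a) ∘ₗ Q y)
      (by intros; ext; simp [add_mul]) (by intros; ext; simp) (by intros; ext; simp [mul_add])
      (by intros; ext; simp)
  let J : H →ₗ[ℂ] H →ₗ[ℂ] A :=
    π.compl₁₂ LinearMap.id (LinearMap.mulLeft ℂ a ∘ₗ π.flip b ∘ₗ S ∘ₗ G)
  let K : H →ₗ[ℂ] H →ₗ[ℂ] A := (LinearMap.mul ℂ A).compl₁₂ (π.flip a)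
    (LinearMap.toSpanSingleton ℂ A b ∘ₗ Coalgebra.counit)
  have hJ : ∀ x z, J x z = sw T x z := by
    intro x z
    obtain ⟨s, hs⟩ := exists_comul x
    have h1 := hπ.act_mul x n a ha (π (S (G z)) b)
    rw [sw_eq_sum hs] at h1
    rw [sw_eq_sum hs, LinearMap.sum_apply]
    simpa [J, T, Q, hπ.mul_act] using h1
  have hK : ∀ x z, K x z = sw (T x) z := by
    intro x z
    have h1 : sw (T x) z = π x a * π (G (sw ((LinearMap.mul ℂ H).compl₁₂ LinearMap.id S) z)) b := by
      obtain ⟨s, hs⟩ := exists_comul z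
      rw [sw_eq_sum hs, sw_eq_sum hs]
      have hGm : ∀ x y, G (x * y) = G x * G y := gradeSign_pow_mul 𝓗 n
      simp [T, Q, Finset.mul_sum, hGm, hGS]
    have h2 : G 1 = 1 := by
      rw [hG, gradeSign_pow_of_mem 𝓗 (SetLike.GradedOne.one_mem (A := 𝓗))]; simp
    rw [h1, hH.antipode_right, Algebra.algebraMap_eq_smul_one, map_smul, h2]
    simp [K, hπ.one_act]
  have h1 : sw K h = π h a * b := by
    have := sw_counit_right (f := K) (g := LinearMap.mulRight ℂ b ∘ₗ π.flip a)
      (fun x y => by simp [K]) h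
    exact this
  -- apply `I` to `θ h a * b = ∑ θ h₍₀₎ (a * θ (S (γ h₍₁₎)) b)` and use the hypothesis for `h₍₀₎`;
  -- only the terms with `h₍₀₎` of degree zero survive, as `δ` vanishes in positive degrees
  rw [← h1, ← sw_coassoc T hJ hK, map_sw, twistedAntipode]
  have h3 : I (a * π (sw ((LinearMap.lsmul ℂ H).compl₁₂ δ.toLinearMap S) h) b) =
      sw (((LinearMap.lsmul ℂ H).compl₁₂ δ.toLinearMap S).compr₂
        (I ∘ₗ LinearMap.mulLeft ℂ a ∘ₗ π.flip b)) h := by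
    rw [← map_sw]; rfl
  rw [h3, ← smul_eq_mul, ← LinearMap.smul_apply]
  have h4 : ∀ f : H →ₗ[ℂ] H →ₗ[ℂ] ℂ, ∀ c : ℂ, (c • sw f) h = sw (c • f) h := by
    intro f c
    obtain ⟨s, hs⟩ := exists_comul h
    rw [LinearMap.smul_apply, sw_eq_sum hs, sw_eq_sum hs, Finset.smul_sum]; rfl
  rw [h4]
  refine hH.sw_congr hh fun p q hpq x hx y hy => ?_
  rcases eq_or_ne p 0 with rfl | hp
  · rw [zero_add] at hpq
    subst hpq
    simp [J, hI, hG, gradeSign_pow_of_mem 𝓗 hy]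
  · simp [J, hI, hδ.delta_deg p hp x hx]

end Invariance

/-! ### Degrees in tensor powers -/

section TensorDegree

variable {H : Type u} [Ring H] [Algebra ℂ H] (𝓗 : ℕ → Submodule ℂ H)

/-- The span of the tensors `h₁ ⊗ ⋯ ⊗ h_k` of homogeneous elements of total degree `N`. -/
def tdeg : ∀ k : ℕ, ℕ → Submodule ℂ (TPow H k)
  | 0, 0 => ⊤
  | 0, _ + 1 => ⊥
  | k + 1, N => Submodule.span ℂ
      {u | ∃ n m, n + m = N ∧ ∃ x ∈ 𝓗 n, ∃ t ∈ tdeg k m, u = tcons k x t}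

variable {𝓗}

theorem tcons_mem {k n m N : ℕ} (hN : n + m = N) {x : H} (hx : x ∈ 𝓗 n) {t : TPow H k}
    (ht : t ∈ tdeg 𝓗 k m) : tcons k x t ∈ tdeg 𝓗 (k + 1) N :=
  Submodule.subset_span ⟨n, m, hN, x, hx, t, ht, rfl⟩

theorem tdeg_succ_le {k N : ℕ} {W : Submodule ℂ (TPow H (k + 1))}
    (hW : ∀ n m, n + m = N → ∀ x ∈ 𝓗 n, ∀ t ∈ tdeg 𝓗 k m, tcons k x t ∈ W) :
    tdeg 𝓗 (k + 1) N ≤ W := by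
  refine Submodule.span_le.2 ?_
  rintro _ ⟨n, m, hN, x, hx, t, ht, rfl⟩
  exact hW n m hN x hx t ht

theorem tdeg_succ_ext {M : Type*} [AddCommGroup M] [Module ℂ M] {k N : ℕ}
    {f g : TPow H (k + 1) →ₗ[ℂ] M}
    (h : ∀ n m, n + m = N → ∀ x ∈ 𝓗 n, ∀ t ∈ tdeg 𝓗 k m, f (tcons k x t) = g (tcons k x t))
    {u : TPow H (k + 1)} (hu : u ∈ tdeg 𝓗 (k + 1) N) : f u = g u :=
  tdeg_succ_le (W := LinearMap.eqLocus f g) h hu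

theorem tdeg_succ_map {M : Type*} [AddCommGroup M] [Module ℂ M] {k N : ℕ}
    {f : TPow H (k + 1) →ₗ[ℂ] M} {W : Submodule ℂ M}
    (h : ∀ n m, n + m = N → ∀ x ∈ 𝓗 n, ∀ t ∈ tdeg 𝓗 k m, f (tcons k x t) ∈ W)
    {u : TPow H (k + 1)} (hu : u ∈ tdeg 𝓗 (k + 1) N) : f u ∈ W :=
  tdeg_succ_le (W := W.comap f) h hu

theorem tdeg_zero_eq_zero {N : ℕ} (hN : N ≠ 0) {t : TPow H 0} (ht : t ∈ tdeg 𝓗 0 N) : t = 0 := by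
  obtain ⟨N, rfl⟩ := Nat.exists_eq_succ_of_ne_zero hN
  exact (Submodule.mem_bot ℂ).1 ht

variable [GradedAlgebra 𝓗]

/-- The tensor power is spanned by its homogeneous elements. -/
theorem mem_of_tdeg_le {k : ℕ} {W : Submodule ℂ (TPow H k)} (hW : ∀ N, tdeg 𝓗 k N ≤ W)
    (t : TPow H k) : t ∈ W := by
  induction k with
  | zero => exact hW 0 Submodule.mem_top
  | succ k ih =>
    have h1 : W.mkQ = 0 := by
      refine TensorProduct.ext' fun x t => ?_
      have h2 : ∀ n, ∀ x ∈ 𝓗 n, ∀ t : TPow H k, W.mkQ (tcons k x t) = 0 := by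
        intro n x hx t
        have : t ∈ W.comap (tcons k x) :=
          ih (fun N t ht => hW (n + N) (tcons_mem rfl hx ht)) t
        simpa using this
      have h3 : W.mkQ ∘ₗ (tcons k).flip t = 0 := linearMap_ext_graded 𝓗 fun n x hx => h2 n x hx t
      exact LinearMap.congr_fun h3 x
    rw [← Submodule.ker_mkQ W, h1]
    trivial

theorem tpow_ext {M : Type*} [AddCommGroup M] [Module ℂ M] {k : ℕ} {f g : TPow H k →ₗ[ℂ] M}
    (h : ∀ N, ∀ t ∈ tdeg 𝓗 k N, f t = g t) : f = g := by
  ext t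
  exact mem_of_tdeg_le (𝓗 := 𝓗) (W := LinearMap.eqLocus f g) h t

omit [GradedAlgebra 𝓗] in
theorem tappend_mem {σ : H} (hσ : σ ∈ 𝓗 0) {k N : ℕ} {t : TPow H k} (ht : t ∈ tdeg 𝓗 k N) :
    tappend σ k t ∈ tdeg 𝓗 (k + 1) N := by
  induction k generalizing N with
  | zero =>
    exact tcons_mem (zero_add N) hσ ht
  | succ k ih =>
    refine tdeg_succ_map (f := tappend σ (k + 1)) (W := tdeg 𝓗 (k + 2) N) ?_ ht
    intro n m hN x hx t ht
    rw [tappend, tlift_tcons]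
    exact tcons_mem hN hx (ih ht)

theorem tdiff_mem {dH : H →ₗ[ℂ] H} (hd : ∀ n, ∀ a ∈ 𝓗 n, dH a ∈ 𝓗 (n + 1)) {k N : ℕ} {t : TPow H k}
    (ht : t ∈ tdeg 𝓗 k N) : tdiff (gradeSign 𝓗) dH k t ∈ tdeg 𝓗 k (N + 1) := by
  induction k generalizing N with
  | zero => exact Submodule.zero_mem _
  | succ k ih =>
    refine tdeg_succ_map (f := tdiff (gradeSign 𝓗) dH (k + 1)) (W := tdeg 𝓗 (k + 1) (N + 1)) ?_ ht
    intro n m hN x hx t ht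
    rw [tdiff, tlift_tcons]
    refine Submodule.add_mem _ (tcons_mem (by omega) (hd n x hx) ht) ?_
    exact tcons_mem (n := n) (m := m + 1) (by omega) (gradeSign_pow_mem 𝓗 hx 1) (ih ht)

variable [Coalgebra ℂ H] {dH S : H →ₗ[ℂ] H}

theorem tact_zero (g : H) (t : TPow H 0) :
    tact (gradeSign 𝓗) 0 g t = Coalgebra.counit (R := ℂ) g • t := rfl

theorem tact_tcons {k p : ℕ} {g x : H} (hx : x ∈ 𝓗 p) (t : TPow H k) {ι : Type*} {s : Finset ι}
    {u v : ι → H} (hs : (Coalgebra.comul g : H ⊗[ℂ] H) = ∑ i ∈ s, u i ⊗ₜ v i) :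
    tact (gradeSign 𝓗) (k + 1) g (tcons k x t) =
      ∑ i ∈ s, tcons k (u i * x) (tact (gradeSign 𝓗) k ((gradeSign 𝓗 ^ p) (v i)) t) := by
  have h1 : ∀ e, (TensorProduct.homTensorHomMap (RingHom.id ℂ) H (TPow H k) H (TPow H k) ∘ₗ
      TensorProduct.map (LinearMap.lcomp ℂ H (gradeSign 𝓗 ^ e) ∘ₗ LinearMap.mul ℂ H)
        (tact (gradeSign 𝓗) k ∘ₗ parityPart (gradeSign 𝓗) e) ∘ₗ Coalgebra.comul) g (x ⊗ₜ t) =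
      ∑ i ∈ s, (u i * (gradeSign 𝓗 ^ e) x) ⊗ₜ
        tact (gradeSign 𝓗) k (parityPart (gradeSign 𝓗) e (v i)) t := by
    intro e
    rw [LinearMap.comp_apply, LinearMap.comp_apply, hs, map_sum, map_sum, LinearMap.sum_apply]
    rfl
  change (∑ e ∈ Finset.range 2,
    (TensorProduct.homTensorHomMap (RingHom.id ℂ) H (TPow H k) H (TPow H k) ∘ₗ
      TensorProduct.map (LinearMap.lcomp ℂ H (gradeSign 𝓗 ^ e) ∘ₗ LinearMap.mul ℂ H)
        (tact (gradeSign 𝓗) k ∘ₗ parityPart (gradeSign 𝓗) e) ∘ₗ Coalgebra.comul)) g (x ⊗ₜ t) = _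
  rw [LinearMap.sum_apply, LinearMap.sum_apply, Finset.sum_congr rfl fun e _ => h1 e,
    Finset.sum_comm]
  refine Finset.sum_congr rfl fun i _ => ?_
  rw [← sum_parityPart_gradeSign, map_sum, LinearMap.sum_apply, map_sum]
  refine Finset.sum_congr rfl fun e _ => ?_
  rw [gradeSign_pow_of_mem 𝓗 hx, mul_smul_comm, map_smul, LinearMap.smul_apply, map_smul]
  rfl

theorem tact_mem (hH : IsDGHopfAlgebra 𝓗 dH S) {k n m N : ℕ} (hN : n + m = N) {g : H} (hg : g ∈ 𝓗 n)
    {t : TPow H k} (ht : t ∈ tdeg 𝓗 k m) : tact (gradeSign 𝓗) k g t ∈ tdeg 𝓗 k N := by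
  induction k generalizing n m N g with
  | zero =>
    rw [tact_zero]
    rcases eq_or_ne n 0 with rfl | hn
    · rw [zero_add] at hN
      subst hN
      exact Submodule.smul_mem _ _ ht
    · rw [hH.counit_deg n hn g hg, zero_smul]
      exact Submodule.zero_mem _
  | succ k ih =>
    refine tdeg_succ_map (f := tact (gradeSign 𝓗) (k + 1) g) (W := tdeg 𝓗 (k + 1) N) ?_ ht
    intro p l hpl x hx t ht
    obtain ⟨ι, _, u, v, r, s, hu, hv, hrs, hs⟩ := hH.exists_comul hg
    rw [tact_tcons hx t hs]
    refine Submodule.sum_mem _ fun i _ => ?_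
    have := hrs i
    exact tcons_mem (n := r i + p) (m := s i + l) (by omega) (SetLike.mul_mem_graded (hu i) hx)
      (ih rfl (gradeSign_pow_mem 𝓗 (hv i) p) ht)

omit [GradedAlgebra 𝓗] in
theorem tface_one_tcons {σ : H} {k : ℕ} {x : H} (t : TPow H k) {ι : Type*} {s : Finset ι}
    {u v : ι → H} (hs : (Coalgebra.comul x : H ⊗[ℂ] H) = ∑ i ∈ s, u i ⊗ₜ v i) :
    tface σ (k + 1) 1 (tcons k x t) = ∑ i ∈ s, tcons (k + 1) (u i) (tcons k (v i) t) := by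
  change TensorProduct.assoc ℂ H H (TPow H k) (Coalgebra.comul x ⊗ₜ t) = _
  rw [hs, TensorProduct.sum_tmul, map_sum]
  rfl

theorem tface_mem (hH : IsDGHopfAlgebra 𝓗 dH S) {σ : H} (hσ : σ ∈ 𝓗 0) {k N : ℕ} (j : ℕ)
    {t : TPow H k} (ht : t ∈ tdeg 𝓗 k N) : tface σ k j t ∈ tdeg 𝓗 (k + 1) N := by
  induction k generalizing N j with
  | zero =>
    cases j with
    | zero => exact tcons_mem (zero_add N) (SetLike.GradedOne.one_mem (A := 𝓗)) ht
    | succ j => exact tappend_mem hσ ht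
  | succ k ih =>
    match j with
    | 0 => exact tcons_mem (zero_add N) (SetLike.GradedOne.one_mem (A := 𝓗)) ht
    | 1 =>
      refine tdeg_succ_map (f := tface σ (k + 1) 1) (W := tdeg 𝓗 (k + 2) N) ?_ ht
      intro n m hN x hx t ht
      obtain ⟨ι, _, u, v, r, s, hu, hv, hrs, hs⟩ := hH.exists_comul hx
      rw [tface_one_tcons t hs]
      refine Submodule.sum_mem _ fun i _ => ?_
      have := hrs i
      exact tcons_mem (n := r i) (m := s i + m) (by omega) (hu i) (tcons_mem rfl (hv i) ht)
    | j + 2 =>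
      refine tdeg_succ_map (f := tface σ (k + 1) (j + 2)) (W := tdeg 𝓗 (k + 2) N) ?_ ht
      intro n m hN x hx t ht
      rw [tface, tlift_tcons]
      exact tcons_mem hN hx (ih (j + 1) ht)

omit [GradedAlgebra 𝓗] in
theorem tface_last (σ : H) (k : ℕ) : tface σ k (k + 1) = tappend σ k := by
  induction k with
  | zero => rfl
  | succ k ih => rw [tface, ih, tappend]

theorem tdegen_mem (hH : IsDGHopfAlgebra 𝓗 dH S) {k N : ℕ} (j : ℕ)
    {t : TPow H (k + 1)} (ht : t ∈ tdeg 𝓗 (k + 1) N) : tdegen k j t ∈ tdeg 𝓗 k N := by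
  induction k generalizing N j with
  | zero =>
    cases j with
    | zero =>
      refine tdeg_succ_map (f := tdegen 0 0) (W := tdeg 𝓗 0 N) ?_ ht
      intro n m hN x hx t ht
      rw [tdegen, tlift_tcons]
      exact tact_mem hH (k := 0) hN hx ht
    | succ j => exact Submodule.zero_mem _
  | succ k ih =>
    cases j with
    | zero =>
      refine tdeg_succ_map (f := tdegen (k + 1) 0) (W := tdeg 𝓗 (k + 1) N) ?_ ht
      intro n m hN x hx t' ht'
      rw [tdegen, tlift_tcons]
      change Coalgebra.counit (R := ℂ) x • t' ∈ _
      rcases eq_or_ne n 0 with rfl | hn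
      · rw [zero_add] at hN
        subst hN
        exact Submodule.smul_mem _ _ ht'
      · rw [hH.counit_deg n hn x hx, zero_smul]
        exact Submodule.zero_mem _
    | succ j =>
      refine tdeg_succ_map (f := tdegen (k + 1) (j + 1)) (W := tdeg 𝓗 (k + 1) N) ?_ ht
      intro n m hN x hx t ht
      rw [tdegen, tlift_tcons]
      exact tcons_mem hN hx (ih j ht)

end TensorDegree

/-! ### The characteristic map -/

section ChiProd

theorem triangle_add (m n : ℕ) :
    (m + n) * (m + n + 1) / 2 = m * (m + 1) / 2 + n * (n + 1) / 2 + m * n := by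
  obtain ⟨a, ha⟩ := Nat.even_mul_succ_self m
  obtain ⟨b, hb⟩ := Nat.even_mul_succ_self n
  have h : (m + n) * (m + n + 1) = (a + b + m * n) + (a + b + m * n) := by
    linear_combination ha + hb
  rw [h, ha, hb]
  omega

theorem triangle_succ (n : ℕ) : (n + 1) * (n + 1 + 1) / 2 = n * (n + 1) / 2 + (n + 1) := by
  rw [triangle_add]; omega

variable {H : Type u} [Ring H] [Algebra ℂ H] (𝓗 : ℕ → Submodule ℂ H) [GradedAlgebra 𝓗]
variable {A : Type v} [Ring A] [Algebra ℂ A] (𝒜 : ℕ → Submodule ℂ A) [GradedAlgebra 𝒜]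
  (θ : H →ₗ[ℂ] A →ₗ[ℂ] A)

/-- The product `± θ h¹ a₁ * ⋯ * θ hᵏ aₖ` under the integral of the characteristic map. -/
def chiProd (k : ℕ) : TPow H k →ₗ[ℂ] ((Fin k → A) → A) :=
  LinearMap.pi fun a => LinearMap.applyₗ (1 : A) ∘ₗ LinearMap.proj a ∘ₗ
    chiAux 𝓗 (gradeSign 𝒜) θ k

variable {𝓗 𝒜}

theorem chiStep_of_mem {n : ℕ} {x : H} (hx : x ∈ 𝓗 n) (a P : A) :
    chiStep 𝓗 (gradeSign 𝒜) θ a x P =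
      (-1 : ℂ) ^ (n * (n + 1) / 2) • ((gradeSign 𝒜 ^ n) P * θ x a) := by
  have h2 : (gradeSign 𝒜 ^ 2) = 1 := by
    ext a; exact gradeSign_gradeSign 𝒜 a
  simp only [chiStep, Finset.sum_range_succ, Finset.sum_range_zero, zero_add, LinearMap.add_apply,
    LinearMap.comp_apply, LinearMap.lcomp_apply, gradeScale_of_mem 𝓗 _ hx, map_smul,
    LinearMap.smul_apply, LinearMap.flip_apply, LinearMap.mul_apply', parityPart_of_mem 𝓗 hx]
  rcases Nat.mod_two_eq_zero_or_one n with hn | hn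
  · rw [if_pos (by omega), if_neg (by omega), ← Nat.mod_add_div n 2, hn, zero_add, pow_mul, h2]
    simp
  · rw [if_neg (by omega), if_pos (by omega)]
    have : gradeSign 𝒜 ^ n = gradeSign 𝒜 ^ 1 := by
      rw [← Nat.mod_add_div n 2, hn, pow_add, pow_mul, h2, one_pow, mul_one]
    rw [this]
    simp

theorem chiAux_tcons {k n : ℕ} {x : H} (hx : x ∈ 𝓗 n) (t : TPow H k) (a : Fin (k + 1) → A) (P : A) :
    chiAux 𝓗 (gradeSign 𝒜) θ (k + 1) (tcons k x t) a P =
      (-1 : ℂ) ^ (n * (n + 1) / 2) •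
        chiAux 𝓗 (gradeSign 𝒜) θ k t (Fin.tail a) ((gradeSign 𝒜 ^ n) P * θ x (a 0)) := by
  rw [← map_smul, ← chiStep_of_mem θ hx]
  rfl

theorem chiAux_eq {k N : ℕ} {t : TPow H k} (ht : t ∈ tdeg 𝓗 k N) (a : Fin k → A) (P : A) :
    chiAux 𝓗 (gradeSign 𝒜) θ k t a P = (gradeSign 𝒜 ^ N) P * chiProd 𝓗 𝒜 θ k t a := by
  induction k generalizing N P with
  | zero =>
    rcases eq_or_ne N 0 with rfl | hN
    · change tzero t • P = P * (tzero t • 1)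
      simp
    · rw [tdeg_zero_eq_zero hN ht]
      simp
  | succ k ih =>
    refine tdeg_succ_ext (f := LinearMap.applyₗ P ∘ₗ LinearMap.proj a ∘ₗ
      chiAux 𝓗 (gradeSign 𝒜) θ (k + 1)) (g := LinearMap.mulLeft ℂ ((gradeSign 𝒜 ^ N) P) ∘ₗ
        LinearMap.proj a ∘ₗ chiProd 𝓗 𝒜 θ (k + 1)) ?_ ht
    intro n m hN x hx t ht
    change chiAux 𝓗 (gradeSign 𝒜) θ (k + 1) (tcons k x t) a P = (gradeSign 𝒜 ^ N) P *
      chiAux 𝓗 (gradeSign 𝒜) θ (k + 1) (tcons k x t) a 1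
    have h1 : (gradeSign 𝒜 ^ n) 1 = 1 := by
      rw [gradeSign_pow_of_mem 𝒜 (SetLike.GradedOne.one_mem (A := 𝒜))]; simp
    rw [chiAux_tcons θ hx, chiAux_tcons θ hx, ih ht, ih ht, h1, one_mul, gradeSign_pow_mul, ← hN,
      add_comm n m, pow_add, mul_smul_comm, mul_assoc, Module.End.mul_apply]

theorem chiProd_tcons {k n m : ℕ} {x : H} (hx : x ∈ 𝓗 n) {t : TPow H k} (ht : t ∈ tdeg 𝓗 k m)
    (a : Fin (k + 1) → A) : chiProd 𝓗 𝒜 θ (k + 1) (tcons k x t) a =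
      (-1 : ℂ) ^ (n * (n + 1) / 2) •
        ((gradeSign 𝒜 ^ m) (θ x (a 0)) * chiProd 𝓗 𝒜 θ k t (Fin.tail a)) := by
  change chiAux 𝓗 (gradeSign 𝒜) θ (k + 1) (tcons k x t) a 1 = _
  have h1 : (gradeSign 𝒜 ^ n) 1 = 1 := by
    rw [gradeSign_pow_of_mem 𝒜 (SetLike.GradedOne.one_mem (A := 𝒜))]; simp
  rw [chiAux_tcons θ hx, chiAux_eq θ ht, h1, one_mul]

theorem chiProd_zero (t : TPow H 0) (a : Fin 0 → A) :
    chiProd 𝓗 𝒜 θ 0 t a = tzero t • (1 : A) := rfl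

theorem chi_eq {k N : ℕ} {t : TPow H k} (ht : t ∈ tdeg 𝓗 k N) (I : A →ₗ[ℂ] ℂ)
    (a : Fin (k + 1) → A) :
    chi 𝓗 (gradeSign 𝒜) θ I k t a =
      I ((gradeSign 𝒜 ^ N) (a 0) * chiProd 𝓗 𝒜 θ k t (Fin.tail a)) := by
  rw [← chiAux_eq θ ht]
  rfl

end ChiProd

section ChiMem

variable {H : Type u} [Ring H] [Algebra ℂ H] {𝓗 : ℕ → Submodule ℂ H} [GradedAlgebra 𝓗]
variable {A : Type v} [Ring A] [Algebra ℂ A] {𝒜 : ℕ → Submodule ℂ A} [GradedAlgebra 𝒜]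
  {θ : H →ₗ[ℂ] A →ₗ[ℂ] A}

theorem IsMultilinear.mul_tail {k : ℕ} (f : A →ₗ[ℂ] A) {φ : (Fin k → A) → A}
    (hφ : IsMultilinear φ) :
    IsMultilinear fun a : Fin (k + 1) → A => f (a 0) * φ (Fin.tail a) := by
  obtain ⟨F, rfl⟩ := hφ
  let G : A →ₗ[ℂ] MultilinearMap ℂ (fun _ : Fin k => A) A :=
    { toFun := fun x => (LinearMap.mulLeft ℂ (f x)).compMultilinearMap F
      map_add' := by intros; ext; simp [add_mul]
      map_smul' := by intros; ext; simp }
  exact ⟨LinearMap.uncurryLeft G, rfl⟩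

theorem isMultilinear_chiProd {k N : ℕ} {t : TPow H k} (ht : t ∈ tdeg 𝓗 k N) :
    IsMultilinear (chiProd 𝓗 𝒜 θ k t) := by
  induction k generalizing N with
  | zero => exact ⟨MultilinearMap.constOfIsEmpty ℂ _ (tzero t • (1 : A)), rfl⟩
  | succ k ih =>
    let W : Submodule ℂ ((Fin (k + 1) → A) → A) :=
      { carrier := {φ | IsMultilinear φ}
        zero_mem' := ⟨0, rfl⟩
        add_mem' := fun h h' => h.add h'
        smul_mem' := fun c _ h => h.smul c }
    refine tdeg_succ_map (f := chiProd 𝓗 𝒜 θ (k + 1)) (W := W) ?_ ht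
    intro n m hN x hx t ht
    have h1 := ((ih ht).mul_tail ((gradeSign 𝒜 ^ m) ∘ₗ θ x)).smul ((-1 : ℂ) ^ (n * (n + 1) / 2))
    have h2 : chiProd 𝓗 𝒜 θ (k + 1) (tcons k x t) = _ := funext (chiProd_tcons θ hx ht)
    change IsMultilinear (chiProd 𝓗 𝒜 θ (k + 1) (tcons k x t))
    rw [h2]
    exact h1

theorem chiProd_mem (hθ : ∀ m n, ∀ h ∈ 𝓗 m, ∀ a ∈ 𝒜 n, θ h a ∈ 𝒜 (m + n)) {k N : ℕ} {t : TPow H k}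
    (ht : t ∈ tdeg 𝓗 k N) {p : Fin k → ℕ} {a : Fin k → A} (ha : ∀ i, a i ∈ 𝒜 (p i)) :
    chiProd 𝓗 𝒜 θ k t a ∈ 𝒜 (N + ∑ i, p i) := by
  induction k generalizing N with
  | zero =>
    rcases eq_or_ne N 0 with rfl | hN
    · rw [chiProd_zero]
      exact Submodule.smul_mem _ _ (by simpa using SetLike.GradedOne.one_mem (A := 𝒜))
    · rw [tdeg_zero_eq_zero hN ht, map_zero]
      exact Submodule.zero_mem _
  | succ k ih =>
    refine tdeg_succ_map (f := LinearMap.proj a ∘ₗ chiProd 𝓗 𝒜 θ (k + 1))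
      (W := 𝒜 (N + ∑ i, p i)) ?_ ht
    intro n m hN x hx t ht
    change chiProd 𝓗 𝒜 θ (k + 1) (tcons k x t) a ∈ _
    rw [chiProd_tcons θ hx ht]
    refine Submodule.smul_mem _ _ ?_
    have h1 := SetLike.mul_mem_graded
      (gradeSign_pow_mem 𝒜 (hθ n (p 0) x hx (a 0) (ha 0)) m)
      (ih (p := Fin.tail p) (a := Fin.tail a) ht fun i => ha i.succ)
    convert h1 using 2
    rw [Fin.sum_univ_succ]
    simp only [Fin.tail]
    omega

theorem continuous_chiProd [TopologicalSpace A] [IsTopologicalRing A]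
    (hθ : ∀ m n, ∀ h ∈ 𝓗 m, ∀ a ∈ 𝒜 n, θ h a ∈ 𝒜 (m + n))
    (hθc : ∀ h n, Continuous fun a => θ h (component 𝒜 n a)) {k N : ℕ} {t : TPow H k}
    (ht : t ∈ tdeg 𝓗 k N) (p : Fin k → ℕ) :
    Continuous fun a : Fin k → A => chiProd 𝓗 𝒜 θ k t fun i => component 𝒜 (p i) (a i) := by
  induction k generalizing N with
  | zero => exact continuous_const
  | succ k ih =>
    have hsmul : ∀ (c : ℂ) (f : (Fin (k + 1) → A) → A), Continuous f →
        Continuous fun a => c • f a := by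
      intro c f hf
      simp only [Algebra.smul_def]
      exact continuous_const.mul hf
    let W : Submodule ℂ ((Fin (k + 1) → A) → A) :=
      { carrier := {φ | Continuous fun a : Fin (k + 1) → A => φ fun i => component 𝒜 (p i) (a i)}
        zero_mem' := continuous_const
        add_mem' := fun h h' => h.add h'
        smul_mem' := fun c φ h => hsmul c _ h }
    refine tdeg_succ_map (f := chiProd 𝓗 𝒜 θ (k + 1)) (W := W) ?_ ht
    intro n m hN x hx t ht
    change Continuous fun a : Fin (k + 1) → A =>
      chiProd 𝓗 𝒜 θ (k + 1) (tcons k x t) fun i => component 𝒜 (p i) (a i)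
    simp only [chiProd_tcons θ hx ht,
      gradeSign_pow_of_mem 𝒜 (hθ n (p 0) x hx _ (component_mem 𝒜 (p 0) _))]
    refine hsmul _ _ (Continuous.mul ?_ ?_)
    · exact hsmul _ _ ((hθc x (p 0)).comp (continuous_apply 0))
    · exact (ih ht (Fin.tail p)).comp (continuous_pi fun i => continuous_apply i.succ)

/-- The characteristic map takes values in the continuous functionals of bounded weight. -/
theorem chi_mem_algCochain [TopologicalSpace A] [IsTopologicalRing A]
    (hc : ∀ n, Continuous (component 𝒜 n))
    (hθ : ∀ m n, ∀ h ∈ 𝓗 m, ∀ a ∈ 𝒜 n, θ h a ∈ 𝒜 (m + n))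
    (hθc : ∀ h n, Continuous fun a => θ h (component 𝒜 n a)) {I : A →ₗ[ℂ] ℂ} (hIc : Continuous I)
    (hI : ∃ N, ∀ n, N < n → ∀ a ∈ 𝒜 n, I a = 0) {k : ℕ} (t : TPow H k) :
    chi 𝓗 (gradeSign 𝒜) θ I k t ∈ algCochain 𝒜 k := by
  refine mem_of_tdeg_le (𝓗 := 𝓗) (W := (algCochain 𝒜 k).comap (chi 𝓗 (gradeSign 𝒜) θ I k)) ?_ t
  intro N t ht
  have h1 : chi 𝓗 (gradeSign 𝒜) θ I k t = fun a =>
      I ((gradeSign 𝒜 ^ N) (a 0) * chiProd 𝓗 𝒜 θ k t (Fin.tail a)) :=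
    funext fun a => chi_eq θ ht I a
  obtain ⟨L, hL⟩ := hI
  rw [Submodule.mem_comap, mem_algCochain_iff hc, h1]
  refine ⟨((isMultilinear_chiProd ht).mul_tail (gradeSign 𝒜 ^ N)).linear_comp I,
    ⟨L, fun m a ha hm => ?_⟩, fun m => hIc.comp (Continuous.mul ?_ ?_)⟩
  · refine hL (m 0 + (N + ∑ i, Fin.tail m i)) ?_ _ (SetLike.mul_mem_graded
      (gradeSign_pow_mem 𝒜 (ha 0) N)
      (chiProd_mem hθ (p := Fin.tail m) (a := Fin.tail a) ht fun i => ha i.succ))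
    rw [Fin.sum_univ_succ] at hm
    simp only [Fin.tail]
    omega
  · exact (continuous_gradeSign_component hc N (m 0)).comp (continuous_apply 0)
  · exact (continuous_chiProd hθ hθc ht (Fin.tail m)).comp
      (continuous_pi fun i => continuous_apply i.succ)

theorem isMultilinear_chi (I : A →ₗ[ℂ] ℂ) {k : ℕ} (t : TPow H k) :
    IsMultilinear (chi 𝓗 (gradeSign 𝒜) θ I k t) := by
  let W : Submodule ℂ (Fun A k) :=
    { carrier := {φ | IsMultilinear φ}
      zero_mem' := ⟨0, rfl⟩
      add_mem' := fun h h' => h.add h'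
      smul_mem' := fun c _ h => h.smul c }
  refine mem_of_tdeg_le (𝓗 := 𝓗) (W := W.comap (chi 𝓗 (gradeSign 𝒜) θ I k)) ?_ t
  intro N t ht
  have h1 : chi 𝓗 (gradeSign 𝒜) θ I k t = fun a =>
      I ((gradeSign 𝒜 ^ N) (a 0) * chiProd 𝓗 𝒜 θ k t (Fin.tail a)) :=
    funext fun a => chi_eq θ ht I a
  change IsMultilinear _
  rw [h1]
  exact ((isMultilinear_chiProd ht).mul_tail (gradeSign 𝒜 ^ N)).linear_comp I

/-- Two multilinear functions which agree on homogeneous tuples are equal. -/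
theorem IsMultilinear.ext_homogeneous {C : Type*} [AddCommGroup C] [Module ℂ C] {n : ℕ}
    {φ ψ : (Fin n → A) → C} (hφ : IsMultilinear φ) (hψ : IsMultilinear ψ)
    (h : ∀ (p : Fin n → ℕ) a, (∀ i, a i ∈ 𝒜 (p i)) → φ a = ψ a) : φ = ψ := by
  obtain ⟨f, rfl⟩ := hφ
  obtain ⟨g, rfl⟩ := hψ
  ext a
  choose M hM using fun i => exists_sum_component 𝒜 (a i)
  have e : a = fun i => ∑ n ∈ Finset.range (∑ i, M i), component 𝒜 n (a i) := funext fun i =>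
    hM i _ (Finset.single_le_sum (f := M) (fun _ _ => Nat.zero_le _) (Finset.mem_univ i))
  rw [e, f.map_sum_finset, g.map_sum_finset]
  exact Finset.sum_congr rfl fun m _ => h m _ fun i => component_mem 𝒜 _ _

end ChiMem

/-! ### The characteristic map commutes with the cyclic operators -/

section ChiComm

variable {H : Type u} [Ring H] [Algebra ℂ H] [Coalgebra ℂ H] {𝓗 : ℕ → Submodule ℂ H}
  [GradedAlgebra 𝓗] {dH S : H →ₗ[ℂ] H} {σ : H} {δ : H →ₐ[ℂ] ℂ}
variable {A : Type v} [Ring A] [Algebra ℂ A] {𝒜 : ℕ → Submodule ℂ A} [GradedAlgebra 𝒜]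
  {d : A →ₗ[ℂ] A} {θ : H →ₗ[ℂ] A →ₗ[ℂ] A} {I : A →ₗ[ℂ] ℂ}

/-- The coproduct in the first tensor factor, as `θ h (a₀ a₁) = ∑ ± θ h₍₀₎ a₀ * θ h₍₁₎ a₁`. -/
theorem chiProd_tface_one (hH : IsDGHopfAlgebra 𝓗 dH S) (hθ : IsDGAction 𝓗 dH 𝒜 d θ) {k N : ℕ}
    {t : TPow H (k + 1)} (ht : t ∈ tdeg 𝓗 (k + 1) N) {p : ℕ} {a : Fin (k + 2) → A}
    (ha : a 0 ∈ 𝒜 p) : chiProd 𝓗 𝒜 θ (k + 2) (tface σ (k + 1) 1 t) a =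
      chiProd 𝓗 𝒜 θ (k + 1) t (Fin.contractNth 0 (· * ·) a) := by
  refine tdeg_succ_ext (f := LinearMap.proj a ∘ₗ chiProd 𝓗 𝒜 θ (k + 2) ∘ₗ tface σ (k + 1) 1)
    (g := LinearMap.proj (Fin.contractNth 0 (· * ·) a) ∘ₗ chiProd 𝓗 𝒜 θ (k + 1)) ?_ ht
  intro n m hN x hx t ht
  obtain ⟨ι, _, u, v, r, s, hu, hv, hrs, hs⟩ := hH.exists_comul hx
  change chiProd 𝓗 𝒜 θ (k + 2) (tface σ (k + 1) 1 (tcons k x t)) a =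
    chiProd 𝓗 𝒜 θ (k + 1) (tcons k x t) (Fin.contractNth 0 (· * ·) a)
  have e : Fin.contractNth 0 (· * ·) a = Fin.cons (α := fun _ => A) (a 0 * a 1)
      (Fin.tail (Fin.tail a)) := by
    conv_lhs => rw [← Fin.cons_self_tail a]
    exact contractNth_zero_cons _ _
  rw [tface_one_tcons t hs, map_sum, Finset.sum_apply, chiProd_tcons θ hx ht, e, Fin.cons_zero,
    Fin.tail_cons, hθ.act_mul x p _ ha, sw_eq_sum hs, map_sum, Finset.sum_mul, Finset.smul_sum]
  refine Finset.sum_congr rfl fun i _ => ?_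
  rw [chiProd_tcons θ (hu i) (tcons_mem rfl (hv i) ht), chiProd_tcons θ (hv i) ht]
  have h1 : Fin.tail a 0 = a 1 := rfl
  simp only [LinearMap.compl₁₂_apply, LinearMap.mul_apply', LinearMap.flip_apply,
    LinearMap.comp_apply, gradeSign_pow_of_mem 𝓗 (hv i), map_smul, h1,
    gradeSign_pow_mul, gradeSign_pow_of_mem 𝒜 (hθ.act_deg _ _ _ (hu i) _ ha), mul_assoc,
    smul_mul_assoc, mul_smul_comm, smul_smul, ← pow_add]
  congr 1
  apply neg_one_pow_congr
  rw [← hrs i, triangle_add]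
  generalize r i * (r i + 1) / 2 = T1
  generalize s i * (s i + 1) / 2 = T2
  push_cast
  grind

/-- A coproduct in the tensor corresponds to a product of neighbouring arguments. -/
theorem chiProd_tface_mid (hH : IsDGHopfAlgebra 𝓗 dH S) (hσ : σ ∈ 𝓗 0)
    (hθ : IsDGAction 𝓗 dH 𝒜 d θ) {k N : ℕ} (j : Fin (k + 1))
    {t : TPow H (k + 1)} (ht : t ∈ tdeg 𝓗 (k + 1) N) {p : Fin (k + 2) → ℕ} {a : Fin (k + 2) → A}
    (ha : ∀ i, a i ∈ 𝒜 (p i)) : chiProd 𝓗 𝒜 θ (k + 2) (tface σ (k + 1) (j + 1) t) a =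
      chiProd 𝓗 𝒜 θ (k + 1) t (Fin.contractNth j.castSucc (· * ·) a) := by
  induction k generalizing N with
  | zero =>
    cases j using Fin.cases with
    | zero => exact chiProd_tface_one hH hθ ht (ha 0)
    | succ j => exact j.elim0
  | succ k ih =>
    cases j using Fin.cases with
    | zero => exact chiProd_tface_one hH hθ ht (ha 0)
    | succ j =>
      refine tdeg_succ_ext
        (f := LinearMap.proj a ∘ₗ chiProd 𝓗 𝒜 θ (k + 3) ∘ₗ tface σ (k + 2) (j + 2))
        (g := LinearMap.proj (Fin.contractNth j.succ.castSucc (· * ·) a) ∘ₗ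
          chiProd 𝓗 𝒜 θ (k + 2)) ?_ ht
      intro n m hN x hx t ht
      change chiProd 𝓗 𝒜 θ (k + 3) (tcons (k + 2) x (tface σ (k + 1) (j + 1) t)) a =
        chiProd 𝓗 𝒜 θ (k + 2) (tcons (k + 1) x t) (Fin.contractNth j.succ.castSucc (· * ·) a)
      have e : Fin.contractNth j.succ.castSucc (· * ·) a = Fin.cons (α := fun _ => A) (a 0)
          (Fin.contractNth j.castSucc (· * ·) (Fin.tail a)) := by
        conv_lhs => rw [← Fin.cons_self_tail a]
        exact contractNth_succ_cons j.castSucc (a 0) (Fin.tail a)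
      rw [chiProd_tcons θ hx (tface_mem hH hσ _ ht), chiProd_tcons θ hx ht, e, Fin.tail_cons,
        Fin.cons_zero, ih j ht (p := Fin.tail p) (a := Fin.tail a) fun i => ha i.succ]

omit [Coalgebra ℂ H] in
theorem chiProd_tappend (hσ : σ ∈ 𝓗 0) {k N : ℕ}
    {t : TPow H k} (ht : t ∈ tdeg 𝓗 k N) (a : Fin (k + 1) → A) :
    chiProd 𝓗 𝒜 θ (k + 1) (tappend σ k t) a =
      chiProd 𝓗 𝒜 θ k t (Fin.init a) * θ σ (a (Fin.last k)) := by
  induction k generalizing N with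
  | zero =>
    have h1 : tappend σ 0 t = tcons 0 σ t := rfl
    rw [h1, chiProd_tcons (m := 0) θ hσ Submodule.mem_top, chiProd_zero, chiProd_zero]
    simp
  | succ k ih =>
    refine tdeg_succ_ext (f := LinearMap.proj a ∘ₗ chiProd 𝓗 𝒜 θ (k + 2) ∘ₗ tappend σ (k + 1))
      (g := LinearMap.mulRight ℂ (θ σ (a (Fin.last (k + 1)))) ∘ₗ LinearMap.proj (Fin.init a) ∘ₗ
        chiProd 𝓗 𝒜 θ (k + 1)) ?_ ht
    intro n m hN x hx t ht
    change chiProd 𝓗 𝒜 θ (k + 2) (tappend σ (k + 1) (tcons k x t)) a =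
      chiProd 𝓗 𝒜 θ (k + 1) (tcons k x t) (Fin.init a) * θ σ (a (Fin.last (k + 1)))
    rw [tappend, tlift_tcons]
    change chiProd 𝓗 𝒜 θ (k + 2) (tcons (k + 1) x (tappend σ k t)) a = _
    rw [chiProd_tcons θ hx (tappend_mem hσ ht), chiProd_tcons θ hx ht, ih ht, smul_mul_assoc,
      mul_assoc]
    rfl

theorem chiProd_tdegen_zero (hH : IsDGHopfAlgebra 𝓗 dH S) (hθ : IsDGAction 𝓗 dH 𝒜 d θ) {k N : ℕ}
    {t : TPow H (k + 1)} (ht : t ∈ tdeg 𝓗 (k + 1) N) (a : Fin k → A) :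
    chiProd 𝓗 𝒜 θ k (tdegen k 0 t) a =
      chiProd 𝓗 𝒜 θ (k + 1) t (Fin.cons (α := fun _ => A) (1 : A) a) := by
  refine tdeg_succ_ext (f := LinearMap.proj a ∘ₗ chiProd 𝓗 𝒜 θ k ∘ₗ tdegen k 0)
    (g := LinearMap.proj (Fin.cons (α := fun _ => A) (1 : A) a) ∘ₗ chiProd 𝓗 𝒜 θ (k + 1)) ?_ ht
  intro n m hN x hx t ht
  have h1 : tdegen k 0 (tcons k x t) = Coalgebra.counit (R := ℂ) x • t := by cases k <;> rfl
  have h2 : (gradeSign 𝒜 ^ m) 1 = 1 := by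
    rw [gradeSign_pow_of_mem 𝒜 (SetLike.GradedOne.one_mem (A := 𝒜))]; simp
  change chiProd 𝓗 𝒜 θ k (tdegen k 0 (tcons k x t)) a =
    chiProd 𝓗 𝒜 θ (k + 1) (tcons k x t) (Fin.cons (α := fun _ => A) (1 : A) a)
  rw [h1, chiProd_tcons θ hx ht, Fin.cons_zero, Fin.tail_cons, hθ.act_one,
    Algebra.algebraMap_eq_smul_one, map_smul, Pi.smul_apply, map_smul, h2, smul_mul_assoc, one_mul,
    smul_smul]
  rcases eq_or_ne n 0 with rfl | hn
  · simp
  · simp [hH.counit_deg n hn x hx]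

theorem chiProd_tdegen (hH : IsDGHopfAlgebra 𝓗 dH S) (hθ : IsDGAction 𝓗 dH 𝒜 d θ) {k N : ℕ}
    (j : Fin (k + 1)) {t : TPow H (k + 1)} (ht : t ∈ tdeg 𝓗 (k + 1) N) (a : Fin k → A) :
    chiProd 𝓗 𝒜 θ k (tdegen k j t) a =
      chiProd 𝓗 𝒜 θ (k + 1) t (Fin.insertNth (α := fun _ => A) j (1 : A) a) := by
  induction k generalizing N with
  | zero =>
    cases j using Fin.cases with
    | zero =>
      rw [Fin.insertNth_zero']
      exact chiProd_tdegen_zero hH hθ ht a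
    | succ j => exact j.elim0
  | succ k ih =>
    cases j using Fin.cases with
    | zero =>
      rw [Fin.insertNth_zero']
      exact chiProd_tdegen_zero hH hθ ht a
    | succ j =>
      refine tdeg_succ_ext
        (f := LinearMap.proj a ∘ₗ chiProd 𝓗 𝒜 θ (k + 1) ∘ₗ tdegen (k + 1) (j + 1))
        (g := LinearMap.proj (Fin.insertNth (α := fun _ => A) j.succ (1 : A) a) ∘ₗ
          chiProd 𝓗 𝒜 θ (k + 2)) ?_ ht
      intro n m hN x hx t ht
      change chiProd 𝓗 𝒜 θ (k + 1) (tcons k x (tdegen k j t)) a =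
        chiProd 𝓗 𝒜 θ (k + 2) (tcons (k + 1) x t)
          (Fin.insertNth (α := fun _ => A) j.succ (1 : A) a)
      have e : Fin.insertNth (α := fun _ => A) j.succ (1 : A) a = Fin.cons (α := fun _ => A) (a 0)
          (Fin.insertNth (α := fun _ => A) j (1 : A) (Fin.tail a)) := by
        conv_lhs => rw [← Fin.cons_self_tail a]
        exact Fin.insertNth_succ_cons j (1 : A) (a 0) (Fin.tail a)
      rw [chiProd_tcons θ hx (tdegen_mem hH _ ht), chiProd_tcons θ hx ht, e, Fin.tail_cons,
        Fin.cons_zero, ih j ht]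

/-- `M (g · u) = ± θ g (M u)` for the diagonal action. -/
theorem chiProd_tact (hH : IsDGHopfAlgebra 𝓗 dH S) (hθ : IsDGAction 𝓗 dH 𝒜 d θ) {k n m : ℕ}
    {g : H} (hg : g ∈ 𝓗 n) {t : TPow H k} (ht : t ∈ tdeg 𝓗 k m) {p : Fin k → ℕ} {a : Fin k → A}
    (ha : ∀ i, a i ∈ 𝒜 (p i)) : chiProd 𝓗 𝒜 θ k (tact (gradeSign 𝓗) k g t) a =
      (-1 : ℂ) ^ (n * (n + 1) / 2 + n * m) • θ g (chiProd 𝓗 𝒜 θ k t a) := by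
  induction k generalizing n m g with
  | zero =>
    rcases eq_or_ne n 0 with rfl | hn
    · rw [tact_zero, map_smul, Pi.smul_apply, chiProd_zero, map_smul, hθ.act_one,
        Algebra.algebraMap_eq_smul_one, smul_comm]
      simp
    · rw [tact_zero, chiProd_zero, chiProd_zero, map_smul, map_smul, hθ.act_one,
        hH.counit_deg n hn g hg]
      simp
  | succ k ih =>
    refine tdeg_succ_ext (f := LinearMap.proj a ∘ₗ chiProd 𝓗 𝒜 θ (k + 1) ∘ₗ
        tact (gradeSign 𝓗) (k + 1) g)
      (g := (-1 : ℂ) ^ (n * (n + 1) / 2 + n * m) • θ g ∘ₗ LinearMap.proj a ∘ₗ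
        chiProd 𝓗 𝒜 θ (k + 1)) ?_ ht
    intro q l hql x hx t ht
    obtain ⟨ι, _, u, v, r, s, hu, hv, hrs, hs⟩ := hH.exists_comul hg
    change chiProd 𝓗 𝒜 θ (k + 1) (tact (gradeSign 𝓗) (k + 1) g (tcons k x t)) a =
      (-1 : ℂ) ^ (n * (n + 1) / 2 + n * m) • θ g (chiProd 𝓗 𝒜 θ (k + 1) (tcons k x t) a)
    have hxa := hθ.act_deg q (p 0) x hx (a 0) (ha 0)
    rw [tact_tcons hx t hs, map_sum, Finset.sum_apply, chiProd_tcons θ hx ht, map_smul,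
      hθ.act_mul g (q + p 0) _ (gradeSign_pow_mem 𝒜 hxa l), sw_eq_sum hs, Finset.smul_sum,
      Finset.smul_sum]
    refine Finset.sum_congr rfl fun i _ => ?_
    have hrsi := hrs i
    rw [chiProd_tcons θ (SetLike.mul_mem_graded (hu i) hx)
        (tact_mem hH rfl (gradeSign_pow_mem 𝓗 (hv i) q) ht),
      ih (gradeSign_pow_mem 𝓗 (hv i) q) ht (p := Fin.tail p) (a := Fin.tail a)
        fun i => ha i.succ, hθ.mul_act]
    simp only [LinearMap.compl₁₂_apply, LinearMap.mul_apply', LinearMap.flip_apply,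
      LinearMap.comp_apply, gradeSign_pow_of_mem 𝓗 (hv i), gradeSign_pow_of_mem 𝒜 hxa, map_smul,
      LinearMap.smul_apply, gradeSign_pow_of_mem 𝒜 (hθ.act_deg _ _ _ (hu i) _ hxa),
      smul_mul_assoc, mul_smul_comm, smul_smul, ← pow_add]
    congr 1
    apply neg_one_pow_congr
    rw [← hrsi, ← hql, triangle_add, triangle_add]
    generalize r i * (r i + 1) / 2 = T1
    generalize s i * (s i + 1) / 2 = T2
    generalize q * (q + 1) / 2 = T3
    push_cast
    grind

omit [Coalgebra ℂ H] [GradedAlgebra 𝓗] in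
theorem d_gradeSign_pow (hd : IsDGAlgebra 𝒜 d) (e : ℕ) (y : A) :
    d ((gradeSign 𝒜 ^ e) y) = (-1 : ℂ) ^ e • (gradeSign 𝒜 ^ e) (d y) := by
  have : d ∘ₗ (gradeSign 𝒜 ^ e) = (-1 : ℂ) ^ e • (gradeSign 𝒜 ^ e) ∘ₗ d := by
    refine linearMap_ext_graded 𝒜 fun n y hy => ?_
    simp only [LinearMap.comp_apply, LinearMap.smul_apply, gradeSign_pow_of_mem 𝒜 hy, map_smul,
      gradeSign_pow_of_mem 𝒜 (hd.map_deg n y hy), smul_smul, ← pow_add]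
    congr 1
    apply neg_one_pow_congr
    push_cast
    grind
  exact LinearMap.congr_fun this y

/-- The chain rule for the differential of the tensor and the differentials of the arguments. -/
theorem chiProd_tdiff (hH : IsDGHopfAlgebra 𝓗 dH S) (hd : IsDGAlgebra 𝒜 d)
    (hθ : IsDGAction 𝓗 dH 𝒜 d θ) {k N : ℕ} {t : TPow H k} (ht : t ∈ tdeg 𝓗 k N) (a : Fin k → A) :
    chiProd 𝓗 𝒜 θ k (tdiff (gradeSign 𝓗) dH k t) a =
      ∑ j : Fin k, chiProd 𝓗 𝒜 θ k t (diffAt (gradeSign 𝒜) d j a) -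
        (-1 : ℂ) ^ N • d (chiProd 𝓗 𝒜 θ k t a) := by
  induction k generalizing N with
  | zero =>
    have h1 : tdiff (gradeSign 𝓗) dH 0 t = 0 := rfl
    rw [h1, map_zero, chiProd_zero, map_smul, hd.isSuperDG.d_one]
    simp
  | succ k ih =>
    refine tdeg_succ_ext
      (f := LinearMap.proj a ∘ₗ chiProd 𝓗 𝒜 θ (k + 1) ∘ₗ tdiff (gradeSign 𝓗) dH (k + 1))
      (g := ∑ j, LinearMap.proj (diffAt (gradeSign 𝒜) d j a) ∘ₗ chiProd 𝓗 𝒜 θ (k + 1) -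
        (-1 : ℂ) ^ N • d ∘ₗ LinearMap.proj a ∘ₗ chiProd 𝓗 𝒜 θ (k + 1)) ?_ ht |>.trans ?_
    · intro n m hN x hx t ht
      have hγθ : ∀ y, θ x (gradeSign 𝒜 y) = (-1 : ℂ) ^ n • gradeSign 𝒜 (θ x y) := by
        intro y
        have : θ x ∘ₗ gradeSign 𝒜 = (-1 : ℂ) ^ n • gradeSign 𝒜 ∘ₗ θ x := by
          refine linearMap_ext_graded 𝒜 fun r y hy => ?_
          simp only [LinearMap.comp_apply, LinearMap.smul_apply, gradeSign_of_mem 𝒜 hy, map_smul,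
            gradeSign_of_mem 𝒜 (hθ.act_deg n r x hx y hy), smul_smul, ← pow_add]
          congr 1
          apply neg_one_pow_congr
          push_cast
          grind
        exact LinearMap.congr_fun this y
      simp only [LinearMap.sub_apply, LinearMap.sum_apply, LinearMap.comp_apply,
        LinearMap.smul_apply, LinearMap.proj_apply]
      have h1 : tdiff (gradeSign 𝓗) dH (k + 1) (tcons k x t) =
          tcons k (dH x) t + (-1 : ℂ) ^ n • tcons k x (tdiff (gradeSign 𝓗) dH k t) := by
        rw [tdiff, tlift_tcons]
        change tcons k (dH x) t + tcons k (gradeSign 𝓗 x) (tdiff (gradeSign 𝓗) dH k t) = _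
        rw [gradeSign_of_mem 𝓗 hx, map_smul, LinearMap.smul_apply]
      have e0 : diffAt (gradeSign 𝒜) d 0 a = Fin.cons (α := fun _ => A) (d (a 0)) (Fin.tail a) := by
        conv_lhs => rw [← Fin.cons_self_tail a]
        exact diffAt_zero_cons _ _
      have e1 : ∀ j : Fin k, diffAt (gradeSign 𝒜) d j.succ a =
          Fin.cons (α := fun _ => A) (gradeSign 𝒜 (a 0))
            (diffAt (gradeSign 𝒜) d j (Fin.tail a)) := by
        intro j
        conv_lhs => rw [← Fin.cons_self_tail a]
        exact diffAt_succ_cons _ _ _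
      rw [Fin.sum_univ_succ, h1, map_add, Pi.add_apply, map_smul, Pi.smul_apply,
        chiProd_tcons θ (hH.map_deg n x hx) ht, chiProd_tcons θ hx (tdiff_mem hH.map_deg ht), ih ht,
        chiProd_tcons θ hx ht, chiProd_tcons θ hx ht, e0, Fin.cons_zero, Fin.tail_cons, map_smul,
        hd.isSuperDG.leibniz, d_gradeSign_pow hd, hθ.d_act n x hx]
      have h2 : ∀ y, gradeSign 𝒜 ((gradeSign 𝒜 ^ m) y) = (gradeSign 𝒜 ^ (m + 1)) y := fun y => by
        rw [pow_succ', Module.End.mul_apply]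
      have h3 : ∀ y, (gradeSign 𝒜 ^ m) (gradeSign 𝒜 y) = (gradeSign 𝒜 ^ (m + 1)) y := fun y => by
        rw [pow_succ, Module.End.mul_apply]
      rw [triangle_succ]
      simp only [chiProd_tcons θ hx ht, e1, Fin.cons_zero, Fin.tail_cons, hγθ, map_smul, map_add,
        mul_sub, smul_mul_assoc, smul_add, add_mul, mul_smul_comm, h2, h3, ← Finset.smul_sum,
        ← Finset.mul_sum]
      simp only [← hN, pow_add (-1 : ℂ), pow_one]
      rcases neg_one_pow_eq_or ℂ n with hn | hn <;> rcases neg_one_pow_eq_or ℂ m with hm | hm <;>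
        rw [hn, hm] <;> module
    · simp only [LinearMap.sub_apply, LinearMap.sum_apply, LinearMap.comp_apply,
        LinearMap.smul_apply, LinearMap.proj_apply]

/-- The characteristic map commutes with the inner faces. -/
theorem chi_face_castSucc (hH : IsDGHopfAlgebra 𝓗 dH S) (hσ : σ ∈ 𝓗 0)
    (hθ : IsDGAction 𝓗 dH 𝒜 d θ) {k : ℕ} (j : Fin (k + 1)) (t : TPow H k) :
    chi 𝓗 (gradeSign 𝒜) θ I (k + 1) (tface σ k j t) =
      algFace (gradeSign 𝒜) k j.castSucc (chi 𝓗 (gradeSign 𝒜) θ I k t) := by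
  suffices h : chi 𝓗 (gradeSign 𝒜) θ I (k + 1) ∘ₗ tface σ k j =
      algFace (gradeSign 𝒜) k j.castSucc ∘ₗ chi 𝓗 (gradeSign 𝒜) θ I k from LinearMap.congr_fun h t
  refine tpow_ext (𝓗 := 𝓗) fun N t ht => ?_
  refine (isMultilinear_chi I _).ext_homogeneous (𝒜 := 𝒜) ((isMultilinear_chi I t).algFace _)
    fun p a ha => ?_
  rw [LinearMap.comp_apply, algFace_castSucc, chi_eq θ (tface_mem hH hσ _ ht), chi_eq θ ht]
  cases j using Fin.cases with
  | zero =>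
    have e : Fin.contractNth (0 : Fin (k + 1)).castSucc (· * ·) a =
        Fin.cons (α := fun _ => A) (a 0 * a 1) (Fin.tail (Fin.tail a)) := by
      conv_lhs => rw [← Fin.cons_self_tail a]
      exact contractNth_zero_cons _ _
    have h1 : tface σ k 0 t = tcons k 1 t := by cases k <;> rfl
    have h2 : Fin.tail a 0 = a 1 := rfl
    rw [e, Fin.cons_zero, Fin.tail_cons, Fin.val_zero, h1,
      chiProd_tcons θ (SetLike.GradedOne.one_mem (A := 𝓗)) ht, hθ.one_act, gradeSign_pow_mul, h2]
    simp [mul_assoc]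
  | succ j =>
    cases k with
    | zero => exact j.elim0
    | succ k =>
      have e : Fin.contractNth j.succ.castSucc (· * ·) a = Fin.cons (α := fun _ => A) (a 0)
          (Fin.contractNth j.castSucc (· * ·) (Fin.tail a)) := by
        conv_lhs => rw [← Fin.cons_self_tail a]
        exact contractNth_succ_cons j.castSucc (a 0) (Fin.tail a)
      rw [e, Fin.cons_zero, Fin.tail_cons, Fin.val_succ,
        chiProd_tface_mid hH hσ hθ j ht (p := Fin.tail p) (a := Fin.tail a) fun i => ha i.succ]

/-- The characteristic map commutes with the last face, by the trace property. -/
theorem chi_face_last (hσ : σ ∈ 𝓗 0)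
    (hθ : IsDGAction 𝓗 dH 𝒜 d θ) (hI : IsClosedInvariantTrace 𝓗 S δ σ 𝒜 d θ I) {k : ℕ}
    (t : TPow H k) : chi 𝓗 (gradeSign 𝒜) θ I (k + 1) (tappend σ k t) =
      algFace (gradeSign 𝒜) k (Fin.last (k + 1)) (chi 𝓗 (gradeSign 𝒜) θ I k t) := by
  suffices h : chi 𝓗 (gradeSign 𝒜) θ I (k + 1) ∘ₗ tappend σ k =
      algFace (gradeSign 𝒜) k (Fin.last (k + 1)) ∘ₗ chi 𝓗 (gradeSign 𝒜) θ I k from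
    LinearMap.congr_fun h t
  refine tpow_ext (𝓗 := 𝓗) fun N t ht => ?_
  refine (isMultilinear_chi I _).ext_homogeneous (𝒜 := 𝒜) ((isMultilinear_chi I t).algFace _)
    fun p a ha => ?_
  have hM := chiProd_mem hθ.act_deg ht (p := Fin.init (Fin.tail p)) (a := Fin.init (Fin.tail a))
    fun i => ha _
  have h1 := hI.trace _ _ _ (gradeSign_pow_mem 𝒜 (ha (Fin.last (k + 1))) N) _
    (SetLike.mul_mem_graded (gradeSign_pow_mem 𝒜 (ha 0) N) hM)
  have e : Fin.contractNth (0 : Fin (k + 1)).castSucc (· * ·) (rotate a) =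
      Fin.cons (α := fun _ => A) (a (Fin.last (k + 1)) * a 0) (Fin.init (Fin.tail a)) :=
    contractNth_zero_cons _ _
  have hl : Fin.tail a (Fin.last k) = a (Fin.last (k + 1)) := rfl
  have h0 : algFace (gradeSign 𝒜) k 0 (chi 𝓗 (gradeSign 𝒜) θ I k t) (rotate a) =
      (-1 : ℂ) ^ (p (Fin.last (k + 1)) * (p 0 + (N + ∑ i, Fin.init (Fin.tail p) i)) +
        p (Fin.last (k + 1)) * N) * I ((gradeSign 𝒜 ^ N) (a 0) *
          (chiProd 𝓗 𝒜 θ k t (Fin.init (Fin.tail a)) * θ σ (a (Fin.last (k + 1))))) := by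
    refine (algFace_castSucc 0 _ _).trans ?_
    rw [e, chi_eq θ ht, Fin.cons_zero, Fin.tail_cons, gradeSign_pow_mul, mul_assoc, h1,
      gradeSign_pow_of_mem 𝒜 (ha (Fin.last (k + 1))), map_smul, mul_smul_comm, map_smul,
      smul_eq_mul, ← mul_assoc, ← pow_add, mul_assoc]
  rw [LinearMap.comp_apply, algFace_last_eq,
    algCyc_of_parity ((isMultilinear_chi I t).algFace _) fun i => gradeSign_of_mem 𝒜 (ha i), h0,
    chi_eq θ (tappend_mem hσ ht), chiProd_tappend hσ ht, hl,
    ← mul_assoc ((-1 : ℂ) ^ (p (Fin.last (k + 1)) * (∑ i, p i + 1))), ← pow_add,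
    Even.neg_one_pow, one_mul]
  -- the remaining exponent is even: compare in `ZMod 2`
  rw [Fin.sum_univ_succ, Fin.sum_univ_castSucc]
  have h2 : ∑ i, Fin.init (Fin.tail p) i = ∑ i : Fin k, p i.castSucc.succ := rfl
  rw [h2, Fin.succ_last, ← ZMod.natCast_eq_zero_iff_even]
  generalize ∑ i : Fin k, p i.castSucc.succ = s
  generalize p (Fin.last (k + 1)) = r
  generalize p 0 = q
  push_cast
  generalize (s : ZMod 2) = s
  generalize (r : ZMod 2) = r
  generalize (q : ZMod 2) = q
  generalize (N : ZMod 2) = N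
  revert s r q N
  decide

theorem chi_degen (hH : IsDGHopfAlgebra 𝓗 dH S) (hθ : IsDGAction 𝓗 dH 𝒜 d θ) {k : ℕ}
    (j : Fin (k + 1)) (t : TPow H (k + 1)) :
    chi 𝓗 (gradeSign 𝒜) θ I k (tdegen k j t) =
      LinearMap.funLeft ℂ ℂ (fun a => Fin.insertNth (α := fun _ => A) j.succ (1 : A) a)
        (chi 𝓗 (gradeSign 𝒜) θ I (k + 1) t) := by
  suffices h : chi 𝓗 (gradeSign 𝒜) θ I k ∘ₗ tdegen k j =
      LinearMap.funLeft ℂ ℂ (fun a => Fin.insertNth (α := fun _ => A) j.succ (1 : A) a) ∘ₗ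
        chi 𝓗 (gradeSign 𝒜) θ I (k + 1) from LinearMap.congr_fun h t
  refine tpow_ext (𝓗 := 𝓗) fun N t ht => ?_
  ext a
  have e : Fin.insertNth (α := fun _ => A) j.succ (1 : A) a = Fin.cons (α := fun _ => A) (a 0)
      (Fin.insertNth (α := fun _ => A) j (1 : A) (Fin.tail a)) := by
    conv_lhs => rw [← Fin.cons_self_tail a]
    exact Fin.insertNth_succ_cons j (1 : A) (a 0) (Fin.tail a)
  rw [LinearMap.comp_apply, LinearMap.comp_apply, LinearMap.funLeft_apply, e,
    chi_eq θ (tdegen_mem hH _ ht), chi_eq θ ht, chiProd_tdegen hH hθ j ht]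
  rfl

/-- The characteristic map commutes with the cyclic operators, by invariance and the trace
property. -/
theorem chi_cyc (hH : IsDGHopfAlgebra 𝓗 dH S) (hδ : IsModularPairInInvolution 𝓗 dH S δ σ)
    (hθ : IsDGAction 𝓗 dH 𝒜 d θ) (hI : IsClosedInvariantTrace 𝓗 S δ σ 𝒜 d θ I) {k : ℕ}
    (t : TPow H k) : chi 𝓗 (gradeSign 𝒜) θ I k (tcyc (gradeSign 𝓗) S δ σ k t) =
      algCyc (gradeSign 𝒜) k (chi 𝓗 (gradeSign 𝒜) θ I k t) := by
  cases k with
  | zero =>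
    refine (isMultilinear_chi I _).ext_homogeneous (𝒜 := 𝒜) (isMultilinear_chi I t).algCyc
      fun p a ha => ?_
    rw [algCyc_of_parity (isMultilinear_chi I t) fun i => gradeSign_of_mem 𝒜 (ha i)]
    have h1 : rotate a = a := by
      ext i
      obtain rfl : i = 0 := Subsingleton.elim (α := Fin 1) _ _
      rfl
    rw [h1, Even.neg_one_pow, one_mul]
    · rfl
    · rw [Fin.sum_univ_one]
      exact Nat.even_mul_succ_self _
  | succ k =>
    have hσ := hδ.sigma_deg
    suffices h : chi 𝓗 (gradeSign 𝒜) θ I (k + 1) ∘ₗ tcyc (gradeSign 𝓗) S δ σ (k + 1) =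
        algCyc (gradeSign 𝒜) (k + 1) ∘ₗ chi 𝓗 (gradeSign 𝒜) θ I (k + 1) from
      LinearMap.congr_fun h t
    refine tpow_ext (𝓗 := 𝓗) fun N t ht => ?_
    refine tdeg_succ_ext ?_ ht
    intro n m hN x hx t ht
    have hxt := tcons_mem hN hx ht
    refine (isMultilinear_chi I _).ext_homogeneous (𝒜 := 𝒜) (isMultilinear_chi I _).algCyc
      fun p a ha => ?_
    have hSx := twistedAntipode_mem hH hδ hx
    have hu := tappend_mem hσ ht
    have hM := chiProd_mem hθ.act_deg ht (p := Fin.init (Fin.tail p))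
      (a := Fin.init (Fin.tail a)) fun i => ha _
    have hl : Fin.tail a (Fin.last k) = a (Fin.last (k + 1)) := rfl
    have h1 : tcyc (gradeSign 𝓗) S δ σ (k + 1) (tcons k x t) =
      tact (gradeSign 𝓗) (k + 1) (twistedAntipode S δ x) (tappend σ k t) := by
      rw [tcyc, tlift_tcons]; rfl
    have hθx := hθ.act_deg n _ x hx _ (ha 0)
    -- invariance turns the action of the twisted antipode of `x` on the product of the others
    -- into the action of `x` on `a 0`; the trace property brings the last argument to the front
    have hinv := hI.invariant n (p 0) x hx (a 0) (ha 0)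
      (chiProd 𝓗 𝒜 θ (k + 1) (tappend σ k t) (Fin.tail a))
    have htr := hI.trace _ _ _ (ha (Fin.last (k + 1))) _ (SetLike.mul_mem_graded hθx hM)
    have hr : rotate a = Fin.cons (α := fun _ => A) (a (Fin.last (k + 1))) (Fin.init a) := rfl
    have hi : Fin.init a 0 = a 0 := rfl
    have hti : Fin.tail (Fin.init a) = Fin.init (Fin.tail a) := rfl
    rw [LinearMap.comp_apply,
      algCyc_of_parity (isMultilinear_chi I _) fun i => gradeSign_of_mem 𝒜 (ha i), hr, h1,
      chi_eq θ (tact_mem hH hN hSx hu), chi_eq θ hxt, Fin.cons_zero, Fin.tail_cons,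
      chiProd_tcons θ hx ht,
      chiProd_tact hH hθ hSx hu (p := Fin.tail p) (a := Fin.tail a) fun i => ha i.succ, hi, hti]
    have h2 : I (a 0 * θ (twistedAntipode S δ x)
        (chiProd 𝓗 𝒜 θ (k + 1) (tappend σ k t) (Fin.tail a))) =
        (-1 : ℂ) ^ (n * p 0 +
          p (Fin.last (k + 1)) * (n + p 0 + (m + ∑ i, Fin.init (Fin.tail p) i))) *
        I (a (Fin.last (k + 1)) * (θ x (a 0) * chiProd 𝓗 𝒜 θ k t (Fin.init (Fin.tail a)))) := by
      have hsq : ∀ e : ℕ, (-1 : ℂ) ^ e * (-1) ^ e = 1 := fun e => by rw [← mul_pow]; simp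
      rw [chiProd_tappend hσ ht, ← mul_assoc, hl] at hinv
      rw [htr, hinv, pow_add, chiProd_tappend hσ ht, hl]
      linear_combination (-(I (a 0 * θ (twistedAntipode S δ x)
        (chiProd 𝓗 𝒜 θ k t (Fin.init (Fin.tail a)) * θ σ (a (Fin.last (k + 1))))))) *
        (hsq (n * p 0) * (-1 : ℂ) ^ (p (Fin.last (k + 1)) *
          (n + p 0 + (m + ∑ i, Fin.init (Fin.tail p) i))) * (-1 : ℂ) ^ (p (Fin.last (k + 1)) *
          (n + p 0 + (m + ∑ i, Fin.init (Fin.tail p) i))) + hsq (p (Fin.last (k + 1)) *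
          (n + p 0 + (m + ∑ i, Fin.init (Fin.tail p) i))))
    simp only [gradeSign_pow_of_mem 𝒜 (ha 0), gradeSign_pow_of_mem 𝒜 (ha (Fin.last (k + 1))),
      gradeSign_pow_of_mem 𝒜 hθx, mul_smul_comm, smul_mul_assoc, map_smul, smul_eq_mul, h2]
    simp only [← mul_assoc, ← pow_add]
    congr 1
    apply neg_one_pow_congr
    rw [Fin.sum_univ_succ, Fin.sum_univ_castSucc, Fin.succ_last, ← hN]
    have h3 : ∑ i, Fin.init (Fin.tail p) i = ∑ i : Fin k, p i.castSucc.succ := rfl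
    rw [h3]
    generalize ∑ i : Fin k, p i.castSucc.succ = s
    generalize p (Fin.last (k + 1)) = r
    generalize p 0 = q
    generalize n * (n + 1) / 2 = T
    push_cast
    generalize (s : ZMod 2) = s
    generalize (r : ZMod 2) = r
    generalize (q : ZMod 2) = q
    generalize (n : ZMod 2) = n
    generalize (m : ZMod 2) = m
    generalize (T : ZMod 2) = T
    revert s r q n m T
    decide

/-- The characteristic map commutes with the differentials, since the functional is closed. -/
theorem chi_diff (hH : IsDGHopfAlgebra 𝓗 dH S) (hd : IsDGAlgebra 𝒜 d)
    (hθ : IsDGAction 𝓗 dH 𝒜 d θ) (hI : IsClosedInvariantTrace 𝓗 S δ σ 𝒜 d θ I) {k : ℕ}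
    (t : TPow H k) : chi 𝓗 (gradeSign 𝒜) θ I k (tdiff (gradeSign 𝓗) dH k t) =
      algDiff (gradeSign 𝒜) d k (chi 𝓗 (gradeSign 𝒜) θ I k t) := by
  suffices h : chi 𝓗 (gradeSign 𝒜) θ I k ∘ₗ tdiff (gradeSign 𝓗) dH k =
      algDiff (gradeSign 𝒜) d k ∘ₗ chi 𝓗 (gradeSign 𝒜) θ I k from LinearMap.congr_fun h t
  refine tpow_ext (𝓗 := 𝓗) fun N t ht => ?_
  ext a
  have e0 : diffAt (gradeSign 𝒜) d 0 a = Fin.cons (α := fun _ => A) (d (a 0)) (Fin.tail a) := by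
    conv_lhs => rw [← Fin.cons_self_tail a]
    exact diffAt_zero_cons _ _
  have e1 : ∀ j : Fin k, diffAt (gradeSign 𝒜) d j.succ a =
      Fin.cons (α := fun _ => A) (gradeSign 𝒜 (a 0)) (diffAt (gradeSign 𝒜) d j (Fin.tail a)) := by
    intro j
    conv_lhs => rw [← Fin.cons_self_tail a]
    exact diffAt_succ_cons _ _ _
  have h2 : ∀ y, gradeSign 𝒜 ((gradeSign 𝒜 ^ N) y) = (gradeSign 𝒜 ^ (N + 1)) y := fun y => by
    rw [pow_succ', Module.End.mul_apply]
  have h3 : ∀ y, (gradeSign 𝒜 ^ N) (gradeSign 𝒜 y) = (gradeSign 𝒜 ^ (N + 1)) y := fun y => by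
    rw [pow_succ, Module.End.mul_apply]
  have hcl := hI.closed ((gradeSign 𝒜 ^ N) (a 0) * chiProd 𝓗 𝒜 θ k t (Fin.tail a))
  rw [hd.isSuperDG.leibniz, h2, map_add, d_gradeSign_pow hd, smul_mul_assoc, map_smul] at hcl
  rw [LinearMap.comp_apply, LinearMap.comp_apply, algDiff_eq_sum, Fin.sum_univ_succ,
    chi_eq θ (tdiff_mem hH.map_deg ht), chiProd_tdiff hH hd hθ ht, e0, chi_eq θ ht, Fin.cons_zero,
    Fin.tail_cons]
  simp only [e1, chi_eq θ ht, Fin.cons_zero, Fin.tail_cons, h3, mul_sub, Finset.mul_sum, map_sub,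
    map_sum, mul_smul_comm, map_smul]
  rcases neg_one_pow_eq_or ℂ N with hN | hN <;> rw [hN] at hcl ⊢ <;>
    simp only [one_smul, neg_smul] at hcl ⊢
  · linear_combination -hcl
  · linear_combination hcl

end ChiComm

/-! ### Maps commuting with the cyclic operators -/

section CyclicMap

variable {X : ℕ → Type u} [∀ n, AddCommGroup (X n)] [∀ n, Module ℂ (X n)]
variable {Y : ℕ → Type v} [∀ n, AddCommGroup (Y n)] [∀ n, Module ℂ (Y n)]

/-- A family of linear maps commuting with all the operators. -/
structure IsCyclicMap (O : CyclicOps X) (P : CyclicOps Y) (f : ∀ k, X k →ₗ[ℂ] Y k) : Prop where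
  face : ∀ k j x, f (k + 1) (O.face k j x) = P.face k j (f k x)
  degen : ∀ k j x, f k (O.degen k j x) = P.degen k j (f (k + 1) x)
  cyc : ∀ k x, f k (O.cyc k x) = P.cyc k (f k x)
  diff : ∀ k x, f k (O.diff k x) = P.diff k (f k x)

variable {O : CyclicOps X} {P : CyclicOps Y} {f : ∀ k, X k →ₗ[ℂ] Y k}

namespace IsCyclicMap

theorem b (hf : IsCyclicMap O P f) (k : ℕ) (x : X k) : f (k + 1) (O.b k x) = P.b k (f k x) := by
  simp [CyclicOps.b, hf.face]

theorem lam (hf : IsCyclicMap O P f) (k : ℕ) (x : X k) : f k (O.lam k x) = P.lam k (f k x) := by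
  simp [CyclicOps.lam, hf.cyc]

theorem lam_pow (hf : IsCyclicMap O P f) (k j : ℕ) (x : X k) :
    f k ((O.lam k ^ j) x) = (P.lam k ^ j) (f k x) := by
  induction j with
  | zero => rfl
  | succ j ih => rw [pow_succ', pow_succ', Module.End.mul_apply, Module.End.mul_apply, hf.lam, ih]

theorem B (hf : IsCyclicMap O P f) (k : ℕ) (x : X (k + 1)) :
    f k (O.B k x) = P.B k (f (k + 1) x) := by
  simp [CyclicOps.B, hf.lam_pow, hf.degen, hf.cyc, hf.lam]

theorem total (hf : IsCyclicMap O P f) (x : ∀ _ k : ℕ, X k) :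
    P.total (totMap f x) = totMap f (O.total x) := by
  ext q k
  have h1 : P.bPart q k (totMap f x) = f k (O.bPart q k x) := by
    cases k with
    | zero => exact (map_zero _).symm
    | succ k => exact (hf.b k _).symm
  have h2 : P.BPart q k (totMap f x) = f k (O.BPart q k x) := by
    cases q with
    | zero => exact (map_zero _).symm
    | succ q => exact (hf.B k _).symm
  change P.bPart q k (totMap f x) + P.BPart q k (totMap f x) +
      (-1 : ℂ) ^ k • P.diff k (f k (x q k)) =
    f k (O.bPart q k x + O.BPart q k x + (-1 : ℂ) ^ k • O.diff k (x q k))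
  rw [h1, h2, ← hf.diff, map_add, map_add, map_smul]

theorem normalized (hf : IsCyclicMap O P f) {k : ℕ} {x : X k} (hx : x ∈ O.normalized k) :
    f k x ∈ P.normalized k := by
  cases k with
  | zero => trivial
  | succ k =>
    simp only [CyclicOps.normalized, Submodule.mem_iInf, LinearMap.mem_ker] at hx ⊢
    intro j
    rw [← hf.degen, hx, map_zero]

end IsCyclicMap

theorem totMap_mem_finiteCochains {W : ∀ k, Submodule ℂ (X k)} {V : ∀ k, Submodule ℂ (Y k)}
    (hf : ∀ k, ∀ x ∈ W k, f k x ∈ V k) {x : ∀ _ k : ℕ, X k} (hx : x ∈ finiteCochains W) :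
    totMap f x ∈ finiteCochains V := by
  obtain ⟨hx, N, hN⟩ := hx
  refine ⟨fun q k => hf k _ (hx q k), N, fun q k h => ?_⟩
  change f k (x q k) = 0
  rw [hN q k h, map_zero]

end CyclicMap

section Pullback

variable {A : Type*} [Ring A] [Algebra ℂ A] {B : Type*} [Ring B] [Algebra ℂ B]

variable {γA dA : A →ₗ[ℂ] A} {γB dB : B →ₗ[ℂ] B} {i : A →ₗ[ℂ] B}

/-- Pull-back of functionals along a linear map. -/
def pull (i : A →ₗ[ℂ] B) (k : ℕ) : Fun B k →ₗ[ℂ] Fun A k :=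
  LinearMap.funLeft ℂ ℂ fun (a : Fin (k + 1) → A) j => i (a j)

theorem map_sign_pow (hγ : ∀ a, i (γA a) = γB (i a)) (e : ℕ) (a : A) :
    i ((γA ^ e) a) = (γB ^ e) (i a) := by
  induction e with
  | zero => rfl
  | succ e ih => rw [pow_succ', pow_succ', Module.End.mul_apply, Module.End.mul_apply, hγ, ih]

theorem map_rot (hγ : ∀ a, i (γA a) = γB (i a)) {k : ℕ} (e : ℕ) (a : Fin (k + 1) → A) :
    (fun j => i (rot γA k e a j)) = rot γB k e fun j => i (a j) := by
  ext j
  cases j using Fin.cases with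
  | zero => simp [rot, parityPart, hγ]
  | succ j => simp [rot, map_sign_pow hγ]

/-- Pull-back along a multiplicative map, not necessarily unital, commutes with the faces. -/
theorem pull_face (hm : ∀ a b, i (a * b) = i a * i b) (hγ : ∀ a, i (γA a) = γB (i a)) (k : ℕ)
    (j : Fin (k + 2)) (φ : Fun B k) :
    pull i (k + 1) (algFace γB k j φ) = algFace γA k j (pull i k φ) := by
  have hcon : ∀ (l : Fin (k + 1)) (a : Fin (k + 2) → A),
      (fun j => i (Fin.contractNth l.castSucc (· * ·) a j)) =
        Fin.contractNth l.castSucc (· * ·) fun j => i (a j) := by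
    intro l a
    ext j
    simp only [Fin.contractNth]
    split_ifs <;> simp [hm]
  ext a
  cases j using Fin.lastCases with
  | last =>
    change algFace γB k (Fin.last (k + 1)) φ _ = _
    rw [algFace_last, algFace_last]
    refine Finset.sum_congr rfl fun e _ => ?_
    rw [← map_rot hγ]
    exact congrArg φ (hcon 0 _).symm
  | cast j =>
    change algFace γB k j.castSucc φ _ = _
    rw [algFace_castSucc, algFace_castSucc]
    exact congrArg φ (hcon j a).symm

theorem pull_cyc (hγ : ∀ a, i (γA a) = γB (i a)) (k : ℕ) (φ : Fun B k) :
    pull i k (algCyc γB k φ) = algCyc γA k (pull i k φ) := by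
  ext a
  change algCyc γB k φ _ = _
  rw [algCyc_apply, algCyc_apply]
  exact Finset.sum_congr rfl fun e _ => by rw [← map_rot hγ]; rfl

theorem pull_diff (hγ : ∀ a, i (γA a) = γB (i a)) (hd : ∀ a, i (dA a) = dB (i a)) (k : ℕ)
    (φ : Fun B k) : pull i k (algDiff γB dB k φ) = algDiff γA dA k (pull i k φ) := by
  ext a
  change algDiff γB dB k φ _ = _
  rw [algDiff_eq_sum, algDiff_eq_sum]
  refine Finset.sum_congr rfl fun j _ => congrArg φ ?_
  ext l
  simp only [diffAt]
  split_ifs <;> simp [hγ, hd]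

/-- Pull-back of functionals along a unital homomorphism commuting with the grading involutions and
the differentials. -/
theorem isCyclicMap_pull (h1 : i 1 = 1) (hm : ∀ a b, i (a * b) = i a * i b)
    (hγ : ∀ a, i (γA a) = γB (i a)) (hd : ∀ a, i (dA a) = dB (i a)) :
    IsCyclicMap (algOps γB dB) (algOps γA dA) (pull i) where
  face := pull_face hm hγ
  degen k j φ := by
    ext a
    change φ _ = φ _
    congr 1
    ext l
    refine Fin.succAboveCases j.succ ?_ (fun l => ?_) l
    · simp [h1]
    · simp
  cyc := pull_cyc hγ
  diff := pull_diff hγ hd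

end Pullback

section ChiCochain

variable {H : Type u} [Ring H] [Algebra ℂ H] [Coalgebra ℂ H] {𝓗 : ℕ → Submodule ℂ H}
  [GradedAlgebra 𝓗] {dH S : H →ₗ[ℂ] H} {σ : H} {δ : H →ₐ[ℂ] ℂ}
variable {A : Type v} [Ring A] [Algebra ℂ A] {𝒜 : ℕ → Submodule ℂ A} [GradedAlgebra 𝒜]
  {d : A →ₗ[ℂ] A} {θ : H →ₗ[ℂ] A →ₗ[ℂ] A} {I : A →ₗ[ℂ] ℂ}

theorem isCyclicMap_chi (hH : IsDGHopfAlgebra 𝓗 dH S) (hδ : IsModularPairInInvolution 𝓗 dH S δ σ)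
    (hd : IsDGAlgebra 𝒜 d) (hθ : IsDGAction 𝓗 dH 𝒜 d θ)
    (hI : IsClosedInvariantTrace 𝓗 S δ σ 𝒜 d θ I) :
    IsCyclicMap (hopfOps 𝓗 dH S δ σ) (algOps (gradeSign 𝒜) d) (chi 𝓗 (gradeSign 𝒜) θ I) where
  face k j t := by
    cases j using Fin.lastCases with
    | last =>
      refine Eq.trans ?_ (chi_face_last hδ.sigma_deg hθ hI t)
      rw [← tface_last]
      rfl
    | cast j => exact chi_face_castSucc hH hδ.sigma_deg hθ j t
  degen k j t := chi_degen hH hθ j t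
  cyc k t := chi_cyc hH hδ hθ hI t
  diff k t := chi_diff hH hd hθ hI t

end ChiCochain

/-! ### Two by two matrices -/

section Internal

variable {B : Type*} [AddCommGroup B] [Module ℂ B]

/-- Submodules which are the ranges of orthogonal projections with locally finite sum one form a
grading. -/
theorem isInternal_of_projections {ℬ : ℕ → Submodule ℂ B} (p : ℕ → B →ₗ[ℂ] B)
    (hmem : ∀ n x, p n x ∈ ℬ n) (hid : ∀ n, ∀ x ∈ ℬ n, p n x = x)
    (hne : ∀ m n, m ≠ n → ∀ x ∈ ℬ n, p m x = 0)
    (hsum : ∀ x, ∃ N, x = ∑ n ∈ Finset.range N, p n x) : DirectSum.IsInternal ℬ := by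
  have key : ∀ (x : DirectSum ℕ fun n => ℬ n) (m : ℕ),
      p m (DirectSum.coeAddMonoidHom ℬ x) = x m := by
    intro x m
    induction x using DirectSum.induction_on with
    | zero => simp
    | of n y =>
      rw [DirectSum.coeAddMonoidHom_of]
      rcases eq_or_ne m n with rfl | h
      · rw [hid m _ y.2, DirectSum.of_eq_same]
      · rw [hne m n h _ y.2, DirectSum.of_eq_of_ne _ _ _ h]
        rfl
    | add x y hx hy => rw [map_add, map_add, hx, hy]; rfl
  refine ⟨fun x y hxy => ?_, fun x => ?_⟩
  · ext m
    rw [← key, ← key]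
    exact congrArg _ hxy
  · obtain ⟨N, hN⟩ := hsum x
    refine ⟨∑ n ∈ Finset.range N, DirectSum.of (fun n => ℬ n) n ⟨p n x, hmem n x⟩, ?_⟩
    rw [map_sum]
    simp only [DirectSum.coeAddMonoidHom_of]
    exact hN.symm

theorem component_eq_of_projections {ℬ : ℕ → Submodule ℂ B} [DirectSum.Decomposition ℬ]
    (p : ℕ → B →ₗ[ℂ] B) (hid : ∀ n, ∀ x ∈ ℬ n, p n x = x)
    (hne : ∀ m n, m ≠ n → ∀ x ∈ ℬ n, p m x = 0) (n : ℕ) : component ℬ n = p n := by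
  refine linearMap_ext_graded ℬ fun m x hx => ?_
  rcases eq_or_ne n m with rfl | h
  · rw [component_of_mem ℬ hx, hid _ _ hx]
  · rw [hne n m h x hx, component_apply, DirectSum.decompose_of_mem_ne ℬ hx h.symm]

end Internal

section MatGrading

variable {A : Type v} [Ring A] [Algebra ℂ A] (𝒜 : ℕ → Submodule ℂ A)

theorem entrywise_apply (f : A →ₗ[ℂ] A) (M : M₂ A) (i j : Fin 2) : entrywise f M i j = f (M i j) :=
  rfl

/-- Matrices with all entries of degree `n`. -/
def matGrading (n : ℕ) : Submodule ℂ (M₂ A) where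
  carrier := {M | ∀ i j, M i j ∈ 𝒜 n}
  zero_mem' := fun _ _ => (𝒜 n).zero_mem
  add_mem' := fun h h' i j => (𝒜 n).add_mem (h i j) (h' i j)
  smul_mem' := fun c _ h i j => (𝒜 n).smul_mem c (h i j)

variable [GradedAlgebra 𝒜]

theorem component_of_mem_ne {m n : ℕ} (h : m ≠ n) {x : A} (hx : x ∈ 𝒜 n) : component 𝒜 m x = 0 := by
  rw [component_apply, DirectSum.decompose_of_mem_ne 𝒜 hx h.symm]

theorem matGrading_isInternal : DirectSum.IsInternal (matGrading 𝒜) := by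
  refine isInternal_of_projections (fun n => entrywise (component 𝒜 n))
    (fun n M i j => component_mem 𝒜 n _)
    (fun n M hM => Matrix.ext fun i j => component_of_mem 𝒜 (hM i j))
    (fun m n h M hM => Matrix.ext fun i j => component_of_mem_ne 𝒜 h (hM i j)) fun M => ?_
  choose N hN using fun ij : Fin 2 × Fin 2 => exists_sum_component 𝒜 (M ij.1 ij.2)
  refine ⟨∑ ij, N ij, Matrix.ext fun i j => ?_⟩
  rw [Matrix.sum_apply]
  exact hN (i, j) _ (Finset.single_le_sum (f := N) (fun _ _ => Nat.zero_le _)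
    (Finset.mem_univ (i, j)))

instance matGradedMonoid : SetLike.GradedMonoid (matGrading 𝒜) where
  one_mem := fun i j => by
    rw [Matrix.one_apply]
    split_ifs
    · exact SetLike.GradedOne.one_mem (A := 𝒜)
    · exact (𝒜 0).zero_mem
  mul_mem := fun m n M N hM hN i j => by
    rw [Matrix.mul_apply]
    exact (𝒜 (m + n)).sum_mem fun l _ => SetLike.mul_mem_graded (hM i l) (hN l j)

instance matGradedAlgebra : GradedAlgebra (matGrading 𝒜) :=
  { matGradedMonoid 𝒜, (matGrading_isInternal 𝒜).chooseDecomposition with }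

theorem component_matGrading (n : ℕ) : component (matGrading 𝒜) n = entrywise (component 𝒜 n) :=
  component_eq_of_projections (ℬ := matGrading 𝒜) (fun n => entrywise (component 𝒜 n))
    (fun _ _ hM => Matrix.ext fun i j => component_of_mem 𝒜 (hM i j))
    (fun _ _ h _ hM => Matrix.ext fun i j => component_of_mem_ne 𝒜 h (hM i j)) n

theorem gradeSign_matGrading : gradeSign (matGrading 𝒜) = entrywise (gradeSign 𝒜) := by
  refine linearMap_ext_graded (matGrading 𝒜) fun n M hM => ?_
  rw [gradeSign_of_mem _ hM]
  ext i j
  rw [entrywise_apply, gradeSign_of_mem 𝒜 (hM i j)]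
  rfl

variable {𝒜} {d : A →ₗ[ℂ] A}

theorem IsDGAlgebra.mat (hd : IsDGAlgebra 𝒜 d) : IsDGAlgebra (matGrading 𝒜) (entrywise d) where
  map_deg n M hM i j := hd.map_deg n _ (hM i j)
  d_d M := Matrix.ext fun i j => hd.d_d _
  leibniz n M hM N := by
    ext i j
    simp only [entrywise_apply, Matrix.mul_apply, Matrix.add_apply, Matrix.smul_apply, map_sum,
      hd.leibniz n _ (hM _ _), Finset.sum_add_distrib, Finset.smul_sum]

theorem IsTopDGAlgebra.mat [TopologicalSpace A] (hd : IsTopDGAlgebra 𝒜 d) :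
    IsTopDGAlgebra (matGrading 𝒜) (entrywise d) where
  toIsDGAlgebra := hd.toIsDGAlgebra.mat
  continuous_d := continuous_matrix fun i j =>
    hd.continuous_d.comp (continuous_id.matrix_elem i j)
  continuous_component n := by
    change Continuous fun M => component (matGrading 𝒜) n M
    rw [component_matGrading]
    exact continuous_matrix fun i j =>
      (hd.continuous_component n).comp (continuous_id.matrix_elem i j)

end MatGrading

section MatAction

variable {H : Type u} [Ring H] [Algebra ℂ H] [Coalgebra ℂ H] {𝓗 : ℕ → Submodule ℂ H}
  [GradedAlgebra 𝓗] {dH S : H →ₗ[ℂ] H} {σ : H} {δ : H →ₐ[ℂ] ℂ}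
variable {A : Type v} [Ring A] [Algebra ℂ A] {𝒜 : ℕ → Submodule ℂ A} [GradedAlgebra 𝒜]
  {d : A →ₗ[ℂ] A} {π : H →ₗ[ℂ] A →ₗ[ℂ] A} {ρp ρm : H →ₗ[ℂ] A} {I : A →ₗ[ℂ] ℂ}

omit [Coalgebra ℂ H] in
theorem matrixAction_apply (h : H) (M : M₂ A) (i j : Fin 2) :
    matrixAction π h M i j = π h (M i j) := rfl

omit [GradedAlgebra 𝒜] in
theorem isDGAction_matrixAction (hπ : IsDGAction 𝓗 dH 𝒜 d π) :
    IsDGAction 𝓗 dH (matGrading 𝒜) (entrywise d) (matrixAction π) where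
  one_act M := Matrix.ext fun i j => hπ.one_act _
  mul_act g h M := Matrix.ext fun i j => hπ.mul_act g h _
  act_one h := by
    ext i j
    rw [matrixAction_apply, Matrix.algebraMap_matrix_apply, Matrix.one_apply]
    split_ifs
    · exact hπ.act_one h
    · exact map_zero _
  act_mul h m M hM N := by
    obtain ⟨s, hs⟩ := exists_comul h
    ext i j
    simp only [matrixAction_apply, Matrix.mul_apply, map_sum, hπ.act_mul h m _ (hM _ _),
      sw_eq_sum hs, Matrix.sum_apply]
    rw [Finset.sum_comm]
    refine Finset.sum_congr rfl fun r _ => ?_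
    simp [Matrix.mul_apply, matrixAction_apply]
  act_deg m n h hh M hM i j := hπ.act_deg m n h hh _ (hM i j)
  d_act m h hh M := Matrix.ext fun i j => hπ.d_act m h hh _

theorem matrixCocycle_apply (ρ : H →ₗ[ℂ] A) (h : H) :
    matrixCocycle ρ h = !![ρ h, 0; 0, algebraMap ℂ A (Coalgebra.counit h)] := rfl

theorem isInnerCocyclePair_matrixCocycle (hH : IsDGHopfAlgebra 𝓗 dH S) (hd : IsDGAlgebra 𝒜 d)
    (hπ : IsDGAction 𝓗 dH 𝒜 d π) (hρ : IsInnerCocyclePair 𝓗 dH σ 𝒜 d π ρp ρm)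
    (hσ : Coalgebra.counit (R := ℂ) σ = 1) :
    IsInnerCocyclePair 𝓗 dH σ (matGrading 𝒜) (entrywise d) (matrixAction π)
      (matrixCocycle ρp) (matrixCocycle ρm) := by
  have hdeg : ∀ {ρ : H →ₗ[ℂ] A}, (∀ n, ∀ h ∈ 𝓗 n, ρ h ∈ 𝒜 n) →
      ∀ n, ∀ h ∈ 𝓗 n, matrixCocycle ρ h ∈ matGrading 𝒜 n := by
    intro ρ hρ n h hh i j
    have h1 : algebraMap ℂ A (Coalgebra.counit h) ∈ 𝒜 n := by
      rcases eq_or_ne n 0 with rfl | hn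
      · exact SetLike.algebraMap_mem_graded 𝒜 _
      · rw [hH.counit_deg n hn h hh, map_zero]
        exact (𝒜 n).zero_mem
    fin_cases i <;> fin_cases j <;> simp [matrixCocycle_apply, hρ n h hh, h1]
  have hcd : ∀ h, Coalgebra.counit (R := ℂ) (dH h) = 0 := by
    intro h
    have : Coalgebra.counit (R := ℂ) ∘ₗ dH = 0 :=
      linearMap_ext_graded 𝓗 fun n h hh =>
        hH.counit_deg (n + 1) n.succ_ne_zero _ (hH.map_deg n h hh)
    exact LinearMap.congr_fun this h
  have hdz : ∀ c : ℂ, d (algebraMap ℂ A c) = 0 := by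
    intro c
    rw [Algebra.algebraMap_eq_smul_one, map_smul, hd.isSuperDG.d_one, smul_zero]
  have hdd : ∀ {ρ : H →ₗ[ℂ] A}, (∀ h, ρ (dH h) = d (ρ h)) →
      ∀ h, matrixCocycle ρ (dH h) = entrywise d (matrixCocycle ρ h) := by
    intro ρ hρ h
    ext i j
    rw [entrywise_apply]
    fin_cases i <;> fin_cases j <;> simp [matrixCocycle_apply, hρ, hcd, hdz]
  have hcc : ∀ h, sw ((LinearMap.mul ℂ A).compl₁₂ (convUnit H A) (convUnit H A)) h =
      algebraMap ℂ A (Coalgebra.counit h) :=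
    fun h => LinearMap.congr_fun (convUnit_conv (convUnit H A)) h
  have hinv : ∀ {ρ ρ' : H →ₗ[ℂ] A}, (∀ h, sw ((LinearMap.mul ℂ A).compl₁₂ ρ ρ') h =
      algebraMap ℂ A (Coalgebra.counit h)) → ∀ h,
      sw ((LinearMap.mul ℂ (M₂ A)).compl₁₂ (matrixCocycle ρ) (matrixCocycle ρ')) h =
        algebraMap ℂ (M₂ A) (Coalgebra.counit h) := by
    intro ρ ρ' hρ h
    obtain ⟨s, hs⟩ := exists_comul h
    have h1 := hρ h
    have h2 := hcc h
    rw [sw_eq_sum hs] at h1 h2 ⊢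
    ext i j
    rw [Matrix.sum_apply, Matrix.algebraMap_matrix_apply]
    fin_cases i <;> fin_cases j <;> simp [matrixCocycle_apply] <;>
      first | exact h1 | simpa [convUnit, Algebra.smul_def] using h2
  refine ⟨hdeg hρ.deg_pos, hdeg hρ.deg_neg, hdd hρ.d_pos, hdd hρ.d_neg, hinv hρ.pos_neg,
    hinv hρ.neg_pos, fun h g => ?_, fun h n g hg => ?_, ?_, ?_, ?_, ?_⟩
  · obtain ⟨s, hs⟩ := exists_comul h
    have h1 := hρ.cocycle_pos h g
    have h2 := hcc h
    rw [sw_eq_sum hs] at h1 h2 ⊢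
    ext i j
    rw [Matrix.sum_apply]
    have h3 : ∑ i ∈ s, algebraMap ℂ A (Coalgebra.counit i.1) *
        π i.2 (algebraMap ℂ A (Coalgebra.counit g)) =
        algebraMap ℂ A (Coalgebra.counit h) * algebraMap ℂ A (Coalgebra.counit g) := by
      rw [← h2, Finset.sum_mul]
      refine Finset.sum_congr rfl fun i _ => ?_
      rw [Algebra.algebraMap_eq_smul_one (Coalgebra.counit g), map_smul, hπ.act_one]
      simp [convUnit]
    fin_cases i <;> fin_cases j <;>
      simp [matrixCocycle_apply, Matrix.mul_apply, matrixAction_apply, hH.counit_mul, h1, h3]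
  · obtain ⟨s, hs⟩ := exists_comul h
    have h1 := hρ.cocycle_neg h n g hg
    have h2 := hcc h
    have h4 := convUnit_comp_gradeSign (A := A) hH n
    rw [sw_eq_sum hs] at h1 h2 ⊢
    ext i j
    rw [Matrix.sum_apply]
    have h3 : ∑ i ∈ s, π i.1 (algebraMap ℂ A (Coalgebra.counit g)) *
        algebraMap ℂ A (Coalgebra.counit ((gradeSign 𝓗 ^ n) i.2)) =
        algebraMap ℂ A (Coalgebra.counit h) * algebraMap ℂ A (Coalgebra.counit g) := by
      rw [← h2, Finset.sum_mul]
      refine Finset.sum_congr rfl fun i _ => ?_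
      have h5 := LinearMap.congr_fun h4 i.2
      rw [Algebra.algebraMap_eq_smul_one (Coalgebra.counit g), map_smul, hπ.act_one]
      change Coalgebra.counit g • algebraMap ℂ A (Coalgebra.counit i.1) *
        (convUnit H A ∘ₗ gradeSign 𝓗 ^ n) i.2 = _
      rw [h5]
      simp [convUnit]
    fin_cases i <;> fin_cases j <;>
      simp [matrixCocycle_apply, Matrix.mul_apply, matrixAction_apply, hH.counit_mul, h1, h3]
  · ext i j; fin_cases i <;> fin_cases j <;> simp [matrixCocycle_apply, hρ.pos_one, hH.counit_one]
  · ext i j; fin_cases i <;> fin_cases j <;> simp [matrixCocycle_apply, hρ.neg_one, hH.counit_one]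
  · ext i j; fin_cases i <;> fin_cases j <;> simp [matrixCocycle_apply, hρ.pos_sigma, hσ]
  · ext i j; fin_cases i <;> fin_cases j <;> simp [matrixCocycle_apply, hρ.neg_sigma, hσ]

end MatAction

/-! ### The twisted action on matrices -/

section MatTwist

variable {H : Type u} [Ring H] [Algebra ℂ H] [Coalgebra ℂ H] {𝓗 : ℕ → Submodule ℂ H}
  [GradedAlgebra 𝓗] {dH S : H →ₗ[ℂ] H} {σ : H} {δ : H →ₐ[ℂ] ℂ}
variable {A : Type v} [Ring A] [Algebra ℂ A] {𝒜 : ℕ → Submodule ℂ A} [GradedAlgebra 𝒜]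
  {d : A →ₗ[ℂ] A} {π : H →ₗ[ℂ] A →ₗ[ℂ] A} {ρp ρm : H →ₗ[ℂ] A} {I : A →ₗ[ℂ] ℂ}

theorem matrixTwist_eq : matrixTwist (gradeSign 𝓗) (gradeSign 𝒜) π ρp ρm =
    twist (gradeSign 𝓗) (gradeSign (matGrading 𝒜)) (matrixAction π) (matrixCocycle ρp)
      (matrixCocycle ρm) := by
  rw [matrixTwist, gradeSign_matGrading]

/-- The two diagonal entries of `h ↦ diag(ρ h, ε h)`. -/
def cocycleEntry (ρ : H →ₗ[ℂ] A) : Fin 2 → H →ₗ[ℂ] A := ![ρ, convUnit H A]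

theorem matrixCocycle_eq_diagonal (ρ : H →ₗ[ℂ] A) (h : H) :
    matrixCocycle ρ h = Matrix.diagonal fun i => cocycleEntry ρ i h := by
  ext i j
  fin_cases i <;> fin_cases j <;> simp [matrixCocycle_apply, cocycleEntry, convUnit]

theorem leftTwist_matrix (h : H) (M : M₂ A) (i j : Fin 2) :
    leftTwist (matrixAction π) (matrixCocycle ρp) h M i j =
      leftTwist π (cocycleEntry ρp i) h (M i j) := by
  obtain ⟨s, hs⟩ := exists_comul h
  rw [leftTwist_apply, leftTwist_apply, conv_eq_sum _ _ hs, conv_eq_sum _ _ hs, Matrix.sum_apply]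
  refine Finset.sum_congr rfl fun r _ => ?_
  rw [matrixCocycle_eq_diagonal, Matrix.diagonal_mul]
  rfl

theorem twist_matrix (h : H) (M : M₂ A) (i j : Fin 2) :
    matrixTwist (gradeSign 𝓗) (gradeSign 𝒜) π ρp ρm h M i j =
      twist (gradeSign 𝓗) (gradeSign 𝒜) π (cocycleEntry ρp i) (cocycleEntry ρm j) h (M i j) := by
  rw [matrixTwist_eq]
  suffices hs : Matrix.entryLinearMap ℂ A i j ∘ₗ
      twist (gradeSign 𝓗) (gradeSign (matGrading 𝒜)) (matrixAction π) (matrixCocycle ρp)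
        (matrixCocycle ρm) h =
      twist (gradeSign 𝓗) (gradeSign 𝒜) π (cocycleEntry ρp i) (cocycleEntry ρm j) h ∘ₗ
        Matrix.entryLinearMap ℂ A i j from LinearMap.congr_fun hs M
  refine linearMap_ext_graded (matGrading 𝒜) fun m M hM => ?_
  obtain ⟨s, hs⟩ := exists_comul h
  change twist (gradeSign 𝓗) (gradeSign (matGrading 𝒜)) (matrixAction π) (matrixCocycle ρp)
    (matrixCocycle ρm) h M i j = twist _ _ π _ _ h (M i j)
  rw [twist_of_mem hM, twist_of_mem (hM i j), conv_eq_sum _ _ hs, conv_eq_sum _ _ hs,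
    Matrix.sum_apply]
  refine Finset.sum_congr rfl fun r _ => ?_
  rw [LinearMap.flip_apply, LinearMap.flip_apply, LinearMap.comp_apply, LinearMap.comp_apply,
    matrixCocycle_eq_diagonal, Matrix.mul_diagonal, leftTwist_matrix]

theorem twist_convUnit (hH : IsDGHopfAlgebra 𝓗 dH S) (h : H) (a : A) :
    twist (gradeSign 𝓗) (gradeSign 𝒜) π (convUnit H A) (convUnit H A) h a = π h a := by
  suffices hs : twist (gradeSign 𝓗) (gradeSign 𝒜) π (convUnit H A) (convUnit H A) h = π h by rw [hs]
  refine linearMap_ext_graded 𝒜 fun m a ha => ?_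
  rw [twist_of_mem ha, convUnit_comp_gradeSign hH, conv_convUnit, LinearMap.flip_apply,
    leftTwist_apply, convUnit_conv]
  rfl

theorem matrixTrace_apply (I : A →ₗ[ℂ] ℂ) (M : M₂ A) : matrixTrace I M = I (M 0 0) + I (M 1 1) := by
  rw [matrixTrace, LinearMap.comp_apply, Matrix.traceLinearMap_apply, Matrix.trace_fin_two, map_add]

theorem isDGAction_matrixTwist (hH : IsDGHopfAlgebra 𝓗 dH S) (hd : IsDGAlgebra 𝒜 d)
    (hπ : IsDGAction 𝓗 dH 𝒜 d π) (hρ : IsInnerCocyclePair 𝓗 dH σ 𝒜 d π ρp ρm)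
    (hσ : Coalgebra.counit (R := ℂ) σ = 1) :
    IsDGAction 𝓗 dH (matGrading 𝒜) (entrywise d)
      (matrixTwist (gradeSign 𝓗) (gradeSign 𝒜) π ρp ρm) := by
  rw [matrixTwist_eq]
  exact isDGAction_twist hH hd.mat (isDGAction_matrixAction hπ)
    (isInnerCocyclePair_matrixCocycle hH hd hπ hρ hσ)

/-- Invariance is checked in the form `I (θ h a) = δ h * I a`, which holds on each diagonal entry,
where the twisted action is `π'` or `π`; as `ρ^±(σ) = 1`, the group-like `σ` acts entrywise by `π`,
and the trace property is that of `I`, entry by entry. -/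
theorem isClosedInvariantTrace_matrixTrace (hH : IsDGHopfAlgebra 𝓗 dH S) (hd : IsDGAlgebra 𝒜 d)
    (hδ : IsModularPairInInvolution 𝓗 dH S δ σ)
    (hπ : IsDGAction 𝓗 dH 𝒜 d π) (hρ : IsInnerCocyclePair 𝓗 dH σ 𝒜 d π ρp ρm)
    (hI : IsClosedInvariantTrace 𝓗 S δ σ 𝒜 d π I)
    (hI' : IsClosedInvariantTrace 𝓗 S δ σ 𝒜 d (twist (gradeSign 𝓗) (gradeSign 𝒜) π ρp ρm) I) :
    IsClosedInvariantTrace 𝓗 S δ σ (matGrading 𝒜) (entrywise d)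
      (matrixTwist (gradeSign 𝓗) (gradeSign 𝒜) π ρp ρm) (matrixTrace I) where
  closed M := by simp [matrixTrace_apply, entrywise_apply, hI.closed]
  invariant m n h hh M hM N := by
    refine invariant_of_apply_act hH hδ
      (isDGAction_matrixTwist hH hd hπ hρ hδ.isGroupLike.counit_eq_one) (fun h M => ?_) hh hM N
    rw [matrixTrace_apply, matrixTrace_apply, twist_matrix, twist_matrix]
    simp only [cocycleEntry, Matrix.cons_val_zero, Matrix.cons_val_one]
    rw [twist_convUnit hH, hI.apply_act hH hδ hπ,
      hI'.apply_act hH hδ (isDGAction_twist hH hd hπ hρ),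
      mul_add]
  trace m n M hM N hN := by
    have hσ : ∀ M : M₂ A, matrixTwist (gradeSign 𝓗) (gradeSign 𝒜) π ρp ρm σ M =
        matrixAction π σ M := by
      intro M
      have h2 := isInnerCocyclePair_matrixCocycle hH hd hπ hρ hδ.isGroupLike.counit_eq_one
      rw [matrixTwist_eq, twist_of_comul_eq hδ.isGroupLike.comul_eq_tmul_self hδ.sigma_deg,
        h2.pos_sigma, h2.neg_sigma, one_mul, mul_one]
    simp only [hσ, matrixTrace_apply, Matrix.mul_apply, Fin.sum_univ_two, map_add,
      matrixAction_apply]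
    rw [hI.trace m n _ (hM 0 0) _ (hN 0 0), hI.trace m n _ (hM 0 1) _ (hN 1 0),
      hI.trace m n _ (hM 1 0) _ (hN 0 1), hI.trace m n _ (hM 1 1) _ (hN 1 1)]
    ring

theorem matrixChi_mem [TopologicalSpace A] [IsTopologicalRing A] (hH : IsDGHopfAlgebra 𝓗 dH S)
    (hd : IsTopDGAlgebra 𝒜 d) (hπ : IsDGAction 𝓗 dH 𝒜 d π) (hπc : ∀ h, Continuous (π h))
    (hρ : IsInnerCocyclePair 𝓗 dH σ 𝒜 d π ρp ρm) (hσ : Coalgebra.counit (R := ℂ) σ = 1)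
    (hIc : Continuous I) (hI : ∃ N, ∀ n, N < n → ∀ a ∈ 𝒜 n, I a = 0) {k : ℕ} (t : TPow H k) :
    matrixChi 𝓗 𝒜 π ρp ρm I k t ∈ algCochain (matGrading 𝒜) k := by
  rw [matrixChi, ← gradeSign_matGrading]
  refine chi_mem_algCochain (hd.mat.continuous_component)
    (isDGAction_matrixTwist hH hd.toIsDGAlgebra hπ hρ hσ).act_deg (fun h n => ?_) ?_ ?_ t
  · rw [matrixTwist_eq]
    exact continuous_twist_component hd.mat.continuous_component (fun h =>
      continuous_matrix fun i j => (hπc h).comp (continuous_id.matrix_elem i j)) h n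
  · simp only [funext (matrixTrace_apply I)]
    exact (hIc.comp (continuous_id.matrix_elem 0 0)).add
      (hIc.comp (continuous_id.matrix_elem 1 1))
  · obtain ⟨N, hN⟩ := hI
    refine ⟨N, fun n hn M hM => ?_⟩
    rw [matrixTrace_apply, hN n hn _ (hM 0 0), hN n hn _ (hM 1 1), add_zero]

/-- On diagonal matrices the product for `π'₂` is the pair of the products for `π'` and `π`. -/
theorem chiProd_diagonal (hH : IsDGHopfAlgebra 𝓗 dH S) {k : ℕ} (t : TPow H k)
    (a : Fin k → Fin 2 → A) :
    chiProd 𝓗 (matGrading 𝒜) (matrixTwist (gradeSign 𝓗) (gradeSign 𝒜) π ρp ρm) k t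
        (fun i => Matrix.diagonal (a i)) =
      Matrix.diagonal ![
        chiProd 𝓗 𝒜 (twist (gradeSign 𝓗) (gradeSign 𝒜) π ρp ρm) k t fun i => a i 0,
        chiProd 𝓗 𝒜 π k t fun i => a i 1] := by
  induction k with
  | zero =>
    rw [chiProd_zero, chiProd_zero, chiProd_zero]
    ext i j
    fin_cases i <;> fin_cases j <;> simp
  | succ k ih =>
    have hdiag : ∀ (x : H) (c : Fin 2 → A),
        matrixTwist (gradeSign 𝓗) (gradeSign 𝒜) π ρp ρm x (Matrix.diagonal c) =
          Matrix.diagonal ![twist (gradeSign 𝓗) (gradeSign 𝒜) π ρp ρm x (c 0), π x (c 1)] := by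
      intro x c
      ext i j
      rw [twist_matrix]
      fin_cases i <;> fin_cases j <;> simp [cocycleEntry, twist_convUnit hH]
    have hsign : ∀ (m : ℕ) (c : Fin 2 → A),
        (gradeSign (matGrading 𝒜) ^ m) (Matrix.diagonal c) =
          Matrix.diagonal fun i => (gradeSign 𝒜 ^ m) (c i) := by
      intro m c
      induction m with
      | zero => rfl
      | succ m ih =>
        simp only [pow_succ', Module.End.mul_apply]
        rw [ih, gradeSign_matGrading]
        ext i j
        rw [entrywise_apply, Matrix.diagonal_apply, Matrix.diagonal_apply]
        split_ifs <;> simp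
    let F : A →ₗ[ℂ] M₂ A := Matrix.diagonalLinearMap (Fin 2) ℂ A ∘ₗ
      LinearMap.single ℂ (fun _ : Fin 2 => A) 0
    let G : A →ₗ[ℂ] M₂ A := Matrix.diagonalLinearMap (Fin 2) ℂ A ∘ₗ
      LinearMap.single ℂ (fun _ : Fin 2 => A) 1
    have hFG : ∀ x y : A, Matrix.diagonal ![x, y] = F x + G y := by
      intro x y
      ext i j
      fin_cases i <;> fin_cases j <;> simp [F, G]
    suffices hs : LinearMap.proj (fun i => Matrix.diagonal (a i)) ∘ₗ
        chiProd 𝓗 (matGrading 𝒜) (matrixTwist (gradeSign 𝓗) (gradeSign 𝒜) π ρp ρm) (k + 1) =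
        F ∘ₗ LinearMap.proj (fun i => a i 0) ∘ₗ
          chiProd 𝓗 𝒜 (twist (gradeSign 𝓗) (gradeSign 𝒜) π ρp ρm) (k + 1) +
        G ∘ₗ LinearMap.proj (fun i => a i 1) ∘ₗ chiProd 𝓗 𝒜 π (k + 1) by
      rw [hFG]
      exact LinearMap.congr_fun hs t
    refine tpow_ext (𝓗 := 𝓗) fun N => fun u hu => tdeg_succ_ext (fun n m _ x hx t ht => ?_) hu
    simp only [LinearMap.add_apply, LinearMap.comp_apply, LinearMap.proj_apply]
    rw [← hFG, chiProd_tcons _ hx ht, chiProd_tcons _ hx ht, chiProd_tcons _ hx ht, hdiag, hsign]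
    change _ • (_ * chiProd 𝓗 (matGrading 𝒜) _ k t fun i => Matrix.diagonal (a i.succ)) = _
    rw [ih, Matrix.diagonal_mul_diagonal]
    ext i j
    fin_cases i <;> fin_cases j <;> simp [Fin.tail_def]

/-- The characteristic map of `π'₂` on diagonal matrices. -/
theorem matrixChi_diagonal (hH : IsDGHopfAlgebra 𝓗 dH S) {k : ℕ} (t : TPow H k)
    (a : Fin (k + 1) → Fin 2 → A) :
    matrixChi 𝓗 𝒜 π ρp ρm I k t (fun i => Matrix.diagonal (a i)) =
      chi 𝓗 (gradeSign 𝒜) (twist (gradeSign 𝓗) (gradeSign 𝒜) π ρp ρm) I k t (fun i => a i 0) +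
        chi 𝓗 (gradeSign 𝒜) π I k t (fun i => a i 1) := by
  suffices hs : LinearMap.proj (fun i => Matrix.diagonal (a i)) ∘ₗ matrixChi 𝓗 𝒜 π ρp ρm I k =
      LinearMap.proj (fun i => a i 0) ∘ₗ
        chi 𝓗 (gradeSign 𝒜) (twist (gradeSign 𝓗) (gradeSign 𝒜) π ρp ρm) I k +
      LinearMap.proj (fun i => a i 1) ∘ₗ chi 𝓗 (gradeSign 𝒜) π I k from LinearMap.congr_fun hs t
  refine tpow_ext (𝓗 := 𝓗) fun N t ht => ?_
  simp only [LinearMap.add_apply, LinearMap.comp_apply, LinearMap.proj_apply]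
  have hpow : ∀ (m : ℕ) (M : M₂ A) (i j : Fin 2),
      (gradeSign (matGrading 𝒜) ^ m) M i j = (gradeSign 𝒜 ^ m) (M i j) := by
    intro m M i j
    induction m with
    | zero => rfl
    | succ m ih =>
      rw [pow_succ', pow_succ', Module.End.mul_apply, Module.End.mul_apply, gradeSign_matGrading,
        entrywise_apply, ← ih, gradeSign_matGrading]
  rw [matrixChi, ← gradeSign_matGrading, chi_eq _ ht, chi_eq _ ht, chi_eq _ ht, matrixTrace_apply]
  change I ((_ * chiProd 𝓗 (matGrading 𝒜) _ k t fun i => Matrix.diagonal (a i.succ)) 0 0) +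
    I ((_ * chiProd 𝓗 (matGrading 𝒜) _ k t fun i => Matrix.diagonal (a i.succ)) 1 1) = _
  rw [chiProd_diagonal hH, Matrix.mul_diagonal, Matrix.mul_diagonal, hpow, hpow]
  simp [Fin.tail_def]

/-- On scalars the characteristic map does not depend on the action. -/
theorem chi_algebraMap {θ θ' : H →ₗ[ℂ] A →ₗ[ℂ] A} (hθ : IsDGAction 𝓗 dH 𝒜 d θ)
    (hθ' : IsDGAction 𝓗 dH 𝒜 d θ') {k : ℕ} (t : TPow H k) (z : Fin (k + 1) → ℂ) :
    chi 𝓗 (gradeSign 𝒜) θ I k t (fun i => algebraMap ℂ A (z i)) =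
      chi 𝓗 (gradeSign 𝒜) θ' I k t (fun i => algebraMap ℂ A (z i)) := by
  have h1 : ∀ k (t : TPow H k) (z : Fin k → ℂ),
      chiAux 𝓗 (gradeSign 𝒜) θ k t (fun i => algebraMap ℂ A (z i)) =
        chiAux 𝓗 (gradeSign 𝒜) θ' k t (fun i => algebraMap ℂ A (z i)) := by
    intro k
    induction k with
    | zero => intro t z; rfl
    | succ k ih =>
      intro t z
      have h2 : ∀ z : ℂ, θ.flip (algebraMap ℂ A z) = θ'.flip (algebraMap ℂ A z) := by
        intro z
        ext h
        rw [LinearMap.flip_apply, LinearMap.flip_apply, Algebra.algebraMap_eq_smul_one, map_smul,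
          map_smul, hθ.act_one, hθ'.act_one]
      have h3 : (LinearMap.proj (Fin.tail fun i => algebraMap ℂ A (z i)) ∘ₗ
          chiAux 𝓗 (gradeSign 𝒜) θ k) = (LinearMap.proj (Fin.tail fun i => algebraMap ℂ A (z i)) ∘ₗ
          chiAux 𝓗 (gradeSign 𝒜) θ' k) := by
        ext t : 1
        exact ih t (Fin.tail z)
      simp only [chiAux, LinearMap.pi_apply, chiStep, h2, h3]
  change I (chiAux 𝓗 (gradeSign 𝒜) θ k t (fun i => algebraMap ℂ A (z i.succ)) _) =
    I (chiAux 𝓗 (gradeSign 𝒜) θ' k t (fun i => algebraMap ℂ A (z i.succ)) _)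
  rw [h1]

end MatTwist

/-! ### Insertion of an element in a functional -/

section CartanSum

/-- The cancellation behind the Cartan formula: in the double sum over insertion positions `m` and
faces `j` only the terms survive in which the face multiplies the inserted element. -/
theorem sum_insert_face {n : ℕ} (F : Fin (n + 1) → Fin (n + 2) → ℂ) (G : Fin (n + 1) → Fin n → ℂ)
    (h1 : ∀ (j : Fin (n + 1)) (m : Fin n), j ≤ m.castSucc → F m.succ j.castSucc = -G j m)
    (h2 : ∀ (j : Fin (n + 1)) (m : Fin n), m.castSucc < j → F m.castSucc j.succ = -G j m) :
    (∑ m, ∑ j, F m j) + ∑ j, ∑ m, G j m = ∑ m, (F m m.castSucc + F m m.succ) := by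
  have key : ∀ m j, F m j = (if j < m.castSucc then F m j else 0) +
      (if m.succ < j then F m j else 0) + (if j = m.castSucc then F m j else 0) +
      (if j = m.succ then F m j else 0) := by
    intro m j
    simp only [Fin.lt_def, Fin.ext_iff, Fin.val_castSucc, Fin.val_succ]
    split_ifs <;> first | omega | simp
  have e1 : ∑ m, ∑ j, (if j < m.castSucc then F m j else 0) =
      ∑ j, ∑ m : Fin n, if j ≤ m.castSucc then -G j m else 0 := by
    rw [Fin.sum_univ_succ]
    rw [Finset.sum_eq_zero (s := Finset.univ) (f := fun j : Fin (n + 2) =>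
      if j < (0 : Fin (n + 1)).castSucc then F 0 j else 0) (fun j _ => by simp), zero_add,
      Finset.sum_comm, Fin.sum_univ_castSucc]
    rw [Finset.sum_eq_zero (s := Finset.univ) (f := fun m : Fin n =>
      if Fin.last (n + 1) < m.succ.castSucc then F m.succ (Fin.last (n + 1)) else 0)
      (fun j _ => if_neg (not_lt.2 (Fin.le_last _))), add_zero]
    refine Finset.sum_congr rfl fun j _ => Finset.sum_congr rfl fun m _ => ?_
    by_cases h : j ≤ m.castSucc
    · rw [if_pos h, if_pos (by
        simp only [Fin.lt_def, Fin.le_def, Fin.val_castSucc, Fin.val_succ] at *; omega), h1 j m h]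
    · rw [if_neg h, if_neg (by
        simp only [Fin.lt_def, Fin.le_def, Fin.val_castSucc, Fin.val_succ] at *; omega)]
  have e2 : ∑ m, ∑ j, (if m.succ < j then F m j else 0) =
      ∑ j, ∑ m : Fin n, if m.castSucc < j then -G j m else 0 := by
    rw [Fin.sum_univ_castSucc]
    rw [Finset.sum_eq_zero (s := Finset.univ) (f := fun j : Fin (n + 2) =>
      if (Fin.last n).succ < j then F (Fin.last n) j else 0)
      (fun j _ => if_neg (by rw [Fin.succ_last]; exact not_lt.2 (Fin.le_last _))), add_zero,
      Finset.sum_comm, Fin.sum_univ_succ]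
    rw [Finset.sum_eq_zero (s := Finset.univ) (f := fun m : Fin n =>
      if m.castSucc.succ < 0 then F m.castSucc 0 else 0)
      (fun j _ => if_neg (Fin.not_lt_zero _)), zero_add]
    refine Finset.sum_congr rfl fun j _ => Finset.sum_congr rfl fun m _ => ?_
    by_cases h : m.castSucc < j
    · rw [if_pos h, if_pos (Fin.succ_lt_succ_iff.2 h), h2 j m h]
    · rw [if_neg h, if_neg (fun h' => h (Fin.succ_lt_succ_iff.1 h'))]
  rw [Finset.sum_congr rfl fun m _ => Finset.sum_congr rfl fun j _ => key m j]
  simp only [Finset.sum_add_distrib]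
  rw [e1, e2]
  simp only [Finset.sum_ite_eq', Finset.mem_univ, if_true]
  have e3 : (∑ j, ∑ m : Fin n, if j ≤ m.castSucc then -G j m else 0) +
      (∑ j, ∑ m : Fin n, if m.castSucc < j then -G j m else 0) + ∑ j, ∑ m, G j m = 0 := by
    simp only [← Finset.sum_add_distrib]
    refine Finset.sum_eq_zero fun j _ => Finset.sum_eq_zero fun m _ => ?_
    rcases le_or_gt j m.castSucc with h | h
    · simp [h, not_lt.2 h]
    · simp [h, not_le.2 h]
  linear_combination e3

end CartanSum

section Tuples

variable {B : Type*} [Ring B]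

theorem contractNth_insertNth_of_lt {n : ℕ} {j m : Fin (n + 1)} (h : j < m) (g : B)
    (x : Fin (n + 1) → B) :
    Fin.contractNth j.castSucc (· * ·) (Fin.insertNth (α := fun _ => B) m.succ g x) =
      Fin.insertNth (α := fun _ => B) m g (Fin.contractNth j (· * ·) x) := by
  induction n with
  | zero => omega
  | succ n ih =>
    induction x using Fin.consCases with | _ x0 x
    cases m using Fin.cases with
    | zero => exact absurd h (Fin.not_lt_zero _)
    | succ m =>
      rw [Fin.insertNth_succ_cons]
      cases j using Fin.cases with
      | zero =>
        induction x using Fin.consCases with | _ x1 x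
        rw [Fin.castSucc_zero, contractNth_zero_cons, contractNth_zero_cons,
          Fin.insertNth_succ_cons,
          Fin.insertNth_succ_cons]
        rfl
      | succ j =>
        rw [Fin.castSucc_succ, contractNth_succ_cons, contractNth_succ_cons,
          ih (Fin.succ_lt_succ_iff.1 h), Fin.insertNth_succ_cons]

theorem contractNth_insertNth_of_le {n : ℕ} {j p : Fin (n + 1)} (h : p ≤ j) (g : B)
    (x : Fin (n + 1) → B) :
    Fin.contractNth j.succ (· * ·) (Fin.insertNth (α := fun _ => B) p.castSucc g x) =
      Fin.insertNth (α := fun _ => B) p g (Fin.contractNth j (· * ·) x) := by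
  induction n with
  | zero =>
    obtain rfl : p = 0 := by omega
    rw [Fin.castSucc_zero, Fin.insertNth_zero', Fin.insertNth_zero', contractNth_succ_cons]
  | succ n ih =>
    cases p using Fin.cases with
    | zero =>
      rw [Fin.castSucc_zero, Fin.insertNth_zero', Fin.insertNth_zero', contractNth_succ_cons]
    | succ p =>
      induction x using Fin.consCases with | _ x0 x
      cases j using Fin.cases with
      | zero => exact absurd h (by simp)
      | succ j =>
        rw [Fin.castSucc_succ, Fin.insertNth_succ_cons, contractNth_succ_cons,
          contractNth_succ_cons, ih (Fin.succ_le_succ_iff.1 h), Fin.insertNth_succ_cons]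

theorem contractNth_insertNth_castSucc {n : ℕ} (p : Fin (n + 1)) (g : B) (x : Fin (n + 1) → B) :
    Fin.contractNth p.castSucc (· * ·) (Fin.insertNth (α := fun _ => B) p.castSucc g x) =
      Function.update x p (g * x p) := by
  induction n with
  | zero =>
    obtain rfl : p = 0 := by omega
    rw [Fin.castSucc_zero, Fin.insertNth_zero', contractNth_zero_cons]
    ext i
    obtain rfl : i = 0 := by omega
    simp
  | succ n ih =>
    induction x using Fin.consCases with | _ x0 x
    cases p using Fin.cases with
    | zero =>
      rw [Fin.castSucc_zero, Fin.insertNth_zero', contractNth_zero_cons, Fin.update_cons_zero]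
      rfl
    | succ p =>
      rw [Fin.castSucc_succ, Fin.insertNth_succ_cons, contractNth_succ_cons, ih, Fin.cons_succ,
        Fin.cons_update]

theorem contractNth_insertNth_succ {n : ℕ} (p : Fin (n + 1)) (g : B) (x : Fin (n + 1) → B) :
    Fin.contractNth p.castSucc (· * ·) (Fin.insertNth (α := fun _ => B) p.succ g x) =
      Function.update x p (x p * g) := by
  induction n with
  | zero =>
    obtain rfl : p = 0 := by omega
    induction x using Fin.consCases with | _ x0 x
    rw [Fin.castSucc_zero, Fin.insertNth_succ_cons, contractNth_zero_cons]
    ext i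
    obtain rfl : i = 0 := by omega
    simp
  | succ n ih =>
    induction x using Fin.consCases with | _ x0 x
    rw [Fin.insertNth_succ_cons]
    cases p using Fin.cases with
    | zero =>
      rw [Fin.castSucc_zero, Fin.insertNth_zero', contractNth_zero_cons, Fin.update_cons_zero]
      rfl
    | succ p =>
      rw [Fin.castSucc_succ, contractNth_succ_cons, ih, Fin.cons_succ, Fin.cons_update]

variable [Algebra ℂ B] {γ d : B →ₗ[ℂ] B} {g : B}

theorem sign_pow_fixed (hg : γ g = g) (e : ℕ) : (γ ^ e) g = g := by
  induction e with
  | zero => rfl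
  | succ e ih => rw [pow_succ', Module.End.mul_apply, ih, hg]

theorem rot_insertNth (hg : γ g = g) {k : ℕ} (e : ℕ) (q : Fin (k + 1)) (x : Fin (k + 1) → B) :
    rot γ (k + 1) e (Fin.insertNth (α := fun _ => B) q.castSucc g x) =
      Fin.insertNth (α := fun _ => B) q.succ g (rot γ k e x) := by
  rw [Fin.eq_insertNth_iff]
  constructor
  · rw [rot, Fin.cons_succ, Fin.insertNth_apply_same, sign_pow_fixed hg]
  · ext i
    cases i using Fin.cases with
    | zero =>
      have h1 : Fin.last (k + 1) = q.castSucc.succAbove (Fin.last k) := by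
        rw [Fin.succAbove_of_le_castSucc _ _ (by simp [Fin.le_def]; omega), Fin.succ_last]
      rw [Fin.removeNth, Fin.succ_succAbove_zero, rot, rot, Fin.cons_zero, Fin.cons_zero, h1,
        Fin.insertNth_apply_succAbove]
    | succ i =>
      rw [Fin.removeNth, Fin.succ_succAbove_succ, rot, rot, Fin.cons_succ, Fin.cons_succ,
        ← Fin.castSucc_succAbove_castSucc, Fin.insertNth_apply_succAbove]

theorem rot_insertNth_last (hg : γ g = g) {k : ℕ} (x : Fin (k + 1) → B) :
    rot γ (k + 1) 0 (Fin.insertNth (α := fun _ => B) (Fin.last (k + 1)) g x) =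
      Fin.cons (α := fun _ => B) g x ∧
    rot γ (k + 1) 1 (Fin.insertNth (α := fun _ => B) (Fin.last (k + 1)) g x) 0 = 0 := by
  rw [Fin.insertNth_last']
  refine ⟨?_, by simp [rot, parityPart, hg]⟩
  ext i
  cases i using Fin.cases with
  | zero =>
    simp only [rot, parityPart, Fin.cons_zero, Fin.snoc_last, LinearMap.smul_apply,
      LinearMap.add_apply, LinearMap.id_apply, hg, pow_zero, one_smul]
    rw [← two_smul ℂ g, smul_smul]
    norm_num
  | succ i => simp [rot]

theorem diffAt_insertNth (hg : γ g = g) {k : ℕ} (m : Fin (k + 1)) (j : Fin k) (x : Fin k → B) :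
    diffAt γ d (m.succAbove j) (Fin.insertNth (α := fun _ => B) m g x) =
      Fin.insertNth (α := fun _ => B) m g (diffAt γ d j x) := by
  rw [Fin.eq_insertNth_iff]
  constructor
  · rw [diffAt, Fin.insertNth_apply_same, hg, if_neg (Fin.succAbove_ne m j).symm, ite_self]
  · ext i
    simp only [Fin.removeNth, diffAt, Fin.insertNth_apply_succAbove, Fin.succAbove_lt_succAbove_iff,
      Fin.succAbove_right_inj]

end Tuples

section Insertion

variable {B : Type*} [Ring B] [Algebra ℂ B] {γ d : B →ₗ[ℂ] B}

/-- Insertion of `g` at position `m`, with the sign `(-1) ^ m`. -/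
def insertAt (g : B) (k : ℕ) (m : Fin (k + 2)) : Fun B (k + 1) →ₗ[ℂ] Fun B k :=
  (-1 : ℂ) ^ (m : ℕ) • LinearMap.funLeft ℂ ℂ (Fin.insertNth (α := fun _ => B) m g)

/-- The sum of the insertions of `g` at all positions but the first. -/
def insertion (g : B) (k : ℕ) : Fun B (k + 1) →ₗ[ℂ] Fun B k :=
  ∑ j : Fin (k + 1), insertAt g k j.succ

variable {g : B}

omit [Ring B] [Algebra ℂ B] in
theorem insertAt_apply {k : ℕ} (m : Fin (k + 2)) (φ : Fun B (k + 1)) (x : Fin (k + 1) → B) :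
    insertAt g k m φ x = (-1 : ℂ) ^ (m : ℕ) * φ (Fin.insertNth (α := fun _ => B) m g x) := rfl

omit [Ring B] [Algebra ℂ B] in
theorem insertion_apply {k : ℕ} (φ : Fun B (k + 1)) (x : Fin (k + 1) → B) :
    insertion g k φ x = ∑ j : Fin (k + 1), insertAt g k j.succ φ x := by
  simp [insertion]

theorem IsMultilinear.insertAt {k : ℕ} {φ : Fun B (k + 1)} (hφ : IsMultilinear φ)
    (m : Fin (k + 2)) : IsMultilinear (insertAt g k m φ) :=
  (hφ.comp (IsSlotwise.insertNth m g)).smul _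

theorem IsMultilinear.insertion {k : ℕ} {φ : Fun B (k + 1)} (hφ : IsMultilinear φ) :
    IsMultilinear (insertion g k φ) := by
  rw [show DGCyc.insertion g k φ = fun x => ∑ j : Fin (k + 1), DGCyc.insertAt g k j.succ φ x from
    funext fun x => insertion_apply φ x]
  exact IsMultilinear.sum _ fun j _ => hφ.insertAt _

/-- Insertion of a closed even element commutes with the differential. -/
theorem diff_insertion (hg : γ g = g) (hdg : d g = 0) {k : ℕ} {φ : Fun B (k + 1)}
    (hφ : IsMultilinear φ) :
    algDiff γ d k (insertion g k φ) = insertion g k (algDiff γ d (k + 1) φ) := by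
  ext x
  rw [algDiff_eq_sum, insertion_apply]
  simp only [insertion_apply]
  rw [Finset.sum_comm]
  refine Finset.sum_congr rfl fun m _ => ?_
  rw [insertAt_apply, algDiff_eq_sum, Fin.sum_univ_succAbove _ m.succ]
  rw [isMultilinear_zero hφ m.succ (by simp [diffAt, hdg]), zero_add, Finset.mul_sum]
  refine Finset.sum_congr rfl fun j _ => ?_
  rw [diffAt_insertNth hg, insertAt_apply]

/-- The Cartan formula `b I + I b = ad g`, where `ad g` acts as a derivation on functionals. -/
theorem b_insertion (hg : γ g = g) {k : ℕ} {φ : Fun B (k + 1)} (hφ : IsMultilinear φ)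
    (x : Fin (k + 2) → B) :
    (algOps γ d).b k (insertion g k φ) x + insertion g (k + 1) ((algOps γ d).b (k + 1) φ) x =
      ∑ i, φ (Function.update x i (g * x i - x i * g)) := by
  set F : Fin (k + 2) → Fin (k + 3) → ℂ := fun m j =>
    (-1 : ℂ) ^ (j : ℕ) * insertAt g (k + 1) m.succ (algFace γ (k + 1) j φ) x with hF
  set G : Fin (k + 2) → Fin (k + 1) → ℂ := fun j m =>
    (-1 : ℂ) ^ (j : ℕ) * algFace γ k j (insertAt g k m.succ φ) x with hG
  have hbI : (algOps γ d).b k (insertion g k φ) x = ∑ j, ∑ m, G j m := by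
    simp only [CyclicOps.b, LinearMap.sum_apply, LinearMap.smul_apply, Finset.sum_apply,
      Pi.smul_apply, smul_eq_mul, insertion, map_sum]
    exact Finset.sum_comm
  have hIb : insertion g (k + 1) ((algOps γ d).b (k + 1) φ) x = ∑ m, ∑ j, F m j := by
    simp only [CyclicOps.b, LinearMap.sum_apply, LinearMap.smul_apply, Finset.sum_apply,
      Pi.smul_apply, smul_eq_mul, insertion, map_sum, map_smul, Finset.mul_sum]
    exact Finset.sum_comm
  have hsq : ∀ n : ℕ, (-1 : ℂ) ^ n * (-1) ^ n = 1 := fun n => by rw [← mul_pow]; simp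
  rw [hbI, hIb, add_comm, sum_insert_face]
  · have hR : ∀ m : Fin (k + 2), F m m.castSucc = -φ (Function.update x m (x m * g)) := by
      intro m
      simp only [hF, insertAt_apply]
      rw [algFace_castSucc, contractNth_insertNth_succ, Fin.val_castSucc, Fin.val_succ, pow_succ]
      linear_combination (-φ (Function.update x m (x m * g))) * hsq m
    -- the last face brings the inserted `g` around to the front, which is the term `i = 0`
    have hL : ∑ m : Fin (k + 2), F m m.succ = ∑ m, φ (Function.update x m (g * x m)) := by
      rw [Fin.sum_univ_castSucc]
      conv_rhs => rw [Fin.sum_univ_succ, add_comm]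
      congr 1
      · refine Finset.sum_congr rfl fun m _ => ?_
        simp only [hF, insertAt_apply]
        rw [Fin.succ_castSucc, algFace_castSucc, contractNth_insertNth_castSucc, ← mul_assoc, hsq,
          one_mul]
      · simp only [hF, insertAt_apply]
        obtain ⟨h1, h2⟩ := rot_insertNth_last hg x
        rw [Fin.succ_last, algFace_last, ← mul_assoc, hsq, one_mul, Finset.sum_range_succ,
          Finset.sum_range_one, h1,
          ← Fin.insertNth_zero', ← Fin.castSucc_zero, contractNth_insertNth_castSucc]
        refine add_eq_left.2 (isMultilinear_zero hφ 0 ?_)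
        rw [Fin.contractNth, if_neg (by simp), if_pos (by simp)]
        exact mul_eq_zero_of_left h2 _
    rw [Finset.sum_add_distrib, hL, ← Finset.sum_add_distrib]
    refine Finset.sum_congr rfl fun m _ => ?_
    rw [hR, neg_add_eq_sub]
    obtain ⟨f, rfl⟩ := hφ
    exact (f.map_update_sub _ _ _ _).symm
  · intro j m hjm
    obtain ⟨j, rfl⟩ : ∃ j' : Fin (k + 1), j = j'.castSucc :=
      ⟨j.castLT (lt_of_le_of_lt hjm m.2), rfl⟩
    simp only [hF, hG, insertAt_apply]
    rw [algFace_castSucc, algFace_castSucc, insertAt_apply,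
      contractNth_insertNth_of_lt (lt_of_le_of_lt hjm (Fin.castSucc_lt_succ))]
    simp only [Fin.val_castSucc, Fin.val_succ, pow_succ]
    ring
  · intro j m hjm
    have hle : m.succ ≤ j := by
      simp only [Fin.lt_def, Fin.le_def, Fin.val_castSucc, Fin.val_succ] at *; omega
    simp only [hF, hG, insertAt_apply]
    cases j using Fin.lastCases with
    | last =>
      rw [Fin.succ_last, algFace_last, algFace_last]
      simp only [insertAt_apply]
      rw [Finset.mul_sum, Finset.mul_sum, Finset.mul_sum, ← Finset.sum_neg_distrib]
      refine Finset.sum_congr rfl fun e _ => ?_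
      rw [Fin.succ_castSucc, rot_insertNth hg, ← Fin.castSucc_zero,
        contractNth_insertNth_of_lt (Fin.succ_pos m)]
      simp only [Fin.val_castSucc, Fin.val_succ, Fin.val_last, Nat.succ_eq_add_one, pow_succ]
      ring
    | cast j =>
      rw [Fin.succ_castSucc, Fin.succ_castSucc, algFace_castSucc, algFace_castSucc, insertAt_apply,
        ← Fin.succ_castSucc j, contractNth_insertNth_of_le hle]
      simp only [Fin.val_castSucc, Fin.val_succ, pow_succ]
      ring

theorem insertAt_lam_castSucc (hg : γ g = g) {k : ℕ} (q : Fin (k + 1)) (φ : Fun B (k + 1)) :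
    insertAt g k q.castSucc ((algOps γ d).lam (k + 1) φ) =
      (algOps γ d).lam k (insertAt g k q.succ φ) := by
  ext x
  change (-1 : ℂ) ^ (q : ℕ) * ((-1 : ℂ) ^ (k + 1) * algCyc γ (k + 1) φ _) =
    (-1 : ℂ) ^ k * algCyc γ k (insertAt g k q.succ φ) x
  simp only [algCyc_apply, insertAt_apply, rot_insertNth hg]
  rw [Finset.mul_sum, Finset.mul_sum, Finset.mul_sum]
  refine Finset.sum_congr rfl fun e _ => ?_
  rw [Fin.val_succ]
  ring

theorem norm_insertAt_lam_pow (hs : IsSuperDG γ d) (hg : γ g = g) {k : ℕ} (i : Fin (k + 2))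
    {φ : Fun B (k + 1)} (hφ : IsMultilinear φ) :
    (algOps γ d).norm k (insertAt g k 0 (((algOps γ d).lam (k + 1) ^ (i : ℕ)) φ)) =
      (algOps γ d).norm k (insertAt g k i φ) := by
  have hC := isCocyclic_multilinear hs
  induction i using Fin.induction generalizing φ with
  | zero => rfl
  | succ q ih =>
    rw [Fin.val_succ, pow_succ, Module.End.mul_apply, ← Fin.val_castSucc, ih (hC.lam_mem hφ),
      insertAt_lam_castSucc hg, hC.norm_lam (hφ.insertAt _)]

/-- Insertion in front of a cyclically averaged functional is, after averaging, insertion at all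
positions, the first one included. -/
theorem norm_insertAt_norm (hs : IsSuperDG γ d) (hg : γ g = g) {k : ℕ} {φ : Fun B (k + 1)}
    (hφ : IsMultilinear φ) :
    (algOps γ d).norm k (insertAt g k 0 ((algOps γ d).norm (k + 1) φ)) =
      (algOps γ d).norm k (insertAt g k 0 φ + insertion g k φ) := by
  have h1 : insertAt g k 0 φ + insertion g k φ = ∑ i : Fin (k + 2), insertAt g k i φ := by
    rw [Fin.sum_univ_succ, insertion, LinearMap.sum_apply]
  have h2 : (algOps γ d).norm (k + 1) φ =
      ∑ i : Fin (k + 2), ((algOps γ d).lam (k + 1) ^ (i : ℕ)) φ := by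
    rw [CyclicOps.norm, LinearMap.sum_apply, Finset.sum_range]
  rw [h1, h2, map_sum, map_sum, map_sum]
  exact Finset.sum_congr rfl fun i _ => norm_insertAt_lam_pow hs hg i hφ

/-- On cyclic functionals the insertions at the various positions are permuted by the cyclic
operator. -/
theorem insertion_of_cyclic (hs : IsSuperDG γ d) (hg : γ g = g) {k : ℕ} {φ : Fun B (k + 1)}
    (hφ : IsMultilinear φ) (hlam : (algOps γ d).lam (k + 1) φ = φ) :
    insertion g k φ = (algOps γ d).norm k (insertAt g k 0 φ) := by
  have h1 : ∀ m : Fin (k + 2),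
      ((algOps γ d).lam k ^ (m : ℕ)) (insertAt g k m φ) = insertAt g k 0 φ := by
    intro m
    induction m using Fin.induction with
    | zero => rfl
    | succ q ih =>
      rw [Fin.val_succ, pow_succ, Module.End.mul_apply, ← insertAt_lam_castSucc hg, hlam]
      exact ih
  rw [insertion, CyclicOps.norm, LinearMap.sum_apply, LinearMap.sum_apply, Finset.sum_range,
    ← Equiv.sum_comp Fin.revPerm]
  refine Finset.sum_congr rfl fun m _ => ?_
  rw [← h1 (Fin.revPerm m).succ, ← Module.End.mul_apply, ← pow_add]
  have h2 : (m : ℕ) + ((Fin.revPerm m).succ : ℕ) = k + 1 := by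
    rw [Fin.val_succ, Fin.revPerm_apply, Fin.val_rev]
    omega
  rw [h2, (isCocyclic_multilinear hs).lam_pow (hφ.insertAt _)]

theorem lam_insertion_of_cyclic (hs : IsSuperDG γ d) (hg : γ g = g) {k : ℕ} {φ : Fun B (k + 1)}
    (hφ : IsMultilinear φ) (hlam : (algOps γ d).lam (k + 1) φ = φ) :
    (algOps γ d).lam k (insertion g k φ) = insertion g k φ := by
  rw [insertion_of_cyclic hs hg hφ hlam, (isCocyclic_multilinear hs).lam_norm (hφ.insertAt _)]

theorem normalized_apply {k : ℕ} {φ : Fun B (k + 1)} (hφ : φ ∈ (algOps γ d).normalized (k + 1))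
    {y : Fin (k + 2) → B} {p : Fin (k + 1)} (hy : y p.succ = 1) : φ y = 0 := by
  have h1 := congr_fun ((Submodule.mem_iInf _).1 hφ p) (Fin.removeNth p.succ y)
  rw [← Fin.insertNth_self_removeNth p.succ y, hy]
  exact h1

theorem insertion_normalized {k : ℕ} {φ : Fun B (k + 1)}
    (hφ : φ ∈ (algOps γ d).normalized (k + 1)) :
    insertion g k φ ∈ (algOps γ d).normalized k := by
  cases k with
  | zero => trivial
  | succ k =>
    refine (Submodule.mem_iInf _).2 fun j => ?_
    ext a
    change insertion g (k + 1) φ (Fin.insertNth (α := fun _ => B) j.succ (1 : B) a) = 0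
    rw [insertion_apply]
    refine Finset.sum_eq_zero fun m _ => ?_
    rw [insertAt_apply, normalized_apply hφ (p := m.succAbove j), mul_zero]
    rw [← Fin.succ_succAbove_succ, Fin.insertNth_apply_succAbove, Fin.insertNth_apply_same]

/-- On normalized functionals `B` simplifies to `N s` with the extra degeneracy `s`. -/
theorem B_of_normalized (hs : IsSuperDG γ d) {k : ℕ} {φ : Fun B (k + 1)} (hm : IsMultilinear φ)
    (hφ : φ ∈ (algOps γ d).normalized (k + 1)) :
    (algOps γ d).B k φ = (algOps γ d).norm k ((algOps γ d).extra k φ) := by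
  have h1 : (algOps γ d).extra k ((algOps γ d).lam (k + 1) φ) = 0 := by
    ext a
    rw [algOps_extra_apply hs.sign_one ((isCocyclic_multilinear hs).lam_mem hm)]
    change (-1 : ℂ) ^ (k + 1) * algCyc γ (k + 1) φ _ = 0
    rw [algCyc_apply, Finset.sum_eq_zero, mul_zero]
    intro e _
    rw [← Fin.insertNth_zero', ← Fin.castSucc_zero, rot_insertNth hs.sign_one]
    exact normalized_apply hφ (p := 0) (Fin.insertNth_apply_same _ _ _)
  change (algOps γ d).norm k ((algOps γ d).extra k (φ - (algOps γ d).lam (k + 1) φ)) = _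
  rw [map_sub, h1, sub_zero]

theorem extra_insertion (hs : IsSuperDG γ d) {k : ℕ} {φ : Fun B (k + 2)} (hφ : IsMultilinear φ) :
    (algOps γ d).extra k (insertion g (k + 1) φ) =
      -(insertAt g k 0 ((algOps γ d).extra (k + 1) φ) +
        insertion g k ((algOps γ d).extra (k + 1) φ)) := by
  ext a
  have h1 : insertAt g k 0 ((algOps γ d).extra (k + 1) φ) +
        insertion g k ((algOps γ d).extra (k + 1) φ) =
      ∑ i : Fin (k + 2), insertAt g k i ((algOps γ d).extra (k + 1) φ) := by
    rw [Fin.sum_univ_succ, insertion, LinearMap.sum_apply]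
  rw [h1, algOps_extra_apply hs.sign_one hφ.insertion, insertion_apply, Pi.neg_apply,
    Finset.sum_apply, ← Finset.sum_neg_distrib]
  refine Finset.sum_congr rfl fun i _ => ?_
  rw [insertAt_apply, insertAt_apply, algOps_extra_apply hs.sign_one hφ, Fin.insertNth_succ_cons,
    Fin.val_succ, pow_succ]
  ring

/-- Insertion of an even element anticommutes with `B` on normalized functionals. -/
theorem B_insertion (hs : IsSuperDG γ d) (hg : γ g = g) {k : ℕ} {φ : Fun B (k + 2)}
    (hm : IsMultilinear φ) (hφ : φ ∈ (algOps γ d).normalized (k + 2)) :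
    (algOps γ d).B k (insertion g (k + 1) φ) = -insertion g k ((algOps γ d).B (k + 1) φ) := by
  have hC := isCocyclic_multilinear hs
  have he : IsMultilinear ((algOps γ d).extra (k + 1) φ) := hC.extra_mem hm
  rw [B_of_normalized hs hm.insertion (insertion_normalized hφ), extra_insertion hs hm, map_neg,
    ← norm_insertAt_norm hs hg he, B_of_normalized hs hm hφ,
    insertion_of_cyclic hs hg (hC.norm_mem he) (hC.lam_norm he)]

end Insertion

/-! ### The algebra with a unit adjoined -/

section UnitGrading

variable {A : Type v} [Ring A] [Algebra ℂ A] (𝒜 : ℕ → Submodule ℂ A) [GradedAlgebra 𝒜]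

/-- The projections of `ℂ ⊕ A` onto its homogeneous components. -/
def unitProj (n : ℕ) : Unitization ℂ A →ₗ[ℂ] Unitization ℂ A where
  toFun x := Unitization.inl (if n = 0 then x.fst else 0) + Unitization.inr (component 𝒜 n x.snd)
  map_add' x y := by ext <;> simp; split_ifs <;> simp
  map_smul' c x := by ext <;> simp

theorem unitProj_fst (n : ℕ) (x : Unitization ℂ A) :
    (unitProj 𝒜 n x).fst = if n = 0 then x.fst else 0 := by simp [unitProj]

theorem unitProj_snd (n : ℕ) (x : Unitization ℂ A) :
    (unitProj 𝒜 n x).snd = component 𝒜 n x.snd := by simp [unitProj]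

theorem unitProj_of_mem (n : ℕ) (x : Unitization ℂ A) (hx : x ∈ unitGrading 𝒜 n) :
    unitProj 𝒜 n x = x := by
  ext
  · rw [unitProj_fst]
    split_ifs with h
    · rfl
    · exact (hx.1 h).symm
  · rw [unitProj_snd, component_of_mem 𝒜 hx.2]

theorem unitProj_of_mem_ne (m n : ℕ) (h : m ≠ n) (x : Unitization ℂ A) (hx : x ∈ unitGrading 𝒜 n) :
    unitProj 𝒜 m x = 0 := by
  ext
  · rw [unitProj_fst]
    split_ifs with h'
    · exact hx.1 (by omega)
    · rfl
  · rw [unitProj_snd, component_of_mem_ne 𝒜 h hx.2]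
    rfl

theorem unitGrading_isInternal : DirectSum.IsInternal (unitGrading 𝒜) := by
  refine isInternal_of_projections (unitProj 𝒜) (fun n x => ⟨fun h => ?_, ?_⟩) (unitProj_of_mem 𝒜)
    (unitProj_of_mem_ne 𝒜) fun x => ?_
  · rw [unitProj_fst, if_neg h]
  · rw [unitProj_snd]
    exact component_mem 𝒜 n _
  · obtain ⟨N, hN⟩ := exists_sum_component 𝒜 x.snd
    refine ⟨N + 1, ?_⟩
    have hf : ∀ s : Finset ℕ, (∑ n ∈ s, unitProj 𝒜 n x).fst = ∑ n ∈ s, (unitProj 𝒜 n x).fst :=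
      fun s => map_sum (Unitization.fstHom ℂ A) _ s
    have hs : ∀ s : Finset ℕ, (∑ n ∈ s, unitProj 𝒜 n x).snd = ∑ n ∈ s, (unitProj 𝒜 n x).snd :=
      fun s => map_sum (Unitization.sndHom ℂ ℂ A) _ s
    ext
    · rw [hf]
      simp [unitProj_fst]
    · rw [hs]
      simp only [unitProj_snd]
      exact hN (N + 1) (Nat.le_succ N)

instance unitGradedMonoid : SetLike.GradedMonoid (unitGrading 𝒜) where
  one_mem := ⟨fun h => absurd rfl h, by simp⟩
  mul_mem := by
    rintro m n x y ⟨hx, hx'⟩ ⟨hy, hy'⟩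
    refine ⟨fun h => ?_, ?_⟩
    · rw [Unitization.fst_mul]
      rcases eq_or_ne m 0 with rfl | hm
      · rw [hy (by omega), mul_zero]
      · rw [hx hm, zero_mul]
    · rw [Unitization.snd_mul]
      refine (𝒜 _).add_mem ((𝒜 _).add_mem ?_ ?_) (SetLike.mul_mem_graded hx' hy')
      · rcases eq_or_ne m 0 with rfl | hm
        · rw [zero_add]
          exact (𝒜 n).smul_mem _ hy'
        · rw [hx hm, zero_smul]
          exact Submodule.zero_mem _
      · rcases eq_or_ne n 0 with rfl | hn
        · exact (𝒜 m).smul_mem _ hx'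
        · rw [hy hn, zero_smul]
          exact Submodule.zero_mem _

instance unitGradedAlgebra : GradedAlgebra (unitGrading 𝒜) :=
  { unitGradedMonoid 𝒜, (unitGrading_isInternal 𝒜).chooseDecomposition with }

theorem component_unitGrading (n : ℕ) : component (unitGrading 𝒜) n = unitProj 𝒜 n :=
  component_eq_of_projections (unitProj 𝒜) (unitProj_of_mem 𝒜) (unitProj_of_mem_ne 𝒜) n

theorem gradeSign_unitGrading : gradeSign (unitGrading 𝒜) = unitSign (gradeSign 𝒜) := by
  refine linearMap_ext_graded (unitGrading 𝒜) fun n x hx => ?_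
  rw [gradeSign_of_mem _ hx]
  ext
  · rcases eq_or_ne n 0 with rfl | hn
    · simp [unitSign]
    · simp [unitSign, hx.1 hn]
  · simp [unitSign, gradeSign_of_mem 𝒜 hx.2]

variable {𝒜} {d : A →ₗ[ℂ] A}

theorem unitDiff_fst (x : Unitization ℂ A) : (unitDiff d x).fst = 0 := by simp [unitDiff]

theorem unitDiff_snd (x : Unitization ℂ A) : (unitDiff d x).snd = d x.snd := by simp [unitDiff]

theorem IsDGAlgebra.unit (hd : IsDGAlgebra 𝒜 d) : IsDGAlgebra (unitGrading 𝒜) (unitDiff d) where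
  map_deg n x hx := ⟨fun _ => unitDiff_fst x, by rw [unitDiff_snd]; exact hd.map_deg n _ hx.2⟩
  d_d x := by
    ext
    · rw [unitDiff_fst]; rfl
    · rw [unitDiff_snd, unitDiff_snd, hd.d_d]; rfl
  leibniz n x hx y := by
    ext
    · simp [unitDiff_fst]
    · simp only [unitDiff_snd, unitDiff_fst, Unitization.snd_mul, Unitization.snd_add,
        Unitization.snd_smul, map_add, map_smul, hd.leibniz n _ hx.2]
      rcases eq_or_ne n 0 with rfl | hn
      · simp only [pow_zero, one_smul, zero_smul, zero_add, add_zero]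
        abel
      · simp only [hx.1 hn, zero_smul, zero_add, add_zero]
        abel

variable [TopologicalSpace A]

/-- The product topology on `ℂ ⊕ A` for the discrete topology of `ℂ`.  Scalar multiplication need
not be continuous on `A` for the usual topology of `ℂ`; for the discrete one `(z, a) ↦ z 1 + a` is
continuous. -/
abbrev unitDiscrete (A : Type v) [TopologicalSpace A] : TopologicalSpace (Unitization ℂ A) :=
  @TopologicalSpace.induced _ (ℂ × A) (fun x => (x.fst, x.snd))
    (@instTopologicalSpaceProd ℂ A ⊥ inferInstance)

/-- The functionals on `ℂ ⊕ A` which are continuous for the discrete topology of `ℂ` and of bounded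
weight. -/
def unitCochain (𝒜 : ℕ → Submodule ℂ A) (k : ℕ) : Submodule ℂ (Fun (Unitization ℂ A) k) :=
  @algCochain (Unitization ℂ A) _ _ (unitDiscrete A) (unitGrading 𝒜) k

omit [Ring A] [Algebra ℂ A] in
theorem continuous_unitDiscrete_iff {X : Type*} [TopologicalSpace X] {f : X → Unitization ℂ A} :
    @Continuous X _ _ (unitDiscrete A) f ↔
      @Continuous X ℂ _ ⊥ (fun x => (f x).fst) ∧ Continuous fun x => (f x).snd := by
  let : TopologicalSpace ℂ := ⊥
  rw [continuous_induced_rng]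
  exact continuous_prodMk

omit [Ring A] [Algebra ℂ A] in
theorem continuous_unitDiscrete_fst :
    @Continuous (Unitization ℂ A) ℂ (unitDiscrete A) ⊥ fun x => x.fst := by
  let τ := unitDiscrete A
  exact (continuous_unitDiscrete_iff.1 continuous_id).1

omit [Ring A] [Algebra ℂ A] in
theorem continuous_unitDiscrete_snd :
    @Continuous (Unitization ℂ A) A (unitDiscrete A) _ fun x => x.snd := by
  let τ := unitDiscrete A
  exact (continuous_unitDiscrete_iff.1 continuous_id).2

theorem continuous_unitDiscrete_algebraMap :
    @Continuous (Unitization ℂ A) A (unitDiscrete A) _ fun x => algebraMap ℂ A x.fst := by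
  let τ := unitDiscrete A
  let : TopologicalSpace ℂ := ⊥
  have : DiscreteTopology ℂ := ⟨rfl⟩
  exact continuous_of_discreteTopology.comp continuous_unitDiscrete_fst

theorem isTopologicalRing_unitDiscrete [IsTopologicalRing A] :
    @IsTopologicalRing (Unitization ℂ A) (unitDiscrete A) _ := by
  let τ := unitDiscrete A
  let : TopologicalSpace ℂ := ⊥
  have : DiscreteTopology ℂ := ⟨rfl⟩
  have h1 : Continuous fun x : Unitization ℂ A => x.fst := continuous_unitDiscrete_fst
  have h2 : Continuous fun x : Unitization ℂ A => x.snd := continuous_unitDiscrete_snd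
  have h3 : Continuous fun x : Unitization ℂ A => algebraMap ℂ A x.fst :=
    continuous_unitDiscrete_algebraMap
  have hop : ∀ op : ℂ → ℂ → ℂ, Continuous fun p : Unitization ℂ A × Unitization ℂ A =>
      op p.1.fst p.2.fst := fun op =>
    (continuous_of_discreteTopology (f := fun z : ℂ × ℂ => op z.1 z.2)).comp
      ((h1.comp continuous_fst).prodMk (h1.comp continuous_snd))
  exact
    { continuous_add := continuous_unitDiscrete_iff.2
        ⟨hop (· + ·), (h2.comp continuous_fst).add (h2.comp continuous_snd)⟩
      continuous_mul := by
        refine continuous_unitDiscrete_iff.2 ⟨hop (· * ·), ?_⟩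
        simp only [Unitization.snd_mul, Algebra.smul_def]
        exact (((h3.comp continuous_fst).mul (h2.comp continuous_snd)).add
          ((h3.comp continuous_snd).mul (h2.comp continuous_fst))).add
          ((h2.comp continuous_fst).mul (h2.comp continuous_snd))
      continuous_neg := continuous_unitDiscrete_iff.2
        ⟨(continuous_of_discreteTopology (f := fun z : ℂ => -z)).comp h1, h2.neg⟩ }

theorem IsTopDGAlgebra.unit (hd : IsTopDGAlgebra 𝒜 d) :
    @IsTopDGAlgebra (Unitization ℂ A) _ _ (unitDiscrete A) (unitGrading 𝒜) _ (unitDiff d) := by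
  let τ := unitDiscrete A
  let : TopologicalSpace ℂ := ⊥
  have : DiscreteTopology ℂ := ⟨rfl⟩
  have h1 : Continuous fun x : Unitization ℂ A => x.fst := continuous_unitDiscrete_fst
  have h2 : Continuous fun x : Unitization ℂ A => x.snd := continuous_unitDiscrete_snd
  refine { toIsDGAlgebra := hd.toIsDGAlgebra.unit, continuous_d := ?_, continuous_component := ?_ }
  · refine continuous_unitDiscrete_iff.2 ⟨?_, ?_⟩
    · simp only [unitDiff_fst]
      exact continuous_const
    · simp only [unitDiff_snd]
      exact hd.continuous_d.comp h2
  · intro n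
    change Continuous fun x => component (unitGrading 𝒜) n x
    rw [component_unitGrading]
    refine continuous_unitDiscrete_iff.2 ⟨?_, ?_⟩
    · simp only [unitProj_fst]
      split_ifs
      · exact h1
      · exact continuous_const
    · simp only [unitProj_snd]
      exact (hd.continuous_component n).comp h2

theorem isCocyclic_unit [IsTopologicalRing A] (hd : IsTopDGAlgebra 𝒜 d) :
    (unitOps 𝒜 d).IsCocyclic (unitCochain 𝒜) := by
  let τ := unitDiscrete A
  have : IsTopologicalRing (Unitization ℂ A) := isTopologicalRing_unitDiscrete
  rw [unitOps, ← gradeSign_unitGrading]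
  exact isCocyclic_algOps hd.unit

/-- Pull-back along a slotwise map from `ℂ ⊕ A` to a graded topological algebra, continuous for the
discrete topology of `ℂ`. -/
theorem comp_mem_unitCochain [IsTopologicalRing A] (hd : IsTopDGAlgebra 𝒜 d) {B : Type*} [Ring B]
    [Algebra ℂ B] [TopologicalSpace B] {ℬ : ℕ → Submodule ℂ B} {k : ℕ}
    (L : Fin (k + 1) → Unitization ℂ A →ₗ[ℂ] B)
    (hL : ∀ i p, ∀ x ∈ unitGrading 𝒜 p, L i x ∈ ℬ p)
    (hLc : ∀ i, @Continuous _ _ (unitDiscrete A) _ (L i))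
    {φ : Fun B k} (hφ : φ ∈ algCochain ℬ k) :
    (fun a => φ fun i => L i (a i)) ∈ unitCochain 𝒜 k := by
  let τ := unitDiscrete A
  have hc : ∀ n, Continuous (component (unitGrading 𝒜) n) := hd.unit.continuous_component
  exact (IsGradedMap.pi (ℬ := ℬ) L (fun i p x hx => ⟨p, le_rfl, hL i p x hx⟩) fun i p =>
    (hLc i).comp (hc p)).comp_mem hc hφ

/-- Pull-back along `A → ℂ ⊕ A`. -/
theorem inr_comp_mem [IsTopologicalRing A] (hd : IsTopDGAlgebra 𝒜 d) {k : ℕ}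
    {φ : Fun (Unitization ℂ A) k} (hφ : φ ∈ unitCochain 𝒜 k) :
    pull (Unitization.inrHom ℂ ℂ A) k φ ∈ algCochain 𝒜 k := by
  let τ := unitDiscrete A
  have hc : ∀ n, Continuous (component 𝒜 n) := hd.continuous_component
  refine (IsGradedMap.pi (ℬ := unitGrading 𝒜) (fun _ => Unitization.inrHom ℂ ℂ A)
    (fun i p a ha => ⟨p, le_rfl, fun _ => rfl, ha⟩) fun i p => ?_).comp_mem hc hφ
  let τ' : TopologicalSpace ℂ := ⊥
  exact continuous_unitDiscrete_iff.2 ⟨continuous_const, hc p⟩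

end UnitGrading

/-! ### The rotation homotopy -/

section Rotation

variable {A : Type v} [Ring A] [Algebra ℂ A]

/-- The coefficients of `i_t (z, a) = z + s² a E₁₁ - s c a (E₁₂ + E₂₁) + c² a E₂₂`, where
`s = sin t` and `c = cos t`. -/
def rotCoeff (t : ℝ) : Fin 4 → ℂ :=
  ![1, (Real.sin t : ℂ) ^ 2, -(Real.sin t * Real.cos t : ℂ), (Real.cos t : ℂ) ^ 2]

/-- The derivatives of the coefficients. -/
def rotCoeff' (t : ℝ) : Fin 4 → ℂ :=
  ![0, 2 * (Real.sin t * Real.cos t : ℂ), (Real.sin t : ℂ) ^ 2 - (Real.cos t : ℂ) ^ 2,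
    -2 * (Real.sin t * Real.cos t : ℂ)]

/-- The linear maps of which `i_t` is a combination with coefficients depending on `t`. -/
def rotPart : Fin 4 → Unitization ℂ A →ₗ[ℂ] M₂ A :=
  ![Algebra.linearMap ℂ (M₂ A) ∘ₗ (Unitization.fstHom ℂ A).toLinearMap,
    Matrix.singleLinearMap ℂ 0 0 ∘ₗ Unitization.sndHom ℂ ℂ A,
    (Matrix.singleLinearMap ℂ 0 1 + Matrix.singleLinearMap ℂ 1 0) ∘ₗ Unitization.sndHom ℂ ℂ A,
    Matrix.singleLinearMap ℂ 1 1 ∘ₗ Unitization.sndHom ℂ ℂ A]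

/-- The map `i_t` as a linear map. -/
def rotMap (A : Type v) [Ring A] [Algebra ℂ A] (t : ℝ) : Unitization ℂ A →ₗ[ℂ] M₂ A :=
  ∑ l, rotCoeff t l • rotPart l

theorem rotMap_apply (t : ℝ) (x : Unitization ℂ A) : rotMap A t x =
    !![x.fst • 1 + (Real.sin t : ℂ) ^ 2 • x.snd, -(Real.sin t * Real.cos t : ℂ) • x.snd;
      -(Real.sin t * Real.cos t : ℂ) • x.snd, x.fst • 1 + (Real.cos t : ℂ) ^ 2 • x.snd] := by
  ext i j
  fin_cases i <;> fin_cases j <;>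
    simp [rotMap, Fin.sum_univ_four, rotCoeff, rotPart, Algebra.algebraMap_eq_smul_one]

theorem iMap_eq (t : ℝ) (x : Unitization ℂ A) : iMap t x = rotMap A t x := by
  rw [rotMap_apply, iMap, uMat, uMat, Real.cos_neg, Real.sin_neg, Matrix.mul_fin_two,
    Matrix.mul_fin_two]
  ext i j
  fin_cases i <;> fin_cases j <;>
    simp [Algebra.algebraMap_eq_smul_one, smul_smul, sq, mul_comm]

theorem rotMap_one (t : ℝ) : rotMap A t 1 = 1 := by
  rw [rotMap_apply]
  ext i j
  fin_cases i <;> fin_cases j <;> simp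

theorem uMat_neg_mul (t : ℝ) : uMat A (-t) * uMat A t = 1 := by
  rw [uMat, uMat, Real.cos_neg, Real.sin_neg, Matrix.mul_fin_two]
  ext i j
  fin_cases i <;> fin_cases j <;>
    simp [Algebra.algebraMap_eq_smul_one, smul_smul, ← add_smul, mul_comm] <;>
    simp [← sq, add_comm]

theorem rotMap_mul (t : ℝ) (x y : Unitization ℂ A) :
    rotMap A t (x * y) = rotMap A t x * rotMap A t y := by
  set E : A → M₂ A := fun a => !![0, 0; 0, a] with hE
  have hadd : ∀ a b, E (a + b) = E a + E b := by
    intro a b; ext i j; fin_cases i <;> fin_cases j <;> simp [hE]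
  have hsmul : ∀ (z : ℂ) a, E (z • a) = z • E a := by
    intro z a; ext i j; fin_cases i <;> fin_cases j <;> simp [hE]
  have hmul : ∀ a b, E (a * b) = E a * E b := by
    intro a b; rw [hE]; simp
  have hi : ∀ x : Unitization ℂ A,
      rotMap A t x = x.fst • 1 + uMat A t * E x.snd * uMat A (-t) := by
    intro x
    rw [← iMap_eq, iMap, Algebra.algebraMap_eq_smul_one]
  have h2 : ∀ a b, uMat A t * E a * uMat A (-t) * (uMat A t * E b * uMat A (-t)) =
      uMat A t * E (a * b) * uMat A (-t) := by
    intro a b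
    rw [hmul]
    calc _ = uMat A t * E a * (uMat A (-t) * uMat A t) * E b * uMat A (-t) := by
          simp only [mul_assoc]
      _ = _ := by rw [uMat_neg_mul, mul_one]; simp only [mul_assoc]
  rw [hi, hi, hi, Unitization.fst_mul, Unitization.snd_mul, hadd, hadd, hsmul, hsmul]
  simp only [mul_add, add_mul, mul_smul_comm, smul_mul_assoc, one_mul, mul_one, h2]
  module

theorem rotMap_sign (γ : A →ₗ[ℂ] A) (h1 : γ 1 = 1) (t : ℝ) (x : Unitization ℂ A) :
    rotMap A t (unitSign γ x) = entrywise γ (rotMap A t x) := by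
  ext i j
  rw [entrywise_apply, rotMap_apply, rotMap_apply]
  fin_cases i <;> fin_cases j <;> simp [unitSign, h1]

theorem rotMap_diff (d : A →ₗ[ℂ] A) (h1 : d 1 = 0) (t : ℝ) (x : Unitization ℂ A) :
    rotMap A t (unitDiff d x) = entrywise d (rotMap A t x) := by
  ext i j
  rw [entrywise_apply, rotMap_apply, rotMap_apply]
  fin_cases i <;> fin_cases j <;> simp [unitDiff, h1]

/-- `i_t` is a unital homomorphism of DG algebras, the rotations being even and closed. -/
theorem isCyclicMap_rotMap {γ d : A →ₗ[ℂ] A} (hs : IsSuperDG γ d) (t : ℝ) :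
    IsCyclicMap (algOps (entrywise γ) (entrywise d)) (algOps (unitSign γ) (unitDiff d))
      (pull (rotMap A t)) :=
  isCyclicMap_pull (rotMap_one t) (rotMap_mul t) (rotMap_sign γ hs.sign_one t)
    (rotMap_diff d hs.d_one t)

/-- `i_t` satisfies the differential equation of conjugation by `exp (t g)`. -/
theorem sum_rotCoeff' (t : ℝ) (x : Unitization ℂ A) : ∑ l, rotCoeff' t l • rotPart l x =
    gMat A * rotMap A t x - rotMap A t x * gMat A := by
  rw [rotMap_apply, gMat, Matrix.mul_fin_two, Matrix.mul_fin_two]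
  ext i j
  fin_cases i <;> fin_cases j <;>
    simp [Fin.sum_univ_four, rotCoeff', rotPart] <;> module

theorem hasDerivAt_rotCoeff (t : ℝ) (l : Fin 4) :
    HasDerivAt (fun t => rotCoeff t l) (rotCoeff' t l) t := by
  have hs : HasDerivAt (fun t : ℝ => (Real.sin t : ℂ)) (Real.cos t : ℂ) t :=
    (Real.hasDerivAt_sin t).ofReal_comp
  have hc : HasDerivAt (fun t : ℝ => (Real.cos t : ℂ)) (-Real.sin t : ℂ) t := by
    simpa using (Real.hasDerivAt_cos t).ofReal_comp
  fin_cases l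
  · exact hasDerivAt_const t 1
  · refine (hs.pow 2).congr_deriv ?_
    simp [rotCoeff']; ring
  · refine (hs.mul hc).neg.congr_deriv ?_
    simp [rotCoeff']; ring
  · refine (hc.pow 2).congr_deriv ?_
    simp [rotCoeff']; ring

theorem continuous_rotCoeff (l : Fin 4) : Continuous fun t => rotCoeff t l :=
  continuous_iff_continuousAt.2 fun t => (hasDerivAt_rotCoeff t l).continuousAt

theorem IsMultilinear.rotMap_expand {n : ℕ} {φ : (Fin n → M₂ A) → ℂ} (hφ : IsMultilinear φ)
    (c : Fin n → Fin 4 → ℂ) (x : Fin n → Unitization ℂ A) :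
    φ (fun i => ∑ l, c i l • rotPart l (x i)) =
      ∑ r : Fin n → Fin 4, (∏ i, c i (r i)) * φ fun i => rotPart (r i) (x i) := by
  have h := hφ
  obtain ⟨f, rfl⟩ := hφ
  rw [f.map_sum]
  exact Finset.sum_congr rfl fun r _ => isMultilinear_smul_univ h _ _

theorem rotMap_eq_sum (t : ℝ) (x : Unitization ℂ A) :
    rotMap A t x = ∑ l, rotCoeff t l • rotPart l x := by
  simp [rotMap]

theorem IsMultilinear.continuous_rotMap {n : ℕ} {φ : (Fin n → M₂ A) → ℂ} (hφ : IsMultilinear φ)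
    (x : Fin n → Unitization ℂ A) : Continuous fun t => φ fun i => rotMap A t (x i) := by
  simp only [rotMap_eq_sum, hφ.rotMap_expand fun _ => rotCoeff _]
  exact continuous_finsetSum _ fun r _ =>
    (continuous_finsetProd _ fun i _ => continuous_rotCoeff (r i)).mul continuous_const

/-- The product rule for `i_t^* φ`, whose derivative is the action of `ad g`. -/
theorem IsMultilinear.hasDerivAt_rotMap {n : ℕ} {φ : (Fin n → M₂ A) → ℂ} (hφ : IsMultilinear φ)
    (x : Fin n → Unitization ℂ A) (t : ℝ) :
    HasDerivAt (fun t => φ fun i => rotMap A t (x i))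
      (∑ i, φ (Function.update (fun i => rotMap A t (x i)) i
        (gMat A * rotMap A t (x i) - rotMap A t (x i) * gMat A))) t := by
  -- as a function of the coefficients, `φ` is a multilinear map of finite dimensional spaces
  let L : Fin n → (Fin 4 → ℂ) →ₗ[ℂ] M₂ A := fun i =>
    Fintype.linearCombination ℂ fun l => rotPart l (x i)
  have hL : ∀ i c, L i c = ∑ l, c l • rotPart l (x i) := fun i c => rfl
  have hexp := fun c : Fin n → Fin 4 → ℂ => hφ.rotMap_expand c x
  obtain ⟨f, rfl⟩ := hφ
  let F : ContinuousMultilinearMap ℂ (fun _ : Fin n => Fin 4 → ℂ) ℂ :=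
    ⟨f.compLinearMap L, by
      change Continuous fun c : Fin n → Fin 4 → ℂ => f fun i => L i (c i)
      simp only [hL, hexp]
      fun_prop⟩
  have hF : ∀ c, F c = f fun i => L i (c i) := fun c => rfl
  have h1 : HasDerivAt (fun t => fun _ : Fin n => rotCoeff t) (fun _ => rotCoeff' t) t :=
    hasDerivAt_pi.2 fun _ => hasDerivAt_pi.2 fun l => hasDerivAt_rotCoeff t l
  have h2 := ((F.restrictScalars ℝ).hasFDerivAt fun _ => rotCoeff t).comp_hasDerivAt t h1
  refine (h2.congr_deriv ?_).congr_of_eventuallyEq (Filter.Eventually.of_forall fun t => ?_)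
  · rw [ContinuousMultilinearMap.linearDeriv_apply]
    refine Finset.sum_congr rfl fun i _ => ?_
    change f _ = f _
    congr 1
    ext1 j
    rcases eq_or_ne j i with rfl | h
    · rw [Function.update_self, Function.update_self, hL, sum_rotCoeff']
    · rw [Function.update_of_ne h, Function.update_of_ne h, hL, rotMap_eq_sum]
  · change f _ = f _
    simp only [rotMap_eq_sum]
    rfl

end Rotation

/-! ### Averages of functionals over the rotation -/

section Local

variable {A B C : Type*}

/-- A linear operator between spaces of functions of several variables is local if each value of its
result is a fixed linear combination of values of its argument.  Such operators commute with
integrals over a parameter. -/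
def IsLocal {k m : ℕ} (T : Fun A k →ₗ[ℂ] Fun B m) : Prop :=
  ∀ b, LinearMap.proj b ∘ₗ T ∈
    Submodule.span ℂ (Set.range fun a => (LinearMap.proj a : Fun A k →ₗ[ℂ] ℂ))

namespace IsLocal

variable {k m n : ℕ} {T T' : Fun A k →ₗ[ℂ] Fun B m}

theorem funLeft (f : (Fin (m + 1) → B) → Fin (k + 1) → A) :
    IsLocal (k := k) (m := m) (LinearMap.funLeft ℂ ℂ f) :=
  fun b => Submodule.subset_span ⟨f b, rfl⟩

theorem id : IsLocal (LinearMap.id : Fun A k →ₗ[ℂ] Fun A k) :=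
  fun b => Submodule.subset_span ⟨b, rfl⟩

theorem smul (hT : IsLocal T) (c : ℂ) : IsLocal (c • T) := fun b =>
  Submodule.smul_mem _ c (hT b)

theorem sub (hT : IsLocal T) (hT' : IsLocal T') : IsLocal (T - T') := fun b => by
  rw [LinearMap.comp_sub]
  exact Submodule.sub_mem _ (hT b) (hT' b)

theorem sum {ι : Type*} (s : Finset ι) {T : ι → Fun A k →ₗ[ℂ] Fun B m}
    (hT : ∀ i ∈ s, IsLocal (T i)) : IsLocal (∑ i ∈ s, T i) := fun b => by
  have h1 : LinearMap.proj b ∘ₗ ∑ i ∈ s, T i =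
      ∑ i ∈ s, (LinearMap.proj b : Fun B m →ₗ[ℂ] ℂ) ∘ₗ T i := by
    ext; simp
  rw [h1]
  exact Submodule.sum_mem _ fun i hi => hT i hi b

theorem comp {S : Fun B m →ₗ[ℂ] Fun C n} (hS : IsLocal S) (hT : IsLocal T) :
    IsLocal (S ∘ₗ T) := fun c => by
  rw [← LinearMap.comp_assoc]
  have h1 := hS c
  generalize LinearMap.proj c ∘ₗ S = l at h1 ⊢
  induction h1 using Submodule.span_induction with
  | mem x hx =>
    obtain ⟨b, rfl⟩ := hx
    exact hT b
  | zero => simp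
  | add x y _ _ hx hy =>
    rw [LinearMap.add_comp]
    exact Submodule.add_mem _ hx hy
  | smul c x _ hx =>
    rw [LinearMap.smul_comp]
    exact Submodule.smul_mem _ c hx

theorem pow {T : Module.End ℂ (Fun A k)} (hT : IsLocal T) (j : ℕ) : IsLocal (T ^ j) := by
  induction j with
  | zero => exact IsLocal.id
  | succ j ih => rw [pow_succ']; exact hT.comp ih

theorem integral (hT : IsLocal T) {F : ℝ → Fun A k} (hF : ∀ a, Continuous fun t => F t a)
    (u v : ℝ) : (fun b => ∫ t in u..v, T (F t) b) = T fun a => ∫ t in u..v, F t a := by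
  have key : ∀ l ∈ Submodule.span ℂ (Set.range fun a => (LinearMap.proj a : Fun A k →ₗ[ℂ] ℂ)),
      (Continuous fun t => l (F t)) ∧ ∫ t in u..v, l (F t) = l fun a => ∫ t in u..v, F t a := by
    intro l hl
    induction hl using Submodule.span_induction with
    | mem x hx =>
      obtain ⟨b, rfl⟩ := hx
      exact ⟨hF b, rfl⟩
    | zero => exact ⟨continuous_const, by simp⟩
    | add x y _ _ hx hy =>
      refine ⟨hx.1.add hy.1, ?_⟩
      rw [LinearMap.add_apply, ← hx.2, ← hy.2]
      exact intervalIntegral.integral_add (hx.1.intervalIntegrable u v)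
        (hy.1.intervalIntegrable u v)
    | smul c x _ hx =>
      refine ⟨continuous_const.mul hx.1, ?_⟩
      rw [LinearMap.smul_apply, ← hx.2]
      exact intervalIntegral.integral_const_mul c _
  exact funext fun b => (key _ (hT b)).2

end IsLocal

variable {A : Type v} [Ring A] [Algebra ℂ A] {γ d : A →ₗ[ℂ] A}

theorem isLocal_algFace (k : ℕ) (j : Fin (k + 2)) : IsLocal (algFace γ k j) := by
  rw [algFace]
  split_ifs
  · exact IsLocal.sum _ fun e _ => IsLocal.funLeft _
  · exact IsLocal.funLeft _

theorem isLocal_algCyc (k : ℕ) : IsLocal (algCyc γ k) :=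
  IsLocal.sum _ fun e _ => IsLocal.funLeft (rot γ k e)

theorem isLocal_algDiff (k : ℕ) : IsLocal (algDiff γ d k) :=
  IsLocal.sum _ fun _ _ => IsLocal.funLeft _

theorem isLocal_b (k : ℕ) : IsLocal ((algOps γ d).b k) :=
  IsLocal.sum _ fun j _ => (isLocal_algFace k j).smul _

theorem isLocal_lam (k : ℕ) : IsLocal ((algOps γ d).lam k) := (isLocal_algCyc k).smul _

theorem isLocal_B (k : ℕ) : IsLocal ((algOps γ d).B k) :=
  (IsLocal.sum _ fun j _ => (isLocal_lam k).pow j).comp <|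
    (IsLocal.funLeft _).comp <| (isLocal_algCyc (k + 1)).comp <|
      IsLocal.id.sub (isLocal_lam (k + 1))

end Local

section RotInt

variable {A : Type v} [Ring A] [Algebra ℂ A] {γ d : A →ₗ[ℂ] A}

/-- The average of the pull-backs of a functional along the homomorphisms `i_t`. -/
def rotInt (k : ℕ) (φ : Fun (M₂ A) k) : Fun (Unitization ℂ A) k := fun a =>
  ∫ t in (0 : ℝ)..(Real.pi / 2), pull (rotMap A t) k φ a

theorem kOp_eq (k : ℕ) (φ : Fun (M₂ A) (k + 1)) :
    kOp k φ = rotInt k (insertion (gMat A) k φ) := by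
  ext a
  refine intervalIntegral.integral_congr fun t _ => ?_
  change insertG k φ _ = insertion (gMat A) k φ _
  simp only [iMap_eq]
  rw [insertion_apply]
  rfl

variable {k m : ℕ} {φ ψ : Fun (M₂ A) k}

theorem rotInt_smul (c : ℂ) (φ : Fun (M₂ A) k) : rotInt k (c • φ) = c • rotInt k φ :=
  funext fun _ => intervalIntegral.integral_const_mul c _

theorem rotInt_zero : rotInt k (0 : Fun (M₂ A) k) = 0 := by
  simpa using rotInt_smul 0 (0 : Fun (M₂ A) k)

theorem rotInt_add (hφ : IsMultilinear φ) (hψ : IsMultilinear ψ) :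
    rotInt k (φ + ψ) = rotInt k φ + rotInt k ψ :=
  funext fun a => intervalIntegral.integral_add
    ((hφ.continuous_rotMap a).intervalIntegrable _ _)
    ((hψ.continuous_rotMap a).intervalIntegrable _ _)

/-- Local operators commuting with all `i_t^*` commute with their average. -/
theorem rotInt_local {T : Fun (M₂ A) k →ₗ[ℂ] Fun (M₂ A) m}
    {T' : Fun (Unitization ℂ A) k →ₗ[ℂ] Fun (Unitization ℂ A) m} (hT' : IsLocal T')
    (hφ : IsMultilinear φ)
    (h : ∀ t, pull (rotMap A t) m (T φ) = T' (pull (rotMap A t) k φ)) :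
    rotInt m (T φ) = T' (rotInt k φ) := by
  rw [show rotInt k φ = fun a => ∫ t in (0 : ℝ)..(Real.pi / 2), pull (rotMap A t) k φ a from rfl,
    ← hT'.integral (F := fun t => pull (rotMap A t) k φ) hφ.continuous_rotMap]
  simp only [← h]
  rfl

/-- The average is a finite combination of restrictions along the linear maps `rotPart`, with the
integrals of trigonometric monomials as coefficients; so it inherits continuity and boundedness of
degree. -/
theorem rotInt_eq_sum (hφ : IsMultilinear φ) : rotInt k φ = ∑ r : Fin (k + 1) → Fin 4,
    (∫ t in (0 : ℝ)..(Real.pi / 2), ∏ i, rotCoeff t (r i)) •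
      fun a => φ fun i => rotPart (r i) (a i) := by
  ext a
  change ∫ t in (0 : ℝ)..(Real.pi / 2), φ (fun i => rotMap A t (a i)) = _
  simp only [rotMap_eq_sum, hφ.rotMap_expand fun _ => rotCoeff _]
  rw [intervalIntegral.integral_finsetSum, Finset.sum_apply]
  · exact Finset.sum_congr rfl fun r _ => intervalIntegral.integral_mul_const _ _
  · exact fun r _ => ((continuous_finsetProd _ fun i _ => continuous_rotCoeff (r i)).mul
      continuous_const).intervalIntegrable _ _

/-- The fundamental theorem of calculus for `t ↦ i_t^* φ`. -/
theorem rotInt_commutator (hφ : IsMultilinear φ) :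
    rotInt k (fun x => ∑ i, φ (Function.update x i (gMat A * x i - x i * gMat A))) =
      pull (rotMap A (Real.pi / 2)) k φ - pull (rotMap A 0) k φ := by
  ext a
  refine intervalIntegral.integral_eq_sub_of_hasDerivAt (fun t _ => hφ.hasDerivAt_rotMap a t) ?_
  refine Continuous.intervalIntegrable (continuous_finsetSum _ fun i _ => ?_) _ _
  have h1 : IsMultilinear fun x : Fin (k + 1) → M₂ A =>
      φ (Function.update x i (gMat A * x i - x i * gMat A)) := by
    have h2 := hφ.comp (IsSlotwise.pi fun l : Fin (k + 1) => if l = i then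
      LinearMap.mulLeft ℂ (gMat A) - LinearMap.mulRight ℂ (gMat A) else LinearMap.id)
    convert h2 using 3 with x
    ext1 l
    rcases eq_or_ne l i with rfl | hl
    · simp
    · simp [hl]
  exact h1.continuous_rotMap a

end RotInt

section Cartan

variable {B : Type*} [Ring B] [Algebra ℂ B] {γ d : B →ₗ[ℂ] B} {g : B}

/-- The Cartan formula in degree zero, where the term `b I` is absent. -/
theorem b_insertion_zero (hg : γ g = g) {φ : Fun B 0} (hφ : IsMultilinear φ) (x : Fin 1 → B) :
    insertion g 0 ((algOps γ d).b 0 φ) x =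
      ∑ i, φ (Function.update x i (g * x i - x i * g)) := by
  have h1 : ∀ y : Fin 2 → B, (algOps γ d).b 0 φ y =
      φ (Fin.contractNth (0 : Fin 1).castSucc (· * ·) y) - algCyc γ 1 (algFace γ 0 0 φ) y := by
    intro y
    rw [CyclicOps.b, Fin.sum_univ_two]
    change (-1 : ℂ) ^ 0 * algFace γ 0 (0 : Fin 1).castSucc φ y +
      (-1 : ℂ) ^ 1 * algFace γ 0 (Fin.last 1) φ y = _
    rw [algFace_castSucc, algFace_last_eq]
    ring
  have hf : ∀ y : Fin 2 → B, algFace γ 0 0 φ y = φ fun _ => y 0 * y 1 := by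
    intro y
    refine (algFace_castSucc (γ := γ) (0 : Fin 1) φ y).trans (congrArg φ ?_)
    ext i
    obtain rfl : i = 0 := Subsingleton.elim (α := Fin 1) _ _
    rfl
  have h2 := rot_insertNth_last hg x
  rw [insertion_apply, Fin.sum_univ_one, Fin.sum_univ_one, insertAt_apply, h1, algCyc_apply,
    Finset.sum_range_succ, Finset.sum_range_one, contractNth_insertNth_succ]
  have h3 : algFace γ 0 0 φ (rot γ 1 0 (Fin.insertNth (α := fun _ => B) (Fin.succ 0) g x)) =
      φ (Function.update x 0 (g * x 0)) := by
    rw [hf]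
    refine congrArg φ (funext fun i => ?_)
    obtain rfl : i = 0 := Subsingleton.elim (α := Fin 1) _ _
    rw [Function.update_self]
    exact congrArg₂ (· * ·) (congr_fun h2.1 0) (congr_fun h2.1 1)
  have h4 : algFace γ 0 0 φ (rot γ 1 1 (Fin.insertNth (α := fun _ => B) (Fin.succ 0) g x)) = 0 := by
    rw [hf]
    refine isMultilinear_zero hφ 0 ?_
    exact (congrArg (· * _) h2.2).trans (zero_mul _)
  obtain ⟨f, rfl⟩ := hφ
  rw [h3, h4, f.map_update_sub]
  simp

end Cartan

/-! ### The Cartan homotopy formula -/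

section Homotopy

variable {A : Type v} [Ring A] [Algebra ℂ A] {γ d : A →ₗ[ℂ] A}

theorem entrywise_gMat {f : A →ₗ[ℂ] A} (h : f 1 = 1) : entrywise f (gMat A) = gMat A := by
  ext i j
  rw [entrywise_apply]
  fin_cases i <;> fin_cases j <;> simp [gMat, h]

theorem entrywise_gMat_of_zero {f : A →ₗ[ℂ] A} (h : f 1 = 0) : entrywise f (gMat A) = 0 := by
  ext i j
  rw [entrywise_apply]
  fin_cases i <;> fin_cases j <;> simp [gMat, h]

/-- The sum of all ways to apply the commutator with `g` to one argument. -/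
def adSum (k : ℕ) (φ : Fun (M₂ A) k) : Fun (M₂ A) k := fun x =>
  ∑ i, φ (Function.update x i (gMat A * x i - x i * gMat A))

/-- Insertion of `g` in all components of a family. -/
def famInsertion (F : ∀ _ k : ℕ, Fun (M₂ A) k) : ∀ _ k : ℕ, Fun (M₂ A) k :=
  fun q k => insertion (gMat A) k (F q (k + 1))

theorem total_apply {X : ℕ → Type*} [∀ n, AddCommGroup (X n)] [∀ n, Module ℂ (X n)]
    (O : CyclicOps X) (x : ∀ _ k : ℕ, X k) (q k : ℕ) :
    O.total x q k = O.bPart q k x + O.BPart q k x + (-1 : ℂ) ^ k • O.diff k (x q k) := rfl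

theorem CyclicOps.IsCocyclic.bPart_mem {X : ℕ → Type*} [∀ n, AddCommGroup (X n)]
    [∀ n, Module ℂ (X n)] {O : CyclicOps X} {W : ∀ k, Submodule ℂ (X k)} (hC : O.IsCocyclic W)
    {x : ∀ _ k : ℕ, X k} (hx : ∀ q k, x q k ∈ W k) (q k : ℕ) : O.bPart q k x ∈ W k := by
  cases k with
  | zero => exact zero_mem _
  | succ k => exact hC.b_mem (hx q k)

theorem CyclicOps.IsCocyclic.BPart_mem {X : ℕ → Type*} [∀ n, AddCommGroup (X n)]
    [∀ n, Module ℂ (X n)] {O : CyclicOps X} {W : ∀ k, Submodule ℂ (X k)} (hC : O.IsCocyclic W)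
    {x : ∀ _ k : ℕ, X k} (hx : ∀ q k, x q k ∈ W k) (q k : ℕ) : O.BPart q k x ∈ W k := by
  cases q with
  | zero => exact zero_mem _
  | succ q =>
    change O.norm k (O.extra k (x q (k + 1) - O.lam (k + 1) (x q (k + 1)))) ∈ W k
    exact hC.norm_mem (hC.extra_mem (sub_mem (hx q (k + 1)) (hC.lam_mem (hx q (k + 1)))))

theorem CyclicOps.IsCocyclic.total_apply_mem {X : ℕ → Type*} [∀ n, AddCommGroup (X n)]
    [∀ n, Module ℂ (X n)] {O : CyclicOps X} {W : ∀ k, Submodule ℂ (X k)} (hC : O.IsCocyclic W)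
    {x : ∀ _ k : ℕ, X k} (hx : ∀ q k, x q k ∈ W k) (q k : ℕ) : O.total x q k ∈ W k :=
  add_mem (add_mem (hC.bPart_mem hx q k) (hC.BPart_mem hx q k))
    (Submodule.smul_mem _ _ (hC.diff_mem (hx q k)))

/-- The Cartan homotopy formula: if insertion of `g` anticommutes with `B` on the components of a
family, then the total differential of the insertion is the action of `ad g`. -/
theorem cartan (h1 : γ 1 = 1) (hd1 : d 1 = 0)
    {F : ∀ _ k : ℕ, Fun (M₂ A) k}
    (hF : ∀ q k, IsMultilinear (F q k))
    (hB : ∀ q k,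
      (algOps (entrywise γ) (entrywise d)).B k (insertion (gMat A) (k + 1) (F q (k + 2))) =
      -insertion (gMat A) k ((algOps (entrywise γ) (entrywise d)).B (k + 1) (F q (k + 2))))
    (q k : ℕ) :
    (algOps (entrywise γ) (entrywise d)).total (famInsertion F) q k +
      famInsertion ((algOps (entrywise γ) (entrywise d)).total F) q k = adSum k (F q k) := by
  set O := algOps (entrywise γ) (entrywise d) with hO
  have hg := entrywise_gMat h1
  have hb : O.bPart q k (famInsertion F) + insertion (gMat A) k (O.bPart q (k + 1) F) =
      adSum k (F q k) := by
    cases k with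
    | zero =>
      change 0 + insertion (gMat A) 0 (O.b 0 (F q 0)) = _
      rw [zero_add]
      exact funext fun x => b_insertion_zero hg (hF q 0) x
    | succ k => exact funext fun x => b_insertion hg (hF q (k + 1)) x
  have hB' : O.BPart q k (famInsertion F) + insertion (gMat A) k (O.BPart q (k + 1) F) = 0 := by
    cases q with
    | zero => exact (zero_add _).trans (map_zero _)
    | succ q =>
      change O.B k (insertion (gMat A) (k + 1) (F q (k + 2))) +
        insertion (gMat A) k (O.B (k + 1) (F q (k + 2))) = 0
      rw [hB, neg_add_cancel]
  have hdiff : O.diff k (famInsertion F q k) =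
      insertion (gMat A) k (O.diff (k + 1) (F q (k + 1))) :=
    diff_insertion hg (entrywise_gMat_of_zero hd1) (hF q (k + 1))
  have hI : famInsertion (O.total F) q k = insertion (gMat A) k (O.bPart q (k + 1) F) +
      insertion (gMat A) k (O.BPart q (k + 1) F) -
      (-1 : ℂ) ^ k • insertion (gMat A) k (O.diff (k + 1) (F q (k + 1))) := by
    change insertion (gMat A) k (O.total F q (k + 1)) = _
    rw [total_apply, map_add, map_add, map_smul, pow_succ, mul_neg_one, neg_smul, sub_eq_add_neg]
  rw [total_apply, hI, hdiff, ← hb]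
  linear_combination (exp := 1) hB'

/-- Averaging over the homomorphisms `i_t` is a map of complexes, the total differential being
local. -/
theorem rotInt_total (hs : IsSuperDG γ d) (hsM : IsSuperDG (entrywise γ) (entrywise d))
    {F : ∀ _ k : ℕ, Fun (M₂ A) k} (hF : ∀ q k, IsMultilinear (F q k)) (q k : ℕ) :
    (algOps (unitSign γ) (unitDiff d)).total (fun q k => rotInt k (F q k)) q k =
      rotInt k ((algOps (entrywise γ) (entrywise d)).total F q k) := by
  set O := algOps (entrywise γ) (entrywise d) with hO
  set P := algOps (unitSign γ) (unitDiff d) with hP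
  have hi := isCyclicMap_rotMap hs
  have hC := isCocyclic_multilinear hsM
  have hb : P.bPart q k (fun q k => rotInt k (F q k)) = rotInt k (O.bPart q k F) := by
    cases k with
    | zero => exact rotInt_zero.symm
    | succ k => exact (rotInt_local (isLocal_b k) (hF q k) fun t => (hi t).b k _).symm
  have hB : P.BPart q k (fun q k => rotInt k (F q k)) = rotInt k (O.BPart q k F) := by
    cases q with
    | zero => exact rotInt_zero.symm
    | succ q => exact (rotInt_local (isLocal_B k) (hF q (k + 1)) fun t => (hi t).B k _).symm
  have hd : P.diff k (rotInt k (F q k)) = rotInt k (O.diff k (F q k)) :=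
    (rotInt_local (isLocal_algDiff k) (hF q k) fun t => (hi t).diff k _).symm
  have hbm : IsMultilinear (O.bPart q k F) := hC.bPart_mem hF q k
  have hBm : IsMultilinear (O.BPart q k F) := hC.BPart_mem hF q k
  have hdm : IsMultilinear ((-1 : ℂ) ^ k • O.diff k (F q k)) :=
    IsMultilinear.smul _ (hC.diff_mem (hF q k))
  have hs2 : IsMultilinear (O.bPart q k F + O.BPart q k F) := hbm.add hBm
  rw [total_apply, total_apply, rotInt_add hs2 hdm, rotInt_add hbm hBm, rotInt_smul, hb, hB, hd]

/-- The homotopy between the restrictions along `i_{π/2}` and `i_0`: the average of the action of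
`ad g` is the integral of the derivative of `i_t^*`. -/
theorem total_kOp (hs : IsSuperDG γ d) (hsM : IsSuperDG (entrywise γ) (entrywise d))
    {F : ∀ _ k : ℕ, Fun (M₂ A) k} (hF : ∀ q k, IsMultilinear (F q k))
    (hB : ∀ q k,
      (algOps (entrywise γ) (entrywise d)).B k (insertion (gMat A) (k + 1) (F q (k + 2))) =
      -insertion (gMat A) k ((algOps (entrywise γ) (entrywise d)).B (k + 1) (F q (k + 2)))) :
    (algOps (unitSign γ) (unitDiff d)).total (fun q k => kOp k (F q (k + 1))) +
      (fun q k => kOp k ((algOps (entrywise γ) (entrywise d)).total F q (k + 1))) =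
      totMap (pull (rotMap A (Real.pi / 2))) F - totMap (pull (rotMap A 0)) F := by
  ext1 q
  ext1 k
  have hI : ∀ q k, IsMultilinear (famInsertion F q k) := fun q k => (hF q (k + 1)).insertion
  have hC := isCocyclic_multilinear hsM
  have hTF : IsMultilinear ((algOps (entrywise γ) (entrywise d)).total F q (k + 1)) :=
    hC.total_apply_mem hF q (k + 1)
  have hTI : IsMultilinear (famInsertion ((algOps (entrywise γ) (entrywise d)).total F) q k) :=
    hTF.insertion
  have hc := cartan hs.sign_one hs.d_one hF hB q k
  have hIT : IsMultilinear ((algOps (entrywise γ) (entrywise d)).total (famInsertion F) q k) :=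
    hC.total_apply_mem hI q k
  have h1 := rotInt_total hs hsM hI q k
  simp only [kOp_eq]
  refine (congrArg₂ (· + ·) h1 rfl).trans ?_
  refine (rotInt_add hIT hTI).symm.trans ?_
  rw [hc]
  exact rotInt_commutator (hF q k)

end Homotopy

section Membership

variable {A : Type v} [Ring A] [Algebra ℂ A] {𝒜 : ℕ → Submodule ℂ A} [GradedAlgebra 𝒜]
  {d : A →ₗ[ℂ] A}

theorem gMat_mem : gMat A ∈ matGrading 𝒜 0 := by
  have h1 : (1 : A) ∈ 𝒜 0 := SetLike.GradedOne.one_mem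
  intro i j
  fin_cases i <;> fin_cases j <;> simp [gMat, h1]

theorem rotPart_mem (l : Fin 4) (p : ℕ) (x : Unitization ℂ A) (hx : x ∈ unitGrading 𝒜 p) :
    rotPart l x ∈ matGrading 𝒜 p := by
  obtain ⟨h0, h1⟩ := hx
  have h2 : x.fst • (1 : A) ∈ 𝒜 p := by
    rcases eq_or_ne p 0 with rfl | hp
    · exact (𝒜 0).smul_mem _ SetLike.GradedOne.one_mem
    · rw [h0 hp, zero_smul]
      exact zero_mem _
  intro i j
  fin_cases l <;> fin_cases i <;> fin_cases j <;>
    simp [rotPart, Algebra.algebraMap_eq_smul_one, h1, h2]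

variable [TopologicalSpace A]

theorem continuous_rotPart (l : Fin 4) :
    @Continuous (Unitization ℂ A) (M₂ A) (unitDiscrete A) _ (rotPart l) := by
  let τ := unitDiscrete A
  have h1 : Continuous fun x : Unitization ℂ A => x.snd := continuous_unitDiscrete_snd
  have h2 : Continuous fun x : Unitization ℂ A => x.fst • (1 : A) := by
    simpa only [Algebra.algebraMap_eq_smul_one] using continuous_unitDiscrete_algebraMap
  refine continuous_matrix fun i j => ?_
  fin_cases l <;> fin_cases i <;> fin_cases j <;>
    simp [rotPart, Algebra.algebraMap_eq_smul_one, h1, h2, continuous_const]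

variable [IsTopologicalRing A]

omit [IsTopologicalRing A] in
theorem insertion_mem (hd : IsTopDGAlgebra 𝒜 d) {k : ℕ} {φ : Fun (M₂ A) (k + 1)}
    (hφ : φ ∈ algCochain (matGrading 𝒜) (k + 1)) :
    insertion (gMat A) k φ ∈ algCochain (matGrading 𝒜) k := by
  have hc : ∀ n, Continuous (component (matGrading 𝒜) n) := hd.mat.continuous_component
  rw [insertion, LinearMap.sum_apply]
  exact sum_mem fun j _ => Submodule.smul_mem _ _
    ((isGradedMap_insertNth hc j.succ gMat_mem).comp_mem hc hφ)

theorem rotInt_mem (hd : IsTopDGAlgebra 𝒜 d) {k : ℕ} {φ : Fun (M₂ A) k}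
    (hφ : φ ∈ algCochain (matGrading 𝒜) k) : rotInt k φ ∈ unitCochain 𝒜 k := by
  rw [rotInt_eq_sum (algCochain.isMultilinear hφ)]
  exact sum_mem fun r _ => Submodule.smul_mem _ _ <| comp_mem_unitCochain hd
    (fun i => rotPart (r i)) (fun i => rotPart_mem (r i)) (fun i => continuous_rotPart (r i)) hφ

theorem kOp_mem (hd : IsTopDGAlgebra 𝒜 d) {k : ℕ} {φ : Fun (M₂ A) (k + 1)}
    (hφ : φ ∈ algCochain (matGrading 𝒜) (k + 1)) : kOp k φ ∈ unitCochain 𝒜 k := by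
  rw [kOp_eq]
  exact rotInt_mem hd (insertion_mem hd hφ)

end Membership

/-! ### The endpoints of the homotopy and the comparison of classes -/

section Endpoints

variable {A : Type v} [Ring A] [Algebra ℂ A] {γ d : A →ₗ[ℂ] A}

/-- The homomorphism `(z, a) ↦ z 1 + a` as a linear map. -/
def unitEval (A : Type v) [Ring A] [Algebra ℂ A] : Unitization ℂ A →ₗ[ℂ] A :=
  Algebra.linearMap ℂ A ∘ₗ (Unitization.fstHom ℂ A).toLinearMap + Unitization.sndHom ℂ ℂ A

theorem unitEval_apply (x : Unitization ℂ A) : unitEval A x = algebraMap ℂ A x.fst + x.snd := rfl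

theorem isCyclicMap_unitPull (hs : IsSuperDG γ d) :
    IsCyclicMap (algOps γ d) (algOps (unitSign γ) (unitDiff d)) (unitPull (A := A)) := by
  refine isCyclicMap_pull (i := unitEval A) ?_ ?_ ?_ ?_
  · simp [unitEval_apply]
  · intro x y
    simp only [unitEval_apply, Unitization.fst_mul, Unitization.snd_mul, map_mul,
      Algebra.algebraMap_eq_smul_one, mul_add, add_mul, smul_mul_assoc, one_mul, mul_smul_comm,
      mul_one]
    module
  · intro x
    simp [unitEval_apply, unitSign, Algebra.algebraMap_eq_smul_one, hs.sign_one]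
  · intro x
    simp [unitEval_apply, unitDiff, Algebra.algebraMap_eq_smul_one, hs.d_one]

theorem rotMap_zero_apply (x : Unitization ℂ A) :
    rotMap A 0 x = Matrix.diagonal ![algebraMap ℂ A x.fst, unitEval A x] := by
  rw [rotMap_apply, unitEval_apply]
  ext i j
  fin_cases i <;> fin_cases j <;> simp [Algebra.algebraMap_eq_smul_one]

theorem rotMap_pi_div_two_apply (x : Unitization ℂ A) :
    rotMap A (Real.pi / 2) x = Matrix.diagonal ![unitEval A x, algebraMap ℂ A x.fst] := by
  rw [rotMap_apply, unitEval_apply]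
  ext i j
  fin_cases i <;> fin_cases j <;> simp [Algebra.algebraMap_eq_smul_one]

variable {H : Type u} [Ring H] [Algebra ℂ H] [Coalgebra ℂ H] {𝓗 : ℕ → Submodule ℂ H}
  [GradedAlgebra 𝓗] {dH S : H →ₗ[ℂ] H} {σ : H}
variable {𝒜 : ℕ → Submodule ℂ A} [GradedAlgebra 𝒜]
  {π : H →ₗ[ℂ] A →ₗ[ℂ] A} {ρp ρm : H →ₗ[ℂ] A} {I : A →ₗ[ℂ] ℂ}

/-- The restrictions of `χ_{π'₂}` along `i_{π/2}` and `i_0` differ by the pull-back of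
`χ_{π'} - χ_π`: the values on scalars, which the two diagonal entries contribute in addition, do not
depend on the action and cancel. -/
theorem pull_matrixChi (hH : IsDGHopfAlgebra 𝓗 dH S) (hd : IsDGAlgebra 𝒜 d)
    (hπ : IsDGAction 𝓗 dH 𝒜 d π) (hρ : IsInnerCocyclePair 𝓗 dH σ 𝒜 d π ρp ρm)
    (α : ∀ _ k : ℕ, TPow H k) :
    totMap (pull (rotMap A (Real.pi / 2))) (totMap (matrixChi 𝓗 𝒜 π ρp ρm I) α) -
        totMap (pull (rotMap A 0)) (totMap (matrixChi 𝓗 𝒜 π ρp ρm I) α) =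
      totMap unitPull (chiTot 𝓗 𝒜 (innerTwist 𝓗 𝒜 π ρp ρm) I α - chiTot 𝓗 𝒜 π I α) := by
  ext q k a
  have h1 := matrixChi_diagonal (I := I) (π := π) (ρp := ρp) (ρm := ρm) (𝒜 := 𝒜) hH (α q k)
    fun i => ![unitEval A (a i), algebraMap ℂ A (a i).fst]
  have h2 := matrixChi_diagonal (I := I) (π := π) (ρp := ρp) (ρm := ρm) (𝒜 := 𝒜) hH (α q k)
    fun i => ![algebraMap ℂ A (a i).fst, unitEval A (a i)]
  have h3 := chi_algebraMap (I := I) hπ (isDGAction_twist hH hd hπ hρ) (α q k) fun i => (a i).fst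
  simp only [Matrix.cons_val_zero, Matrix.cons_val_one] at h1 h2
  change matrixChi 𝓗 𝒜 π ρp ρm I k (α q k) (fun i => rotMap A (Real.pi / 2) (a i)) -
      matrixChi 𝓗 𝒜 π ρp ρm I k (α q k) (fun i => rotMap A 0 (a i)) =
    chi 𝓗 (gradeSign 𝒜) (twist (gradeSign 𝓗) (gradeSign 𝒜) π ρp ρm) I k (α q k)
        (fun i => unitEval A (a i)) -
      chi 𝓗 (gradeSign 𝒜) π I k (α q k) fun i => unitEval A (a i)
  simp only [rotMap_zero_apply, rotMap_pi_div_two_apply]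
  rw [h1, h2, h3]
  ring

end Endpoints

section Membership

variable {A : Type v} [Ring A] [Algebra ℂ A] {𝒜 : ℕ → Submodule ℂ A} [GradedAlgebra 𝒜]
  {d : A →ₗ[ℂ] A} [TopologicalSpace A] [IsTopologicalRing A]

theorem pull_rotMap_mem (hd : IsTopDGAlgebra 𝒜 d) (t : ℝ) {k : ℕ} {φ : Fun (M₂ A) k}
    (hφ : φ ∈ algCochain (matGrading 𝒜) k) : pull (rotMap A t) k φ ∈ unitCochain 𝒜 k := by
  have h1 : pull (rotMap A t) k φ = ∑ r : Fin (k + 1) → Fin 4,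
      (∏ i, rotCoeff t (r i)) • fun a => φ fun i => rotPart (r i) (a i) := by
    ext a
    change φ (fun i => rotMap A t (a i)) = _
    simp only [rotMap_eq_sum, (algCochain.isMultilinear hφ).rotMap_expand fun _ => rotCoeff _,
      Finset.sum_apply, Pi.smul_apply, smul_eq_mul]
  rw [h1]
  exact sum_mem fun r _ => Submodule.smul_mem _ _ <| comp_mem_unitCochain hd
    (fun i => rotPart (r i)) (fun i => rotPart_mem (r i)) (fun i => continuous_rotPart (r i)) hφ

theorem unitPull_mem (hd : IsTopDGAlgebra 𝒜 d) {k : ℕ} {φ : Fun A k}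
    (hφ : φ ∈ algCochain 𝒜 k) : unitPull k φ ∈ unitCochain 𝒜 k := by
  refine comp_mem_unitCochain hd (fun _ => unitEval A) (fun _ p x hx => ?_) (fun _ => ?_) hφ
  · rw [unitEval_apply]
    refine add_mem ?_ hx.2
    rcases eq_or_ne p 0 with rfl | hp
    · rw [Algebra.algebraMap_eq_smul_one]
      exact (𝒜 0).smul_mem _ SetLike.GradedOne.one_mem
    · rw [hx.1 hp, map_zero]
      exact zero_mem _
  · let τ := unitDiscrete A
    exact continuous_unitDiscrete_algebraMap.add continuous_unitDiscrete_snd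

omit [IsTopologicalRing A] in
theorem isSuperDG_entrywise (hd : IsTopDGAlgebra 𝒜 d) :
    IsSuperDG (entrywise (gradeSign 𝒜)) (entrywise d) := by
  rw [← gradeSign_matGrading]
  exact IsDGAlgebra.isSuperDG (matGrading 𝒜) hd.mat.toIsDGAlgebra

theorem isCocyclic_matrix (hd : IsTopDGAlgebra 𝒜 d) :
    (algOps (entrywise (gradeSign 𝒜)) (entrywise d)).IsCocyclic (algCochain (matGrading 𝒜)) := by
  rw [← gradeSign_matGrading]
  exact isCocyclic_algOps hd.mat

end Membership

section Comparison

variable {A : Type v} [Ring A] [Algebra ℂ A] {𝒜 : ℕ → Submodule ℂ A} [GradedAlgebra 𝒜]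
  {d : A →ₗ[ℂ] A} [TopologicalSpace A] [IsTopologicalRing A]

theorem CyclicOps.B_of_cyclic {X : ℕ → Type*} [∀ n, AddCommGroup (X n)] [∀ n, Module ℂ (X n)]
    (O : CyclicOps X) {k : ℕ} {x : X (k + 1)} (hx : O.lam (k + 1) x = x) : O.B k x = 0 := by
  simp [CyclicOps.B, hx]

/-- A cocycle of the total complex is cohomologous to a cyclic cocycle in column zero. -/
theorem CyclicOps.single_total {X : ℕ → Type*} [∀ n, AddCommGroup (X n)] [∀ n, Module ℂ (X n)]
    {O : CyclicOps X} {W : ∀ k, Submodule ℂ (X k)} (h : O.IsCocyclic W) {x : ∀ _ k : ℕ, X k}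
    (hx : x ∈ finiteCochains W) (hT : O.total x = 0) : ∃ K, ∃ ψ ∈ famFin W K, O.famP ψ = 0 ∧
      O.famD ψ = 0 ∧ ∃ y ∈ finiteCochains W, x = Pi.single 0 ψ + O.total y := by
  obtain ⟨K, ψ, hψ, hP, y, hy, rfl⟩ := h.exists_cyclic hx (map_zero _) (by rw [hT, Pi.single_zero])
  refine ⟨K, ψ, hψ, hP, ?_, y, hy, rfl⟩
  rw [map_add, h.total_total hy, add_zero, IsCocyclic.total_single_of_cyclic hP] at hT
  simpa using congr_fun hT 0

theorem totMap_single {X : ℕ → Type*} [∀ n, AddCommGroup (X n)] [∀ n, Module ℂ (X n)]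
    {Y : ℕ → Type*} [∀ n, AddCommGroup (Y n)] [∀ n, Module ℂ (Y n)] (f : ∀ k, X k →ₗ[ℂ] Y k)
    (q : ℕ) (φ : ∀ k, X k) : totMap f (Pi.single q φ) = Pi.single q fun k => f k (φ k) := by
  ext r k
  change f k ((Pi.single q φ : ∀ _ k : ℕ, X k) r k) = _
  rcases eq_or_ne r q with rfl | hr
  · simp
  · simp [Pi.single_eq_of_ne hr]

theorem kOp_mem_finiteCochains (hd : IsTopDGAlgebra 𝒜 d) {F : ∀ _ k : ℕ, Fun (M₂ A) k}
    (hF : F ∈ finiteCochains (algCochain (matGrading 𝒜))) :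
    (fun q k => kOp k (F q (k + 1))) ∈ finiteCochains (unitCochain 𝒜) := by
  obtain ⟨hF, N, hN⟩ := hF
  refine ⟨fun q k => kOp_mem hd (hF q (k + 1)), N, fun q k h => ?_⟩
  change kOp k (F q (k + 1)) = 0
  rw [kOp_eq, hN q (k + 1) (by omega), map_zero, rotInt_zero]

/-- If the restrictions of a cocycle on matrices along `i_{π/2}` and `i_0` differ by the pull-back
of a cocycle `Θ`, then `Θ` is a coboundary.  Both cocycles may be replaced by cyclic ones, for which
the homotopy formula is available; one obtains a primitive of the pull-back of `Θ`, which may again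
be taken cyclic, and can then be restricted along the non-unital inclusion of `A`. -/
theorem exists_total_eq (hd : IsTopDGAlgebra 𝒜 d) {Φ : ∀ _ k : ℕ, Fun (M₂ A) k}
    {Θ : ∀ _ k : ℕ, Fun A k} (hΦ : Φ ∈ finiteCochains (algCochain (matGrading 𝒜)))
    (hΘ : Θ ∈ algCochains 𝒜)
    (hTΦ : (algOps (entrywise (gradeSign 𝒜)) (entrywise d)).total Φ = 0)
    (hTΘ : (dgaOps 𝒜 d).total Θ = 0)
    (h : totMap (pull (rotMap A (Real.pi / 2))) Φ - totMap (pull (rotMap A 0)) Φ =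
      totMap unitPull Θ) : ∃ y ∈ algCochains 𝒜, (dgaOps 𝒜 d).total y = Θ := by
  set O := algOps (entrywise (gradeSign 𝒜)) (entrywise d) with hO
  have hs := IsDGAlgebra.isSuperDG 𝒜 hd.toIsDGAlgebra
  have hsM := isSuperDG_entrywise hd
  have hCM := isCocyclic_matrix hd
  have hCA : (dgaOps 𝒜 d).IsCocyclic (algCochain 𝒜) := isCocyclic_algOps hd
  have hCU := isCocyclic_unit hd
  obtain ⟨K, ψ, hψ, hPψ, hDψ, y, hy, rfl⟩ := CyclicOps.single_total hCM hΦ hTΦ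
  obtain ⟨K', θ, hθ, hPθ, -, y', hy', rfl⟩ := CyclicOps.single_total hCA hΘ hTΘ
  have hψm := CyclicOps.IsCocyclic.single_mem hψ 0
  have hψl : ∀ k, O.lam k (ψ k) = ψ k := fun k => (sub_eq_zero.1 (congr_fun hPψ k)).symm
  have hT0 : O.total (Pi.single 0 ψ) = 0 := by
    rw [CyclicOps.IsCocyclic.total_single_of_cyclic hPψ, hDψ, Pi.single_zero]
  have hg := entrywise_gMat (A := A) hs.sign_one
  -- on cyclic cochains `B` vanishes, before and after insertion
  have hK := total_kOp hs hsM (F := Pi.single 0 ψ)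
    (fun q k => algCochain.isMultilinear (hψm.1 q k)) (by
      intro q k
      cases q with
      | zero =>
        have h2 := algCochain.isMultilinear (hψ.1 (k + 2))
        rw [Pi.single_eq_same, CyclicOps.B_of_cyclic _
          (lam_insertion_of_cyclic hsM hg h2 (hψl (k + 2))),
          CyclicOps.B_of_cyclic _ (hψl (k + 2)), map_zero, neg_zero]
      | succ q => simp)
  have hK0 : (fun q k => kOp k (O.total (Pi.single 0 ψ) q (k + 1))) =
      (0 : ∀ _ k : ℕ, Fun (Unitization ℂ A) k) := by
    rw [hT0]
    ext1 q
    ext1 k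
    rw [kOp_eq]
    exact (congrArg _ (map_zero _)).trans rotInt_zero
  rw [← hO, hK0, add_zero] at hK
  have hi := isCyclicMap_rotMap hs
  have hp := isCyclicMap_unitPull hs
  have ht : ∀ t, (unitOps 𝒜 d).total (totMap (pull (rotMap A t)) y) =
      totMap (pull (rotMap A t)) (O.total y) := fun t => (hi t).total y
  have hty : (unitOps 𝒜 d).total (totMap unitPull y') =
      totMap unitPull ((dgaOps 𝒜 d).total y') := hp.total y'
  rw [map_add, map_add, map_add, totMap_single unitPull] at h
  -- a primitive of the pull-back of the cyclic cocycle `θ`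
  have hY : (unitOps 𝒜 d).total
      ((fun q k => kOp k ((Pi.single 0 ψ : ∀ _ k : ℕ, Fun (M₂ A) k) q (k + 1))) +
      (totMap (pull (rotMap A (Real.pi / 2))) y - totMap (pull (rotMap A 0)) y) -
      totMap unitPull y') = Pi.single 0 fun k => unitPull k (θ k) := by
    rw [map_sub, map_add, map_sub, ht, ht, hty, eq_sub_of_add_eq h.symm]
    refine (congrArg (fun z => z + _ - _) hK).trans ?_
    abel
  have hYm := sub_mem (add_mem (kOp_mem_finiteCochains hd hψm)
    (sub_mem (totMap_mem_finiteCochains (fun k φ => pull_rotMap_mem hd (Real.pi / 2)) hy)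
      (totMap_mem_finiteCochains (fun k φ => pull_rotMap_mem hd 0) hy)))
    (totMap_mem_finiteCochains (fun k φ => unitPull_mem hd) hy')
  have hθl : (unitOps 𝒜 d).famP (fun k => unitPull k (θ k)) = 0 := by
    ext1 k
    have h1 : unitPull k ((dgaOps 𝒜 d).lam k (θ k)) = (unitOps 𝒜 d).lam k (unitPull k (θ k)) :=
      hp.lam k (θ k)
    rw [CyclicOps.famP_apply, ← h1, ← map_sub]
    exact (congrArg _ (congr_fun hPθ k)).trans (map_zero _)
  obtain ⟨K'', η, hη, hPη, w, hw, hYw⟩ := hCU.exists_cyclic hYm hθl hY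
  rw [hYw, map_add, hCU.total_total hw, add_zero,
    CyclicOps.IsCocyclic.total_single_of_cyclic hPη] at hY
  have hθη : (unitOps 𝒜 d).famD η = fun k => unitPull k (θ k) := by simpa using congr_fun hY 0
  -- restriction along the inclusion `s` of `A`, which is not unital, respects faces, cyclic
  -- operators and the differential, but not the degeneracies; on cyclic cochains these play no role
  set s := Unitization.inrHom ℂ ℂ A with hs'
  have hsm : ∀ a b, s (a * b) = s a * s b := fun a b => Unitization.inr_mul ℂ a b
  have hsγ : ∀ a, s (gradeSign 𝒜 a) = unitSign (gradeSign 𝒜) (s a) := by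
    intro a; ext <;> simp [hs', unitSign]
  have hsd : ∀ a, s (d a) = unitDiff d (s a) := by
    intro a; ext <;> simp [hs', unitDiff]
  have hb : ∀ k (φ : Fun (Unitization ℂ A) k), pull s (k + 1) ((unitOps 𝒜 d).b k φ) =
      (dgaOps 𝒜 d).b k (pull s k φ) := by
    intro k φ
    have h1 := pull_face hsm hsγ k
    simp only [CyclicOps.b, LinearMap.sum_apply, map_sum, LinearMap.smul_apply, map_smul]
    exact Finset.sum_congr rfl fun j _ => congrArg _ (h1 j φ)
  have hdf : ∀ k (φ : Fun (Unitization ℂ A) k), pull s k ((unitOps 𝒜 d).diff k φ) =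
      (dgaOps 𝒜 d).diff k (pull s k φ) := fun k φ => pull_diff hsγ hsd k φ
  have hsp : ∀ k (φ : Fun A k), pull s k (unitPull k φ) = φ := by
    intro k φ
    ext a
    change φ (fun i => unitEval A (s (a i))) = φ a
    simp [hs', unitEval_apply]
  have hDs : (dgaOps 𝒜 d).famD (fun k => pull s k (η k)) = θ := by
    ext1 k
    rw [← hsp k (θ k), ← congr_fun hθη k]
    cases k with
    | zero => rw [CyclicOps.famD_zero, CyclicOps.famD_zero, hdf]
    | succ k =>
      rw [CyclicOps.famD_succ, CyclicOps.famD_succ, map_add, map_smul, hdf, hb]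
  have hPs : (dgaOps 𝒜 d).famP (fun k => pull s k (η k)) = 0 := by
    ext1 k
    have h1 : pull s k ((unitOps 𝒜 d).lam k (η k)) = (dgaOps 𝒜 d).lam k (pull s k (η k)) :=
      congrArg (fun x => (-1 : ℂ) ^ k • x) (pull_cyc hsγ k (η k))
    rw [CyclicOps.famP_apply, ← h1, ← map_sub]
    exact (congrArg _ (congr_fun hPη k)).trans (map_zero _)
  have hm : (fun k => pull s k (η k)) ∈ CyclicOps.famFin (algCochain 𝒜) K'' :=
    ⟨fun k => inr_comp_mem hd (hη.1 k), fun k hk => by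
      change pull s k (η k) = 0
      rw [hη.2 k hk, map_zero]⟩
  have hm0 : (Pi.single 0 fun k => pull s k (η k) : ∀ _ k : ℕ, Fun A k) ∈ algCochains 𝒜 :=
    CyclicOps.IsCocyclic.single_mem hm 0
  refine ⟨_, (algCochains 𝒜).add_mem hm0 hy', ?_⟩
  rw [map_add, CyclicOps.IsCocyclic.total_single_of_cyclic hPs, hDs]

end Comparison

/-! ### Normalized cochains -/

section Normalized

variable {A : Type v} [Ring A] [Algebra ℂ A] {γ d : A →ₗ[ℂ] A}

theorem rotInt_normalized (hs : IsSuperDG γ d) {k : ℕ} {φ : Fun (M₂ A) k}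
    (hφ : φ ∈ (algOps (entrywise γ) (entrywise d)).normalized k) :
    rotInt k φ ∈ (algOps (unitSign γ) (unitDiff d)).normalized k := by
  cases k with
  | zero => trivial
  | succ k =>
    refine (Submodule.mem_iInf _).2 fun j => funext fun a => ?_
    have h1 : ∀ t, pull (rotMap A t) (k + 1) φ
        (Fin.insertNth (α := fun _ => Unitization ℂ A) j.succ 1 a) = 0 := fun t =>
      congr_fun ((Submodule.mem_iInf _).1 ((isCyclicMap_rotMap hs t).normalized hφ) j) a
    change ∫ t in (0 : ℝ)..(Real.pi / 2), pull (rotMap A t) (k + 1) φ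
      (Fin.insertNth (α := fun _ => Unitization ℂ A) j.succ 1 a) = 0
    simp only [h1, intervalIntegral.integral_zero]

theorem kOp_normalized (hs : IsSuperDG γ d) {k : ℕ} {φ : Fun (M₂ A) (k + 1)}
    (hφ : φ ∈ (algOps (entrywise γ) (entrywise d)).normalized (k + 1)) :
    kOp k φ ∈ (algOps (unitSign γ) (unitDiff d)).normalized k := by
  rw [kOp_eq]
  exact rotInt_normalized hs (insertion_normalized hφ)

/-- A normalized multilinear functional depends only on the components in `A` of all arguments but
the first. -/
theorem normalized_eq_snd {k : ℕ} {φ : Fun (Unitization ℂ A) k} (hm : IsMultilinear φ)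
    (hφ : φ ∈ (algOps (unitSign γ) (unitDiff d)).normalized k) (x : Fin (k + 1) → Unitization ℂ A) :
    φ x = φ (Function.update (fun i => Unitization.inr (x i).snd) 0 (x 0)) := by
  have key : ∀ s : Finset (Fin (k + 1)), 0 ∉ s →
      φ x = φ fun i => if i ∈ s then Unitization.inr (x i).snd else x i := by
    intro s
    induction s using Finset.induction_on with
    | empty => simp
    | insert p s hp ih =>
      intro h0
      rw [Finset.mem_insert, not_or] at h0
      rw [ih h0.2]
      set y : Fin (k + 1) → Unitization ℂ A :=
        fun i => if i ∈ s then Unitization.inr (x i).snd else x i with hy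
      have h1 : (fun i => if i ∈ insert p s then Unitization.inr (x i).snd else x i) =
          Function.update y p (Unitization.inr (x p).snd) := by
        ext1 i
        rcases eq_or_ne i p with rfl | hi
        · simp
        · simp [hi, hy]
      have h2 : y = Function.update y p ((x p).fst • 1 + Unitization.inr (x p).snd) := by
        conv_lhs => rw [← Function.update_eq_self p y]
        congr 1
        simp only [hy, if_neg hp]
        ext <;> simp
      have h3 : φ (Function.update y p 1) = 0 := by
        obtain ⟨p, rfl⟩ := Fin.exists_succ_eq.2 (Ne.symm h0.1)
        cases k with
        | zero => exact p.elim0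
        | succ k => exact normalized_apply hφ (Function.update_self _ _ _)
      obtain ⟨f, rfl⟩ := hm
      rw [h1]
      conv_lhs => rw [h2]
      rw [f.map_update_add, f.map_update_smul, h3, smul_zero, zero_add]
  rw [key (Finset.univ.erase 0) (Finset.notMem_erase _ _)]
  congr 1
  ext1 i
  rcases eq_or_ne i 0 with rfl | hi
  · simp
  · simp [hi]

variable {𝒜 : ℕ → Submodule ℂ A} [GradedAlgebra 𝒜] [TopologicalSpace A]

omit [GradedAlgebra 𝒜] in
theorem unitCochain.isMultilinear {k : ℕ} {φ : Fun (Unitization ℂ A) k}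
    (hm : φ ∈ unitCochain 𝒜 k) : IsMultilinear φ := by
  let τ := unitDiscrete A
  exact algCochain.isMultilinear hm

/-- A normalized functional which is continuous for the discrete topology of `ℂ` is continuous for
the usual one, as it depends on at most one scalar, in a linear way. -/
theorem mem_algCochain_unit {k : ℕ} {φ : Fun (Unitization ℂ A) k} (hm : φ ∈ unitCochain 𝒜 k)
    (hφ : φ ∈ (unitOps 𝒜 d).normalized k) : φ ∈ algCochain (unitGrading 𝒜) k := by
  have hsnd := normalized_eq_snd (unitCochain.isMultilinear hm) hφ
  obtain ⟨f, rfl⟩ := unitCochain.isMultilinear hm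
  refine ⟨⟨⟨f, ?_⟩, rfl⟩, hm.2⟩
  have hdec : ∀ x : Fin (k + 1) → Unitization ℂ A, f x =
      (x 0).fst * f (Function.update (fun i => Unitization.inr (x i).snd) 0 1) +
        f fun i => Unitization.inr (x i).snd := by
    intro x
    have h0 : x 0 = (x 0).fst • 1 + Unitization.inr (x 0).snd := by ext <;> simp
    rw [hsnd x]
    conv_lhs => rw [h0]
    rw [f.map_update_add, f.map_update_smul, Function.update_eq_self_iff.2 rfl]
    rfl
  have hp : Continuous fun x : Unitization ℂ A => (x.fst, x.snd) := continuous_induced_dom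
  have hc : ∀ c : (Fin (k + 1) → A) → Fin (k + 1) → Unitization ℂ A,
      (∀ i, @Continuous _ _ _ (unitDiscrete A) fun a => c a i) → Continuous fun a => f (c a) := by
    intro c h
    let τ := unitDiscrete A
    obtain ⟨⟨F, hF⟩, -⟩ := hm
    rw [← hF]
    exact F.cont.comp (continuous_pi h)
  have hinr : ∀ i : Fin (k + 1), @Continuous (Fin (k + 1) → A) _ _ (unitDiscrete A)
      fun a => Unitization.inr (a i) := by
    intro i
    let τ' : TopologicalSpace ℂ := ⊥
    exact continuous_unitDiscrete_iff.2 ⟨continuous_const, continuous_apply i⟩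
  have h1 := hc (fun a => Function.update (fun i => Unitization.inr (a i)) 0 1) fun i => by
    rcases eq_or_ne i 0 with rfl | hi
    · simp only [Function.update_self]
      exact @continuous_const _ _ _ (unitDiscrete A) _
    · simp only [Function.update_of_ne hi]
      exact hinr i
  have h2 := hc (fun a i => Unitization.inr (a i)) hinr
  have hs : Continuous fun (x : Fin (k + 1) → Unitization ℂ A) i => (x i).snd :=
    continuous_pi fun i => (continuous_snd.comp hp).comp (continuous_apply i)
  refine Continuous.congr ?_ fun x => (hdec x).symm
  exact ((continuous_fst.comp hp).comp (continuous_apply 0)).mul (h1.comp hs) |>.add (h2.comp hs)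

end Normalized

/-! ### The characteristic map with values in functionals on matrices -/

section MatrixChi

variable {H : Type u} [Ring H] [Algebra ℂ H] [Coalgebra ℂ H] {𝓗 : ℕ → Submodule ℂ H}
  [GradedAlgebra 𝓗] {dH S : H →ₗ[ℂ] H} {σ : H} {δ : H →ₐ[ℂ] ℂ}
variable {A : Type v} [Ring A] [Algebra ℂ A] {𝒜 : ℕ → Submodule ℂ A} [GradedAlgebra 𝒜]
  {d : A →ₗ[ℂ] A} {π : H →ₗ[ℂ] A →ₗ[ℂ] A} {ρp ρm : H →ₗ[ℂ] A} {I : A →ₗ[ℂ] ℂ}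

theorem isMultilinear_matrixChi {k : ℕ} (t : TPow H k) :
    IsMultilinear (matrixChi 𝓗 𝒜 π ρp ρm I k t) := by
  rw [matrixChi, ← gradeSign_matGrading]
  exact isMultilinear_chi _ t

/-- The twisted action on matrices and the matrix trace satisfy the hypotheses under which the
characteristic map respects the cyclic structure. -/
theorem isCyclicMap_matrixChi (hH : IsDGHopfAlgebra 𝓗 dH S) (hd : IsDGAlgebra 𝒜 d)
    (hδ : IsModularPairInInvolution 𝓗 dH S δ σ)
    (hπ : IsDGAction 𝓗 dH 𝒜 d π) (hρ : IsInnerCocyclePair 𝓗 dH σ 𝒜 d π ρp ρm)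
    (hI : IsClosedInvariantTrace 𝓗 S δ σ 𝒜 d π I)
    (hI' : IsClosedInvariantTrace 𝓗 S δ σ 𝒜 d (innerTwist 𝓗 𝒜 π ρp ρm) I) :
    IsCyclicMap (hopfOps 𝓗 dH S δ σ) (algOps (entrywise (gradeSign 𝒜)) (entrywise d))
      (matrixChi 𝓗 𝒜 π ρp ρm I) := by
  have h1 : matrixChi 𝓗 𝒜 π ρp ρm I = chi 𝓗 (gradeSign (matGrading 𝒜))
      (matrixTwist (gradeSign 𝓗) (gradeSign 𝒜) π ρp ρm) (matrixTrace I) := by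
    rw [gradeSign_matGrading]
    rfl
  rw [h1, ← gradeSign_matGrading]
  exact isCyclicMap_chi hH hδ hd.mat
    (isDGAction_matrixTwist hH hd hπ hρ hδ.isGroupLike.counit_eq_one)
    (isClosedInvariantTrace_matrixTrace hH hd hδ hπ hρ hI hI')

/-- The map `K ∘ χ_{π'₂}` on families. -/
def homotopy (𝓗 : ℕ → Submodule ℂ H) [GradedAlgebra 𝓗] (𝒜 : ℕ → Submodule ℂ A) [GradedAlgebra 𝒜]
    (π : H →ₗ[ℂ] A →ₗ[ℂ] A) (ρp ρm : H →ₗ[ℂ] A) (I : A →ₗ[ℂ] ℂ) :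
    (∀ _ k : ℕ, TPow H k) →ₗ[ℂ] (∀ _ k : ℕ, Fun (Unitization ℂ A) k) where
  toFun α q k := kOp k (matrixChi 𝓗 𝒜 π ρp ρm I (k + 1) (α q (k + 1)))
  map_add' α β := by
    ext1 q
    ext1 k
    simp only [Pi.add_apply, map_add, kOp_eq]
    exact rotInt_add (isMultilinear_matrixChi _).insertion (isMultilinear_matrixChi _).insertion
  map_smul' c α := by
    ext1 q
    ext1 k
    simp only [Pi.smul_apply, map_smul, kOp_eq, RingHom.id_apply]
    exact rotInt_smul c _

/-- The homotopy formula on normalized cochains, for which insertion of `g` anticommutes with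
`B`. -/
theorem homotopy_total (hH : IsDGHopfAlgebra 𝓗 dH S) [TopologicalSpace A] [IsTopologicalRing A]
    (hd : IsTopDGAlgebra 𝒜 d)
    (hδ : IsModularPairInInvolution 𝓗 dH S δ σ)
    (hπ : IsDGAction 𝓗 dH 𝒜 d π) (hρ : IsInnerCocyclePair 𝓗 dH σ 𝒜 d π ρp ρm)
    (hI : IsClosedInvariantTrace 𝓗 S δ σ 𝒜 d π I)
    (hI' : IsClosedInvariantTrace 𝓗 S δ σ 𝒜 d (innerTwist 𝓗 𝒜 π ρp ρm) I)
    {α : ∀ _ k : ℕ, TPow H k} (hα : ∀ q k, α q k ∈ (hopfOps 𝓗 dH S δ σ).normalized k) :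
    (unitOps 𝒜 d).total (homotopy 𝓗 𝒜 π ρp ρm I α) +
        homotopy 𝓗 𝒜 π ρp ρm I ((hopfOps 𝓗 dH S δ σ).total α) =
      totMap unitPull (chiTot 𝓗 𝒜 (innerTwist 𝓗 𝒜 π ρp ρm) I α - chiTot 𝓗 𝒜 π I α) := by
  have hs := IsDGAlgebra.isSuperDG 𝒜 hd.toIsDGAlgebra
  have hsM := isSuperDG_entrywise hd
  have hm := isCyclicMap_matrixChi hH hd.toIsDGAlgebra hδ hπ hρ hI hI'
  have h1 := total_kOp hs hsM (F := totMap (matrixChi 𝓗 𝒜 π ρp ρm I) α)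
    (fun q k => isMultilinear_matrixChi _) fun q k => B_insertion hsM (entrywise_gMat hs.sign_one)
      (isMultilinear_matrixChi _) (hm.normalized (hα q (k + 2)))
  rw [hm.total] at h1
  rw [← pull_matrixChi hH hd.toIsDGAlgebra hπ hρ]
  exact h1

theorem homotopy_mem [TopologicalSpace A] [IsTopologicalRing A] (hH : IsDGHopfAlgebra 𝓗 dH S)
    (hd : IsTopDGAlgebra 𝒜 d) (hδ : IsModularPairInInvolution 𝓗 dH S δ σ)
    (hπ : IsDGAction 𝓗 dH 𝒜 d π) (hπc : ∀ h, Continuous (π h))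
    (hρ : IsInnerCocyclePair 𝓗 dH σ 𝒜 d π ρp ρm)
    (hIc : Continuous I) (hIN : ∃ N, ∀ n, N < n → ∀ a ∈ 𝒜 n, I a = 0)
    (hI : IsClosedInvariantTrace 𝓗 S δ σ 𝒜 d π I)
    (hI' : IsClosedInvariantTrace 𝓗 S δ σ 𝒜 d (innerTwist 𝓗 𝒜 π ρp ρm) I)
    {α : ∀ _ k : ℕ, TPow H k} (hα : α ∈ hopfNormCochains 𝓗 dH S δ σ) :
    homotopy 𝓗 𝒜 π ρp ρm I α ∈ unitNormCochains 𝒜 d := by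
  have hs := IsDGAlgebra.isSuperDG 𝒜 hd.toIsDGAlgebra
  have hm := isCyclicMap_matrixChi hH hd.toIsDGAlgebra hδ hπ hρ hI hI'
  have hmem := totMap_mem_finiteCochains (fun k t _ =>
    matrixChi_mem hH hd hπ hπc hρ hδ.isGroupLike.counit_eq_one hIc hIN t) hα
  have hK := kOp_mem_finiteCochains hd hmem
  refine ⟨fun q k => ?_, hK.2⟩
  have hn := kOp_normalized hs (hm.normalized (hα.1 q (k + 1)))
  exact ⟨mem_algCochain_unit (hK.1 q k) hn, hn⟩

/-- The continuity assumption is on homogeneous components only, so that it applies to the twisted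
action, whose signs depend on the degree of the argument. -/
theorem isCochainMap_chiTot [TopologicalSpace A] [IsTopologicalRing A]
    (hH : IsDGHopfAlgebra 𝓗 dH S) (hd : IsTopDGAlgebra 𝒜 d)
    (hδ : IsModularPairInInvolution 𝓗 dH S δ σ)
    (hπ : IsDGAction 𝓗 dH 𝒜 d π) (hπc : ∀ h n, Continuous fun a => π h (component 𝒜 n a))
    (hIc : Continuous I) (hIN : ∃ N, ∀ n, N < n → ∀ a ∈ 𝒜 n, I a = 0)
    (hI : IsClosedInvariantTrace 𝓗 S δ σ 𝒜 d π I) :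
    IsCochainMap (hopfOps 𝓗 dH S δ σ) (hopfCochains H) (dgaOps 𝒜 d) (algCochains 𝒜)
      (chiTot 𝓗 𝒜 π I) where
  map_mem _ hx := totMap_mem_finiteCochains (fun _ t _ =>
    chi_mem_algCochain hd.continuous_component hπ.act_deg hπc hIc hIN t) hx
  comm x _ := (isCyclicMap_chi hH hδ hd.toIsDGAlgebra hπ hI).total x

/-- On arbitrary cocycles the difference of the characteristic maps is a coboundary. -/
theorem exists_total_eq_chiTot_sub [TopologicalSpace A] [IsTopologicalRing A]
    (hH : IsDGHopfAlgebra 𝓗 dH S)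
    (hd : IsTopDGAlgebra 𝒜 d) (hδ : IsModularPairInInvolution 𝓗 dH S δ σ)
    (hπ : IsDGAction 𝓗 dH 𝒜 d π) (hπc : ∀ h, Continuous (π h))
    (hρ : IsInnerCocyclePair 𝓗 dH σ 𝒜 d π ρp ρm)
    (hIc : Continuous I) (hIN : ∃ N, ∀ n, N < n → ∀ a ∈ 𝒜 n, I a = 0)
    (hI : IsClosedInvariantTrace 𝓗 S δ σ 𝒜 d π I)
    (hI' : IsClosedInvariantTrace 𝓗 S δ σ 𝒜 d (innerTwist 𝓗 𝒜 π ρp ρm) I)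
    (hχ : IsCochainMap (hopfOps 𝓗 dH S δ σ) (hopfCochains H) (dgaOps 𝒜 d) (algCochains 𝒜)
      (chiTot 𝓗 𝒜 π I))
    (hχ' : IsCochainMap (hopfOps 𝓗 dH S δ σ) (hopfCochains H) (dgaOps 𝒜 d) (algCochains 𝒜)
      (chiTot 𝓗 𝒜 (innerTwist 𝓗 𝒜 π ρp ρm) I))
    {α : ∀ _ k : ℕ, TPow H k} (hα : α ∈ hopfCochains H)
    (hTα : (hopfOps 𝓗 dH S δ σ).total α = 0) :
    ∃ y ∈ algCochains 𝒜, (dgaOps 𝒜 d).total y =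
      chiTot 𝓗 𝒜 (innerTwist 𝓗 𝒜 π ρp ρm) I α - chiTot 𝓗 𝒜 π I α := by
  have hm := isCyclicMap_matrixChi hH hd.toIsDGAlgebra hδ hπ hρ hI hI'
  refine exists_total_eq hd (Φ := totMap (matrixChi 𝓗 𝒜 π ρp ρm I) α)
    (totMap_mem_finiteCochains (fun k t _ =>
      matrixChi_mem hH hd hπ hπc hρ hδ.isGroupLike.counit_eq_one hIc hIN t) hα)
    (sub_mem (hχ'.map_mem α hα) (hχ.map_mem α hα)) ?_ ?_
    (pull_matrixChi hH hd.toIsDGAlgebra hπ hρ α)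
  · rw [hm.total, hTα, map_zero]
  · rw [map_sub, hχ'.comm α hα, hχ.comm α hα, hTα, map_zero, map_zero, sub_zero]

end MatrixChi

end DGCyc

end

theorem mainTheorem2 {H Ω : Type*}
    -- the DG Hopf algebra with its modular pair in involution
    [Ring H] [Algebra ℂ H] [Coalgebra ℂ H] (𝓗 : ℕ → Submodule ℂ H) [GradedAlgebra 𝓗]
    (dH S : H →ₗ[ℂ] H) (hH : IsDGHopfAlgebra 𝓗 dH S)
    (δ : H →ₐ[ℂ] ℂ) (σ : H) (hδσ : IsModularPairInInvolution 𝓗 dH S δ σ)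
    -- the DG algebra
    [Ring Ω] [Algebra ℂ Ω] [TopologicalSpace Ω] [IsTopologicalRing Ω]
    (𝒜 : ℕ → Submodule ℂ Ω) [GradedAlgebra 𝒜] (d : Ω →ₗ[ℂ] Ω) (hΩ : IsTopDGAlgebra 𝒜 d)
    -- the action `π` and the action `π'` conjugate to it by an inner cocycle pair
    (π π' : H →ₗ[ℂ] Ω →ₗ[ℂ] Ω) (hπ : IsDGAction 𝓗 dH 𝒜 d π) (hπc : ∀ h, Continuous (π h))
    (ρp ρm : H →ₗ[ℂ] Ω) (hρ : IsInnerCocyclePair 𝓗 dH σ 𝒜 d π ρp ρm)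
    (hπ' : π' = innerTwist 𝓗 𝒜 π ρp ρm)
    -- the functional, vanishing in large degrees, a closed invariant trace for both actions
    (I : Ω →ₗ[ℂ] ℂ) (hIc : Continuous I) (hI : ∃ N, ∀ n, N < n → ∀ a ∈ 𝒜 n, I a = 0)
    (hIπ : IsClosedInvariantTrace 𝓗 S δ σ 𝒜 d π I)
    (hIπ' : IsClosedInvariantTrace 𝓗 S δ σ 𝒜 d π' I) :
    -- the characteristic maps are maps of complexes, inducing the same map in cohomology
    (∃ (hχ : IsCochainMap (hopfOps 𝓗 dH S δ σ) (hopfCochains H) (dgaOps 𝒜 d) (algCochains 𝒜)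
          (chiTot 𝓗 𝒜 π I))
        (hχ' : IsCochainMap (hopfOps 𝓗 dH S δ σ) (hopfCochains H) (dgaOps 𝒜 d) (algCochains 𝒜)
          (chiTot 𝓗 𝒜 π' I)),
        HC.map hχ = HC.map hχ') ∧
    -- the explicit homotopy `K ∘ χ_{π'₂}` on normalized cochains
    ∃ h : (∀ _ k : ℕ, TPow H k) →ₗ[ℂ] (∀ _ k : ℕ, Fun (Unitization ℂ Ω) k),
      (∀ α q k, h α q k = kOp k (matrixChi 𝓗 𝒜 π ρp ρm I (k + 1) (α q (k + 1)))) ∧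
      ∀ α ∈ hopfNormCochains 𝓗 dH S δ σ,
        h α ∈ unitNormCochains 𝒜 d ∧
        (unitOps 𝒜 d).total (h α) + h ((hopfOps 𝓗 dH S δ σ).total α) =
          totMap unitPull (chiTot 𝓗 𝒜 π' I α - chiTot 𝓗 𝒜 π I α) := by
  subst hπ'
  have hχ := isCochainMap_chiTot hH hΩ hδσ hπ
    (fun h n => (hπc h).comp (hΩ.continuous_component n)) hIc hI hIπ
  have hχ' := isCochainMap_chiTot hH hΩ hδσ (isDGAction_twist hH hΩ.toIsDGAlgebra hπ hρ)
    (continuous_twist_component hΩ.continuous_component hπc) hIc hI hIπ'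
  refine ⟨⟨hχ, hχ', ?_⟩, homotopy 𝓗 𝒜 π ρp ρm I, fun _ _ _ => rfl, fun α hα => ⟨?_, ?_⟩⟩
  · refine Submodule.linearMap_qext _ (LinearMap.ext fun ⟨α, hα, hTα⟩ => Eq.symm ?_)
    obtain ⟨y, hy, hyα⟩ := exists_total_eq_chiTot_sub hH hΩ hδσ hπ hπc hρ hIc hI hIπ hIπ' hχ hχ' hα
      hTα
    exact (Submodule.Quotient.eq _).2 (Submodule.mem_comap.2 ⟨y, hy, hyα⟩)
  · exact homotopy_mem hH hΩ hδσ hπ hπc hρ hIc hI hIπ hIπ' hα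
  · exact homotopy_total hH hΩ hδσ hπ hρ hIπ hIπ' hα.1
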